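/- Conventions. Let $d\ge 1$. Write $\widehat V(\xi)=\int_{\mathbb R^d} e^{-i\langle x,\xi\rangle}V(x)\,dx$, let $m(D)$ be the Fourier multiplier with symbol $m(\xi)$, $\langle D\rangle=(1+|D|^2)^{1/2}$, $\|V\|_{H^m}=\|\langle D\rangle^mV\|_{L^2}$, and let $L^\infty_{\mathrm{comp}}(\mathbb R^d)$ be the complex-valued bounded functions of compact support. On the Hilbert space $H^1(\mathbb R^d)\times L^2(\mathbb R^d)$ let $$U_0(t)=\begin{bmatrix}\cos(t|D|) & \frac{\sin(t|D|)}{|D|}\\ -|D|\sin(t|D|) & \cos(t|D|)\end{bmatrix},\qquad \mathbf V=\begin{bmatrix}0&0\\V&0\end{bmatrix},\qquad (\Lambda F)(t)=\int_0^tU_0(t-s)F(s)\,ds,$$ $W_{2,V}=(\Lambda\mathbf V)^2U_0$, and $\langle\phi,W_{2,V}\rangle=\int_{\mathbb R}\phi(t)\,W_{2,V}(t)\,dt$ (all integrals in the strong sense). Theorem. There are constants $c_{j,d}\in\mathbb R\setminus\{0\}$ ($j\ge0$), depending only on $j,d$, and $C_{m,d}$ ($m\ge 0$), depending only on $m,d$,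 such that the following holds for every $V\in L^\infty_{\mathrm{comp}}(\mathbb R^d)$. There is a function $a_{2,V}\in C([0,\infty))$ with $$|a_{2,V}(t)|\le(2\pi)^{-\lfloor d/2\rfloor}\|V\|_{L^2}^2\qquad(t\ge 0)$$ such that for every even $\phi\in C^\infty_c(\mathbb R)$ the operator $\langle\phi,W_{2,V}\rangle$ is trace class on $H^1\times L^2$ and $$\operatorname{tr}\langle\phi,W_{2,V}\rangle=\begin{cases}\displaystyle\int_0^\infty t^{4-d}a_{2,V}(t)\phi(t)\,dt,&1\le d\le4,\\[2mm]\displaystyle\int_0^\infty a_{2,V}(t)\,\partial_t(t^{-1}\partial_t)^{\frac{d-5}2}\phi(t)\,dt,&d\ge5\text{ odd},\\[2mm]\displaystyle\int_0^\infty a_{2,V}(t)\,(t^{-1}\partial_t)^{\frac{d-4}2}\phi(t)\,dt,&d\ge4\text{ even},\end{cases}$$ and moreover: (i) If $m\ge0$ is an integer and $V\in H^m(\mathbb R^d)$, then $a_{2,V}\in C^{2m}([0,\infty))$ (with one-sided derivatives at $0$), $|\partial_t^ja_{2,V}(t)|\le C_{m,d}\|V\|_{H^m}^2$ for all $0\le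 j\le2m$ and $t\ge0$, and $\partial_t^ja_{2,V}(0)=0$ for odd $j\le2m$. If in addition $V$ is real valued, then $$\partial_t^{2j}a_{2,V}(0)=c_{j,d}\,\||D|^jV\|_{L^2}^2\qquad(0\le j\le m).$$ (ii) Conversely, if $V$ is real valued, $m\ge0$ is an integer, and there are $b_0,\dots,b_{m-1}\in\mathbb C$ and $C<\infty$ with $$\Bigl|a_{2,V}(t)-\sum_{j=0}^{m-1}b_jt^{2j}\Bigr|\le C\,t^{2m}\qquad(0\le t\le1),$$ then $V\in H^m(\mathbb R^d)$, and hence the conclusions of (i) hold. -/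

import Mathlib

open MeasureTheory Set FourierTransform
open scoped ENNReal ContDiff SchwartzMap Topology

noncomputable section

namespace WaveTrace

/-- Euclidean space `ℝ^d`. -/
abbrev Rd (d : ℕ) : Type := EuclideanSpace ℝ (Fin d)

/-- The complex Hilbert space `L²(ℝ^d)`. -/
abbrev L2 (d : ℕ) : Type := Lp ℂ 2 (volume : Measure (Rd d))

/-- The Banach space `L^∞(ℝ^d)`. -/
abbrev LInfty (d : ℕ) : Type := Lp ℂ ∞ (volume : Measure (Rd d))

/-- The symbol of `|D|`.  Mathlib's Fourier transform is `∫ e^{-2πi⟨x,ξ⟩} f(x) dx`, so the frequency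
of `e^{2πi⟨x,ξ⟩}` is `2πξ`. -/
def freq {d : ℕ} (ξ : Rd d) : ℝ := 2 * Real.pi * ‖ξ‖

/-- The symbol `(1 + |D|²)^{1/2}` of `⟨D⟩`. -/
def bracket {d : ℕ} (ξ : Rd d) : ℝ := √(1 + freq ξ ^ 2)

/-! ### Fourier multipliers -/

/-- The Fourier multiplier `m(D) f`, with `m` expressed in Mathlib's frequency variable, for `f` in
the natural domain `m · 𝓕 f ∈ L²`. -/
def multiplier {d : ℕ} (m : Rd d → ℝ) (f : L2 d)
    (h : MemLp (fun ξ => (m ξ : ℂ) * (𝓕 f : L2 d) ξ) 2 volume) : L2 d :=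
  𝓕⁻ (h.toLp _)

theorem fourier_multiplier {d : ℕ} (m : Rd d → ℝ) (f : L2 d)
    (h : MemLp (fun ξ => (m ξ : ℂ) * (𝓕 f : L2 d) ξ) 2 volume) :
    ((𝓕 (multiplier m f h) : L2 d) : Rd d → ℂ) =ᵐ[volume]
      fun ξ => (m ξ : ℂ) * (𝓕 f : L2 d) ξ := by
  have : (𝓕 (multiplier m f h) : L2 d) = h.toLp _ := fourier_fourierInv_eq _
  rw [this]
  exact h.coeFn_toLp

theorem memLp_mul_of_bound {d : ℕ} {m n : Rd d → ℝ} (hm : Continuous m) (C : ℝ)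
    (hmn : ∀ ξ, |m ξ| ≤ C * |n ξ|) (f : L2 d)
    (h : MemLp (fun ξ => (n ξ : ℂ) * (f : Rd d → ℂ) ξ) 2 volume) :
    MemLp (fun ξ => (m ξ : ℂ) * (f : Rd d → ℂ) ξ) 2 volume := by
  refine MemLp.of_le_mul (c := C) h ?_ (Filter.Eventually.of_forall fun ξ => ?_)
  · exact (Complex.continuous_ofReal.comp hm).aestronglyMeasurable.mul (Lp.aestronglyMeasurable f)
  · simp only [norm_mul, Complex.norm_real, Real.norm_eq_abs]
    rw [← mul_assoc]
    exact mul_le_mul_of_nonneg_right (hmn ξ) (norm_nonneg _)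

theorem memLp_mul_of_bdd {d : ℕ} {m : Rd d → ℝ} (hm : Continuous m) (C : ℝ)
    (hC : ∀ ξ, |m ξ| ≤ C) (f : L2 d) :
    MemLp (fun ξ => (m ξ : ℂ) * (f : Rd d → ℂ) ξ) 2 volume :=
  memLp_mul_of_bound (n := fun _ => 1) hm C (by simpa using hC) f (by simpa using Lp.memLp f)

theorem continuous_freq {d : ℕ} : Continuous (freq : Rd d → ℝ) := by
  unfold freq; fun_prop

theorem continuous_bracket {d : ℕ} : Continuous (bracket : Rd d → ℝ) :=
  (continuous_const.add (continuous_freq.pow 2)).sqrt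

theorem freq_nonneg {d : ℕ} (ξ : Rd d) : 0 ≤ freq ξ := by
  unfold freq; positivity

theorem one_le_bracket {d : ℕ} (ξ : Rd d) : 1 ≤ bracket ξ :=
  Real.one_le_sqrt.mpr (by nlinarith [sq_nonneg (freq ξ)])

theorem freq_le_bracket {d : ℕ} (ξ : Rd d) : freq ξ ≤ bracket ξ :=
  Real.le_sqrt_of_sq_le (by linarith)

theorem bracket_le {d : ℕ} (ξ : Rd d) : bracket ξ ≤ 1 + freq ξ :=
  Real.sqrt_le_iff.mpr ⟨by linarith [freq_nonneg ξ], by nlinarith [freq_nonneg ξ]⟩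

/-! ### The Hilbert space `H¹(ℝ^d)` -/

/-- The functions `f ∈ L²` with `⟨D⟩ f ∈ L²`. -/
def sobolevOne (d : ℕ) : Submodule ℂ (L2 d) where
  carrier := {f | MemLp (fun ξ => (bracket ξ : ℂ) * (𝓕 f : L2 d) ξ) 2 volume}
  zero_mem' := by
    have h : (𝓕 (0 : L2 d) : L2 d) = 0 := (Lp.fourierTransformₗᵢ (Rd d) ℂ).map_zero
    have h0 : MemLp (fun _ : Rd d => (0 : ℂ)) 2 volume := MemLp.zero
    refine (memLp_congr_ae ?_).mp h0
    rw [h]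
    filter_upwards [Lp.coeFn_zero ℂ 2 (volume : Measure (Rd d))] with ξ hξ
    simp
  add_mem' := by
    intro f g hf hg
    have h : (𝓕 (f + g) : L2 d) = 𝓕 f + 𝓕 g := (Lp.fourierTransformₗᵢ (Rd d) ℂ).map_add f g
    refine (memLp_congr_ae ?_).mp (MemLp.add hf hg)
    rw [h]
    filter_upwards [Lp.coeFn_add (𝓕 f : L2 d) (𝓕 g)] with ξ hξ
    simp only [hξ, Pi.add_apply, mul_add]
  smul_mem' := by
    intro c f hf
    have h : (𝓕 (c • f) : L2 d) = c • 𝓕 f := (Lp.fourierTransformₗᵢ (Rd d) ℂ).map_smul c f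
    refine (memLp_congr_ae ?_).mp (MemLp.const_smul hf c)
    rw [h]
    filter_upwards [Lp.coeFn_smul c (𝓕 f : L2 d)] with ξ hξ
    simp only [hξ, Pi.smul_apply, smul_eq_mul, mul_left_comm]

/-- The Sobolev space `H¹(ℝ^d)`, normed by `‖⟨D⟩ f‖_{L²}` below (and not by the norm of `L²`). -/
def H1 (d : ℕ) : Type := sobolevOne d

instance (d : ℕ) : AddCommGroup (H1 d) := inferInstanceAs (AddCommGroup (sobolevOne d))
instance (d : ℕ) : Module ℂ (H1 d) := inferInstanceAs (Module ℂ (sobolevOne d))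

/-- The inclusion `H¹ → L²`. -/
def H1.toL2 {d : ℕ} : H1 d →ₗ[ℂ] L2 d := (sobolevOne d).subtype

theorem H1.mem {d : ℕ} (f : H1 d) :
    MemLp (fun ξ => (bracket ξ : ℂ) * (𝓕 (H1.toL2 f) : L2 d) ξ) 2 volume := f.2

/-- An element of `H¹` from a function of `L²` with `⟨D⟩ f ∈ L²`. -/
def H1.mk {d : ℕ} (f : L2 d)
    (h : MemLp (fun ξ => (bracket ξ : ℂ) * (𝓕 f : L2 d) ξ) 2 volume) : H1 d := ⟨f, h⟩

/-- The Fourier transform of `⟨D⟩ f` for `f ∈ H¹`, an element of `L²`. -/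
def H1.weighted {d : ℕ} : H1 d →ₗ[ℂ] L2 d where
  toFun f := (H1.mem f).toLp _
  map_add' f g := by
    have h : (𝓕 (H1.toL2 (f + g)) : L2 d) = 𝓕 (H1.toL2 f) + 𝓕 (H1.toL2 g) := by
      rw [map_add]; exact (Lp.fourierTransformₗᵢ (Rd d) ℂ).map_add _ _
    rw [← MemLp.toLp_add]
    refine (MemLp.toLp_eq_toLp_iff _ _).mpr ?_
    rw [h]
    filter_upwards [Lp.coeFn_add (𝓕 (H1.toL2 f) : L2 d) (𝓕 (H1.toL2 g))] with ξ hξ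
    simp only [hξ, Pi.add_apply, mul_add]
  map_smul' c f := by
    have h : (𝓕 (H1.toL2 (c • f)) : L2 d) = c • 𝓕 (H1.toL2 f) := by
      rw [map_smul]; exact (Lp.fourierTransformₗᵢ (Rd d) ℂ).map_smul _ _
    rw [RingHom.id_apply, ← MemLp.toLp_const_smul]
    refine (MemLp.toLp_eq_toLp_iff _ _).mpr ?_
    rw [h]
    filter_upwards [Lp.coeFn_smul c (𝓕 (H1.toL2 f) : L2 d)] with ξ hξ
    simp only [hξ, Pi.smul_apply, smul_eq_mul, mul_left_comm]

theorem H1.coeFn_weighted {d : ℕ} (f : H1 d) :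
    (H1.weighted f : Rd d → ℂ) =ᵐ[volume]
      fun ξ => (bracket ξ : ℂ) * (𝓕 (H1.toL2 f) : L2 d) ξ :=
  (H1.mem f).coeFn_toLp

theorem H1.weighted_injective {d : ℕ} : Function.Injective (H1.weighted (d := d)) := by
  intro f g hfg
  have h1 := H1.coeFn_weighted f
  rw [hfg] at h1
  have h2 : (𝓕 (H1.toL2 f) : L2 d) = 𝓕 (H1.toL2 g) := by
    refine Lp.ext ?_
    filter_upwards [h1, H1.coeFn_weighted g] with ξ hξ hξ'
    have hb : (bracket ξ : ℂ) ≠ 0 := by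
      exact_mod_cast (lt_of_lt_of_le one_pos (one_le_bracket ξ)).ne'
    exact mul_left_cancel₀ hb (hξ.symm.trans hξ')
  exact Subtype.ext ((Lp.fourierTransformₗᵢ (Rd d) ℂ).injective h2)

theorem H1.weighted_surjective {d : ℕ} : Function.Surjective (H1.weighted (d := d)) := by
  intro g
  have hc : Continuous fun ξ : Rd d => (bracket ξ)⁻¹ :=
    continuous_bracket.inv₀ fun ξ => (lt_of_lt_of_le one_pos (one_le_bracket ξ)).ne'
  have hm := memLp_mul_of_bdd hc 1 (fun ξ => by
    have := one_le_bracket ξ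
    rw [abs_of_nonneg (by positivity)]
    exact inv_le_one_of_one_le₀ this) g
  have hF : (𝓕 (𝓕⁻ (hm.toLp _) : L2 d) : L2 d) = hm.toLp _ := fourier_fourierInv_eq _
  have key : (fun ξ => (bracket ξ : ℂ) * (𝓕 (𝓕⁻ (hm.toLp _) : L2 d) : L2 d) ξ)
      =ᵐ[volume] g := by
    rw [hF]
    filter_upwards [hm.coeFn_toLp] with ξ hξ
    have hb : (bracket ξ : ℂ) ≠ 0 := by
      exact_mod_cast (lt_of_lt_of_le one_pos (one_le_bracket ξ)).ne'
    rw [hξ]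
    push_cast
    rw [← mul_assoc, mul_inv_cancel₀ hb, one_mul]
  refine ⟨H1.mk (𝓕⁻ (hm.toLp _)) ((memLp_congr_ae key).mpr (Lp.memLp g)), ?_⟩
  refine Lp.ext ?_
  exact (H1.coeFn_weighted _).trans key

instance (d : ℕ) : NormedAddCommGroup (H1 d) :=
  NormedAddCommGroup.induced (H1 d) (L2 d) H1.weighted H1.weighted_injective

theorem H1.norm_def {d : ℕ} (f : H1 d) : ‖f‖ = ‖H1.weighted f‖ := rfl

/-- The inner product of `H¹` is `⟨⟨D⟩ f, ⟨D⟩ g⟩_{L²}`, computed on the Fourier side. -/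
instance (d : ℕ) : InnerProductSpace ℂ (H1 d) where
  inner f g := inner ℂ (H1.weighted f) (H1.weighted g)
  norm_smul_le c f := by simp only [H1.norm_def, map_smul, norm_smul, le_refl]
  norm_sq_eq_re_inner f := by
    rw [H1.norm_def]; exact norm_sq_eq_re_inner (𝕜 := ℂ) (H1.weighted f)
  conj_inner_symm f g := inner_conj_symm _ _
  add_left f g h := by simp only [map_add, inner_add_left]
  smul_left f g c := by simp only [map_smul, inner_smul_left]

instance (d : ℕ) : CompleteSpace (H1 d) := by
  let e : H1 d ≃ₗᵢ[ℂ] L2 d :=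
    { LinearEquiv.ofBijective H1.weighted ⟨H1.weighted_injective, H1.weighted_surjective⟩ with
      norm_map' := fun _ => rfl }
  exact (completeSpace_congr (e := e.toEquiv) e.isometry.isUniformEmbedding).mpr inferInstance

/-! ### The free wave group -/

theorem memLp_cos {d : ℕ} (t : ℝ) (f : L2 d) :
    MemLp (fun ξ => (Real.cos (t * freq ξ) : ℂ) * (𝓕 f : L2 d) ξ) 2 volume := by
  have h := memLp_mul_of_bdd (d := d) (m := fun ξ => Real.cos (t * freq ξ))
    (Real.continuous_cos.comp (continuous_const.mul continuous_freq)) 1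
    (fun ξ => Real.abs_cos_le_one _) (𝓕 f)
  exact h

/-- `C(t) = cos(t|D|)` on `L²`. -/
def cosL2 {d : ℕ} (t : ℝ) (f : L2 d) : L2 d :=
  multiplier (fun ξ => Real.cos (t * freq ξ)) f (memLp_cos t f)

/-- `C(t) = cos(t|D|)` on `H¹`. -/
def cosH1 {d : ℕ} (t : ℝ) (f : H1 d) : H1 d :=
  H1.mk (cosL2 t (H1.toL2 f)) (by
    have h := memLp_mul_of_bound (d := d)
      (m := fun ξ => bracket ξ * Real.cos (t * freq ξ)) (n := bracket)
      (continuous_bracket.mul (Real.continuous_cos.comp (continuous_const.mul continuous_freq)))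
      1 (fun ξ => by
        rw [abs_mul, mul_comm]
        exact mul_le_mul_of_nonneg_right (Real.abs_cos_le_one _) (abs_nonneg _))
      (𝓕 (H1.toL2 f)) (H1.mem f)
    refine (memLp_congr_ae ?_).mp h
    filter_upwards [fourier_multiplier _ _ (memLp_cos t (H1.toL2 f))] with ξ hξ
    unfold cosL2
    rw [hξ]; push_cast; ring)

theorem memLp_sin {d : ℕ} (t : ℝ) (f : L2 d) :
    MemLp (fun ξ => ((t * Real.sinc (t * freq ξ) : ℝ) : ℂ) * (𝓕 f : L2 d) ξ) 2 volume :=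
  memLp_mul_of_bdd (d := d) (m := fun ξ => t * Real.sinc (t * freq ξ))
    (continuous_const.mul (Real.continuous_sinc.comp (continuous_const.mul continuous_freq))) |t|
    (fun ξ => by
      rw [abs_mul]
      exact mul_le_of_le_one_right (abs_nonneg _) (Real.abs_sinc_le_one _)) (𝓕 f)

theorem mul_abs_sinc_le (t r : ℝ) : |r * (t * Real.sinc (t * r))| ≤ 1 := by
  by_cases h : t * r = 0
  · rw [← mul_assoc, mul_comm r t, h]; simp
  · rw [Real.sinc_of_ne_zero h, ← mul_assoc, mul_comm r t, mul_div_cancel₀ _ h]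
    exact Real.abs_sin_le_one _

/-- `S(t) = sin(t|D|)/|D|` as a map `L² → H¹`; its symbol is `t sinc(t|ξ|)`, where
`sinc r = sin r / r` and `sinc 0 = 1`. -/
def sinH1 {d : ℕ} (t : ℝ) (f : L2 d) : H1 d :=
  H1.mk (multiplier (fun ξ => t * Real.sinc (t * freq ξ)) f (memLp_sin t f)) (by
    have h := memLp_mul_of_bdd (d := d)
      (m := fun ξ => bracket ξ * (t * Real.sinc (t * freq ξ)))
      (continuous_bracket.mul (continuous_const.mul
        (Real.continuous_sinc.comp (continuous_const.mul continuous_freq))))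
      (|t| + 1) (fun ξ => by
        have h1 := mul_abs_sinc_le t (freq ξ)
        have h2 : |t * Real.sinc (t * freq ξ)| ≤ |t| := by
          rw [abs_mul]
          exact mul_le_of_le_one_right (abs_nonneg _) (Real.abs_sinc_le_one _)
        have hb := bracket_le ξ
        have hb1 := one_le_bracket ξ
        rw [abs_mul, abs_of_nonneg (freq_nonneg ξ)] at h1
        rw [abs_mul, abs_of_nonneg (by linarith : 0 ≤ bracket ξ)]
        nlinarith [abs_nonneg (t * Real.sinc (t * freq ξ))])
      (𝓕 f)
    refine (memLp_congr_ae ?_).mp h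
    filter_upwards [fourier_multiplier _ _ (memLp_sin t f)] with ξ hξ
    rw [hξ]; push_cast; ring)

/-- `Δ S(t) = -|D| sin(t|D|)` as a map `H¹ → L²`. -/
def lapSin {d : ℕ} (t : ℝ) (f : H1 d) : L2 d :=
  multiplier (fun ξ => -(freq ξ * Real.sin (t * freq ξ))) (H1.toL2 f)
    (memLp_mul_of_bound (d := d) (m := fun ξ => -(freq ξ * Real.sin (t * freq ξ))) (n := bracket)
      (continuous_freq.mul
        (Real.continuous_sin.comp (continuous_const.mul continuous_freq))).neg 1
      (fun ξ => by
        have h1 := freq_le_bracket ξ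
        have h2 := Real.abs_sin_le_one (t * freq ξ)
        rw [abs_neg, abs_mul, one_mul]
        calc |freq ξ| * |Real.sin (t * freq ξ)| ≤ |freq ξ| :=
              mul_le_of_le_one_right (abs_nonneg _) h2
          _ ≤ |bracket ξ| := by
              rw [abs_of_nonneg (freq_nonneg ξ)]; exact h1.trans (le_abs_self _))
      (𝓕 (H1.toL2 f)) (H1.mem f))

/-- The energy space `H¹ × L²`, with its Hilbert space structure. -/
abbrev Energy (d : ℕ) : Type := WithLp 2 (H1 d × L2 d)

/-- The free wave group `U₀(t)(f, g) = (C(t) f + S(t) g, Δ S(t) f + C(t) g)`. -/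
def freeWave {d : ℕ} (t : ℝ) (u : Energy d) : Energy d :=
  WithLp.toLp 2 (cosH1 t u.fst + sinH1 t u.snd, lapSin t u.fst + cosL2 t u.snd)

/-- The operator `(f, g) ↦ (0, V f)` on `H¹ × L²`. -/
def potential {d : ℕ} (V : LInfty d) (u : Energy d) : Energy d :=
  WithLp.toLp 2 (0, V • H1.toL2 u.fst)

/-- The Duhamel operator `(Λ F)(t) = ∫₀ᵗ U₀(t - s) F(s) ds`. -/
def duhamel {d : ℕ} (F : ℝ → Energy d) (t : ℝ) : Energy d :=
  ∫ s in (0 : ℝ)..t, freeWave (t - s) (F s)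

/-- The Duhamel terms `W_{k,V} = (Λ 𝐕)^k U₀`, applied to `u`, as functions of `t`. -/
def duhamelTerm {d : ℕ} (V : LInfty d) (u : Energy d) : ℕ → ℝ → Energy d
  | 0 => fun t => freeWave t u
  | k + 1 => duhamel fun s => potential V (duhamelTerm V u k s)

/-- `⟨φ, W_{k,V}⟩ u = ∫ φ(t) W_{k,V}(t) u dt`. -/
def smearedTerm {d : ℕ} (V : LInfty d) (k : ℕ) (φ : ℝ → ℂ) (u : Energy d) : Energy d :=
  ∫ t : ℝ, φ t • duhamelTerm V u k t

/-! ### Trace class operators -/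

/-- `A` is trace class: `A = ∑ₙ ⟨xₙ, ·⟩ yₙ` with `∑ₙ ‖xₙ‖ ‖yₙ‖ < ∞`. -/
def IsTraceClass {H : Type*} [NormedAddCommGroup H] [InnerProductSpace ℂ H]
    (A : H →L[ℂ] H) : Prop :=
  ∃ x y : ℕ → H, Summable (fun n => ‖x n‖ * ‖y n‖) ∧
    ∀ u, HasSum (fun n => inner ℂ (x n) u • y n) (A u)

/-- `A` is trace class and its trace, computed in any Hilbert basis, is `τ`. -/
def HasTrace.{u} {H : Type u} [NormedAddCommGroup H] [InnerProductSpace ℂ H]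
    (A : H →L[ℂ] H) (τ : ℂ) : Prop :=
  IsTraceClass A ∧
    ∀ (ι : Type u) (b : HilbertBasis ι ℂ H), HasSum (fun i => inner ℂ (b i) (A (b i))) τ

/-! ### Potentials and Sobolev norms -/

/-- `V` has compact support (vanishes almost everywhere outside a compact set). -/
def CompactlySupported {d : ℕ} (V : LInfty d) : Prop :=
  ∃ K : Set (Rd d), IsCompact K ∧ ∀ᵐ x, x ∉ K → V x = 0

/-- `V` is real valued. -/
def IsReal {d : ℕ} (V : LInfty d) : Prop := ∀ᵐ x, (V x).im = 0

/-- `V ∈ H^m(ℝ^d)`. -/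
def InSobolev {d : ℕ} (m : ℕ) (V : LInfty d) : Prop :=
  TemperedDistribution.MemSobolev (m : ℝ) 2 (V : 𝓢'(Rd d, ℂ))

/-- `‖V‖_{L²}²`. -/
def l2NormSq {d : ℕ} (V : LInfty d) : ℝ := ∫ x, ‖V x‖ ^ 2

/-- `‖V‖_{H^m}² = ‖⟨D⟩^m V‖_{L²}²`, for `V ∈ H^m` of compact support (Mathlib's Fourier transform
is unitary, so that no power of `2π` appears). -/
def sobolevNormSq {d : ℕ} (m : ℕ) (V : LInfty d) : ℝ :=
  ∫ ξ, (1 + freq ξ ^ 2) ^ m * ‖𝓕 (V : Rd d → ℂ) ξ‖ ^ 2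

/-- `‖|D|^j V‖_{L²}²`, for `V ∈ H^j` of compact support. -/
def homSobolevNormSq {d : ℕ} (j : ℕ) (V : LInfty d) : ℝ :=
  ∫ ξ, freq ξ ^ (2 * j) * ‖𝓕 (V : Rd d → ℂ) ξ‖ ^ 2

/-- The operator `t⁻¹ ∂_t`, used for `t > 0`. -/
def invDeriv (φ : ℝ → ℂ) : ℝ → ℂ := fun t => (t : ℂ)⁻¹ * deriv φ t

end WaveTrace

end

/-!
The operator `⟨φ, W_{2,V}⟩` is studied on the Fourier side, where multiplication by `V` is
convolution with `v = 𝓕 V`. There it is a `2 × 2` matrix of integral operators with kernels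
`∫ v(ξ - ζ) v(ζ - η) M(ξ, ζ, η) dζ`. The symbols `M` are iterated convolutions in time of the
scalar propagators `sin(t a) / a` and `cos(t a)`, integrated against `φ`. The off-diagonal symbols
are odd in time and vanish because `φ` is even (`propSymbol_pos_vel`, `propSymbol_vel_pos`); the
diagonal ones are, up to conjugation by `⟨D⟩`, both equal to `M_φ = duhamelSymbol φ`.

*Trace class.* The wave equation in the outgoing variable reads
`(1 + |ξ|²) M_φ = M_{φ - φ''} + (a term with one convolution less)`. Iterating it writes the
kernel as a finite sum of kernels in which one of the symbols of the three factors decays like a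
high power of the frequency. The kernel is then a product of two Hilbert–Schmidt kernels. If the
middle symbol decays, the decay is shared between both factors (`isFactorable_sandwich_middle`);
if an outer one does, a smooth cutoff equal to `1` on the support of `V` is inserted next to it
(`isFactorable_sandwich_left`, `isFactorable_sandwich_right`). A product of two Hilbert–Schmidt
operators is nuclear, its trace in any Hilbert basis is the integral of the kernel over the
diagonal, and so (`exists_hasTrace_smearedTerm`)
`tr ⟨φ, W_{2,V}⟩ = 2 ∬ v(ξ - ζ) v(ζ - ξ) M_φ(ξ, ζ, ξ) dζ dξ`.

*Evaluation.* The factor `v(ξ - ζ) v(ζ - ξ)` is symmetric in `ξ` and `ζ`, so only the symmetrized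
symbol matters. It is a divided difference, hence an average over `0 ≤ θ ≤ 1` of a function `P` of
`(1 - θ)|ξ|² + θ|ζ|²`, where `P(a²)` is the cosine transform of an even test function determined
by `φ`. With `ζ = ξ - η` and the square completed, the integral over `ξ` is a radial integral of
`P(|ξ|² + θ(1 - θ)|η|²)` over `ℝ^d` (`integral_freqSymbol`). Integration by parts in the radius
lowers the dimension by two (`radialInt_add_two`). In dimension two the integral is explicit, and
in dimension one it is given by the Bessel function `J₀` (`radialInt_one_eq`). In every dimension
it is thus a pairing of the weight in the trace formula with the cosine transform of a finite
measure on `[-1, 1]` (`IsTraceKernel`, `IsTraceMeasure`). Therefore (`traceDensity`)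
`a(t) = K ∫ v(η) v(-η) ∫ cos(t |η| u) dν(u) dη`, where `ν` and `K` depend only on the dimension
and the mass of `K ν` is at most `(2π)^{-⌊d/2⌋}`.

*Regularity.* If `V ∈ H^m`, this integral can be differentiated `2m` times; it is even in `t`, and
for real `V`, where `v(η) v(-η) = |v(η)|²`, its even derivatives at `0` are multiples of
`∫ |η|^{2j} |v(η)|² dη`. Conversely, for real `V`, the central difference of order `2m` at the
origin kills the given polynomial, and up to sign and the factor `K` it is the integral of a
nonnegative function. Fatou's lemma bounds the moment of order `2m`
(`integrable_moment_of_expansion`), and the moment on a single slice `u ≠ 0` gives `V ∈ H^m`.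
-/

noncomputable section

namespace WaveTrace

/-! ### Even test functions and their cosine transforms -/

/-- An even, smooth, compactly supported function on `ℝ`. -/
structure EvenTest (φ : ℝ → ℂ) : Prop where
  smooth : ContDiff ℝ ∞ φ
  supp : HasCompactSupport φ
  even : ∀ t, φ (-t) = φ t

namespace EvenTest

variable {φ : ℝ → ℂ}

theorem continuous (h : EvenTest φ) : Continuous φ := h.smooth.continuous

theorem integrable_mul (h : EvenTest φ) {g : ℝ → ℂ} (hg : Continuous g) :
    Integrable fun t => φ t * g t :=
  (h.continuous.mul hg).integrable_of_hasCompactSupport h.supp.mul_right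

theorem exists_bound (h : EvenTest φ) : ∃ R : ℝ, 0 < R ∧ ∀ t, R ≤ |t| → φ t = 0 := by
  obtain ⟨R, hR⟩ := h.supp.isCompact.isBounded.subset_closedBall 0
  refine ⟨max R 0 + 1, by positivity, fun t ht => ?_⟩
  by_contra hne
  have h1 := hR (subset_tsupport φ hne)
  rw [Metric.mem_closedBall, dist_zero_right, Real.norm_eq_abs] at h1
  linarith [le_max_left R 0]

theorem hasDerivAt (h : EvenTest φ) (t : ℝ) : HasDerivAt φ (deriv φ t) t :=
  (h.smooth.differentiable (by simp) t).hasDerivAt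

theorem smooth_deriv (h : EvenTest φ) : ContDiff ℝ ∞ (deriv φ) :=
  (contDiff_infty_iff_deriv.1 h.smooth).2

theorem deriv_neg (h : EvenTest φ) (t : ℝ) : deriv φ (-t) = -deriv φ t := by
  have h1 : (fun s => φ (-s)) = φ := funext h.even
  have h2 := deriv_comp_neg φ t
  rw [h1] at h2
  rw [h2, neg_neg]

theorem deriv_deriv (h : EvenTest φ) : EvenTest (deriv (deriv φ)) where
  smooth := (contDiff_infty_iff_deriv.1 h.smooth_deriv).2
  supp := h.supp.deriv.deriv
  even t := by
    have h1 : (fun s => deriv φ (-s)) = fun s => -deriv φ s := funext h.deriv_neg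
    have h2 := deriv_comp_neg (deriv φ) t
    rw [h1, deriv.fun_neg] at h2
    exact (neg_injective h2).symm

/-- `φ - φ''` is an even test function; it represents the symbol `1 + |D|²` acting on `φ(|D|)`. -/
theorem sub_deriv_deriv (h : EvenTest φ) : EvenTest fun t => φ t - deriv (deriv φ) t where
  smooth := h.smooth.sub h.deriv_deriv.smooth
  supp := h.supp.sub h.deriv_deriv.supp
  even t := by rw [h.even, h.deriv_deriv.even]

end EvenTest

/-- The integrals `∫₀¹ sᵏ g(ts) ds` form a family closed under differentiation in `t`. -/
theorem contDiff_integral_mul_pow (n : ℕ) : ∀ (k : ℕ) (g : ℝ → ℂ), ContDiff ℝ ∞ g →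
    ContDiff ℝ n fun t : ℝ => ∫ s in (0 : ℝ)..1, (s : ℂ) ^ k * g (t * s) := by
  have hcont : ∀ (k : ℕ) (g : ℝ → ℂ), Continuous g →
      Continuous (Function.uncurry fun t s : ℝ => (s : ℂ) ^ k * g (t * s)) := by
    intro k g hg
    exact ((Complex.continuous_ofReal.comp continuous_snd).pow k).mul
      (hg.comp (continuous_fst.mul continuous_snd))
  have hder : ∀ (k : ℕ) (g : ℝ → ℂ), ContDiff ℝ ∞ g → ∀ t : ℝ,
      HasDerivAt (fun t : ℝ => ∫ s in (0 : ℝ)..1, (s : ℂ) ^ k * g (t * s))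
        (∫ s in (0 : ℝ)..1, (s : ℂ) ^ (k + 1) * deriv g (t * s)) t := by
    intro k g hg t
    have hg' := (contDiff_infty_iff_deriv.1 hg)
    have hc := hcont (k + 1) (deriv g) hg'.2.continuous
    obtain ⟨C, hC⟩ := ((isCompact_Icc (a := t - 1) (b := t + 1)).prod
      (isCompact_Icc (a := (0 : ℝ)) (b := 1))).exists_bound_of_continuousOn hc.continuousOn
    refine (intervalIntegral.hasDerivAt_integral_of_dominated_loc_of_deriv_le
      (bound := fun _ => C) (F' := fun t s => (s : ℂ) ^ (k + 1) * deriv g (t * s))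
      (Metric.ball_mem_nhds t one_pos) ?_ ?_ ?_ ?_ ?_ ?_).2
    · exact Filter.Eventually.of_forall fun x =>
        ((hcont k g hg.continuous).comp (Continuous.prodMk_right x)).aestronglyMeasurable
    · exact ((hcont k g hg.continuous).comp (Continuous.prodMk_right t)).intervalIntegrable _ _
    · exact (hc.comp (Continuous.prodMk_right t)).aestronglyMeasurable
    · refine Filter.Eventually.of_forall fun s hs x hx => hC (x, s) ⟨?_, ?_⟩
      · rw [Metric.mem_ball, Real.dist_eq, abs_lt] at hx
        constructor <;> linarith
      · rw [uIoc_of_le zero_le_one] at hs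
        exact ⟨hs.1.le, hs.2⟩
    · exact intervalIntegrable_const
    · refine Filter.Eventually.of_forall fun s _ x _ => ?_
      have h1 : HasDerivAt (fun x : ℝ => g (x * s)) (s • deriv g (x * s)) x := by
        have := (hg'.1 (x * s)).hasDerivAt.scomp x (hasDerivAt_mul_const s)
        exact this
      have h2 := h1.const_mul ((s : ℂ) ^ k)
      refine h2.congr_deriv ?_
      rw [Complex.real_smul]
      ring
  induction n with
  | zero =>
    intro k g hg
    rw [Nat.cast_zero, contDiff_zero]
    exact intervalIntegral.continuous_parametric_intervalIntegral_of_continuous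
      (hcont k g hg.continuous) continuous_const
  | succ n ih =>
    intro k g hg
    rw [Nat.cast_succ, contDiff_succ_iff_deriv]
    refine ⟨fun t => (hder k g hg t).differentiableAt, by simp, ?_⟩
    have : deriv (fun t : ℝ => ∫ s in (0 : ℝ)..1, (s : ℂ) ^ k * g (t * s)) =
        fun t => ∫ s in (0 : ℝ)..1, (s : ℂ) ^ (k + 1) * deriv g (t * s) :=
      funext fun t => (hder k g hg t).deriv
    rw [this]
    exact ih (k + 1) (deriv g) (contDiff_infty_iff_deriv.1 hg).2

namespace EvenTest

variable {φ : ℝ → ℂ}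

/-- The derivative of an even test function is `t` times an even test function, by Hadamard's
formula `φ'(t) = t ∫₀¹ φ''(ts) ds`. -/
theorem exists_deriv_eq_mul (h : EvenTest φ) :
    ∃ ψ, EvenTest ψ ∧ ∀ t : ℝ, deriv φ t = t * ψ t := by
  have h0 : deriv φ 0 = 0 := by
    have := h.deriv_neg 0
    rw [neg_zero] at this
    exact self_eq_neg.1 this
  have key : ∀ t : ℝ, deriv φ t = t * ∫ s in (0 : ℝ)..1, (s : ℂ) ^ 0 * deriv (deriv φ) (t * s) := by
    intro t
    simp only [pow_zero, one_mul]
    have h1 := intervalIntegral.integral_eq_sub_of_hasDerivAt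
      (f := fun s : ℝ => deriv φ (t * s)) (f' := fun s => (t : ℂ) * deriv (deriv φ) (t * s))
      (a := 0) (b := 1) (fun s _ => by
        have := ((h.smooth_deriv.differentiable (by simp) (t * s)).hasDerivAt).scomp s
          (hasDerivAt_const_mul t)
        rw [Complex.real_smul] at this
        exact this)
      ((continuous_const.mul (h.deriv_deriv.continuous.comp
        (continuous_const.mul continuous_id))).intervalIntegrable _ _)
    rw [intervalIntegral.integral_const_mul] at h1
    rw [h1]; simp [h0]
  refine ⟨fun t => ∫ s in (0 : ℝ)..1, (s : ℂ) ^ 0 * deriv (deriv φ) (t * s), ?_, key⟩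
  refine ⟨contDiff_infty.2 fun n => contDiff_integral_mul_pow n 0 _ h.deriv_deriv.smooth, ?_, ?_⟩
  · obtain ⟨R, hR, hφ⟩ := h.exists_bound
    refine HasCompactSupport.of_support_subset_isCompact (isCompact_Icc (a := -R) (b := R)) ?_
    intro t ht
    by_contra hn
    apply ht
    have htR : R < |t| := by
      by_contra hle
      exact hn (abs_le.1 (not_lt.1 hle))
    have h1 : deriv φ t = 0 := by
      have : φ =ᶠ[𝓝 t] fun _ => 0 := by
        filter_upwards [(isOpen_lt continuous_const continuous_abs).mem_nhds htR] with s hs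
        exact hφ s (le_of_lt hs)
      rw [this.deriv_eq]; simp
    have h2 := key t
    rw [h1] at h2
    have ht0 : (t : ℂ) ≠ 0 := by
      have : t ≠ 0 := abs_pos.1 (hR.trans htR)
      exact_mod_cast this
    exact (mul_eq_zero.1 h2.symm).resolve_left ht0
  · intro t
    refine intervalIntegral.integral_congr fun s _ => ?_
    simp only [neg_mul, h.deriv_deriv.even]

end EvenTest

/-- The function `t ↦ -∫ₜ^∞ s χ(s) ds`, for even `χ` of compact support. -/
def tailMoment (χ : ℝ → ℂ) (t : ℝ) : ℂ :=
  (∫ s in (0 : ℝ)..t, (s : ℂ) * χ s) - ∫ s in Ioi (0 : ℝ), (s : ℂ) * χ s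

namespace EvenTest

variable {χ : ℝ → ℂ}

theorem continuous_id_mul (h : EvenTest χ) : Continuous fun s : ℝ => (s : ℂ) * χ s :=
  Complex.continuous_ofReal.mul h.continuous

theorem hasDerivAt_tailMoment (h : EvenTest χ) (t : ℝ) :
    HasDerivAt (tailMoment χ) (t * χ t) t :=
  (h.continuous_id_mul.integral_hasStrictDerivAt 0 t).hasDerivAt.sub_const _

theorem tailMoment_eq_zero {R : ℝ} (hR : 0 < R)
    (hχ : ∀ t, R ≤ |t| → χ t = 0) {t : ℝ} (ht : R ≤ t) : tailMoment χ t = 0 := by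
  have h0 : 0 ≤ t := hR.le.trans ht
  unfold tailMoment
  rw [intervalIntegral.integral_of_le h0, sub_eq_zero]
  refine (setIntegral_eq_of_subset_of_forall_sdiff_eq_zero measurableSet_Ioi
    Ioc_subset_Ioi_self fun s hs => ?_).symm
  have h1 : t < s := by
    by_contra hle
    exact hs.2 ⟨hs.1, not_lt.1 hle⟩
  rw [hχ s ((ht.trans h1.le).trans (le_abs_self s)), mul_zero]

theorem tailMoment_neg (h : EvenTest χ) (t : ℝ) : tailMoment χ (-t) = tailMoment χ t := by
  unfold tailMoment
  congr 1
  have h1 := intervalIntegral.integral_comp_neg (a := 0) (b := t) fun s : ℝ => (s : ℂ) * χ s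
  rw [neg_zero] at h1
  rw [intervalIntegral.integral_symm, ← h1, ← intervalIntegral.integral_neg]
  refine intervalIntegral.integral_congr fun s _ => ?_
  simp [h.even]

protected theorem tailMoment (h : EvenTest χ) : EvenTest (tailMoment χ) where
  smooth := by
    rw [contDiff_infty_iff_deriv]
    refine ⟨fun t => (h.hasDerivAt_tailMoment t).differentiableAt, ?_⟩
    have : deriv (tailMoment χ) = fun t : ℝ => (t : ℂ) * χ t :=
      funext fun t => (h.hasDerivAt_tailMoment t).deriv
    rw [this]
    exact Complex.ofRealCLM.contDiff.mul h.smooth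
  supp := by
    obtain ⟨R, hR, hχ⟩ := h.exists_bound
    refine HasCompactSupport.of_support_subset_isCompact (isCompact_Icc (a := -R) (b := R)) ?_
    intro t ht
    by_contra hn
    apply ht
    have htR : R < |t| := by
      by_contra hle
      exact hn (abs_le.1 (not_lt.1 hle))
    rcases abs_cases t with h1 | h1
    · exact tailMoment_eq_zero hR hχ (by linarith)
    · rw [← h.tailMoment_neg]
      exact tailMoment_eq_zero hR hχ (by linarith)
  even := h.tailMoment_neg

theorem deriv_tailMoment (h : EvenTest χ) (t : ℝ) : deriv (tailMoment χ) t = t * χ t :=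
  (h.hasDerivAt_tailMoment t).deriv

/-- An even test function is determined by its derivative. -/
theorem eq_of_deriv_eq {χ' : ℝ → ℂ} (h : EvenTest χ) (h' : EvenTest χ')
    (hd : ∀ t, deriv χ t = deriv χ' t) : χ = χ' := by
  obtain ⟨R, hR, hχ⟩ := h.exists_bound
  obtain ⟨R', hR', hχ'⟩ := h'.exists_bound
  funext t
  have h1 := is_const_of_deriv_eq_zero (f := fun t => χ t - χ' t)
    (fun t => ((h.hasDerivAt t).sub (h'.hasDerivAt t)).differentiableAt)
    (fun t => by
      have := ((h.hasDerivAt t).sub (h'.hasDerivAt t)).deriv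
      rw [hd, sub_self] at this
      exact this) t (R + R')
  have h2 : |R + R'| = R + R' := abs_of_pos (by linarith)
  simp only [hχ (R + R') (by linarith), hχ' (R + R') (by linarith), sub_self] at h1
  exact sub_eq_zero.1 h1

theorem tailMoment_eq_of_deriv {φ : ℝ → ℂ} (hφ : EvenTest φ) (h : EvenTest χ)
    (hd : ∀ t : ℝ, deriv φ t = t * χ t) : tailMoment χ = φ :=
  eq_of_deriv_eq h.tailMoment hφ fun t => by rw [h.deriv_tailMoment, hd]

end EvenTest

/-- The cosine transform `∫ χ(t) cos(tv) dt`. -/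
def cosTransform (χ : ℝ → ℂ) (v : ℝ) : ℂ := ∫ t : ℝ, χ t * (Real.cos (t * v) : ℂ)

namespace EvenTest

variable {χ : ℝ → ℂ}

theorem continuous_cos (v : ℝ) : Continuous fun t : ℝ => (Real.cos (t * v) : ℂ) := by fun_prop

theorem continuous_sin (v : ℝ) : Continuous fun t : ℝ => (Real.sin (t * v) : ℂ) := by fun_prop

theorem hasDerivAt_cos_mul (v t : ℝ) :
    HasDerivAt (fun t : ℝ => (Real.cos (t * v) : ℂ)) (-(v * (Real.sin (t * v) : ℂ))) t := by
  have h := ((hasDerivAt_mul_const (x := t) v).cos).ofReal_comp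
  convert h using 1
  push_cast
  ring

theorem hasDerivAt_sin_mul (v t : ℝ) :
    HasDerivAt (fun t : ℝ => (Real.sin (t * v) : ℂ)) (v * (Real.cos (t * v) : ℂ)) t := by
  have h := ((hasDerivAt_mul_const (x := t) v).sin).ofReal_comp
  convert h using 1
  push_cast
  ring

theorem integral_deriv_mul (h : ContDiff ℝ ∞ χ) (hs : HasCompactSupport χ) {g g' : ℝ → ℂ}
    (hg : ∀ t, HasDerivAt g (g' t) t) (hg' : Continuous g') :
    ∫ t, deriv χ t * g t = -∫ t, χ t * g' t := by
  have hgc : Continuous g := continuous_iff_continuousAt.2 fun t => (hg t).continuousAt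
  have hd := (contDiff_infty_iff_deriv.1 h)
  have := integral_mul_deriv_eq_deriv_mul_of_integrable (u := χ) (v := g) (u' := deriv χ) (v' := g')
    (fun t _ => (hd.1 t).hasDerivAt) (fun t _ => hg t)
    ((h.continuous.mul hg').integrable_of_hasCompactSupport hs.mul_right)
    ((hd.2.continuous.mul hgc).integrable_of_hasCompactSupport hs.deriv.mul_right)
    ((h.continuous.mul hgc).integrable_of_hasCompactSupport hs.mul_right)
  rw [this, neg_neg]

/-- The derivative in `v` brings down a factor `t`. As `t χ` is the derivative of `tailMoment χ`, an
integration by parts turns the sine back into a cosine. -/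
theorem hasDerivAt_cosTransform (h : EvenTest χ) (v : ℝ) :
    HasDerivAt (cosTransform χ) (v * cosTransform (tailMoment χ) v) v := by
  have h1 : HasDerivAt (cosTransform χ) (∫ t : ℝ, χ t * (-(t * (Real.sin (t * v) : ℂ)))) v := by
    refine (hasDerivAt_integral_of_dominated_loc_of_deriv_le (bound := fun t : ℝ => ‖(t : ℂ) * χ t‖)
      (F := fun (v t : ℝ) => χ t * (Real.cos (t * v) : ℂ))
      (F' := fun (v t : ℝ) => χ t * (-(t * (Real.sin (t * v) : ℂ)))) Filter.univ_mem
      ?_ ?_ ?_ ?_ ?_ ?_).2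
    · exact Filter.Eventually.of_forall fun v =>
        (h.integrable_mul (continuous_cos v)).aestronglyMeasurable
    · exact h.integrable_mul (continuous_cos v)
    · exact (h.integrable_mul
        ((Complex.continuous_ofReal.mul (continuous_sin v)).neg)).aestronglyMeasurable
    · refine Filter.Eventually.of_forall fun t x _ => ?_
      rw [norm_mul, norm_neg, norm_mul, norm_mul, mul_comm ‖χ t‖]
      refine mul_le_mul_of_nonneg_right (mul_le_of_le_one_right (norm_nonneg _) ?_) (norm_nonneg _)
      rw [Complex.norm_real]
      exact Real.abs_sin_le_one _
    · exact (h.continuous_id_mul.integrable_of_hasCompactSupport h.supp.mul_left).norm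
    · refine Filter.Eventually.of_forall fun t x _ => ?_
      have := hasDerivAt_cos_mul t x
      simp only [mul_comm x t] at this
      exact (this.const_mul (χ t)).congr_of_eventuallyEq
        (Filter.Eventually.of_forall fun y => by simp only [mul_comm y t])
  have h2 := integral_deriv_mul h.tailMoment.smooth h.tailMoment.supp
    (hasDerivAt_sin_mul v) (continuous_const.mul (continuous_cos v))
  convert h1 using 1
  have h3 : (v : ℂ) * cosTransform (tailMoment χ) v =
      ∫ t : ℝ, tailMoment χ t * (v * (Real.cos (t * v) : ℂ)) := by
    rw [cosTransform, ← integral_const_mul]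
    congr 1; funext t; ring
  rw [h3, ← neg_eq_iff_eq_neg.2 h2, ← integral_neg]
  congr 1; funext t
  rw [h.deriv_tailMoment]; ring

theorem continuous_cosTransform (h : EvenTest χ) : Continuous (cosTransform χ) :=
  continuous_iff_continuousAt.2 fun v => (h.hasDerivAt_cosTransform v).continuousAt

/-- The operator `1 - ∂²` acts on cosine transforms as multiplication by `1 + v²`. -/
theorem cosTransform_mul (h : EvenTest χ) (v : ℝ) :
    (1 + (v : ℂ) ^ 2) * cosTransform χ v =
      cosTransform (fun t => χ t - deriv (deriv χ) t) v := by
  have h1 : ∫ t, deriv (deriv χ) t * (Real.cos (t * v) : ℂ) =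
      -((v : ℂ) ^ 2 * cosTransform χ v) := by
    rw [integral_deriv_mul h.smooth_deriv h.supp.deriv (hasDerivAt_cos_mul v)
      (continuous_const.mul (continuous_sin v)).neg]
    have h2 := integral_deriv_mul h.smooth h.supp
      (fun t => ((hasDerivAt_sin_mul v t).const_mul (v : ℂ)).neg)
      (continuous_const.mul (continuous_const.mul (continuous_cos v))).neg
    rw [show (fun t => deriv χ t * -((v : ℂ) * (Real.sin (t * v) : ℂ))) =
      fun t => deriv χ t * (-fun t => (v : ℂ) * (Real.sin (t * v) : ℂ)) t from rfl, h2,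
      cosTransform, ← integral_const_mul, neg_neg, ← integral_neg]
    congr 1; funext t; ring
  have h3 : cosTransform (fun t => χ t - deriv (deriv χ) t) v =
      (∫ t, χ t * (Real.cos (t * v) : ℂ)) - ∫ t, deriv (deriv χ) t * (Real.cos (t * v) : ℂ) := by
    rw [← integral_sub (h.integrable_mul (continuous_cos v))
      (h.deriv_deriv.integrable_mul (continuous_cos v))]
    simp only [cosTransform, sub_mul]
  rw [h3, h1, cosTransform]
  ring

/-- The cosine transform of a test function decays rapidly. -/
theorem norm_cosTransform_le (N : ℕ) : ∀ {χ : ℝ → ℂ}, EvenTest χ →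
    ∃ C : ℝ, 0 ≤ C ∧ ∀ v, ‖cosTransform χ v‖ ≤ C * ((1 + v ^ 2) ^ N)⁻¹ := by
  induction N with
  | zero =>
    intro χ h
    refine ⟨∫ t, ‖χ t‖, integral_nonneg fun _ => norm_nonneg _, fun v => ?_⟩
    simp only [pow_zero, inv_one, mul_one]
    refine norm_integral_le_of_norm_le
      (h.continuous.integrable_of_hasCompactSupport h.supp).norm
      (Filter.Eventually.of_forall fun t => ?_)
    rw [norm_mul, Complex.norm_real]
    exact mul_le_of_le_one_right (norm_nonneg _) (Real.abs_cos_le_one _)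
  | succ N ih =>
    intro χ h
    obtain ⟨C, hC, hb⟩ := ih h.sub_deriv_deriv
    refine ⟨C, hC, fun v => ?_⟩
    have h1 := hb v
    rw [← h.cosTransform_mul, norm_mul] at h1
    have h2 : ‖(1 + (v : ℂ) ^ 2)‖ = 1 + v ^ 2 := by
      have : (1 + (v : ℂ) ^ 2) = ((1 + v ^ 2 : ℝ) : ℂ) := by push_cast; ring
      rw [this, Complex.norm_real, Real.norm_eq_abs, abs_of_pos (by positivity)]
    rw [h2] at h1
    rw [pow_succ, mul_inv, ← mul_assoc, ← div_eq_mul_inv, le_div_iff₀ (by positivity), mul_comm]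
    exact h1

/-- The cosine transform as a function of the squared frequency. -/
theorem hasDerivAt_cosTransform_sqrt (h : EvenTest χ) {u : ℝ} (hu : 0 < u) :
    HasDerivAt (fun u => cosTransform χ (√u)) (cosTransform (tailMoment χ) (√u) / 2) u := by
  have h1 := (h.hasDerivAt_cosTransform (√u)).scomp u (Real.hasDerivAt_sqrt hu.ne')
  refine h1.congr_deriv ?_
  have : (√u : ℂ) ≠ 0 := by exact_mod_cast (Real.sqrt_pos.2 hu).ne'
  rw [Complex.real_smul]
  push_cast
  field_simp

end EvenTest

theorem integral_eq_two_mul_of_even {f : ℝ → ℂ} (hf : Integrable f) (he : ∀ t, f (-t) = f t) :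
    ∫ t, f t = 2 * ∫ t in Ioi (0 : ℝ), f t := by
  have h1 := intervalIntegral.integral_Iic_add_Ioi (b := (0 : ℝ)) hf.integrableOn hf.integrableOn
  have h2 := integral_comp_neg_Ioi (0 : ℝ) f
  rw [neg_zero] at h2
  simp only [he] at h2
  rw [← h1, ← h2]
  ring

theorem EvenTest.cosTransform_eq_two_mul {χ : ℝ → ℂ} (h : EvenTest χ) (v : ℝ) :
    cosTransform χ v = 2 * ∫ t in Ioi (0 : ℝ), χ t * (Real.cos (t * v) : ℂ) :=
  integral_eq_two_mul_of_even (h.integrable_mul (EvenTest.continuous_cos v)) fun t => by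
    rw [h.even, neg_mul, Real.cos_neg]

/-! ### Integrals of radial cosine transforms -/

namespace EvenTest

variable {χ : ℝ → ℂ}

theorem continuous_cosTransform_sqrt (h : EvenTest χ) (M : ℝ) :
    Continuous fun y : ℝ => cosTransform χ (√(y ^ 2 + M)) :=
  h.continuous_cosTransform.comp (Real.continuous_sqrt.comp (by fun_prop))

theorem norm_pow_mul_cosTransform_le (h : EvenTest χ) (k : ℕ) {M : ℝ} (hM : 0 ≤ M) :
    ∃ C : ℝ, 0 ≤ C ∧ ∀ y : ℝ, 0 ≤ y →
      ‖(y ^ k : ℝ) • cosTransform χ (√(y ^ 2 + M))‖ ≤ C * (1 + y ^ 2)⁻¹ := by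
  obtain ⟨C, hC, hb⟩ := norm_cosTransform_le (k + 1) h
  refine ⟨C, hC, fun y hy => ?_⟩
  have h1 := hb (√(y ^ 2 + M))
  rw [Real.sq_sqrt (by positivity)] at h1
  rw [norm_smul, Real.norm_eq_abs, abs_of_nonneg (by positivity)]
  have h2 : y ≤ 1 + (y ^ 2 + M) := by nlinarith [sq_nonneg (y - 1)]
  have h3 : y ^ k ≤ (1 + (y ^ 2 + M)) ^ k := pow_le_pow_left₀ hy h2 k
  calc y ^ k * ‖cosTransform χ (√(y ^ 2 + M))‖
      ≤ (1 + (y ^ 2 + M)) ^ k * (C * ((1 + (y ^ 2 + M)) ^ (k + 1))⁻¹) :=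
        mul_le_mul h3 h1 (norm_nonneg _) (by positivity)
    _ = C * (1 + (y ^ 2 + M))⁻¹ := by
        rw [pow_succ]
        field_simp
        ring
    _ ≤ C * (1 + y ^ 2)⁻¹ := by
        refine mul_le_mul_of_nonneg_left ?_ hC
        exact inv_anti₀ (by positivity) (by linarith)

theorem integrableOn_pow_mul_cosTransform (h : EvenTest χ) (k : ℕ) {M : ℝ} (hM : 0 ≤ M) :
    IntegrableOn (fun y : ℝ => (y ^ k : ℝ) • cosTransform χ (√(y ^ 2 + M))) (Ioi 0) := by
  obtain ⟨C, _, hb⟩ := h.norm_pow_mul_cosTransform_le k hM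
  refine Integrable.mono' ((integrable_inv_one_add_sq.const_mul C).integrableOn (s := Ioi 0)) ?_ ?_
  · exact ((continuous_pow k).smul (h.continuous_cosTransform_sqrt M)).aestronglyMeasurable
  · filter_upwards [ae_restrict_mem measurableSet_Ioi] with y hy using hb y (le_of_lt hy)

theorem tendsto_pow_mul_cosTransform (h : EvenTest χ) (k : ℕ) {M : ℝ} (hM : 0 ≤ M) :
    Filter.Tendsto (fun y : ℝ => (y ^ k : ℝ) • cosTransform χ (√(y ^ 2 + M)))
      Filter.atTop (𝓝 0) := by
  obtain ⟨C, _, hb⟩ := h.norm_pow_mul_cosTransform_le k hM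
  have h1 : Filter.Tendsto (fun y : ℝ => C * (1 + y ^ 2)⁻¹) Filter.atTop (𝓝 0) := by
    have : Filter.Tendsto (fun y : ℝ => 1 + y ^ 2) Filter.atTop Filter.atTop :=
      Filter.tendsto_atTop_add_const_left _ _ (Filter.tendsto_pow_atTop two_ne_zero)
    simpa using this.inv_tendsto_atTop.const_mul C
  refine squeeze_zero_norm' ?_ h1
  filter_upwards [Filter.eventually_ge_atTop 0] with y hy using hb y hy

theorem hasDerivAt_cosTransform_sqrt_sq_add (h : EvenTest χ) {M : ℝ} (hM : 0 ≤ M) {y : ℝ}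
    (hy : 0 < y) : HasDerivAt (fun y : ℝ => cosTransform χ (√(y ^ 2 + M)))
      (y • cosTransform (tailMoment χ) (√(y ^ 2 + M))) y := by
  have h1 := (h.hasDerivAt_cosTransform_sqrt (u := y ^ 2 + M) (by positivity)).scomp y
    ((hasDerivAt_pow 2 y).add_const M)
  refine h1.congr_deriv ?_
  simp only [Complex.real_smul]
  push_cast
  ring

/-- Integration by parts in the radial variable. -/
theorem integral_pow_succ_tailMoment (h : EvenTest χ) (k : ℕ) {M : ℝ} (hM : 0 ≤ M) :
    ∫ y in Ioi (0 : ℝ), (y ^ (k + 2) : ℝ) • cosTransform (tailMoment χ) (√(y ^ 2 + M)) =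
      -((k + 1 : ℝ) • ∫ y in Ioi (0 : ℝ), (y ^ k : ℝ) • cosTransform χ (√(y ^ 2 + M))) := by
  have hi := (h.tailMoment.integrableOn_pow_mul_cosTransform (k + 2) hM)
  have hi' : IntegrableOn (fun y : ℝ => (k + 1 : ℝ) • ((y ^ k : ℝ) •
      cosTransform χ (√(y ^ 2 + M)))) (Ioi 0) :=
    (h.integrableOn_pow_mul_cosTransform k hM).smul (k + 1 : ℝ)
  have key := integral_Ioi_of_hasDerivAt_of_tendsto (a := 0) (m := 0)
    (f := fun y : ℝ => (y ^ (k + 1) : ℝ) • cosTransform χ (√(y ^ 2 + M)))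
    (f' := fun y : ℝ => (y ^ (k + 2) : ℝ) • cosTransform (tailMoment χ) (√(y ^ 2 + M)) +
      (k + 1 : ℝ) • ((y ^ k : ℝ) • cosTransform χ (√(y ^ 2 + M))))
    ((continuous_pow _).smul (h.continuous_cosTransform_sqrt M)).continuousWithinAt
    (fun y hy => by
      have h1 := (hasDerivAt_pow (k + 1) y).smul (h.hasDerivAt_cosTransform_sqrt_sq_add hM hy)
      refine h1.congr_deriv ?_
      simp only [Complex.real_smul, Nat.add_sub_cancel]
      push_cast
      ring)
    (hi.add hi') (h.tendsto_pow_mul_cosTransform (k + 1) hM)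
  rw [integral_add hi hi', integral_smul] at key
  rw [eq_neg_iff_add_eq_zero, key]
  simp

/-- The planar case: the radial integrand is an exact derivative. -/
theorem integral_mul_tailMoment (h : EvenTest χ) {M : ℝ} (hM : 0 ≤ M) :
    ∫ y in Ioi (0 : ℝ), (y ^ 1 : ℝ) • cosTransform (tailMoment χ) (√(y ^ 2 + M)) =
      -cosTransform χ (√M) := by
  have key := integral_Ioi_of_hasDerivAt_of_tendsto (a := 0) (m := 0)
    (f := fun y : ℝ => cosTransform χ (√(y ^ 2 + M)))
    (f' := fun y : ℝ => (y ^ 1 : ℝ) • cosTransform (tailMoment χ) (√(y ^ 2 + M)))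
    (h.continuous_cosTransform_sqrt M).continuousWithinAt
    (fun y hy => by rw [pow_one]; exact h.hasDerivAt_cosTransform_sqrt_sq_add hM hy)
    (h.tailMoment.integrableOn_pow_mul_cosTransform 1 hM)
    (by simpa using h.tendsto_pow_mul_cosTransform 0 hM)
  rw [key]; simp

end EvenTest

/-- The integral of `ξ ↦ p(‖ξ‖² + M)` over `ℝ^d`, where `p(v²)` is the cosine transform of `χ`. -/
def radialInt (d : ℕ) (χ : ℝ → ℂ) (M : ℝ) : ℂ := ∫ ξ : Rd d, cosTransform χ (√(‖ξ‖ ^ 2 + M))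

/-- Polar coordinates. -/
theorem radialInt_eq (d : ℕ) (hd : 1 ≤ d) (χ : ℝ → ℂ) (M : ℝ) :
    radialInt d χ M = (d * (√Real.pi ^ d / Real.Gamma (d / 2 + 1)) : ℝ) •
      ∫ y in Ioi (0 : ℝ), (y ^ (d - 1) : ℝ) • cosTransform χ (√(y ^ 2 + M)) := by
  obtain ⟨n, rfl⟩ : ∃ n, d = n + 1 := ⟨d - 1, by omega⟩
  have : Nontrivial (Rd (n + 1)) := inferInstance
  have h := integral_fun_norm_addHaar (volume : Measure (Rd (n + 1)))
    fun y => cosTransform χ (√(y ^ 2 + M))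
  have hv : (volume : Measure (Rd (n + 1))).real (Metric.ball 0 1) =
      √Real.pi ^ (n + 1) / Real.Gamma ((n + 1 : ℕ) / 2 + 1) := by
    rw [measureReal_def, EuclideanSpace.volume_ball, Fintype.card_fin, ENNReal.ofReal_one, one_pow,
      one_mul, ENNReal.toReal_ofReal]
    have : 0 < Real.Gamma ((n + 1 : ℕ) / 2 + 1) := Real.Gamma_pos_of_pos (by positivity)
    positivity
  rw [radialInt, h, hv, finrank_euclideanSpace_fin, ← Nat.cast_smul_eq_nsmul ℝ, smul_smul]

/-- Integration by parts in the radius lowers the dimension by two. -/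
theorem radialInt_add_two {χ : ℝ → ℂ} (h : EvenTest χ) {d : ℕ} (hd : 1 ≤ d) {M : ℝ} (hM : 0 ≤ M) :
    radialInt (d + 2) (tailMoment χ) M = (-(2 * Real.pi) : ℝ) • radialInt d χ M := by
  obtain ⟨n, rfl⟩ : ∃ n, d = n + 1 := ⟨d - 1, by omega⟩
  rw [radialInt_eq _ (by omega), radialInt_eq _ hd, show n + 1 + 2 - 1 = n + 2 by omega,
    show n + 1 - 1 = n by omega, h.integral_pow_succ_tailMoment n hM, ← neg_smul, smul_smul,
    smul_smul]
  congr 1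
  have hG : Real.Gamma (((n + 1 + 2 : ℕ) : ℝ) / 2 + 1) =
      (((n + 1 : ℕ) : ℝ) / 2 + 1) * Real.Gamma (((n + 1 : ℕ) : ℝ) / 2 + 1) := by
    rw [← Real.Gamma_add_one (by positivity)]
    congr 1
    push_cast; ring
  have hpos : 0 < Real.Gamma (((n + 1 : ℕ) : ℝ) / 2 + 1) := Real.Gamma_pos_of_pos (by positivity)
  rw [hG, pow_add, Real.sq_sqrt Real.pi_pos.le]
  push_cast at hpos ⊢
  field_simp

/-- In dimension two the radial integral is explicit. -/
theorem radialInt_two {χ : ℝ → ℂ} (h : EvenTest χ) {M : ℝ} (hM : 0 ≤ M) :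
    radialInt 2 (tailMoment χ) M = (-(2 * Real.pi) : ℝ) • cosTransform χ (√M) := by
  rw [radialInt_eq _ (by norm_num), h.integral_mul_tailMoment hM, Nat.cast_ofNat,
    Real.sq_sqrt Real.pi_pos.le, div_self two_ne_zero, Real.Gamma_add_one one_ne_zero,
    Real.Gamma_one, smul_neg, neg_smul]
  norm_num

theorem radialInt_one {χ : ℝ → ℂ} (h : EvenTest χ) {M : ℝ} (hM : 0 ≤ M) :
    radialInt 1 χ M = ∫ y : ℝ, cosTransform χ (√(y ^ 2 + M)) := by
  have hi : Integrable fun y : ℝ => cosTransform χ (√(y ^ 2 + M)) := by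
    obtain ⟨C, _, hb⟩ := h.norm_pow_mul_cosTransform_le 0 hM
    refine Integrable.mono' (integrable_inv_one_add_sq.const_mul C)
      (h.continuous_cosTransform_sqrt M).aestronglyMeasurable
      (Filter.Eventually.of_forall fun y => ?_)
    have := hb |y| (abs_nonneg y)
    simpa using this
  rw [integral_eq_two_mul_of_even hi (fun t => by rw [neg_sq]), radialInt_eq 1 le_rfl]
  have hG : Real.Gamma ((1 : ℕ) / 2 + 1) = √Real.pi / 2 := by
    rw [Nat.cast_one, Real.Gamma_add_one (by norm_num), Real.Gamma_one_half_eq]; ring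
  have h2 : ((1 : ℕ) * (√Real.pi ^ 1 / Real.Gamma ((1 : ℕ) / 2 + 1)) : ℝ) = 2 := by
    rw [hG]
    have : 0 < √Real.pi := Real.sqrt_pos.2 Real.pi_pos
    field_simp
    simp
  rw [h2]
  simp [Complex.real_smul]

/-! ### The line integral of a radial function in the plane -/

theorem integral_complex_eq {F : ℂ → ℂ} (hF : Integrable F) :
    ∫ z, F z = ∫ x : ℝ, ∫ y : ℝ, F ⟨x, y⟩ := by
  have hp := Complex.volume_preserving_equiv_real_prod.symm Complex.measurableEquivRealProd
  rw [← hp.integral_comp' F]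
  have hi : Integrable (fun p : ℝ × ℝ => F (Complex.measurableEquivRealProd.symm p)) :=
    (hp.integrable_comp_emb (MeasurableEquiv.measurableEmbedding _)).2 hF
  rw [Measure.volume_eq_prod] at hi ⊢
  rw [integral_prod _ hi]
  rfl

/-- The integral of `cexp (i Re(w̄ z))` against a rotation invariant function depends on `‖w‖`. -/
theorem integral_rotation {g : ℂ → ℂ} (hg : ∀ (c : Circle) z, g (c * z) = g z) (w : ℂ) :
    ∫ z, g z * Complex.exp (((starRingEnd ℂ w * z).re : ℂ) * Complex.I) =
      ∫ z, g z * Complex.exp (((‖w‖ * z.re : ℝ) : ℂ) * Complex.I) := by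
  have hp := (rotation (Circle.exp w.arg)).measurePreserving
  rw [← hp.integral_comp (rotation (Circle.exp w.arg)).toHomeomorph.measurableEmbedding]
  congr 1; funext z
  have h1 : starRingEnd ℂ w * ((Circle.exp w.arg : ℂ) * z) = ((‖w‖ : ℝ) : ℂ) * z := by
    have h2 : w = ‖w‖ * (Circle.exp w.arg : ℂ) := by
      rw [Circle.coe_exp, Complex.norm_mul_exp_arg_mul_I]
    have h3 : starRingEnd ℂ (Circle.exp w.arg : ℂ) * (Circle.exp w.arg : ℂ) = 1 := by
      rw [mul_comm, Complex.mul_conj, Circle.normSq_coe, Complex.ofReal_one]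
    have h4 : starRingEnd ℂ w = ‖w‖ * starRingEnd ℂ (Circle.exp w.arg : ℂ) := by
      conv_lhs => rw [h2]
      rw [map_mul, Complex.conj_ofReal]
    rw [h4]
    calc _ = (‖w‖ : ℂ) * (starRingEnd ℂ (Circle.exp w.arg : ℂ) * (Circle.exp w.arg : ℂ)) * z := by
          ring
      _ = _ := by rw [h3, mul_one]
  rw [rotation_apply, hg, h1, Complex.re_ofReal_mul]

/-- The integral of the radial function `ψ(|·|)` on `ℝ³` over the lines parallel to an axis. -/
def lineInt (ψ : ℝ → ℂ) (z : ℂ) : ℂ := ∫ s : ℝ, ψ (√(‖z‖ ^ 2 + s ^ 2))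

namespace EvenTest

variable {ψ : ℝ → ℂ}

theorem continuous_comp_sqrt (h : EvenTest ψ) (z : ℂ) :
    Continuous fun w : ℂ => ψ (√(‖z‖ ^ 2 + ‖w‖ ^ 2)) :=
  h.continuous.comp (Real.continuous_sqrt.comp (by fun_prop))

theorem le_sqrt_add {R a b : ℝ} (hR : 0 < R) (ha : R ≤ |a|) : R ≤ |√(a ^ 2 + b ^ 2)| := by
  rw [abs_of_nonneg (Real.sqrt_nonneg _)]
  refine Real.le_sqrt_of_sq_le ?_
  rw [← sq_abs a]
  nlinarith [sq_nonneg b]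

theorem hasCompactSupport_lineInt (h : EvenTest ψ) : HasCompactSupport (lineInt ψ) := by
  obtain ⟨R, hR, hψ⟩ := h.exists_bound
  refine HasCompactSupport.of_support_subset_isCompact (isCompact_closedBall (0 : ℂ) R) ?_
  intro z hz
  by_contra hn
  apply hz
  rw [Metric.mem_closedBall, dist_zero_right, not_le] at hn
  have : ∀ s : ℝ, ψ (√(‖z‖ ^ 2 + s ^ 2)) = 0 := fun s =>
    hψ _ (le_sqrt_add hR (hn.le.trans (le_abs_self _)))
  simp [lineInt, this]

theorem continuous_lineInt (h : EvenTest ψ) : Continuous (lineInt ψ) := by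
  obtain ⟨R, hR, hψ⟩ := h.exists_bound
  have h1 : lineInt ψ = fun z : ℂ => ∫ s in Icc (-R) R, ψ (√(‖z‖ ^ 2 + s ^ 2)) := by
    funext z
    refine (setIntegral_eq_integral_of_forall_compl_eq_zero fun s hs => hψ _ ?_).symm
    rw [add_comm]
    refine le_sqrt_add hR ?_
    by_contra hlt
    exact hs (abs_le.1 (not_le.1 hlt).le)
  rw [h1]
  refine continuous_parametric_integral_of_continuous ?_ isCompact_Icc
  exact h.continuous.comp (Real.continuous_sqrt.comp (by fun_prop))

theorem integrable_lineInt_mul (h : EvenTest ψ) {e : ℂ → ℂ} (he : Continuous e) :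
    Integrable fun z => lineInt ψ z * e z :=
  (h.continuous_lineInt.mul he).integrable_of_hasCompactSupport
    h.hasCompactSupport_lineInt.mul_right

/-- The integral of a radial function on `ℝ³` over the planes orthogonal to an axis, by polar
coordinates in the plane. -/
theorem integral_comp_sqrt (h : EvenTest ψ) (x : ℝ) :
    ∫ w : ℂ, ψ (√(x ^ 2 + ‖w‖ ^ 2)) = (-(2 * Real.pi) : ℝ) • tailMoment ψ x := by
  have h1 := integral_fun_norm_addHaar (volume : Measure ℂ) fun y => ψ (√(x ^ 2 + y ^ 2))
  have hv : (volume : Measure ℂ).real (Metric.ball 0 1) = Real.pi := by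
    rw [measureReal_def, Complex.volume_ball]; simp
  obtain ⟨R, hR, hψ⟩ := h.exists_bound
  have hz : ∀ y : ℝ, R ≤ y → R ≤ |√(x ^ 2 + y ^ 2)| := fun y hy => by
    rw [add_comm]; exact le_sqrt_add hR (hy.trans (le_abs_self _))
  have key := integral_Ioi_of_hasDerivAt_of_tendsto (a := 0) (m := 0)
    (f := fun y : ℝ => tailMoment ψ (√(x ^ 2 + y ^ 2)))
    (f' := fun y : ℝ => (y ^ (2 - 1) : ℝ) • ψ (√(x ^ 2 + y ^ 2)))
    (h.tailMoment.continuous.comp (Real.continuous_sqrt.comp (by fun_prop))).continuousWithinAt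
    (fun y hy => by
      have hy : 0 < y := hy
      have hne : (0 : ℝ) < x ^ 2 + y ^ 2 := by positivity
      have h2 := (h.hasDerivAt_tailMoment (√(x ^ 2 + y ^ 2))).scomp y
        (((hasDerivAt_pow 2 y).const_add (x ^ 2)).sqrt hne.ne')
      refine h2.congr_deriv ?_
      have : ((√(x ^ 2 + y ^ 2) : ℝ) : ℂ) ≠ 0 := by exact_mod_cast (Real.sqrt_pos.2 hne).ne'
      simp only [Complex.real_smul]
      push_cast
      field_simp)
    (Integrable.integrableOn (Continuous.integrable_of_hasCompactSupport
      ((continuous_pow _).smul (h.continuous.comp (Real.continuous_sqrt.comp (by fun_prop))))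
      (HasCompactSupport.of_support_subset_isCompact (isCompact_Icc (a := -R) (b := R))
        fun y hy => by
          by_contra hn
          apply hy
          have hy' : R ≤ |y| := by
            by_contra hlt
            exact hn (abs_le.1 (not_le.1 hlt).le)
          have : R ≤ |√(x ^ 2 + y ^ 2)| := by rw [add_comm]; exact le_sqrt_add hR hy'
          simp [hψ _ this])))
    (tendsto_const_nhds.congr' (by
      filter_upwards [Filter.eventually_ge_atTop R] with y hy
      refine (tailMoment_eq_zero hR hψ ?_).symm
      have := hz y hy
      rwa [abs_of_nonneg (Real.sqrt_nonneg _)] at this))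
  rw [h1, hv, Complex.finrank_real_complex, key]
  have h3 : tailMoment ψ (√(x ^ 2 + 0 ^ 2)) = tailMoment ψ x := by
    rw [zero_pow two_ne_zero, add_zero, Real.sqrt_sq_eq_abs]
    rcases abs_cases x with hx | hx
    · rw [hx.1]
    · rw [hx.1, h.tailMoment_neg]
  rw [h3]
  simp only [zero_sub, smul_neg, Complex.real_smul, nsmul_eq_mul]
  push_cast
  ring

theorem integrable_comp_sqrt (h : EvenTest ψ) (z : ℂ) :
    Integrable fun w : ℂ => ψ (√(‖z‖ ^ 2 + ‖w‖ ^ 2)) := by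
  obtain ⟨R, hR, hψ⟩ := h.exists_bound
  refine (h.continuous_comp_sqrt z).integrable_of_hasCompactSupport
    (HasCompactSupport.of_support_subset_isCompact (isCompact_closedBall (0 : ℂ) R) fun w hw => ?_)
  by_contra hn
  apply hw
  rw [Metric.mem_closedBall, dist_zero_right, not_le] at hn
  refine hψ _ ?_
  rw [add_comm]
  exact le_sqrt_add hR (hn.le.trans (le_abs_self _))

theorem norm_mk_sq (x y : ℝ) : ‖(⟨x, y⟩ : ℂ)‖ ^ 2 = x ^ 2 + y ^ 2 := by
  rw [Complex.norm_eq_sqrt_sq_add_sq, Real.sq_sqrt (by positivity)]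

/-- Fubini: the integral of a line integral over the remaining direction is a plane integral. -/
theorem integral_lineInt (h : EvenTest ψ) (x : ℝ) :
    ∫ y : ℝ, lineInt ψ ⟨x, y⟩ = (-(2 * Real.pi) : ℝ) • tailMoment ψ x := by
  have h1 := h.integral_comp_sqrt x
  have h2 := h.integrable_comp_sqrt x
  have h3 : ‖(x : ℂ)‖ ^ 2 = x ^ 2 := by rw [Complex.norm_real, Real.norm_eq_abs, sq_abs]
  rw [h3] at h2
  rw [← h1, integral_complex_eq h2]
  simp only [lineInt, norm_mk_sq, add_assoc]

theorem lineInt_rotation (c : Circle) (z : ℂ) : lineInt ψ (c * z) = lineInt ψ z := by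
  simp only [lineInt, norm_mul, Circle.norm_coe, one_mul]

/-- The Fourier transform in `x` of the transform in `y` of a radial function of `(x, y)`. -/
theorem fourier_lineInt (h : EvenTest ψ) (v w : ℝ) :
    𝓕 (fun x : ℝ => ∫ y : ℝ, lineInt ψ ⟨x, y⟩ * Complex.exp (((v * y : ℝ) : ℂ) * Complex.I)) w =
      (-(2 * Real.pi) : ℝ) • cosTransform (tailMoment ψ) (√((2 * Real.pi * w) ^ 2 + v ^ 2)) := by
  set W : ℂ := ⟨-(2 * Real.pi * w), v⟩ with hW
  have hWn : ‖W‖ = √((2 * Real.pi * w) ^ 2 + v ^ 2) := by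
    rw [Complex.norm_eq_sqrt_sq_add_sq, hW]; simp
  -- the plane wave with frequency `W` may be rotated to one in the direction `x`
  have h1 := integral_rotation (g := lineInt ψ) lineInt_rotation W
  rw [integral_complex_eq (h.integrable_lineInt_mul (by fun_prop)),
    integral_complex_eq (h.integrable_lineInt_mul (by fun_prop))] at h1
  rw [Real.fourier_real_eq_integral_exp_smul]
  have hl : ∀ x : ℝ, Complex.exp (((-2 * Real.pi * x * w : ℝ) : ℂ) * Complex.I) •
      (∫ y : ℝ, lineInt ψ ⟨x, y⟩ * Complex.exp (((v * y : ℝ) : ℂ) * Complex.I)) =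
      ∫ y : ℝ, lineInt ψ ⟨x, y⟩ *
        Complex.exp (((starRingEnd ℂ W * ⟨x, y⟩).re : ℂ) * Complex.I) := by
    intro x
    rw [smul_eq_mul, ← integral_const_mul]
    congr 1; funext y
    rw [mul_left_comm, ← Complex.exp_add, ← add_mul]
    congr 3
    simp only [hW, Complex.mul_re, Complex.conj_re, Complex.conj_im]
    push_cast; ring
  simp only [hl]
  rw [h1, ← hWn]
  have hr : ∀ x : ℝ, ∫ y : ℝ, lineInt ψ ⟨x, y⟩ *
      Complex.exp (((‖W‖ * (⟨x, y⟩ : ℂ).re : ℝ) : ℂ) * Complex.I) =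
      (-(2 * Real.pi) : ℝ) • (tailMoment ψ x * Complex.exp (((‖W‖ * x : ℝ) : ℂ) * Complex.I)) := by
    intro x
    have := integral_mul_const (μ := volume) (Complex.exp (((‖W‖ * x : ℝ) : ℂ) * Complex.I))
      fun y : ℝ => lineInt ψ ⟨x, y⟩
    rw [h.integral_lineInt, smul_mul_assoc] at this
    exact this
  simp only [hr]
  rw [integral_smul]
  congr 1
  have hc := h.tailMoment.integrable_mul (continuous_cos ‖W‖)
  have hs := (h.tailMoment.integrable_mul (continuous_sin ‖W‖)).mul_const Complex.I
  have hsplit : ∀ x : ℝ, tailMoment ψ x * Complex.exp (((‖W‖ * x : ℝ) : ℂ) * Complex.I) =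
      tailMoment ψ x * (Real.cos (x * ‖W‖) : ℂ) +
        tailMoment ψ x * (Real.sin (x * ‖W‖) : ℂ) * Complex.I := by
    intro x
    rw [Complex.exp_mul_I, ← Complex.ofReal_cos, ← Complex.ofReal_sin, mul_comm ‖W‖ x]
    ring
  simp only [hsplit]
  rw [integral_add hc hs, integral_mul_const]
  have hodd : ∫ x : ℝ, tailMoment ψ x * (Real.sin (x * ‖W‖) : ℂ) = 0 := by
    have h1 := integral_neg_eq_self (μ := (volume : Measure ℝ))
      fun x : ℝ => tailMoment ψ x * (Real.sin (x * ‖W‖) : ℂ)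
    simp only [h.tailMoment_neg, neg_mul, Real.sin_neg, Complex.ofReal_neg, mul_neg] at h1
    rw [integral_neg] at h1
    exact neg_eq_self.1 h1
  rw [hodd, zero_mul, add_zero, cosTransform]

end EvenTest

/-- The integral representation `∫ cos(x cos α) dα` over a period of the Bessel function
`2π J₀(x)`. -/
def besselInt (x : ℝ) : ℝ := ∫ α in Ioo (-Real.pi) Real.pi, Real.cos (x * Real.cos α)

namespace EvenTest

variable {ψ : ℝ → ℂ}

/-- Fourier inversion at the origin for the function of `fourier_lineInt`. At `x = 0` that function
is the planar Fourier transform of the radial function `ψ(|·|)`. -/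
theorem radialInt_one_tailMoment_exp (h : EvenTest ψ) (v : ℝ) :
    radialInt 1 (tailMoment ψ) (v ^ 2) =
      -∫ z : ℂ, ψ ‖z‖ * Complex.exp (((v * z.re : ℝ) : ℂ) * Complex.I) := by
  set G : ℝ → ℂ := fun x => ∫ y : ℝ, lineInt ψ ⟨x, y⟩ *
    Complex.exp (((v * y : ℝ) : ℂ) * Complex.I) with hG
  have hmk : Continuous fun p : ℝ × ℝ => (⟨p.1, p.2⟩ : ℂ) :=
    Complex.equivRealProdCLM.symm.continuous
  obtain ⟨R, hR⟩ := h.hasCompactSupport_lineInt.isCompact.isBounded.subset_closedBall 0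
  have hzero : ∀ x y : ℝ, R < |x| ∨ R < |y| → lineInt ψ ⟨x, y⟩ = 0 := by
    intro x y hxy
    by_contra hne
    have h1 := hR (subset_tsupport _ hne)
    rw [Metric.mem_closedBall, dist_zero_right] at h1
    have h2 := Complex.abs_re_le_norm ⟨x, y⟩
    have h3 := Complex.abs_im_le_norm ⟨x, y⟩
    simp only at h2 h3
    rcases hxy with h | h <;> linarith
  have hGc : Continuous G := by
    have : G = fun x => ∫ y in Icc (-R) R, lineInt ψ ⟨x, y⟩ *
        Complex.exp (((v * y : ℝ) : ℂ) * Complex.I) := by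
      funext x
      refine (setIntegral_eq_integral_of_forall_compl_eq_zero fun y hy => ?_).symm
      rw [hzero x y (Or.inr (by
        by_contra hlt
        exact hy (abs_le.1 (not_lt.1 hlt)))), zero_mul]
    rw [this]
    refine continuous_parametric_integral_of_continuous ?_ isCompact_Icc
    refine (h.continuous_lineInt.comp hmk).mul ?_
    fun_prop
  have hGi : Integrable G := by
    refine hGc.integrable_of_hasCompactSupport
      (HasCompactSupport.of_support_subset_isCompact (isCompact_Icc (a := -R) (b := R)) ?_)
    intro x hx
    by_contra hn
    apply hx
    have : R < |x| := by
      by_contra hlt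
      exact hn (abs_le.1 (not_lt.1 hlt))
    simp only [hG, hzero x _ (Or.inl this), zero_mul, integral_zero]
  have hF : 𝓕 G = fun w : ℝ => (-(2 * Real.pi) : ℝ) •
      cosTransform (tailMoment ψ) (√((2 * Real.pi * w) ^ 2 + v ^ 2)) :=
    funext fun w => h.fourier_lineInt v w
  have hi : Integrable fun y : ℝ => cosTransform (tailMoment ψ) (√(y ^ 2 + v ^ 2)) := by
    obtain ⟨C, _, hb⟩ := h.tailMoment.norm_pow_mul_cosTransform_le 0 (sq_nonneg v)
    refine Integrable.mono' (integrable_inv_one_add_sq.const_mul C)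
      (h.tailMoment.continuous_cosTransform_sqrt _).aestronglyMeasurable
      (Filter.Eventually.of_forall fun y => ?_)
    have := hb |y| (abs_nonneg y)
    simpa using this
  have hFi : Integrable (𝓕 G) := by
    rw [hF]
    exact (hi.comp_mul_left' (by positivity : (2 * Real.pi) ≠ 0)).smul (-(2 * Real.pi) : ℝ)
  -- at the origin the inversion formula is an integral of `𝓕 G`, that is, `radialInt 1`
  have hinv := hGi.fourierInv_fourier_eq hFi (v := 0) hGc.continuousAt
  rw [Real.fourierInv_eq'] at hinv
  simp only [inner_zero_right, mul_zero, Complex.ofReal_zero, zero_mul, Complex.exp_zero,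
    one_smul] at hinv
  rw [hF, integral_smul,
    Measure.integral_comp_mul_left (fun y => cosTransform (tailMoment ψ) (√(y ^ 2 + v ^ 2))),
    ← radialInt_one h.tailMoment (sq_nonneg v), smul_smul, abs_of_pos (by positivity),
    neg_mul, mul_inv_cancel₀ (by positivity), neg_smul, one_smul] at hinv
  -- at `x = 0` the two line integrals combine to a plane integral
  have hG0 : G 0 = ∫ z : ℂ, ψ ‖z‖ * Complex.exp (((v * z.re : ℝ) : ℂ) * Complex.I) := by
    have hψ : Integrable fun z : ℂ => ψ ‖z‖ * Complex.exp (((v * z.re : ℝ) : ℂ) * Complex.I) := by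
      have h1 := h.integrable_comp_sqrt 0
      simp only [norm_zero, zero_pow two_ne_zero, zero_add, Real.sqrt_sq (norm_nonneg _)] at h1
      refine h1.mul_bdd (c := 1) (by fun_prop : Continuous _).aestronglyMeasurable
        (Filter.Eventually.of_forall fun z => (Complex.norm_exp_ofReal_mul_I _).le)
    rw [integral_complex_eq hψ]
    simp only [hG]
    congr 1; funext y
    rw [integral_mul_const]
    simp only [lineInt, norm_mk_sq, zero_pow two_ne_zero, zero_add]
    simp only [Complex.norm_eq_sqrt_sq_add_sq]
  rw [← hG0, ← hinv, neg_neg]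

/-- The line integrals of a radial function in the plane in terms of the Bessel function `J₀`. -/
theorem radialInt_one_eq (h : EvenTest ψ) (v : ℝ) :
    radialInt 1 (tailMoment ψ) (v ^ 2) =
      -∫ t in Ioi (0 : ℝ), deriv (tailMoment ψ) t * (besselInt (t * v) : ℂ) := by
  have hi : ∀ v : ℝ, Integrable fun z : ℂ =>
      ψ ‖z‖ * Complex.exp (((v * z.re : ℝ) : ℂ) * Complex.I) := by
    intro v
    have h1 := h.integrable_comp_sqrt 0
    simp only [norm_zero, zero_pow two_ne_zero, zero_add, Real.sqrt_sq (norm_nonneg _)] at h1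
    exact h1.mul_bdd (c := 1) (by fun_prop : Continuous _).aestronglyMeasurable
      (Filter.Eventually.of_forall fun z => (Complex.norm_exp_ofReal_mul_I _).le)
  have h1 := h.radialInt_one_tailMoment_exp v
  have h2 := h.radialInt_one_tailMoment_exp (-v)
  rw [neg_sq] at h2
  -- only the even part in `v` of the exponential contributes
  have h3 : radialInt 1 (tailMoment ψ) (v ^ 2) =
      -∫ z : ℂ, ψ ‖z‖ * (Real.cos (v * z.re) : ℂ) := by
    have h4 : ∫ z : ℂ, ψ ‖z‖ * (Real.cos (v * z.re) : ℂ) =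
        ((∫ z : ℂ, ψ ‖z‖ * Complex.exp (((v * z.re : ℝ) : ℂ) * Complex.I)) +
          ∫ z : ℂ, ψ ‖z‖ * Complex.exp (((-v * z.re : ℝ) : ℂ) * Complex.I)) / 2 := by
      rw [← integral_add (hi v) (hi (-v)), ← integral_div]
      congr 1; funext z
      rw [Complex.ofReal_cos, Complex.cos]
      push_cast
      simp only [neg_mul]
      ring
    rw [h4]
    linear_combination h1 / 2 + h2 / 2
  have hint : Integrable fun z : ℂ => ψ ‖z‖ * (Real.cos (v * z.re) : ℂ) := by
    have h1 := h.integrable_comp_sqrt 0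
    simp only [norm_zero, zero_pow two_ne_zero, zero_add, Real.sqrt_sq (norm_nonneg _)] at h1
    refine h1.mul_bdd (c := 1) (by fun_prop : Continuous _).aestronglyMeasurable
      (Filter.Eventually.of_forall fun z => ?_)
    rw [Complex.norm_real]
    exact Real.abs_cos_le_one _
  have hpolar : ∀ p : ℝ × ℝ, p ∈ polarCoord.target →
      p.1 • (ψ ‖Complex.polarCoord.symm p‖ *
        (Real.cos (v * (Complex.polarCoord.symm p).re) : ℂ)) =
      ((p.1 : ℂ) * ψ p.1) * (Real.cos (p.1 * v * Real.cos p.2) : ℂ) := by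
    intro p hp
    have hp1 : 0 < p.1 := by
      rw [polarCoord_target] at hp; exact hp.1
    rw [Complex.norm_polarCoord_symm, abs_of_pos hp1, Complex.polarCoord_symm_apply,
      Complex.re_ofReal_mul, Complex.real_smul, mul_assoc]
    simp only [Complex.add_re, Complex.ofReal_re, Complex.mul_re, Complex.I_re, mul_zero,
      Complex.ofReal_im, Complex.I_im, mul_one, sub_self, add_zero]
    rw [mul_left_comm v, ← mul_assoc p.1 v]
  rw [h3, ← Complex.integral_comp_polarCoord_symm,
    setIntegral_congr_fun polarCoord.open_target.measurableSet hpolar,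
    polarCoord_target, Measure.volume_eq_prod, setIntegral_prod]
  · congr 1
    refine setIntegral_congr_fun measurableSet_Ioi fun t _ => ?_
    simp only
    rw [integral_const_mul, h.deriv_tailMoment, besselInt, ← integral_complex_ofReal]
  · have hc : Continuous fun p : ℝ × ℝ =>
        ((p.1 : ℂ) * ψ p.1) * (Real.cos (p.1 * v * Real.cos p.2) : ℂ) := by
      have := h.continuous
      fun_prop
    obtain ⟨R, hR, hψ⟩ := h.exists_bound
    refine ((hc.continuousOn.integrableOn_compact ((isCompact_Icc (a := (0 : ℝ)) (b := R)).prod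
      (isCompact_Icc (a := -Real.pi) (b := Real.pi)))).of_forall_sdiff_eq_zero
      (measurableSet_Ioi.prod measurableSet_Ioo) ?_)
    rintro p ⟨hp, hn⟩
    have : R ≤ |p.1| := by
      by_contra hlt
      refine hn ⟨⟨le_of_lt hp.1, (le_abs_self _).trans (not_le.1 hlt).le⟩, hp.2.1.le, hp.2.2.le⟩
    rw [hψ _ this, mul_zero, zero_mul]

end EvenTest

/-! ### The kernel of the trace as a superposition of cosines -/

/-- The function paired with `a` on `(0, ∞)` in the trace formula in dimension `d`. -/
def traceWeight (d : ℕ) (φ : ℝ → ℂ) (t : ℝ) : ℂ :=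
  if d ≤ 4 then (t : ℂ) ^ (4 - d) * φ t
  else if Odd d then deriv (invDeriv^[(d - 5) / 2] φ) t
  else invDeriv^[(d - 4) / 2] φ t

theorem invDeriv_congr {f g : ℝ → ℂ} (h : ∀ t, t ≠ 0 → f t = g t) {t : ℝ} (ht : t ≠ 0) :
    invDeriv f t = invDeriv g t := by
  have : f =ᶠ[𝓝 t] g := by
    filter_upwards [isOpen_ne.mem_nhds ht] with s hs using h s hs
  rw [invDeriv, invDeriv, this.deriv_eq]

theorem invDeriv_iterate_congr {f g : ℝ → ℂ} (h : ∀ t, t ≠ 0 → f t = g t) (k : ℕ) :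
    ∀ t, t ≠ 0 → invDeriv^[k] f t = invDeriv^[k] g t := by
  induction k with
  | zero => simpa using h
  | succ k ih =>
    intro t ht
    rw [Function.iterate_succ_apply', Function.iterate_succ_apply']
    exact invDeriv_congr ih ht

theorem invDeriv_eq_of_deriv_eq_mul {φ ψ : ℝ → ℂ} (h : ∀ t : ℝ, deriv φ t = t * ψ t) {t : ℝ}
    (ht : t ≠ 0) : invDeriv φ t = ψ t := by
  have : (t : ℂ) ≠ 0 := by exact_mod_cast ht
  rw [invDeriv, h, ← mul_assoc, inv_mul_cancel₀ this, one_mul]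

/-- The weight in dimension `d + 2` is the weight in dimension `d` of `t⁻¹ ∂ₜ φ`. -/
theorem traceWeight_add_two {d : ℕ} (hd : 4 ≤ d) {φ ψ : ℝ → ℂ}
    (h : ∀ t : ℝ, deriv φ t = t * ψ t) {t : ℝ} (ht : 0 < t) :
    traceWeight (d + 2) φ t = traceWeight d ψ t := by
  have hk : ∀ k, ∀ t, t ≠ 0 → invDeriv^[k + 1] φ t = invDeriv^[k] ψ t := fun k t ht => by
    rw [Function.iterate_succ_apply]
    exact invDeriv_iterate_congr (fun t ht => invDeriv_eq_of_deriv_eq_mul h ht) k t ht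
  have h6 : ¬ d + 2 ≤ 4 := by omega
  rcases Nat.even_or_odd d with he | ho
  · have h1 : ¬ Odd (d + 2) := Nat.not_odd_iff_even.2 (he.add even_two)
    have h2 : (d + 2 - 4) / 2 = (d - 4) / 2 + 1 := by omega
    rw [traceWeight, if_neg h6, if_neg h1, h2, hk _ t ht.ne', traceWeight]
    split_ifs with h3 h4
    · have : d = 4 := by omega
      subst this; simp
    · exact absurd h4 (Nat.not_odd_iff_even.2 he)
    · rfl
  · have h1 : Odd (d + 2) := ho.add_even even_two
    have h5 : ¬ d ≤ 4 := by
      intro h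
      have : d = 4 := by omega
      subst this
      exact absurd ho (by decide)
    have h2 : (d + 2 - 5) / 2 = (d - 5) / 2 + 1 := by
      obtain ⟨m, rfl⟩ := ho
      omega
    rw [traceWeight, if_neg h6, if_pos h1, h2, traceWeight, if_neg h5, if_pos ho]
    have : invDeriv^[(d - 5) / 2 + 1] φ =ᶠ[𝓝 t] invDeriv^[(d - 5) / 2] ψ := by
      filter_upwards [isOpen_ne.mem_nhds ht.ne'] with s hs using hk _ s hs
    exact this.deriv_eq

theorem traceWeight_five (φ : ℝ → ℂ) (t : ℝ) : traceWeight 5 φ t = deriv φ t := by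
  rw [traceWeight, if_neg (by norm_num), if_pos (by decide)]
  simp

/-- On `(0, ∞)` the weight is a continuous function of compact support. -/
theorem exists_traceWeight_eq (d : ℕ) : ∀ {φ : ℝ → ℂ}, EvenTest φ → ∃ w : ℝ → ℂ, Continuous w ∧
    HasCompactSupport w ∧ ∀ t, 0 < t → traceWeight d φ t = w t := by
  induction d using Nat.strong_induction_on with
  | _ d ih =>
    intro φ h
    by_cases h4 : d ≤ 4
    · refine ⟨fun t => (t : ℂ) ^ (4 - d) * φ t,
        (Complex.continuous_ofReal.pow _).mul h.continuous, h.supp.mul_left, fun t _ => ?_⟩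
      rw [traceWeight, if_pos h4]
    · rcases Nat.lt_or_ge d 6 with h6 | h6
      · obtain rfl : d = 5 := by omega
        exact ⟨deriv φ, h.smooth_deriv.continuous, h.supp.deriv, fun t _ => traceWeight_five φ t⟩
      · obtain ⟨e, rfl⟩ : ∃ e, d = e + 2 := ⟨d - 2, by omega⟩
        obtain ⟨ψ, hψ, hd⟩ := h.exists_deriv_eq_mul
        obtain ⟨w, hw, hs, he⟩ := ih e (by omega) hψ
        exact ⟨w, hw, hs, fun t ht => (traceWeight_add_two (by omega) hd ht).trans (he t ht)⟩

/-- The cosine transform of a finite measure on `ℝ`. -/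
def cosMeasure (ν : Measure ℝ) (x : ℝ) : ℝ := ∫ u, Real.cos (x * u) ∂ν

theorem integrable_cos_mul (ν : Measure ℝ) [IsFiniteMeasure ν] (x : ℝ) :
    Integrable (fun u => Real.cos (x * u)) ν :=
  Integrable.of_bound (by fun_prop : Continuous fun u : ℝ => Real.cos (x * u)).aestronglyMeasurable
    1 (Filter.Eventually.of_forall fun u => Real.abs_cos_le_one _)

theorem continuous_cosMeasure (ν : Measure ℝ) [IsFiniteMeasure ν] : Continuous (cosMeasure ν) :=
  continuous_of_dominated (bound := fun _ => 1)
    (fun x => (integrable_cos_mul ν x).aestronglyMeasurable)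
    (fun x => Filter.Eventually.of_forall fun u => Real.abs_cos_le_one _)
    (integrable_const _) (Filter.Eventually.of_forall fun u => by fun_prop)

theorem abs_cosMeasure_le (ν : Measure ℝ) [IsFiniteMeasure ν] (x : ℝ) :
    |cosMeasure ν x| ≤ ν.real univ := by
  have := norm_integral_le_of_norm_le_const (μ := ν) (f := fun u => Real.cos (x * u)) (C := 1)
    (Filter.Eventually.of_forall fun u => Real.abs_cos_le_one _)
  simpa [cosMeasure] using this

/-- `ν` and `κ` represent the radial integral in dimension `d` as `κ` times the pairing of the
weight with the cosine transform of `ν`; the total mass is controlled as required for the uniform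
bound on the trace density. -/
structure IsTraceKernel (d : ℕ) (ν : Measure ℝ) (κ : ℝ) : Prop where
  finite : IsFiniteMeasure ν
  ne_zero : κ ≠ 0
  le_one : ∀ᵐ u ∂ν, |u| ≤ 1
  ae_ne : ∃ᵐ u ∂ν, u ≠ 0
  mass : |κ| * ν.real univ ≤ 4 * (2 * Real.pi) ^ (d - d / 2)
  eq : ∀ φ : ℝ → ℂ, EvenTest φ → ∀ v : ℝ, radialInt d (tailMoment (tailMoment φ)) (v ^ 2) =
    κ * ∫ t in Ioi (0 : ℝ), traceWeight d φ t * (cosMeasure ν (t * v) : ℂ)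

/-- Integration by parts against `tailMoment χ`, whose derivative is `t χ`. -/
theorem EvenTest.integral_tailMoment_mul {χ : ℝ → ℂ} (h : EvenTest χ) {H H' : ℝ → ℂ}
    (hH : ∀ t, HasDerivAt H (H' t) t) (hH' : Continuous H') (h0 : H 0 = 0) :
    ∫ t in Ioi (0 : ℝ), tailMoment χ t * H' t = -∫ t in Ioi (0 : ℝ), t * χ t * H t := by
  have hHc : Continuous H := continuous_iff_continuousAt.2 fun t => (hH t).continuousAt
  obtain ⟨R, hR, hχ⟩ := h.exists_bound
  have hi1 : IntegrableOn (fun t : ℝ => t * χ t * H t) (Ioi 0) :=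
    ((h.continuous_id_mul.mul hHc).integrable_of_hasCompactSupport
      h.supp.mul_left.mul_right).integrableOn
  have hi2 : IntegrableOn (fun t : ℝ => tailMoment χ t * H' t) (Ioi 0) :=
    (h.tailMoment.integrable_mul hH').integrableOn
  have key := integral_Ioi_of_hasDerivAt_of_tendsto (a := 0) (m := 0)
    (f := fun t => tailMoment χ t * H t) (f' := fun t => t * χ t * H t + tailMoment χ t * H' t)
    (h.tailMoment.continuous.mul hHc).continuousWithinAt
    (fun t _ => (h.hasDerivAt_tailMoment t).mul (hH t)) (hi1.add hi2)
    (tendsto_const_nhds.congr' (by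
      filter_upwards [Filter.eventually_ge_atTop R] with y hy
      rw [EvenTest.tailMoment_eq_zero hR hχ hy, zero_mul]))
  rw [integral_add hi1 hi2, h0, mul_zero, sub_zero] at key
  exact eq_neg_of_add_eq_zero_right key

theorem besselInt_eq_cosMeasure (x : ℝ) :
    besselInt x = cosMeasure ((volume.restrict (Ioo (-Real.pi) Real.pi)).map Real.cos) x := by
  rw [cosMeasure, integral_map Real.continuous_cos.aemeasurable
    (by fun_prop : Continuous fun u : ℝ => Real.cos (x * u)).aestronglyMeasurable]
  rfl

theorem continuous_besselInt : Continuous besselInt := by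
  have : besselInt = cosMeasure ((volume.restrict (Ioo (-Real.pi) Real.pi)).map Real.cos) :=
    funext besselInt_eq_cosMeasure
  rw [this]; exact continuous_cosMeasure _

theorem map_cos_real_univ :
    ((volume.restrict (Ioo (-Real.pi) Real.pi)).map Real.cos).real univ = 2 * Real.pi := by
  rw [measureReal_def, Measure.map_apply Real.measurable_cos .univ, preimage_univ,
    Measure.restrict_apply_univ, Real.volume_Ioo, ENNReal.toReal_ofReal (by linarith [Real.pi_pos])]
  ring

theorem map_cos_le_one :
    ∀ᵐ u ∂((volume.restrict (Ioo (-Real.pi) Real.pi)).map Real.cos), |u| ≤ 1 :=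
  (ae_map_iff Real.measurable_cos.aemeasurable
    (measurableSet_le measurable_abs measurable_const)).2
      (Filter.Eventually.of_forall Real.abs_cos_le_one)

theorem frequently_cos_ne :
    ∃ᵐ α ∂(volume.restrict (Ioo (-Real.pi) Real.pi)), Real.cos α ≠ 0 := by
  intro h
  have h1 : ∀ᵐ α ∂(volume.restrict (Ioo (0 : ℝ) 1)), False := by
    have hsub : Ioo (0 : ℝ) 1 ⊆ Ioo (-Real.pi) Real.pi :=
      Ioo_subset_Ioo (by linarith [Real.pi_pos]) (by linarith [Real.pi_gt_three])
    filter_upwards [ae_mono (Measure.restrict_mono hsub le_rfl) h,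
      ae_restrict_mem measurableSet_Ioo] with α hα hm
    exact hα (Real.cos_pos_of_mem_Ioo ⟨by linarith [hm.1, Real.pi_pos],
      by linarith [hm.2, Real.pi_gt_three]⟩).ne'
  rw [Filter.eventually_false_iff_eq_bot, ae_eq_bot, Measure.restrict_eq_zero] at h1
  simp at h1

/-- In dimension one, integration by parts against `J₀` leaves the mean value of `s J₀(sv)` over
`[0, t]`, again a superposition of cosines. -/
theorem isTraceKernel_one : IsTraceKernel 1
    (((volume.restrict (Ioo (0 : ℝ) 1)).prod
      (volume.restrict (Ioo (-Real.pi) Real.pi))).map fun p => √p.1 * Real.cos p.2) (1 / 2) := by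
  have hm : Measurable fun p : ℝ × ℝ => √p.1 * Real.cos p.2 := by fun_prop
  refine ⟨inferInstance, by norm_num, ?_, ?_, ?_, ?_⟩
  · rw [ae_map_iff hm.aemeasurable (measurableSet_le measurable_abs measurable_const),
      Measure.prod_restrict]
    filter_upwards [ae_restrict_mem (measurableSet_Ioo.prod measurableSet_Ioo)] with p hp
    rw [abs_mul, abs_of_nonneg (Real.sqrt_nonneg _)]
    exact mul_le_one₀ (Real.sqrt_le_one.2 hp.1.2.le) (abs_nonneg _) (Real.abs_cos_le_one _)
  · intro h
    simp only [not_not] at h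
    replace h := (ae_map_iff (p := fun x => x = 0) hm.aemeasurable
      (measurableSet_singleton (0 : ℝ))).1 h
    have h1 := Measure.ae_ae_of_ae_prod h
    have h2 : ∀ᵐ x ∂(volume.restrict (Ioo (0 : ℝ) 1)), False := by
      filter_upwards [h1, ae_restrict_mem measurableSet_Ioo] with x hx hx0
      refine frequently_cos_ne ?_
      filter_upwards [hx] with α hα
      have := (mul_eq_zero.1 hα).resolve_left (Real.sqrt_pos.2 hx0.1).ne'
      simpa using this
    rw [Filter.eventually_false_iff_eq_bot, ae_eq_bot, Measure.restrict_eq_zero] at h2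
    simp at h2
  · rw [measureReal_def, Measure.map_apply hm .univ, preimage_univ, ← univ_prod_univ,
      Measure.prod_prod, Measure.restrict_apply_univ, Measure.restrict_apply_univ,
      Real.volume_Ioo, Real.volume_Ioo, ENNReal.toReal_mul, ENNReal.toReal_ofReal (by norm_num),
      ENNReal.toReal_ofReal (by linarith [Real.pi_pos]), abs_of_pos (by norm_num)]
    norm_num
    nlinarith [Real.pi_pos]
  · intro φ h v
    rw [h.tailMoment.radialInt_one_eq]
    have hc : Continuous fun s : ℝ => (s : ℂ) * (besselInt (s * v) : ℂ) := by
      have := continuous_besselInt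
      fun_prop
    have key := h.integral_tailMoment_mul
      (H := fun t => ∫ s in (0 : ℝ)..t, (s : ℂ) * (besselInt (s * v) : ℂ))
      (fun t => (hc.integral_hasStrictDerivAt 0 t).hasDerivAt) hc intervalIntegral.integral_same
    have h1 : ∀ t : ℝ, deriv (tailMoment (tailMoment φ)) t * (besselInt (t * v) : ℂ) =
        tailMoment φ t * (t * (besselInt (t * v) : ℂ)) := fun t => by
      rw [h.tailMoment.deriv_tailMoment]; ring
    simp only [h1]
    rw [key, neg_neg, ← integral_const_mul]
    refine setIntegral_congr_fun measurableSet_Ioi fun t ht => ?_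
    have ht : (0 : ℝ) < t := ht
    -- the substitution `s = t √σ`
    have hsub := intervalIntegral.integral_comp_mul_deriv
      (f := fun s : ℝ => s ^ 2 / t ^ 2) (f' := fun s => 2 * s / t ^ 2)
      (g := fun σ => besselInt (t * v * √σ)) (a := 0) (b := t)
      (fun s _ => by
        have := (hasDerivAt_pow 2 s).div_const (t ^ 2)
        simpa using this)
      (by fun_prop) (by have := continuous_besselInt; fun_prop)
    have hleft : ∫ s in (0 : ℝ)..t, ((fun σ => besselInt (t * v * √σ)) ∘ fun s => s ^ 2 / t ^ 2) s *
        (2 * s / t ^ 2) = 2 / t ^ 2 * ∫ s in (0 : ℝ)..t, s * besselInt (s * v) := by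
      rw [← intervalIntegral.integral_const_mul]
      refine intervalIntegral.integral_congr fun s hs => ?_
      rw [uIcc_of_le ht.le] at hs
      have : t * v * √(s ^ 2 / t ^ 2) = s * v := by
        rw [← div_pow, Real.sqrt_sq (div_nonneg hs.1 ht.le)]
        field_simp
      simp only [Function.comp, this]
      ring
    have hright : ∫ σ in (0 : ℝ)..1, besselInt (t * v * √σ) = cosMeasure
        (((volume.restrict (Ioo (0 : ℝ) 1)).prod
        (volume.restrict (Ioo (-Real.pi) Real.pi))).map fun p => √p.1 * Real.cos p.2) (t * v) := by
      have hcont : Continuous fun p : ℝ × ℝ => Real.cos (t * v * (√p.1 * Real.cos p.2)) := by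
        fun_prop
      rw [cosMeasure, integral_map hm.aemeasurable
        (by fun_prop : Continuous fun u : ℝ => Real.cos (t * v * u)).aestronglyMeasurable,
        integral_prod _ (Integrable.of_bound hcont.aestronglyMeasurable 1
          (Filter.Eventually.of_forall fun _ => Real.abs_cos_le_one _)),
        intervalIntegral.integral_of_le zero_le_one, integral_Ioc_eq_integral_Ioo]
      simp only [besselInt, mul_assoc]
    rw [hleft] at hsub
    have hz : (0 : ℝ) ^ 2 / t ^ 2 = 0 := by simp
    have ho : t ^ 2 / t ^ 2 = 1 := div_self (by positivity)
    simp only [hz, ho] at hsub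
    rw [hright] at hsub
    rw [← hsub, traceWeight, if_pos (by norm_num)]
    have hcast : ∫ s in (0 : ℝ)..t, (s : ℂ) * (besselInt (s * v) : ℂ) =
        ((∫ s in (0 : ℝ)..t, s * besselInt (s * v) : ℝ) : ℂ) := by
      rw [← intervalIntegral.integral_ofReal]
      push_cast; rfl
    simp only [hcast]
    have : (t : ℂ) ≠ 0 := by exact_mod_cast ht.ne'
    generalize (∫ s in (0 : ℝ)..t, s * besselInt (s * v)) = X
    push_cast
    field_simp

theorem EvenTest.cosTransform_sqrt_sq {χ : ℝ → ℂ} (h : EvenTest χ) (v : ℝ) :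
    cosTransform χ (√(v ^ 2)) = 2 * ∫ t in Ioi (0 : ℝ), χ t * (Real.cos (t * v) : ℂ) := by
  rw [Real.sqrt_sq_eq_abs, ← h.cosTransform_eq_two_mul]
  rcases abs_cases v with hv | hv
  · rw [hv.1]
  · simp only [hv.1, cosTransform, mul_neg, Real.cos_neg]

/-- In dimension two the weight is paired with the mean value of `cos(sv)` over `[0, t]`. -/
theorem isTraceKernel_two :
    IsTraceKernel 2 (volume.restrict (Ioo (0 : ℝ) 1)) (4 * Real.pi) := by
  refine ⟨inferInstance, by positivity, ?_, ?_, ?_, ?_⟩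
  · filter_upwards [ae_restrict_mem measurableSet_Ioo] with u hu
    rw [abs_of_pos hu.1]; exact hu.2.le
  · intro h
    have h2 : ∀ᵐ x ∂(volume.restrict (Ioo (0 : ℝ) 1)), False := by
      filter_upwards [h, ae_restrict_mem measurableSet_Ioo] with x hx hx0
      exact hx hx0.1.ne'
    rw [Filter.eventually_false_iff_eq_bot, ae_eq_bot, Measure.restrict_eq_zero] at h2
    simp at h2
  · rw [measureReal_restrict_apply_univ, Real.volume_real_Ioo_of_le zero_le_one,
      abs_of_pos (by positivity)]
    norm_num
    nlinarith [Real.pi_pos]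
  · intro φ h v
    rw [radialInt_two h.tailMoment (sq_nonneg v), h.tailMoment.cosTransform_sqrt_sq]
    have hc : Continuous fun s : ℝ => (Real.cos (s * v) : ℂ) := EvenTest.continuous_cos v
    have key := h.integral_tailMoment_mul
      (H := fun t => ∫ s in (0 : ℝ)..t, (Real.cos (s * v) : ℂ))
      (fun t => (hc.integral_hasStrictDerivAt 0 t).hasDerivAt) hc intervalIntegral.integral_same
    have h1 : ∀ t : ℝ, traceWeight 2 φ t *
        (cosMeasure (volume.restrict (Ioo (0 : ℝ) 1)) (t * v) : ℂ) =
        t * φ t * ∫ s in (0 : ℝ)..t, (Real.cos (s * v) : ℂ) := by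
      intro t
      have h2 := intervalIntegral.mul_integral_comp_mul_left (a := 0) (b := 1) (c := t)
        (f := fun s => Real.cos (s * v))
      rw [mul_zero, mul_one, intervalIntegral.integral_of_le zero_le_one,
        integral_Ioc_eq_integral_Ioo] at h2
      rw [intervalIntegral.integral_ofReal, ← h2, traceWeight, if_pos (by norm_num), cosMeasure]
      have h3 : ∀ u : ℝ, t * v * u = t * u * v := fun u => by ring
      simp only [h3]
      push_cast
      ring
    rw [key]
    simp only [h1]
    rw [Complex.real_smul]
    push_cast
    ring

/-- Dimension three is reduced to dimension one, where the weight `t φ` is paired with `J₀`. -/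
theorem isTraceKernel_three : IsTraceKernel 3
    ((volume.restrict (Ioo (-Real.pi) Real.pi)).map Real.cos) (2 * Real.pi) := by
  refine ⟨inferInstance, by positivity, map_cos_le_one, ?_, ?_, ?_⟩
  · intro h
    simp only [not_not] at h
    replace h := (ae_map_iff (p := fun x => x = 0) Real.measurable_cos.aemeasurable
      (measurableSet_singleton (0 : ℝ))).1 h
    exact frequently_cos_ne (h.mono fun α hα => by simpa using hα)
  · rw [map_cos_real_univ, abs_of_pos (by positivity)]
    norm_num
    nlinarith [Real.pi_pos, mul_pos Real.pi_pos Real.pi_pos]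
  · intro φ h v
    rw [radialInt_add_two h.tailMoment le_rfl (sq_nonneg v), h.radialInt_one_eq]
    simp only [h.deriv_tailMoment, besselInt_eq_cosMeasure, traceWeight]
    norm_num

/-- In dimension four the radial integral is a cosine transform. -/
theorem isTraceKernel_four : IsTraceKernel 4 (Measure.dirac 1) (8 * Real.pi ^ 2) := by
  refine ⟨inferInstance, by positivity, ?_, ?_, ?_, ?_⟩
  · rw [ae_dirac_eq]; simp
  · rw [ae_dirac_eq]; simp
  · rw [abs_of_pos (by positivity)]
    norm_num
    nlinarith [Real.pi_pos, mul_pos Real.pi_pos Real.pi_pos]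
  · intro φ h v
    rw [radialInt_add_two h.tailMoment (by norm_num) (sq_nonneg v), radialInt_two h (sq_nonneg v),
      h.cosTransform_sqrt_sq]
    simp only [traceWeight, cosMeasure, integral_dirac, Complex.real_smul]
    norm_num
    ring

/-- In dimension five the weight `φ'` arises from the Bessel function of dimension one, applied to
`t⁻¹ φ'`. -/
theorem isTraceKernel_five : IsTraceKernel 5
    ((volume.restrict (Ioo (-Real.pi) Real.pi)).map Real.cos) (-(4 * Real.pi ^ 2)) := by
  refine ⟨inferInstance, by simp [Real.pi_ne_zero], map_cos_le_one, isTraceKernel_three.ae_ne,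
    ?_, ?_⟩
  · rw [map_cos_real_univ, abs_neg, abs_of_pos (by positivity)]
    norm_num
    nlinarith [Real.pi_pos, mul_pos (mul_pos Real.pi_pos Real.pi_pos) Real.pi_pos]
  · intro φ h v
    -- `ψ = t⁻¹ φ'`, so that `φ` is the tail moment of `ψ`
    obtain ⟨ψ, hψ, hd⟩ := h.exists_deriv_eq_mul
    have hφ := EvenTest.tailMoment_eq_of_deriv h hψ hd
    have h5 := radialInt_add_two (d := 3) h.tailMoment (by norm_num) (sq_nonneg v)
    have h3 := radialInt_add_two (d := 1) h le_rfl (sq_nonneg v)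
    rw [h5, h3]
    have h1 := hψ.radialInt_one_eq v
    rw [hφ] at h1
    rw [h1]
    simp only [besselInt_eq_cosMeasure, traceWeight_five, Complex.real_smul]
    push_cast
    ring

/-- Two more dimensions replace `φ` by `t⁻¹ φ'`, and keep the measure. -/
theorem IsTraceKernel.add_two {d : ℕ} (hd : 4 ≤ d) {ν : Measure ℝ} {κ : ℝ}
    (h : IsTraceKernel d ν κ) : IsTraceKernel (d + 2) ν (-(2 * Real.pi) * κ) := by
  refine ⟨h.finite, mul_ne_zero (by simp [Real.pi_ne_zero]) h.ne_zero, h.le_one, h.ae_ne, ?_, ?_⟩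
  · rw [abs_mul, abs_neg, abs_of_pos (by positivity : 0 < 2 * Real.pi),
      show d + 2 - (d + 2) / 2 = d - d / 2 + 1 by omega, pow_succ, mul_assoc]
    nlinarith [h.mass, Real.pi_pos]
  · intro φ hφ v
    -- `ψ = t⁻¹ φ'`, so that `φ` is the tail moment of `ψ`
    obtain ⟨ψ, hψ, hdψ⟩ := hφ.exists_deriv_eq_mul
    have h1 := EvenTest.tailMoment_eq_of_deriv hφ hψ hdψ
    have h2 := h.eq ψ hψ v
    rw [h1] at h2
    have h3 : ∫ t in Ioi (0 : ℝ), traceWeight (d + 2) φ t * (cosMeasure ν (t * v) : ℂ) =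
        ∫ t in Ioi (0 : ℝ), traceWeight d ψ t * (cosMeasure ν (t * v) : ℂ) :=
      setIntegral_congr_fun measurableSet_Ioi fun t ht => by
        simp only [traceWeight_add_two hd hdψ ht]
    rw [radialInt_add_two hφ.tailMoment (by omega) (sq_nonneg v), h2, h3]
    rw [Complex.real_smul]
    push_cast
    ring

theorem exists_isTraceKernel : ∀ d : ℕ, 1 ≤ d → ∃ ν κ, IsTraceKernel d ν κ := by
  intro d
  induction d using Nat.strong_induction_on with
  | _ d ih =>
    intro hd
    rcases Nat.lt_or_ge d 6 with h6 | h6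
    · interval_cases d
      · exact ⟨_, _, isTraceKernel_one⟩
      · exact ⟨_, _, isTraceKernel_two⟩
      · exact ⟨_, _, isTraceKernel_three⟩
      · exact ⟨_, _, isTraceKernel_four⟩
      · exact ⟨_, _, isTraceKernel_five⟩
    · obtain ⟨e, rfl⟩ : ∃ e, d = e + 2 := ⟨d - 2, by omega⟩
      obtain ⟨ν, κ, h⟩ := ih e (by omega) (by omega)
      exact ⟨ν, _, h.add_two (by omega)⟩

/-! ### Nuclear representations and traces -/

section Nuclear

variable {H : Type*} [NormedAddCommGroup H] [InnerProductSpace ℂ H]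

/-- `A = ∑ₙ ⟨xₙ, ·⟩ yₙ` with `∑ₙ ‖xₙ‖ ‖yₙ‖ < ∞` and `τ = ∑ₙ ⟨xₙ, yₙ⟩`. -/
def IsNuclear (A : H →L[ℂ] H) (τ : ℂ) : Prop :=
  ∃ x y : ℕ → H, Summable (fun n => ‖x n‖ * ‖y n‖) ∧
    (∀ u, HasSum (fun n => inner ℂ (x n) u • y n) (A u)) ∧ HasSum (fun n => inner ℂ (x n) (y n)) τ

/-- The trace in an arbitrary Hilbert basis is obtained from a nuclear representation by Parseval's
identity and an exchange of summations. -/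
theorem IsNuclear.hasTrace {H : Type*} [NormedAddCommGroup H] [InnerProductSpace ℂ H]
    {A : H →L[ℂ] H} {τ : ℂ} (h : IsNuclear A τ) : HasTrace A τ := by
  obtain ⟨x, y, hs, hA, hτ⟩ := h
  refine ⟨⟨x, y, hs, hA⟩, fun ι b => ?_⟩
  -- the Cauchy–Schwarz and Bessel inequalities bound the partial sums over the basis
  have hfin : ∀ n (s : Finset ι),
      ∑ i ∈ s, ‖inner ℂ (x n) (b i) * inner ℂ (b i) (y n)‖ ≤ ‖x n‖ * ‖y n‖ := fun n s => by
    simp only [norm_mul]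
    refine (Real.sum_mul_le_sqrt_mul_sqrt s _ _).trans ?_
    refine mul_le_mul ?_ ?_ (Real.sqrt_nonneg _) (norm_nonneg _)
    · refine Real.sqrt_le_iff.2 ⟨norm_nonneg _, ?_⟩
      simp only [norm_inner_symm (x n)]
      exact b.orthonormal.sum_inner_products_le (x n)
    · exact Real.sqrt_le_iff.2 ⟨norm_nonneg _, b.orthonormal.sum_inner_products_le (y n)⟩
  have hb : ∀ n, Summable fun i => ‖inner ℂ (x n) (b i) * inner ℂ (b i) (y n)‖ := fun n =>
    summable_of_sum_le (fun i => norm_nonneg _) (hfin n)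
  have hle : ∀ n, ∑' i, ‖inner ℂ (x n) (b i) * inner ℂ (b i) (y n)‖ ≤ ‖x n‖ * ‖y n‖ := fun n =>
    Real.tsum_le_of_sum_le (fun i => norm_nonneg _) (hfin n)
  have hsum : Summable fun p : ℕ × ι => inner ℂ (x p.1) (b p.2) * inner ℂ (b p.2) (y p.1) := by
    refine Summable.of_norm ?_
    refine (summable_prod_of_nonneg fun p => norm_nonneg _).2 ⟨hb, ?_⟩
    exact Summable.of_nonneg_of_le (fun n => tsum_nonneg fun i => norm_nonneg _) hle hs
  have h1 : HasSum (fun p : ℕ × ι => inner ℂ (x p.1) (b p.2) * inner ℂ (b p.2) (y p.1)) τ := by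
    have h2 := hsum.hasSum.prod_fiberwise fun n => b.hasSum_inner_mul_inner (x n) (y n)
    rw [← h2.unique hτ]
    exact hsum.hasSum
  have h3 : HasSum (fun p : ι × ℕ => inner ℂ (x p.2) (b p.1) * inner ℂ (b p.1) (y p.2)) τ :=
    ((Equiv.prodComm ι ℕ).hasSum_iff (f := fun p : ℕ × ι =>
      inner ℂ (x p.1) (b p.2) * inner ℂ (b p.2) (y p.1))).2 h1
  refine h3.prod_fiberwise fun i => ?_
  have h4 := (innerSL ℂ (b i)).hasSum (hA (b i))
  simpa [inner_smul_right] using h4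

theorem IsNuclear.add {A B : H →L[ℂ] H} {σ τ : ℂ} (hA : IsNuclear A σ) (hB : IsNuclear B τ) :
    IsNuclear (A + B) (σ + τ) := by
  obtain ⟨x, y, hs, hA, hσ⟩ := hA
  obtain ⟨x', y', hs', hB, hτ⟩ := hB
  let e := Equiv.natSumNatEquivNat
  refine ⟨fun n => Sum.elim x x' (e.symm n), fun n => Sum.elim y y' (e.symm n), ?_, fun u => ?_, ?_⟩
  · exact (e.symm.summable_iff (f := fun s => ‖Sum.elim x x' s‖ * ‖Sum.elim y y' s‖)).2
      (HasSum.sum (f := fun s => ‖Sum.elim x x' s‖ * ‖Sum.elim y y' s‖)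
        hs.hasSum hs'.hasSum).summable
  · exact (e.symm.hasSum_iff (f := fun s => inner ℂ (Sum.elim x x' s) u • Sum.elim y y' s)).2
      (HasSum.sum (f := fun s => inner ℂ (Sum.elim x x' s) u • Sum.elim y y' s) (hA u) (hB u))
  · exact (e.symm.hasSum_iff (f := fun s => inner ℂ (Sum.elim x x' s) (Sum.elim y y' s))).2
      (HasSum.sum (f := fun s => inner ℂ (Sum.elim x x' s) (Sum.elim y y' s)) hσ hτ)

/-- Any countable index set may be used in a nuclear representation, in particular a finite one. -/
theorem IsNuclear.of_countable {ι : Type*} [Countable ι] {A : H →L[ℂ] H} {τ : ℂ} (x y : ι → H)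
    (hs : Summable fun n => ‖x n‖ * ‖y n‖) (hA : ∀ u, HasSum (fun n => inner ℂ (x n) u • y n) (A u))
    (hτ : HasSum (fun n => inner ℂ (x n) (y n)) τ) : IsNuclear A τ := by
  obtain ⟨e, he⟩ := exists_injective_nat ι
  have hx : ∀ n, Function.extend e x 0 (e n) = x n := fun n => he.extend_apply _ _ _
  have hy : ∀ n, Function.extend e y 0 (e n) = y n := fun n => he.extend_apply _ _ _
  have hn : ∀ n, n ∉ range e → Function.extend e x 0 n = 0 := fun n hn =>
    Function.extend_apply' _ _ _ fun ⟨a, ha⟩ => hn ⟨a, ha⟩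
  refine ⟨Function.extend e x 0, Function.extend e y 0, ?_, fun u => ?_, ?_⟩
  · refine (he.summable_iff fun n h => by simp [hn n h]).1 ?_
    simpa only [Function.comp_def, hx, hy] using hs
  · refine (he.hasSum_iff fun n h => by simp [hn n h]).1 ?_
    simpa only [Function.comp_def, hx, hy] using hA u
  · refine (he.hasSum_iff fun n h => by simp [hn n h]).1 ?_
    simpa only [Function.comp_def, hx, hy] using hτ

/-- Nuclear representations are transported by a pair of isometric embeddings. -/
theorem IsNuclear.map {K : Type*} [NormedAddCommGroup K] [InnerProductSpace ℂ K]
    {A : H →L[ℂ] H} {τ : ℂ} (h : IsNuclear A τ) (J : H →ₗᵢ[ℂ] K) (P : K →L[ℂ] H)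
    (hP : ∀ x u, inner ℂ (J x) u = inner ℂ x (P u)) :
    IsNuclear (J.toContinuousLinearMap ∘L A ∘L P) τ := by
  obtain ⟨x, y, hs, hA, hτ⟩ := h
  refine ⟨fun n => J (x n), fun n => J (y n), by simpa using hs, fun u => ?_, by simpa using hτ⟩
  have := J.toContinuousLinearMap.hasSum (hA (P u))
  simpa [hP] using this

/-- The balls of radius `1 / 2` about the basis vectors are disjoint. -/
theorem countable_of_hilbertBasis [TopologicalSpace.SeparableSpace H] {ι : Type*}
    (b : HilbertBasis ι ℂ H) : Countable ι := by
  have hd : Pairwise (Function.onFun Disjoint fun i => Metric.ball (b i) (1 / 2)) := by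
    intro i j hij
    refine Metric.ball_disjoint_ball ?_
    have h1 : ‖b i - b j‖ ^ 2 = 2 := by
      have h2 := norm_sub_sq (𝕜 := ℂ) (b i) (b j)
      rw [b.orthonormal.1 i, b.orthonormal.1 j, b.orthonormal.2 hij] at h2
      rw [h2]; norm_num
    rw [dist_eq_norm]
    nlinarith [norm_nonneg (b i - b j)]
  exact hd.countable_of_isOpen_disjoint (fun i => Metric.isOpen_ball)
    fun i => ⟨b i, Metric.mem_ball_self (by norm_num)⟩

end Nuclear

/-! ### Hilbert–Schmidt kernels -/

section HilbertSchmidt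

set_option linter.unusedSectionVars false

variable {X Ω : Type*} [MeasurableSpace X] [MeasurableSpace Ω] {μ : Measure X} {ν : Measure Ω}
  [SigmaFinite μ] [SigmaFinite ν] {k l : X × Ω → ℂ}

theorem norm_sq_eq_integral {Y : Type*} [MeasurableSpace Y] {ρ : Measure Y} (f : Lp ℂ 2 ρ) :
    ‖f‖ ^ 2 = ∫ y, ‖f y‖ ^ 2 ∂ρ := by
  have h := inner_self_eq_norm_sq_to_K (𝕜 := ℂ) f
  rw [L2.inner_def] at h
  have h2 : ∀ y, inner ℂ (f y) (f y) = ((‖f y‖ ^ 2 : ℝ) : ℂ) := fun y => by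
    rw [inner_self_eq_norm_sq_to_K]; norm_cast
  simp only [h2, integral_complex_ofReal] at h
  have h3 : ((‖f‖ ^ 2 : ℝ) : ℂ) = ((∫ y, ‖f y‖ ^ 2 ∂ρ : ℝ) : ℂ) := by
    rw [h]; norm_cast
  exact Complex.ofReal_injective h3

theorem inner_eq_integral {Y : Type*} [MeasurableSpace Y] {ρ : Measure Y} (f g : Lp ℂ 2 ρ) :
    inner ℂ f g = ∫ y, starRingEnd ℂ (f y) * g y ∂ρ := by
  rw [L2.inner_def]
  simp only [RCLike.inner_apply, mul_comm]

theorem inner_toLp_left {Y : Type*} [MeasurableSpace Y] {ρ : Measure Y} {f : Y → ℂ}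
    (hf : MemLp f 2 ρ) (g : Lp ℂ 2 ρ) :
    inner ℂ (hf.toLp f) g = ∫ y, starRingEnd ℂ (f y) * g y ∂ρ := by
  rw [inner_eq_integral]
  refine integral_congr_ae ?_
  filter_upwards [hf.coeFn_toLp] with y hy
  rw [hy]

theorem MemLp.star_mul_integrable {Y : Type*} [MeasurableSpace Y] {ρ : Measure Y} {f g : Y → ℂ}
    (hf : MemLp f 2 ρ) (hg : MemLp g 2 ρ) : Integrable (fun y => starRingEnd ℂ (f y) * g y) ρ :=
  hf.star.integrable_mul hg

theorem memLp_prod_right (hk : MemLp k 2 (μ.prod ν)) :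
    ∀ᵐ x ∂μ, MemLp (fun w => k (x, w)) 2 ν := by
  have h1 := ((memLp_two_iff_integrable_sq_norm hk.1).1 hk).prod_right_ae
  filter_upwards [h1, hk.1.prodMk_left] with x hx hm
  exact (memLp_two_iff_integrable_sq_norm hm).2 hx

theorem norm_integral_mul_sq_le {Y : Type*} [MeasurableSpace Y] {ρ : Measure Y} {f : Y → ℂ}
    (hf : MemLp f 2 ρ) (g : Lp ℂ 2 ρ) :
    ‖∫ y, f y * g y ∂ρ‖ ^ 2 ≤ (∫ y, ‖f y‖ ^ 2 ∂ρ) * ‖g‖ ^ 2 := by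
  have h1 := inner_toLp_left hf.star g
  have h2 : ∫ y, starRingEnd ℂ ((star f) y) * g y ∂ρ = ∫ y, f y * g y ∂ρ := by
    simp
  rw [h2] at h1
  rw [← h1]
  have h3 : ‖hf.star.toLp (star f)‖ ^ 2 = ∫ y, ‖f y‖ ^ 2 ∂ρ := by
    rw [norm_sq_eq_integral]
    refine integral_congr_ae ?_
    filter_upwards [hf.star.coeFn_toLp] with y hy
    rw [hy]; simp
  rw [← h3, ← mul_pow]
  exact pow_le_pow_left₀ (norm_nonneg _) (norm_inner_le_norm _ _) 2

theorem integrable_integral_norm_sq (hk : MemLp k 2 (μ.prod ν)) :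
    Integrable (fun x => ∫ w, ‖k (x, w)‖ ^ 2 ∂ν) μ :=
  ((memLp_two_iff_integrable_sq_norm hk.1).1 hk).integral_prod_left

theorem aestronglyMeasurable_kernel_mul (hk : MemLp k 2 (μ.prod ν)) (h : Lp ℂ 2 ν) :
    AEStronglyMeasurable (fun x => ∫ w, k (x, w) * h w ∂ν) μ :=
  (hk.1.mul (Lp.aestronglyMeasurable h).comp_snd).integral_prod_right'

theorem memLp_kernel_mul (hk : MemLp k 2 (μ.prod ν)) (h : Lp ℂ 2 ν) :
    MemLp (fun x => ∫ w, k (x, w) * h w ∂ν) 2 μ := by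
  rw [memLp_two_iff_integrable_sq_norm (aestronglyMeasurable_kernel_mul hk h)]
  refine Integrable.mono' ((integrable_integral_norm_sq hk).mul_const (‖h‖ ^ 2))
    ((aestronglyMeasurable_kernel_mul hk h).norm.pow 2) ?_
  filter_upwards [memLp_prod_right hk] with x hx
  rw [Real.norm_eq_abs, abs_of_nonneg (by positivity)]
  exact norm_integral_mul_sq_le hx h

/-- The operator `L²(ν) → L²(μ)` with square integrable kernel `k`. -/
def kernelOp (hk : MemLp k 2 (μ.prod ν)) : Lp ℂ 2 ν →L[ℂ] Lp ℂ 2 μ :=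
  LinearMap.mkContinuous
    { toFun := fun h => (memLp_kernel_mul hk h).toLp _
      map_add' := fun f g => by
        rw [← MemLp.toLp_add]
        refine (MemLp.toLp_eq_toLp_iff _ _).2 ?_
        filter_upwards [memLp_prod_right hk] with x hx
        have hadd : ∫ w, (k (x, w) * f w + k (x, w) * g w) ∂ν =
            (∫ w, k (x, w) * f w ∂ν) + ∫ w, k (x, w) * g w ∂ν :=
          integral_add (hx.integrable_mul (Lp.memLp f)) (hx.integrable_mul (Lp.memLp g))
        rw [Pi.add_apply, ← hadd]
        refine integral_congr_ae ?_
        filter_upwards [Lp.coeFn_add f g] with w hw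
        rw [hw, Pi.add_apply, mul_add]
      map_smul' := fun c f => by
        rw [RingHom.id_apply, ← MemLp.toLp_const_smul]
        refine (MemLp.toLp_eq_toLp_iff _ _).2 (Filter.Eventually.of_forall fun x => ?_)
        rw [Pi.smul_apply, smul_eq_mul, ← integral_const_mul]
        refine integral_congr_ae ?_
        filter_upwards [Lp.coeFn_smul c f] with w hw
        rw [hw, Pi.smul_apply, smul_eq_mul, mul_left_comm] }
    (√(∫ x, ∫ w, ‖k (x, w)‖ ^ 2 ∂ν ∂μ)) fun h => by
      refine abs_le_of_sq_le_sq' ?_ (by positivity) |>.2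
      rw [mul_pow, Real.sq_sqrt (integral_nonneg fun x => integral_nonneg fun w => by positivity),
        norm_sq_eq_integral, ← integral_mul_const]
      have hm := memLp_kernel_mul hk h
      have h1 : ∫ x, ‖(hm.toLp _ : Lp ℂ 2 μ) x‖ ^ 2 ∂μ = ∫ x, ‖∫ w, k (x, w) * h w ∂ν‖ ^ 2 ∂μ := by
        refine integral_congr_ae ?_
        filter_upwards [hm.coeFn_toLp] with x hx
        rw [hx]
      refine h1.le.trans (integral_mono_ae ((memLp_two_iff_integrable_sq_norm hm.1).1 hm)
        ((integrable_integral_norm_sq hk).mul_const _) ?_)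
      filter_upwards [memLp_prod_right hk] with x hx using norm_integral_mul_sq_le hx h

theorem coeFn_kernelOp (hk : MemLp k 2 (μ.prod ν)) (h : Lp ℂ 2 ν) :
    (kernelOp hk h : X → ℂ) =ᵐ[μ] fun x => ∫ w, k (x, w) * h w ∂ν :=
  (memLp_kernel_mul hk h).coeFn_toLp

/-- An operator with square integrable kernel is Hilbert–Schmidt. -/
theorem summable_norm_kernelOp_sq (hk : MemLp k 2 (μ.prod ν)) {ι : Type*}
    (e : HilbertBasis ι ℂ (Lp ℂ 2 ν)) : Summable fun i => ‖kernelOp hk (e i)‖ ^ 2 := by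
  refine summable_of_sum_le (c := ∫ x, ∫ w, ‖k (x, w)‖ ^ 2 ∂ν ∂μ) (fun i => by positivity)
    fun s => ?_
  have hint : ∀ i, Integrable (fun x => ‖kernelOp hk (e i) x‖ ^ 2) μ := fun i =>
    (memLp_two_iff_integrable_sq_norm (Lp.memLp _).1).1 (Lp.memLp _)
  simp only [norm_sq_eq_integral]
  rw [← integral_finsetSum s fun i _ => hint i]
  refine integral_mono_ae (integrable_finsetSum s fun i _ => hint i)
    (integrable_integral_norm_sq hk) ?_
  have h1 : ∀ᵐ x ∂μ, ∀ i ∈ s, kernelOp hk (e i) x = ∫ w, k (x, w) * e i w ∂ν :=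
    (Finset.eventually_all s).2 fun i _ => coeFn_kernelOp hk (e i)
  filter_upwards [memLp_prod_right hk, h1] with x hx h1
  have h2 : ∀ i ∈ s, ‖kernelOp hk (e i) x‖ ^ 2 =
      ‖inner ℂ (e i) (hx.star.toLp (star fun w => k (x, w)))‖ ^ 2 := fun i hi => by
    rw [h1 i hi, norm_inner_symm, inner_toLp_left]
    simp
  rw [Finset.sum_congr rfl h2]
  refine (e.orthonormal.sum_inner_products_le _).trans (le_of_eq ?_)
  rw [norm_sq_eq_integral]
  refine integral_congr_ae ?_
  filter_upwards [hx.star.coeFn_toLp] with w hw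
  rw [hw]; simp

/-- The adjoint of an operator with kernel `k(x, w)` has kernel `conj k(x, w)`. -/
theorem inner_kernelOp (hk : MemLp k 2 (μ.prod ν)) (g : Lp ℂ 2 μ) (h : Lp ℂ 2 ν) :
    inner ℂ g (kernelOp hk h) =
      ∫ w, (∫ x, starRingEnd ℂ (g x) * k (x, w) ∂μ) * h w ∂ν := by
  have hint : Integrable (fun p : X × Ω => starRingEnd ℂ (g p.1) * (k p * h p.2)) (μ.prod ν) := by
    have h1 : MemLp (fun p : X × Ω => g p.1 * starRingEnd ℂ (h p.2)) 2 (μ.prod ν) := by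
      refine (memLp_two_iff_integrable_sq_norm ?_).2 ?_
      · exact (Lp.aestronglyMeasurable g).comp_fst.mul
          (Lp.aestronglyMeasurable h).star.comp_snd
      · have := ((memLp_two_iff_integrable_sq_norm (Lp.memLp g).1).1 (Lp.memLp g)).mul_prod
          ((memLp_two_iff_integrable_sq_norm (Lp.memLp h).1).1 (Lp.memLp h))
        refine this.congr (Filter.Eventually.of_forall fun p => ?_)
        simp [mul_pow]
    refine (MemLp.star_mul_integrable h1 hk).congr (Filter.Eventually.of_forall fun p => ?_)
    simp; ring
  rw [inner_eq_integral]
  have h1 : ∫ x, starRingEnd ℂ (g x) * kernelOp hk h x ∂μ =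
      ∫ x, ∫ w, starRingEnd ℂ (g x) * (k (x, w) * h w) ∂ν ∂μ := by
    refine integral_congr_ae ?_
    filter_upwards [coeFn_kernelOp hk h] with x hx
    rw [hx, integral_const_mul]
  rw [h1, integral_integral_swap hint]
  congr 1; funext w
  rw [← integral_mul_const]
  congr 1; funext x
  ring

/-- The product of two Hilbert–Schmidt operators, given by kernels `k` and `l`, is nuclear, and its
trace is the integral of `conj l · k`. -/
theorem isNuclear_kernelOp_comp_adjoint [MeasurableSpace.CountablyGenerated Ω]
    (hk : MemLp k 2 (μ.prod ν)) (hl : MemLp l 2 (μ.prod ν)) :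
    IsNuclear (kernelOp hk ∘L ContinuousLinearMap.adjoint (kernelOp hl))
      (∫ x, ∫ w, starRingEnd ℂ (l (x, w)) * k (x, w) ∂ν ∂μ) := by
  have : Fact ((2 : ℝ≥0∞) ≠ ⊤) := ⟨by norm_num⟩
  obtain ⟨s, e, -⟩ := exists_hilbertBasis ℂ (Lp ℂ 2 ν)
  have : Countable s := countable_of_hilbertBasis e
  have hsum : Summable fun i => ‖kernelOp hl (e i)‖ * ‖kernelOp hk (e i)‖ := by
    refine Summable.of_nonneg_of_le (fun i => by positivity) (fun i => ?_)
      ((summable_norm_kernelOp_sq hl e).add (summable_norm_kernelOp_sq hk e))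
    nlinarith [sq_nonneg (‖kernelOp hl (e i)‖ - ‖kernelOp hk (e i)‖),
      norm_nonneg (kernelOp hl (e i)), norm_nonneg (kernelOp hk (e i))]
  refine IsNuclear.of_countable (fun i => kernelOp hl (e i)) (fun i => kernelOp hk (e i)) hsum ?_ ?_
  · intro u
    have h1 := (kernelOp hk).hasSum (e.hasSum_repr (ContinuousLinearMap.adjoint (kernelOp hl) u))
    simpa [HilbertBasis.repr_apply_apply, ContinuousLinearMap.adjoint_inner_right] using h1
  · have hint : ∀ i, Integrable (fun x => starRingEnd ℂ (kernelOp hl (e i) x) *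
        kernelOp hk (e i) x) μ := fun i => MemLp.star_mul_integrable (Lp.memLp _) (Lp.memLp _)
    have hS : Summable fun i => ∫ x, ‖starRingEnd ℂ (kernelOp hl (e i) x) *
        kernelOp hk (e i) x‖ ∂μ := by
      refine Summable.of_nonneg_of_le (fun i => integral_nonneg fun x => norm_nonneg _)
        (fun i => ?_) ((summable_norm_kernelOp_sq hl e).add (summable_norm_kernelOp_sq hk e))
      rw [norm_sq_eq_integral, norm_sq_eq_integral, ← integral_add
        ((memLp_two_iff_integrable_sq_norm (Lp.memLp _).1).1 (Lp.memLp _))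
        ((memLp_two_iff_integrable_sq_norm (Lp.memLp _).1).1 (Lp.memLp _))]
      refine integral_mono (hint i).norm
        (((memLp_two_iff_integrable_sq_norm (Lp.memLp _).1).1 (Lp.memLp _)).add
        ((memLp_two_iff_integrable_sq_norm (Lp.memLp _).1).1 (Lp.memLp _))) fun x => ?_
      simp only [norm_mul, RCLike.norm_conj]
      nlinarith [sq_nonneg (‖kernelOp hl (e i) x‖ - ‖kernelOp hk (e i) x‖),
        norm_nonneg (kernelOp hl (e i) x), norm_nonneg (kernelOp hk (e i) x)]
    have h1 := hasSum_integral_of_summable_integral_norm hint hS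
    have h2 : ∫ x, ∑' i, starRingEnd ℂ (kernelOp hl (e i) x) * kernelOp hk (e i) x ∂μ =
        ∫ x, ∫ w, starRingEnd ℂ (l (x, w)) * k (x, w) ∂ν ∂μ := by
      refine integral_congr_ae ?_
      have hl' : ∀ᵐ x ∂μ, ∀ i, kernelOp hl (e i) x = ∫ w, l (x, w) * e i w ∂ν :=
        ae_all_iff.2 fun i => coeFn_kernelOp hl (e i)
      have hk' : ∀ᵐ x ∂μ, ∀ i, kernelOp hk (e i) x = ∫ w, k (x, w) * e i w ∂ν :=
        ae_all_iff.2 fun i => coeFn_kernelOp hk (e i)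
      filter_upwards [hl', hk', memLp_prod_right hl, memLp_prod_right hk] with x h1 h2 hlx hkx
      have h3 : ∀ {f : Ω → ℂ} (hf : MemLp f 2 ν) i,
          inner ℂ (hf.star.toLp (star f)) (e i) = ∫ w, f w * e i w ∂ν := fun hf i => by
        rw [inner_toLp_left]; simp
      have h4 := (e.hasSum_inner_mul_inner (hkx.star.toLp _) (hlx.star.toLp _)).tsum_eq
      rw [inner_toLp_left] at h4
      have h5 : ∀ i, starRingEnd ℂ (kernelOp hl (e i) x) * kernelOp hk (e i) x =
          inner ℂ (hkx.star.toLp (star fun w => k (x, w))) (e i) *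
            inner ℂ (e i) (hlx.star.toLp (star fun w => l (x, w))) := fun i => by
        rw [h1, h2, ← h3 hlx, ← h3 hkx, inner_conj_symm, mul_comm]
      simp only [h5]
      rw [h4]
      refine integral_congr_ae ?_
      filter_upwards [hlx.star.coeFn_toLp] with w hw
      rw [hw]
      simp [mul_comm]
    rw [← h2]
    simpa only [inner_eq_integral] using h1

theorem coeFn_adjoint_kernelOp (hl : MemLp l 2 (μ.prod ν)) (f : Lp ℂ 2 μ) :
    (ContinuousLinearMap.adjoint (kernelOp hl) f : Ω → ℂ) =ᵐ[ν]
      fun w => ∫ x, starRingEnd ℂ (l (x, w)) * f x ∂μ := by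
  have hl' : MemLp (fun p : Ω × X => starRingEnd ℂ (l p.swap)) 2 (ν.prod μ) :=
    (hl.comp_measurePreserving Measure.measurePreserving_swap).star
  have h2 : kernelOp hl' f = ContinuousLinearMap.adjoint (kernelOp hl) f := by
    refine ext_inner_right ℂ fun h => ?_
    rw [ContinuousLinearMap.adjoint_inner_left, inner_kernelOp, inner_eq_integral]
    refine integral_congr_ae ?_
    filter_upwards [coeFn_kernelOp hl' f] with w hw
    rw [hw, ← integral_conj]
    congr 2; funext x
    simp [mul_comm]
  rw [← h2]
  exact coeFn_kernelOp hl' f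

end HilbertSchmidt

/-! ### The Fourier transform of a compactly supported bounded function -/

section Potential

variable {d : ℕ}

/-- On `L¹ ∩ L²` the Fourier transform of `L²` is given by the Fourier integral. -/
theorem coeFn_fourier_toLp {f : Rd d → ℂ} (h1 : Integrable f) (h2 : MemLp f 2 volume) :
    ((𝓕 (h2.toLp f) : L2 d) : Rd d → ℂ) =ᵐ[volume] 𝓕 f := by
  have hc : Continuous (𝓕 f) :=
    VectorFourier.fourierIntegral_continuous Real.continuous_fourierChar continuous_inner h1
  refine ae_eq_of_integral_contDiff_smul_eq
    ((Lp.memLp (𝓕 (h2.toLp f) : L2 d)).locallyIntegrable (by norm_num))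
    hc.locallyIntegrable fun g hg hgs => ?_
  have hgs' : HasCompactSupport fun x => (g x : ℂ) := hgs.comp_left Complex.ofReal_zero
  have hg' : ContDiff ℝ ∞ fun x => (g x : ℂ) := Complex.ofRealCLM.contDiff.comp hg
  set G : 𝓢(Rd d, ℂ) := hgs'.toSchwartzMap hg'
  have hG : ∀ x, G x = (g x : ℂ) := fun x => rfl
  have e1 : ∫ x, g x • (𝓕 (h2.toLp f) : L2 d) x = ∫ x, 𝓕 G x • f x := by
    calc ∫ x, g x • (𝓕 (h2.toLp f) : L2 d) x
        = Lp.toTemperedDistribution (𝓕 (h2.toLp f) : L2 d) G := by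
          rw [Lp.toTemperedDistribution_apply]; rfl
      _ = Lp.toTemperedDistribution (h2.toLp f) (𝓕 G) := by
          rw [← Lp.fourier_toTemperedDistribution_eq, TemperedDistribution.fourier_apply]
      _ = ∫ x, 𝓕 G x • f x := by
          rw [Lp.toTemperedDistribution_apply]
          refine integral_congr_ae ?_
          filter_upwards [h2.coeFn_toLp] with x hx
          rw [hx]
  have e2 : ∫ x, 𝓕 G x • f x = ∫ x, G x • 𝓕 f x := by
    have := VectorFourier.integral_fourierIntegral_smul_eq_flip (L := innerₗ (Rd d))
      Real.continuous_fourierChar continuous_inner (G.integrable (μ := volume)) h1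
    rw [SchwartzMap.fourier_coe]
    simpa using! this
  rw [e1, e2]
  rfl

/-- Bounded functions with compact support. -/
structure IsBddCompact (V : Rd d → ℂ) : Prop where
  memLp : MemLp V ∞ volume
  vanish : ∃ R : ℝ, 0 < R ∧ ∀ᵐ x, R < ‖x‖ → V x = 0

namespace IsBddCompact

variable {V : Rd d → ℂ}

theorem memLp_mul (h : IsBddCompact V) {g : Rd d → ℂ} (hg : MemLp g 2 volume) :
    MemLp (fun x => V x * g x) 2 volume :=
  hg.mul (p := ∞) (q := 2) (r := 2) h.memLp

theorem exists_le (h : IsBddCompact V) : ∃ C : ℝ, 0 ≤ C ∧ ∀ᵐ x, ‖V x‖ ≤ C := by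
  refine ⟨(eLpNorm V ∞ volume).toReal, ENNReal.toReal_nonneg, ?_⟩
  filter_upwards [ae_le_eLpNormEssSup (f := V) (μ := volume)] with x hx
  rw [← eLpNorm_exponent_top] at hx
  have := ENNReal.toReal_mono h.memLp.2.ne hx
  simpa using this

theorem memLp_of (h : IsBddCompact V) (p : ℝ≥0∞) : MemLp V p volume := by
  obtain ⟨R, hR, hv⟩ := h.vanish
  have h1 : MemLp V p (volume.restrict (Metric.closedBall 0 R)) := by
    have : IsFiniteMeasure (volume.restrict (Metric.closedBall (0 : Rd d) R)) :=
      ⟨by simpa using measure_closedBall_lt_top⟩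
    exact (h.memLp.restrict _).mono_exponent le_top
  have h2 := (memLp_indicator_iff_restrict (f := V) (p := p) (μ := volume)
    (Metric.isClosed_closedBall (x := (0 : Rd d)) (ε := R)).measurableSet).2 h1
  refine (memLp_congr_ae ?_).1 h2
  filter_upwards [hv] with x hx
  by_cases hxR : x ∈ Metric.closedBall (0 : Rd d) R
  · rw [indicator_of_mem hxR]
  · rw [indicator_of_notMem hxR, hx (by simpa using hxR)]

theorem integrable (h : IsBddCompact V) : Integrable V := memLp_one_iff_integrable.1 (h.memLp_of 1)

theorem integrable_mul (h : IsBddCompact V) {g : Rd d → ℂ} (hg : MemLp g 2 volume) :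
    Integrable (fun x => V x * g x) :=
  (h.memLp_of 2).integrable_mul hg

theorem comp_neg (h : IsBddCompact V) : IsBddCompact fun x => V (-x) where
  memLp := h.memLp.comp_measurePreserving (Measure.measurePreserving_neg volume)
  vanish := by
    obtain ⟨R, hR, hv⟩ := h.vanish
    refine ⟨R, hR, ?_⟩
    have := (Measure.measurePreserving_neg (volume : Measure (Rd d))).quasiMeasurePreserving.ae hv
    filter_upwards [this] with x hx hxR
    exact hx (by simpa using hxR)

theorem continuous_fourier (h : IsBddCompact V) : Continuous (𝓕 V) :=
  VectorFourier.fourierIntegral_continuous Real.continuous_fourierChar continuous_inner h.integrable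

theorem memLp_fourier (h : IsBddCompact V) : MemLp (𝓕 V) 2 volume :=
  (memLp_congr_ae (coeFn_fourier_toLp h.integrable (h.memLp_of 2))).1 (Lp.memLp _)

theorem integral_norm_fourier_sq (h : IsBddCompact V) :
    ∫ ξ, ‖𝓕 V ξ‖ ^ 2 = ∫ x, ‖V x‖ ^ 2 := by
  have h1 := Lp.norm_fourier_eq ((h.memLp_of 2).toLp V)
  have h2 : ∀ {f : Rd d → ℂ} {F : L2 d}, F =ᵐ[volume] f → ‖F‖ ^ 2 = ∫ x, ‖f x‖ ^ 2 := fun hF => by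
    rw [norm_sq_eq_integral]
    refine integral_congr_ae ?_
    filter_upwards [hF] with x hx
    rw [hx]
  rw [← h2 (coeFn_fourier_toLp h.integrable (h.memLp_of 2)), h1, h2 (h.memLp_of 2).coeFn_toLp]

/-- Multiplication by `V` is convolution with `𝓕 V` on the Fourier side. -/
theorem fourier_mul_eq (h : IsBddCompact V) (f : L2 d) (ξ : Rd d) :
    𝓕 (fun x => V x * f x) ξ = ∫ ζ, 𝓕 V (ξ - ζ) * (𝓕 f : L2 d) ζ := by
  set k : Rd d → ℂ := fun x => starRingEnd ℂ (V x * (Real.fourierChar (-(inner ℝ x ξ)) : ℂ)) with hk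
  have hce : Continuous fun x : Rd d => (Real.fourierChar (-(inner ℝ x ξ)) : ℂ) :=
    continuous_subtype_val.comp (Real.continuous_fourierChar.comp (by fun_prop))
  have hkm : ∀ p, MemLp k p volume := fun p => by
    refine ((h.memLp_of p).of_le ((h.memLp_of p).1.mul hce.aestronglyMeasurable).star
      (Filter.Eventually.of_forall fun x => ?_))
    simp only [hk, RCLike.norm_conj, norm_mul, Circle.norm_coe, mul_one, le_refl]
  have h1 : 𝓕 (fun x => V x * f x) ξ = inner ℂ ((hkm 2).toLp k) f := by
    rw [inner_toLp_left, Real.fourier_eq]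
    congr 1; funext x
    simp only [hk, Complex.conj_conj, Circle.smul_def, smul_eq_mul]
    ring
  rw [h1, ← Lp.inner_fourier_eq, inner_eq_integral]
  refine integral_congr_ae ?_
  filter_upwards [coeFn_fourier_toLp (memLp_one_iff_integrable.1 (hkm 1)) (hkm 2)] with ζ hζ
  rw [hζ]
  congr 1
  rw [Real.fourier_eq, Real.fourier_eq, ← integral_conj]
  congr 1; funext x
  simp only [hk, Circle.smul_def, smul_eq_mul, map_mul, Complex.conj_conj, ← Circle.coe_inv_eq_conj,
    ← AddChar.map_neg_eq_inv, neg_neg]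
  rw [mul_left_comm, ← Circle.coe_mul, ← AddChar.map_add_eq_mul, mul_comm]
  congr 3
  rw [inner_sub_right]; ring

theorem coeFn_fourier_mul (h : IsBddCompact V) (f : L2 d) :
    ((𝓕 ((h.memLp_mul (Lp.memLp f)).toLp _) : L2 d) : Rd d → ℂ) =ᵐ[volume]
      fun ξ => ∫ ζ, 𝓕 V (ξ - ζ) * (𝓕 f : L2 d) ζ := by
  filter_upwards [coeFn_fourier_toLp (h.integrable_mul (Lp.memLp f))
    (h.memLp_mul (Lp.memLp f))] with ξ hξ
  rw [hξ, h.fourier_mul_eq]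

theorem fourier_comp_neg (V : Rd d → ℂ) (ξ : Rd d) : 𝓕 (fun x => V (-x)) ξ = 𝓕 V (-ξ) := by
  have := Real.fourier_comp_linearIsometry (LinearIsometryEquiv.neg ℝ (E := Rd d)) V ξ
  simpa [Function.comp_def] using this

end IsBddCompact

/-- Convolution with `v` is bounded on `L²`. -/
def IsConvBounded (v : Rd d → ℂ) : Prop :=
  ∃ C : ℝ, 0 ≤ C ∧ ∀ g : Rd d → ℂ, MemLp g 2 volume →
    MemLp (fun ξ => ∫ ζ, v (ξ - ζ) * g ζ) 2 volume ∧
      ∫ ξ, ‖∫ ζ, v (ξ - ζ) * g ζ‖ ^ 2 ≤ C * ∫ ζ, ‖g ζ‖ ^ 2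

/-- Plancherel's theorem: convolution with `𝓕 V` is multiplication by the bounded function `V`. -/
theorem IsBddCompact.isConvBounded {V : Rd d → ℂ} (h : IsBddCompact V) : IsConvBounded (𝓕 V) := by
  obtain ⟨C, hC, hb⟩ := h.exists_le
  refine ⟨C ^ 2, by positivity, fun g hg => ?_⟩
  set f : L2 d := 𝓕⁻ (hg.toLp g)
  have hf : (𝓕 f : L2 d) =ᵐ[volume] g := by
    rw [show (𝓕 f : L2 d) = hg.toLp g from fourier_fourierInv_eq _]; exact hg.coeFn_toLp
  have he : ∀ ξ, ∫ ζ, 𝓕 V (ξ - ζ) * (𝓕 f : L2 d) ζ = ∫ ζ, 𝓕 V (ξ - ζ) * g ζ := fun ξ => by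
    refine integral_congr_ae ?_
    filter_upwards [hf] with ζ hζ
    rw [hζ]
  have hF := h.coeFn_fourier_mul f
  simp only [he] at hF
  refine ⟨(memLp_congr_ae hF).1 (Lp.memLp _), ?_⟩
  have e1 : ∫ ξ, ‖∫ ζ, 𝓕 V (ξ - ζ) * g ζ‖ ^ 2 = ∫ x, ‖V x * f x‖ ^ 2 := by
    have h1 := Lp.norm_fourier_eq ((h.memLp_mul (Lp.memLp f)).toLp _)
    have h2 : ∀ {f : Rd d → ℂ} {F : L2 d}, F =ᵐ[volume] f → ‖F‖ ^ 2 = ∫ x, ‖f x‖ ^ 2 :=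
      fun hF => by
        rw [norm_sq_eq_integral]
        refine integral_congr_ae ?_
        filter_upwards [hF] with x hx
        rw [hx]
    rw [← h2 hF, h1, h2 (h.memLp_mul (Lp.memLp f)).coeFn_toLp]
  have e2 : ∫ ζ, ‖g ζ‖ ^ 2 = ∫ x, ‖f x‖ ^ 2 := by
    rw [← norm_sq_eq_integral, ← Lp.norm_fourier_eq, norm_sq_eq_integral]
    refine integral_congr_ae ?_
    filter_upwards [hf] with ζ hζ
    rw [hζ]
  rw [e1, e2, ← integral_const_mul]
  refine integral_mono_ae
    ((memLp_two_iff_integrable_sq_norm (h.memLp_mul (Lp.memLp f)).1).1 (h.memLp_mul (Lp.memLp f)))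
    (((memLp_two_iff_integrable_sq_norm (Lp.memLp f).1).1 (Lp.memLp f)).const_mul _) ?_
  filter_upwards [hb] with x hx
  simp only [norm_mul, mul_pow]
  gcongr

/-- Functions decaying faster than every power of the distance to the origin. -/
def IsRapid (Ψ : Rd d → ℂ) : Prop :=
  ∀ N : ℕ, ∃ C : ℝ, 0 ≤ C ∧ ∀ ξ, ‖Ψ ξ‖ * (1 + ‖ξ‖) ^ N ≤ C

/-- The properties of the Fourier transform `v` of a potential on which the trace class estimates
rest. The last one says that the potential equals its product with a smooth cutoff. -/
structure IsPotentialTransform (v : Rd d → ℂ) : Prop where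
  continuous : Continuous v
  memLp : MemLp v 2 volume
  conv : IsConvBounded v
  conv_neg : IsConvBounded fun ξ => v (-ξ)
  reproduce : ∃ Ψ : Rd d → ℂ, Continuous Ψ ∧ IsRapid Ψ ∧ ∀ ξ, v ξ = ∫ κ, Ψ (ξ - κ) * v κ

theorem IsBddCompact.isPotentialTransform {V : Rd d → ℂ} (h : IsBddCompact V) :
    IsPotentialTransform (𝓕 V) where
  continuous := h.continuous_fourier
  memLp := h.memLp_fourier
  conv := h.isConvBounded
  conv_neg := by
    have := h.comp_neg.isConvBounded
    rwa [show 𝓕 (fun x => V (-x)) = fun ξ => 𝓕 V (-ξ) from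
      funext (IsBddCompact.fourier_comp_neg V)] at this
  reproduce := by
    obtain ⟨R, hR, hv⟩ := h.vanish
    -- a smooth cutoff equal to `1` on the support of `V`; its Fourier transform reproduces `𝓕 V`
    let χ : ContDiffBump (0 : Rd d) := ⟨R, R + 1, hR, by linarith⟩
    have hχs : HasCompactSupport fun x => (χ x : ℂ) :=
      χ.hasCompactSupport.comp_left Complex.ofReal_zero
    have hχd : ContDiff ℝ ∞ fun x => (χ x : ℂ) := Complex.ofRealCLM.contDiff.comp χ.contDiff
    set G : 𝓢(Rd d, ℂ) := hχs.toSchwartzMap hχd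
    have hG : IsBddCompact (G : Rd d → ℂ) := by
      refine ⟨G.memLp ∞ volume, R + 1, by linarith, Filter.Eventually.of_forall fun x hx => ?_⟩
      have : χ x = 0 := χ.zero_of_le_dist (by simpa using hx.le)
      change (χ x : ℂ) = 0
      rw [this, Complex.ofReal_zero]
    refine ⟨𝓕 (G : Rd d → ℂ), hG.continuous_fourier, fun N => ?_, fun ξ => ?_⟩
    · have := SchwartzMap.one_add_le_sup_seminorm_apply (𝕜 := ℝ) (m := (N, 0)) (k := N) (n := 0)
        le_rfl le_rfl (𝓕 G)
      refine ⟨2 ^ N * ((Finset.Iic ((N, 0) : ℕ × ℕ)).sup fun m => SchwartzMap.seminorm ℝ m.1 m.2)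
          (𝓕 G), by positivity, fun ξ => ?_⟩
      have h1 := this ξ
      rw [norm_iteratedFDeriv_zero, SchwartzMap.fourier_coe] at h1
      rw [mul_comm]; exact h1
    · have h1 := hG.fourier_mul_eq ((h.memLp_of 2).toLp V) ξ
      have h2 : ∫ x, 𝓕 (G : Rd d → ℂ) (ξ - x) * (𝓕 ((h.memLp_of 2).toLp V) : L2 d) x =
          ∫ x, 𝓕 (G : Rd d → ℂ) (ξ - x) * 𝓕 V x := by
        refine integral_congr_ae ?_
        filter_upwards [coeFn_fourier_toLp h.integrable (h.memLp_of 2)] with x hx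
        rw [hx]
      rw [h2] at h1
      rw [← h1, Real.fourier_eq, Real.fourier_eq]
      refine integral_congr_ae ?_
      filter_upwards [hv, (h.memLp_of 2).coeFn_toLp] with x hx hx'
      rw [hx']
      by_cases hxR : R < ‖x‖
      · rw [hx hxR, mul_zero]
      · have h3 : (χ : Rd d → ℝ) x = 1 := χ.one_of_mem_closedBall (by simpa using hxR)
        have h4 : G x = 1 := by
          change (χ x : ℂ) = 1
          rw [h3, Complex.ofReal_one]
        rw [h4, one_mul]

theorem IsPotentialTransform.comp_neg {v : Rd d → ℂ} (h : IsPotentialTransform v) :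
    IsPotentialTransform fun ξ => v (-ξ) where
  continuous := h.continuous.comp continuous_neg
  memLp := h.memLp.comp_measurePreserving (Measure.measurePreserving_neg volume)
  conv := h.conv_neg
  conv_neg := by simpa only [neg_neg] using h.conv
  reproduce := by
    obtain ⟨Ψ, hΨ, hr, he⟩ := h.reproduce
    refine ⟨fun ξ => Ψ (-ξ), hΨ.comp continuous_neg, fun N => ?_, fun ξ => ?_⟩
    · obtain ⟨C, hC, hb⟩ := hr N
      exact ⟨C, hC, fun ξ => by simpa using hb (-ξ)⟩
    · rw [he (-ξ), ← integral_neg_eq_self]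
      congr 1; funext κ
      rw [neg_sub_neg, ← neg_sub ξ κ]

end Potential

/-! ### Nuclear integral kernels -/

section NuclearKernel

variable {d : ℕ}

/-- `K` is the kernel of a nuclear operator on `L²(ℝ^d)` whose trace is `∫ K(ξ, ξ) dξ`. -/
def IsNuclearKernel (K : Rd d → Rd d → ℂ) : Prop :=
  Integrable (fun ξ => K ξ ξ) ∧
    ∃ hK : MemLp (Function.uncurry K) 2 ((volume : Measure (Rd d)).prod volume),
      IsNuclear (kernelOp hK) (∫ ξ, K ξ ξ)

theorem IsNuclearKernel.add {K L : Rd d → Rd d → ℂ} (hK : IsNuclearKernel K)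
    (hL : IsNuclearKernel L) : IsNuclearKernel fun ξ η => K ξ η + L ξ η := by
  obtain ⟨hKi, hKm, hKn⟩ := hK
  obtain ⟨hLi, hLm, hLn⟩ := hL
  have hm : MemLp (Function.uncurry fun ξ η => K ξ η + L ξ η) 2
      ((volume : Measure (Rd d)).prod volume) := hKm.add hLm
  refine ⟨hKi.add hLi, hm, ?_⟩
  have h1 : kernelOp hm = kernelOp hKm + kernelOp hLm := by
    refine ContinuousLinearMap.ext fun f => Lp.ext ?_
    rw [add_apply]
    filter_upwards [coeFn_kernelOp hm f, coeFn_kernelOp hKm f, coeFn_kernelOp hLm f,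
      Lp.coeFn_add (kernelOp hKm f) (kernelOp hLm f), memLp_prod_right hKm,
      memLp_prod_right hLm] with x h1 h2 h3 h4 h5 h6
    rw [h1, h4, Pi.add_apply, h2, h3]
    refine Eq.trans ?_ (integral_add (h5.integrable_mul (Lp.memLp f))
      (h6.integrable_mul (Lp.memLp f)))
    congr 1; funext w
    simp only [Function.uncurry]
    ring
  rw [h1, integral_add hKi hLi]
  exact hKn.add hLn

/-- `K` is the composition of two Hilbert–Schmidt kernels through an auxiliary measure space. -/
def IsFactorable (K : Rd d → Rd d → ℂ) : Prop :=
  ∃ (Ω : Type) (_ : MeasurableSpace Ω) (_ : MeasurableSpace.CountablyGenerated Ω) (μ : Measure Ω)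
    (_ : SigmaFinite μ) (k l : Rd d × Ω → ℂ), Measurable k ∧ Measurable l ∧
    MemLp k 2 (volume.prod μ) ∧ MemLp l 2 (volume.prod μ) ∧
    ∀ ξ η, K ξ η = ∫ w, k (ξ, w) * l (η, w) ∂μ

theorem IsFactorable.swap {K : Rd d → Rd d → ℂ} (h : IsFactorable K) :
    IsFactorable fun ξ η => K η ξ := by
  obtain ⟨Ω, i, j, μ, hμ, k, l, hk, hl, hk2, hl2, he⟩ := h
  refine ⟨Ω, i, j, μ, hμ, l, k, hl, hk, hl2, hk2, fun ξ η => ?_⟩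
  simp only [he, mul_comm]

theorem IsFactorable.isNuclearKernel {K : Rd d → Rd d → ℂ} (h : IsFactorable K) :
    IsNuclearKernel K := by
  obtain ⟨Ω, i, j, μ, hμ, k, l, hk, hl, hk2, hl2, he⟩ := h
  have hki := integrable_integral_norm_sq hk2
  have hli := integrable_integral_norm_sq hl2
  have hmeas : StronglyMeasurable (Function.uncurry K) := by
    have : Function.uncurry K = fun p : Rd d × Rd d => ∫ w, k (p.1, w) * l (p.2, w) ∂μ := by
      funext p; exact he _ _
    rw [this]
    refine StronglyMeasurable.integral_prod_right (f := fun (p : Rd d × Rd d) w =>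
      k (p.1, w) * l (p.2, w)) (Measurable.stronglyMeasurable ?_)
    exact (hk.comp (by fun_prop)).mul (hl.comp (by fun_prop))
  have hm : MemLp (Function.uncurry K) 2 ((volume : Measure (Rd d)).prod volume) := by
    rw [memLp_two_iff_integrable_sq_norm hmeas.aestronglyMeasurable]
    refine Integrable.mono' (hki.mul_prod hli)
      (hmeas.norm.pow 2).aestronglyMeasurable ?_
    have h1 : ∀ᵐ p : Rd d × Rd d ∂((volume : Measure (Rd d)).prod volume),
        MemLp (fun w => k (p.1, w)) 2 μ :=
      Measure.quasiMeasurePreserving_fst.ae (memLp_prod_right hk2)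
    have h2 : ∀ᵐ p : Rd d × Rd d ∂((volume : Measure (Rd d)).prod volume),
        MemLp (fun w => l (p.2, w)) 2 μ :=
      Measure.quasiMeasurePreserving_snd.ae (memLp_prod_right hl2)
    filter_upwards [h1, h2] with p h1 h2
    rw [Real.norm_of_nonneg (by positivity), Function.uncurry_apply_pair, he]
    have h3 := norm_integral_mul_sq_le h1 (h2.toLp _)
    have h4 : ‖h2.toLp _‖ ^ 2 = ∫ w, ‖l (p.2, w)‖ ^ 2 ∂μ := by
      rw [norm_sq_eq_integral]
      refine integral_congr_ae ?_
      filter_upwards [h2.coeFn_toLp] with w hw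
      rw [hw]
    rw [h4] at h3
    refine le_trans (le_of_eq ?_) h3
    congr 2
    refine integral_congr_ae ?_
    filter_upwards [h2.coeFn_toLp] with w hw
    rw [hw]
  have hl2' : MemLp (fun p => starRingEnd ℂ (l p)) 2 (volume.prod μ) := hl2.star
  have hmul : Integrable (fun p : Rd d × Ω => k p * l p) (volume.prod μ) := hk2.integrable_mul hl2
  have hdiag : ∫ ξ, K ξ ξ = ∫ ξ, ∫ w, starRingEnd ℂ (starRingEnd ℂ (l (ξ, w))) * k (ξ, w) ∂μ := by
    simp only [he, Complex.conj_conj, mul_comm]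
  refine ⟨?_, hm, ?_⟩
  · simp only [he]
    exact hmul.integral_prod_left
  have hop : kernelOp hm = kernelOp hk2 ∘L ContinuousLinearMap.adjoint (kernelOp hl2') := by
    refine ContinuousLinearMap.ext fun f => Lp.ext ?_
    rw [ContinuousLinearMap.comp_apply]
    filter_upwards [coeFn_kernelOp hm f, coeFn_kernelOp hk2
      (ContinuousLinearMap.adjoint (kernelOp hl2') f), memLp_prod_right hk2] with ξ h1 h2 h3
    have h4 : ∫ w, k (ξ, w) * (ContinuousLinearMap.adjoint (kernelOp hl2') f : Ω → ℂ) w ∂μ =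
        ∫ w, (∫ η, k (ξ, w) * (l (η, w) * f η)) ∂μ := by
      refine integral_congr_ae ?_
      filter_upwards [coeFn_adjoint_kernelOp hl2' f] with w hw
      rw [hw, ← integral_const_mul]
      simp only [Complex.conj_conj]
    have h5 : Integrable (Function.uncurry fun w η => k (ξ, w) * (l (η, w) * f η))
        (μ.prod volume) := by
      have h6 : MemLp (fun p : Ω × Rd d => k (ξ, p.1) * f p.2) 2 (μ.prod volume) := by
        refine (memLp_two_iff_integrable_sq_norm ?_).2 ?_
        · exact h3.1.comp_fst.mul (Lp.aestronglyMeasurable f).comp_snd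
        · have := ((memLp_two_iff_integrable_sq_norm h3.1).1 h3).mul_prod
            ((memLp_two_iff_integrable_sq_norm (Lp.memLp f).1).1 (Lp.memLp f))
          refine this.congr (Filter.Eventually.of_forall fun p => ?_)
          simp [mul_pow]
      refine (h6.integrable_mul (hl2.comp_measurePreserving
        Measure.measurePreserving_swap)).congr (Filter.Eventually.of_forall fun p => ?_)
      simp only [Function.uncurry, Function.comp, Prod.swap, Pi.mul_apply]
      ring
    rw [h1, h2, h4, integral_integral_swap h5]
    congr 1; funext η
    simp only [Function.uncurry, he]
    rw [← integral_mul_const]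
    congr 1; funext w
    ring
  rw [hop, hdiag]
  exact isNuclear_kernelOp_comp_adjoint hk2 hl2'

/-- An integrable and square integrable weight. -/
def weight (ξ : Rd d) : ℝ := ((1 + ‖ξ‖) ^ (d + 1))⁻¹

theorem weight_pos (ξ : Rd d) : 0 < weight ξ := by unfold weight; positivity

theorem weight_le_one (ξ : Rd d) : weight ξ ≤ 1 :=
  inv_le_one_of_one_le₀ (one_le_pow₀ (by linarith [norm_nonneg ξ]))

theorem continuous_weight : Continuous (weight : Rd d → ℝ) := by
  unfold weight
  exact (by fun_prop : Continuous fun ξ : Rd d => (1 + ‖ξ‖) ^ (d + 1)).inv₀ fun ξ => by positivity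

theorem integrable_weight : Integrable (weight : Rd d → ℝ) := by
  have := integrable_one_add_norm (E := Rd d) (μ := volume) (r := d + 1) (by simp)
  refine this.congr (Filter.Eventually.of_forall fun ξ => ?_)
  simp only [weight]
  rw [Real.rpow_neg (by positivity), ← Real.rpow_natCast]
  push_cast; rfl

theorem integrable_weight_sq : Integrable fun ξ : Rd d => weight ξ ^ 2 :=
  integrable_weight.mono' (continuous_weight.pow 2).aestronglyMeasurable
    (Filter.Eventually.of_forall fun ξ => by
      rw [Real.norm_of_nonneg (by positivity)]
      nlinarith [weight_pos ξ, weight_le_one ξ])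

/-- Peetre's inequality. -/
theorem weight_mul_le (ξ κ : Rd d) : (weight κ)⁻¹ ≤ (weight ξ)⁻¹ * (1 + ‖ξ - κ‖) ^ (d + 1) := by
  simp only [weight, inv_inv]
  rw [← mul_pow]
  refine pow_le_pow_left₀ (by positivity) ?_ _
  have : ‖κ‖ ≤ ‖ξ‖ + ‖ξ - κ‖ := by
    calc ‖κ‖ = ‖ξ - (ξ - κ)‖ := by rw [sub_sub_cancel]
      _ ≤ _ := norm_sub_le _ _
  nlinarith [norm_nonneg ξ, norm_nonneg (ξ - κ), mul_nonneg (norm_nonneg ξ) (norm_nonneg (ξ - κ))]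

variable {Ω : Type} [MeasurableSpace Ω]

/-- A bounded measurable family of symbols. -/
structure IsBddSymbol (m : Ω → Rd d → ℂ) : Prop where
  measurable : Measurable (Function.uncurry m)
  bound : ∃ C : ℝ, 0 ≤ C ∧ ∀ w ξ, ‖m w ξ‖ ≤ C

/-- A measurable family of symbols which decay, uniformly in the parameter, like the square of
`weight`. -/
structure IsDecayingSymbol (m : Ω → Rd d → ℂ) : Prop where
  measurable : Measurable (Function.uncurry m)
  bound : ∃ C : ℝ, 0 ≤ C ∧ ∀ w ξ, ‖m w ξ‖ ≤ C * weight ξ ^ 2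

theorem IsDecayingSymbol.isBddSymbol {m : Ω → Rd d → ℂ} (h : IsDecayingSymbol m) :
    IsBddSymbol m := by
  obtain ⟨C, hC, hb⟩ := h.bound
  exact ⟨h.measurable, C, hC, fun w ξ => (hb w ξ).trans
    (mul_le_of_le_one_right hC (pow_le_one₀ (weight_pos ξ).le (weight_le_one ξ)))⟩

/-- The kernel, on the Fourier side, of the operator `∫ m₁(w, D) V m₂(w, D) V m₃(w, D) dμ(w)`, where
`v` is the Fourier transform of `V`. -/
def sandwich (v : Rd d → ℂ) (μ : Measure Ω) (m₁ m₂ m₃ : Ω → Rd d → ℂ) (ξ η : Rd d) : ℂ :=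
  ∫ w, m₁ w ξ * m₃ w η * (∫ ζ, v (ξ - ζ) * v (ζ - η) * m₂ w ζ) ∂μ

theorem memLp_two_mul_sub {f g : Rd d → ℝ} (hf : Integrable fun ξ => f ξ ^ 2)
    (hg : Integrable fun ξ => g ξ ^ 2) :
    Integrable (fun p : Rd d × Rd d => (f p.2 * g (p.1 - p.2)) ^ 2) (volume.prod volume) := by
  have := hf.convolution_integrand (ContinuousLinearMap.mul ℝ ℝ) hg
  simpa only [mul_pow, ContinuousLinearMap.mul_apply'] using this

theorem memLp_two_mul_sub' {f g : Rd d → ℝ} (hf : Integrable fun ξ => f ξ ^ 2)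
    (hg : Integrable fun ξ => g ξ ^ 2) :
    Integrable (fun p : Rd d × Rd d => (f p.1 * g (p.1 - p.2)) ^ 2) (volume.prod volume) := by
  have := (memLp_two_mul_sub hf (g := fun ξ => g (-ξ)) hg.comp_neg).swap
  refine this.congr (Filter.Eventually.of_forall fun p => ?_)
  simp [Function.comp]

/-- A kernel dominated by a square integrable function which does not depend on a parameter in a
finite measure space is square integrable. -/
theorem memLp_two_of_norm_le (μ : Measure Ω) [IsFiniteMeasure μ] {k : Rd d × (Rd d × Ω) → ℂ}
    (hk : Measurable k) {h : Rd d × Rd d → ℝ} (hh : Integrable (fun p => h p ^ 2)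
      (volume.prod volume)) (hkh : ∀ ξ ζ w, ‖k (ξ, ζ, w)‖ ≤ h (ξ, ζ)) :
    MemLp k 2 (volume.prod (volume.prod μ)) := by
  rw [memLp_two_iff_integrable_sq_norm hk.aestronglyMeasurable]
  have h1 := hh.comp_fst μ
  have h2 := ((measurePreserving_prodAssoc (volume : Measure (Rd d)) (volume : Measure (Rd d))
    μ).symm MeasurableEquiv.prodAssoc).integrable_comp_of_integrable h1
  refine h2.mono' (hk.norm.pow_const 2).aestronglyMeasurable
    (Filter.Eventually.of_forall fun p => ?_)
  rw [Real.norm_of_nonneg (by positivity)]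
  exact pow_le_pow_left₀ (norm_nonneg _) (hkh p.1 p.2.1 p.2.2) 2

namespace IsPotentialTransform

variable {v : Rd d → ℂ} {μ : Measure Ω} {m₁ m₂ m₃ : Ω → Rd d → ℂ}

theorem memLp_comp_sub (hv : IsPotentialTransform v) (ξ : Rd d) :
    MemLp (fun ζ => v (ξ - ζ)) 2 volume :=
  hv.memLp.comp_measurePreserving (Measure.measurePreserving_sub_left volume ξ)

theorem memLp_comp_sub_right (hv : IsPotentialTransform v) (η : Rd d) :
    MemLp (fun ζ => v (ζ - η)) 2 volume :=
  hv.memLp.comp_measurePreserving (measurePreserving_sub_right volume η)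

theorem integrable_mul (hv : IsPotentialTransform v) (ξ η : Rd d) :
    Integrable fun ζ => v (ξ - ζ) * v (ζ - η) :=
  (hv.memLp_comp_sub ξ).integrable_mul (hv.memLp_comp_sub_right η)

theorem integrable_sq (hv : IsPotentialTransform v) : Integrable fun ζ => ‖v ζ‖ ^ 2 :=
  (memLp_two_iff_integrable_sq_norm hv.memLp.1).1 hv.memLp

/-- Transposition exchanges the outer symbols and reflects `v`. -/
theorem sandwich_swap (v : Rd d → ℂ) (μ : Measure Ω) (m₁ m₂ m₃ : Ω → Rd d → ℂ) (ξ η : Rd d) :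
    sandwich v μ m₁ m₂ m₃ ξ η = sandwich (fun ζ => v (-ζ)) μ m₃ m₂ m₁ η ξ := by
  unfold sandwich
  congr 1; funext w
  rw [mul_comm (m₁ w ξ)]
  congr 2; funext ζ
  simp only [neg_sub]
  rw [mul_comm (v (ξ - ζ))]

variable [MeasurableSpace.CountablyGenerated Ω] [IsFiniteMeasure μ]

/-- If the middle symbol decays, its decay is shared between both factors. -/
theorem isFactorable_sandwich_middle (hv : IsPotentialTransform v) (h₁ : IsBddSymbol m₁)
    (h₂ : IsDecayingSymbol m₂) (h₃ : IsBddSymbol m₃) :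
    IsFactorable (sandwich v μ m₁ m₂ m₃) := by
  obtain ⟨C₁, hC₁, hb₁⟩ := h₁.bound
  obtain ⟨C₂, hC₂, hb₂⟩ := h₂.bound
  obtain ⟨C₃, hC₃, hb₃⟩ := h₃.bound
  have hvm := hv.continuous.measurable
  have hwm : Measurable (weight : Rd d → ℝ) := continuous_weight.measurable
  have hw0 : ∀ ζ : Rd d, (weight ζ : ℂ) ≠ 0 := fun ζ => by exact_mod_cast (weight_pos ζ).ne'
  -- `m₂` decays like `weight²`, so that one power of `weight` is left for each factor
  set k : Rd d × (Rd d × Ω) → ℂ := fun p => m₁ p.2.2 p.1 * v (p.1 - p.2.1) * weight p.2.1 with hk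
  set l : Rd d × (Rd d × Ω) → ℂ := fun p =>
    (weight p.2.1 : ℂ)⁻¹ * m₂ p.2.2 p.2.1 * v (p.2.1 - p.1) * m₃ p.2.2 p.1 with hl
  have hkm : Measurable k :=
    ((h₁.measurable.comp (g := Function.uncurry m₁) (f := fun p : Rd d × (Rd d × Ω) =>
      (p.2.2, p.1)) (by fun_prop)).mul (hvm.comp (by fun_prop))).mul
      (Complex.measurable_ofReal.comp (hwm.comp (by fun_prop)))
  have hlm : Measurable l :=
    ((((Complex.measurable_ofReal.comp (hwm.comp (by fun_prop))).inv).mul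
      (h₂.measurable.comp (g := Function.uncurry m₂) (f := fun p : Rd d × (Rd d × Ω) =>
      (p.2.2, p.2.1)) (by fun_prop))).mul (hvm.comp (by fun_prop))).mul
      (h₃.measurable.comp (g := Function.uncurry m₃) (f := fun p : Rd d × (Rd d × Ω) =>
      (p.2.2, p.1)) (by fun_prop))
  refine ⟨Rd d × Ω, inferInstance, inferInstance, volume.prod μ, inferInstance, k, l, hkm, hlm,
    ?_, ?_, fun ξ η => ?_⟩
  · refine memLp_two_of_norm_le μ hkm (memLp_two_mul_sub (f := fun ζ => C₁ * weight ζ)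
      (g := fun ζ => ‖v ζ‖) ?_ hv.integrable_sq) fun ξ ζ w => ?_
    · simpa only [mul_pow] using integrable_weight_sq.const_mul _
    · simp only [hk, norm_mul, Complex.norm_real, Real.norm_of_nonneg (weight_pos ζ).le]
      nlinarith [mul_le_mul_of_nonneg_right (hb₁ w ξ)
        (mul_nonneg (norm_nonneg (v (ξ - ζ))) (weight_pos ζ).le)]
  · refine memLp_two_of_norm_le μ hlm (memLp_two_mul_sub (f := fun ζ => C₂ * C₃ * weight ζ)
      (g := fun ζ => ‖v (-ζ)‖) ?_ hv.integrable_sq.comp_neg) fun ξ ζ w => ?_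
    · simpa only [mul_pow] using integrable_weight_sq.const_mul _
    · simp only [hl, norm_mul, norm_inv, Complex.norm_real, Real.norm_of_nonneg (weight_pos ζ).le,
        neg_sub]
      have h1 : (weight ζ)⁻¹ * ‖m₂ w ζ‖ ≤ C₂ * weight ζ := by
        rw [inv_mul_le_iff₀ (weight_pos ζ)]
        refine (hb₂ w ζ).trans (le_of_eq (by ring))
      calc (weight ζ)⁻¹ * ‖m₂ w ζ‖ * ‖v (ζ - ξ)‖ * ‖m₃ w ξ‖
          ≤ C₂ * weight ζ * ‖v (ζ - ξ)‖ * C₃ := by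
            gcongr
            · exact mul_nonneg (mul_nonneg hC₂ (weight_pos ζ).le) (norm_nonneg _)
            · exact hb₃ w ξ
        _ = _ := by ring
  · have h1 : ∀ p : Rd d × Ω, k (ξ, p) * l (η, p) =
        m₁ p.2 ξ * m₃ p.2 η * (v (ξ - p.1) * v (p.1 - η) * m₂ p.2 p.1) := fun p => by
      simp only [hk, hl]
      field_simp [hw0 p.1]
    simp only [h1]
    rw [integral_prod_symm, sandwich]
    · congr 1; funext w
      exact (integral_const_mul _ _).symm
    · refine Integrable.mono' (((hv.integrable_mul ξ η).norm.const_mul (C₁ * C₃ * C₂)).comp_fst μ)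
        ?_ (Filter.Eventually.of_forall fun p => ?_)
      · simp only [← h1]
        exact ((hkm.comp measurable_prodMk_left).mul
          (hlm.comp measurable_prodMk_left)).aestronglyMeasurable
      · obtain ⟨C, hC, hb⟩ := h₂.isBddSymbol.bound
        have hw1 : weight p.1 ^ 2 ≤ 1 := pow_le_one₀ (weight_pos _).le (weight_le_one _)
        have hm2 : ‖m₂ p.2 p.1‖ ≤ C₂ := (hb₂ p.2 p.1).trans (mul_le_of_le_one_right hC₂ hw1)
        rw [norm_mul, norm_mul, norm_mul (v _ * v _)]
        calc ‖m₁ p.2 ξ‖ * ‖m₃ p.2 η‖ * (‖v (ξ - p.1) * v (p.1 - η)‖ * ‖m₂ p.2 p.1‖)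
            ≤ C₁ * C₃ * (‖v (ξ - p.1) * v (p.1 - η)‖ * C₂) := by
              gcongr
              · exact hb₁ _ _
              · exact hb₃ _ _
          _ = _ := by ring

/-- If the first symbol decays, a smooth cutoff is inserted to the left of the first potential. -/
theorem isFactorable_sandwich_left (hv : IsPotentialTransform v) (h₁ : IsDecayingSymbol m₁)
    (h₂ : IsBddSymbol m₂) (h₃ : IsBddSymbol m₃) :
    IsFactorable (sandwich v μ m₁ m₂ m₃) := by
  obtain ⟨C₁, hC₁, hb₁⟩ := h₁.bound
  obtain ⟨C₂, hC₂, hb₂⟩ := h₂.bound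
  obtain ⟨C₃, hC₃, hb₃⟩ := h₃.bound
  obtain ⟨Ψ, hΨc, hΨr, hΨ⟩ := hv.reproduce
  obtain ⟨A, hA, hconv⟩ := hv.conv_neg
  obtain ⟨CΨ, hCΨ, hbΨ⟩ := hΨr (2 * (d + 1))
  set I : ℝ := ∫ ζ, ‖v ζ‖ ^ 2 with hI
  have hI0 : 0 ≤ I := integral_nonneg fun ζ => by positivity
  have hvm := hv.continuous.measurable
  have hΨm := hΨc.measurable
  have hwm : Measurable (weight : Rd d → ℝ) := continuous_weight.measurable
  have hw0 : ∀ ζ : Rd d, (weight ζ : ℂ) ≠ 0 := fun ζ => by exact_mod_cast (weight_pos ζ).ne'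
  have hΨw : ∀ ζ, ‖Ψ ζ‖ * (1 + ‖ζ‖) ^ (d + 1) ≤ CΨ * weight ζ := fun ζ => by
    rw [weight, ← div_eq_mul_inv, le_div_iff₀ (by positivity), mul_assoc, ← pow_add, ← two_mul]
    exact hbΨ ζ
  have hΨi : Integrable Ψ := by
    refine (integrable_weight.const_mul CΨ).mono' hΨc.aestronglyMeasurable
      (Filter.Eventually.of_forall fun ζ => (le_trans ?_ (hΨw ζ)))
    exact le_mul_of_one_le_right (norm_nonneg _) (one_le_pow₀ (by linarith [norm_nonneg ζ]))
  have hgm : ∀ (w : Ω) (κ : Rd d), MemLp (fun ζ => v (κ - ζ) * m₂ w ζ) 2 volume ∧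
      ∫ ζ, ‖v (κ - ζ) * m₂ w ζ‖ ^ 2 ≤ C₂ ^ 2 * I := fun w κ => by
    have hmeas : Measurable fun ζ => v (κ - ζ) * m₂ w ζ :=
      (hvm.comp (by fun_prop)).mul (h₂.measurable.comp measurable_prodMk_left)
    have hle : ∀ ζ, ‖v (κ - ζ) * m₂ w ζ‖ ≤ C₂ * ‖v (κ - ζ)‖ := fun ζ => by
      rw [norm_mul, mul_comm]
      exact mul_le_mul_of_nonneg_right (hb₂ w ζ) (norm_nonneg _)
    have hm := MemLp.of_le_mul (hv.memLp_comp_sub κ) hmeas.aestronglyMeasurable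
      (Filter.Eventually.of_forall hle)
    refine ⟨hm, ?_⟩
    have h1 : Integrable fun ζ => ‖v (κ - ζ)‖ ^ 2 := hv.integrable_sq.comp_sub_left κ
    have h2 : ∫ ζ, ‖v (κ - ζ)‖ ^ 2 = I := integral_sub_left_eq_self (fun ζ => ‖v ζ‖ ^ 2) volume κ
    rw [← h2, ← integral_const_mul]
    refine integral_mono ((memLp_two_iff_integrable_sq_norm hm.1).1 hm) (h1.const_mul _)
      fun ζ => ?_
    simpa only [mul_pow] using pow_le_pow_left₀ (norm_nonneg _) (hle ζ) 2
  -- the part of the kernel to the right of the cutoff, with `κ` the frequency after the cutoff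
  set H : Rd d × (Rd d × Ω) → ℂ := fun p =>
    ∫ ζ, v (p.2.1 - ζ) * v (ζ - p.1) * m₂ p.2.2 ζ with hH
  have hHm : Measurable H := by
    refine (StronglyMeasurable.integral_prod_right (f := fun (p : Rd d × (Rd d × Ω)) ζ =>
      v (p.2.1 - ζ) * v (ζ - p.1) * m₂ p.2.2 ζ) (Measurable.stronglyMeasurable ?_)).measurable
    exact ((hvm.comp (by fun_prop)).mul (hvm.comp (by fun_prop))).mul
      (h₂.measurable.comp (g := Function.uncurry m₂)
        (f := fun q : (Rd d × (Rd d × Ω)) × Rd d => (q.1.2.2, q.2)) (by fun_prop))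
  have hHb : ∀ η κ w, ‖H (η, κ, w)‖ ≤ C₂ * I := fun η κ w => by
    have h1 : H (η, κ, w) = ∫ ζ, (v (κ - ζ) * m₂ w ζ) * v (ζ - η) := by
      simp only [hH]; congr 1; funext ζ; ring
    have h2 := norm_integral_mul_sq_le (hgm w κ).1 ((hv.memLp_comp_sub_right η).toLp _)
    have h3 : ‖(hv.memLp_comp_sub_right η).toLp _‖ ^ 2 = I := by
      rw [norm_sq_eq_integral, hI, ← integral_sub_right_eq_self (fun ζ => ‖v ζ‖ ^ 2) η]
      refine integral_congr_ae ?_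
      filter_upwards [(hv.memLp_comp_sub_right η).coeFn_toLp] with ζ hζ
      rw [hζ]
    have h4 : ∫ ζ, (v (κ - ζ) * m₂ w ζ) * ((hv.memLp_comp_sub_right η).toLp _ : Lp ℂ 2 _) ζ =
        H (η, κ, w) := by
      rw [h1]
      refine integral_congr_ae ?_
      filter_upwards [(hv.memLp_comp_sub_right η).coeFn_toLp] with ζ hζ
      rw [hζ]
    rw [h3, h4] at h2
    refine abs_le_of_sq_le_sq' (h2.trans ?_) (by positivity) |>.2
    calc _ ≤ C₂ ^ 2 * I * I := mul_le_mul_of_nonneg_right (hgm w κ).2 hI0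
      _ = _ := by ring
  -- in `η` it is a convolution with the reflection of `v`, and hence square integrable, uniformly
  -- in `κ`
  have hHi : ∀ κ w, MemLp (fun η => H (η, κ, w)) 2 volume ∧
      ∫ η, ‖H (η, κ, w)‖ ^ 2 ≤ A * (C₂ ^ 2 * I) := fun κ w => by
    have h1 := hconv _ (hgm w κ).1
    have h2 : ∀ η, H (η, κ, w) = ∫ ζ, v (-(η - ζ)) * (v (κ - ζ) * m₂ w ζ) := fun η => by
      simp only [hH, neg_sub]; congr 1; funext ζ; ring
    simp only [h2]
    exact ⟨h1.1, h1.2.trans (mul_le_mul_of_nonneg_left (hgm w κ).2 hA)⟩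
  -- a power of `weight κ` makes the right factor square integrable in `κ`; the rapid decay of `Ψ`
  -- lets `m₁` compensate for it in the left factor
  set k : Rd d × (Rd d × Ω) → ℂ := fun p =>
    m₁ p.2.2 p.1 * Ψ (p.1 - p.2.1) * (weight p.2.1 : ℂ)⁻¹ with hk
  set l : Rd d × (Rd d × Ω) → ℂ := fun p => weight p.2.1 * m₃ p.2.2 p.1 * H p with hl
  have hkm : Measurable k :=
    ((h₁.measurable.comp (g := Function.uncurry m₁) (f := fun p : Rd d × (Rd d × Ω) =>
      (p.2.2, p.1)) (by fun_prop)).mul (hΨm.comp (by fun_prop))).mul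
      (Complex.measurable_ofReal.comp (hwm.comp (by fun_prop))).inv
  have hlm : Measurable l :=
    ((Complex.measurable_ofReal.comp (hwm.comp (by fun_prop))).mul
      (h₃.measurable.comp (g := Function.uncurry m₃) (f := fun p : Rd d × (Rd d × Ω) =>
      (p.2.2, p.1)) (by fun_prop))).mul hHm
  have hlb : ∀ η κ w, ‖l (η, κ, w)‖ ≤ weight κ * C₃ * ‖H (η, κ, w)‖ := fun η κ w => by
    simp only [hl, norm_mul, Complex.norm_real, Real.norm_of_nonneg (weight_pos κ).le]
    have := weight_pos κ
    gcongr
    exact hb₃ w η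
  refine ⟨Rd d × Ω, inferInstance, inferInstance, volume.prod μ, inferInstance, k, l, hkm, hlm,
    ?_, ?_, fun ξ η => ?_⟩
  · refine memLp_two_of_norm_le μ hkm (memLp_two_mul_sub' (f := fun ζ => C₁ * CΨ * weight ζ)
      (g := weight) ?_ integrable_weight_sq) fun ξ κ w => ?_
    · simpa only [mul_pow] using integrable_weight_sq.const_mul _
    · simp only [hk, norm_mul, norm_inv, Complex.norm_real, Real.norm_of_nonneg (weight_pos κ).le]
      have := weight_pos ξ
      calc ‖m₁ w ξ‖ * ‖Ψ (ξ - κ)‖ * (weight κ)⁻¹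
          ≤ C₁ * weight ξ ^ 2 * ‖Ψ (ξ - κ)‖ * ((weight ξ)⁻¹ * (1 + ‖ξ - κ‖) ^ (d + 1)) := by
            have := weight_pos κ
            gcongr
            · exact hb₁ w ξ
            · exact weight_mul_le ξ κ
        _ = C₁ * weight ξ * (‖Ψ (ξ - κ)‖ * (1 + ‖ξ - κ‖) ^ (d + 1)) := by
            field_simp
        _ ≤ C₁ * weight ξ * (CΨ * weight (ξ - κ)) := by
            exact mul_le_mul_of_nonneg_left (hΨw (ξ - κ)) (by positivity)
        _ = _ := by ring
  · rw [memLp_two_iff_integrable_sq_norm hlm.aestronglyMeasurable, integrable_prod_iff'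
      (hlm.norm.pow_const 2).aestronglyMeasurable]
    have hle : ∀ η κ w, ‖l (η, κ, w)‖ ^ 2 ≤ (weight κ * C₃) ^ 2 * ‖H (η, κ, w)‖ ^ 2 :=
      fun η κ w => by
        rw [← mul_pow]; exact pow_le_pow_left₀ (norm_nonneg _) (hlb η κ w) 2
    have hHsq : ∀ κ w, Integrable fun η => ‖H (η, κ, w)‖ ^ 2 := fun κ w =>
      (memLp_two_iff_integrable_sq_norm (hHi κ w).1.1).1 (hHi κ w).1
    have hli : ∀ κ w, Integrable fun η => ‖l (η, κ, w)‖ ^ 2 := fun κ w =>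
      ((hHsq κ w).const_mul _).mono' ((hlm.comp measurable_prodMk_right).norm.pow_const
        2).aestronglyMeasurable (Filter.Eventually.of_forall fun η => by
          rw [Real.norm_of_nonneg (by positivity)]; exact hle η κ w)
    refine ⟨Filter.Eventually.of_forall fun p => hli p.1 p.2, ?_⟩
    refine Integrable.mono' ((integrable_weight_sq.const_mul (C₃ ^ 2 * (A * (C₂ ^ 2 * I)))).comp_fst
      μ) (hlm.norm.pow_const 2).norm.stronglyMeasurable.integral_prod_left'.aestronglyMeasurable
      (Filter.Eventually.of_forall fun p => ?_)
    rw [Real.norm_of_nonneg (integral_nonneg fun η => norm_nonneg _)]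
    calc ∫ η, ‖‖l (η, p)‖ ^ 2‖ = ∫ η, ‖l (η, p.1, p.2)‖ ^ 2 := by
          congr 1; funext η; rw [Real.norm_of_nonneg (by positivity)]
      _ ≤ ∫ η, (weight p.1 * C₃) ^ 2 * ‖H (η, p.1, p.2)‖ ^ 2 :=
          integral_mono (hli _ _) ((hHsq _ _).const_mul _) fun η => hle η p.1 p.2
      _ ≤ (weight p.1 * C₃) ^ 2 * (A * (C₂ ^ 2 * I)) := by
          rw [integral_const_mul]
          exact mul_le_mul_of_nonneg_left (hHi _ _).2 (by positivity)
      _ = _ := by ring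
  · have h1 : ∀ p : Rd d × Ω, k (ξ, p) * l (η, p) =
        m₁ p.2 ξ * m₃ p.2 η * (Ψ (ξ - p.1) * H (η, p)) := fun p => by
      simp only [hk, hl]
      field_simp [hw0 p.1]
    simp only [h1]
    rw [integral_prod_symm, sandwich]
    · congr 1; funext w
      change _ = ∫ κ, m₁ w ξ * m₃ w η * (Ψ (ξ - κ) * H (η, κ, w))
      rw [integral_const_mul]
      congr 1
      -- the insertion of the cutoff
      have h2 : ∀ ζ, v (ξ - ζ) = ∫ κ, Ψ (ξ - κ) * v (κ - ζ) := fun ζ => by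
        rw [hΨ, ← integral_sub_right_eq_self (fun κ => Ψ (ξ - ζ - κ) * v κ) ζ]
        congr 1; funext κ
        rw [sub_sub, add_sub_cancel]
      simp only [hH, h2, ← integral_mul_const, ← integral_const_mul]
      rw [integral_integral_swap]
      · congr 1; funext κ
        congr 1; funext ζ
        ring
      · have hm : Measurable (Function.uncurry fun ζ κ =>
            Ψ (ξ - κ) * v (κ - ζ) * v (ζ - η) * m₂ w ζ) :=
          (((hΨm.comp (by fun_prop)).mul (hvm.comp (by fun_prop))).mul
            (hvm.comp (by fun_prop))).mul ((h₂.measurable.comp measurable_prodMk_left).comp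
              measurable_fst)
        rw [integrable_prod_iff' hm.aestronglyMeasurable]
        have h3 : ∀ κ, Integrable fun ζ => Ψ (ξ - κ) * v (κ - ζ) * v (ζ - η) * m₂ w ζ := fun κ => by
          refine (((hgm w κ).1.integrable_mul (hv.memLp_comp_sub_right η)).const_mul
            (Ψ (ξ - κ))).congr (Filter.Eventually.of_forall fun ζ => ?_)
          simp only [Pi.mul_apply]; ring
        refine ⟨Filter.Eventually.of_forall h3, ?_⟩
        refine Integrable.mono' ((hΨi.comp_sub_left ξ).norm.mul_const (C₂ * I))
          hm.norm.stronglyMeasurable.integral_prod_left'.aestronglyMeasurable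
          (Filter.Eventually.of_forall fun κ => ?_)
        rw [Real.norm_of_nonneg (integral_nonneg fun η => norm_nonneg _)]
        simp only [Function.uncurry, norm_mul, mul_assoc]
        rw [integral_const_mul]
        refine mul_le_mul_of_nonneg_left ?_ (norm_nonneg _)
        have e1 : (∫ ζ, ‖v (κ - ζ)‖ * (‖v (ζ - η)‖ * ‖m₂ w ζ‖)) ≤
            ∫ ζ, (C₂ / 2) * (‖v (κ - ζ)‖ ^ 2 + ‖v (ζ - η)‖ ^ 2) := by
          refine integral_mono_of_nonneg (Filter.Eventually.of_forall fun ζ => by positivity)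
            (((hv.integrable_sq.comp_sub_left κ).add
              (hv.integrable_sq.comp_sub_right η)).const_mul _)
            (Filter.Eventually.of_forall fun ζ => ?_)
          have e2 : ‖v (κ - ζ)‖ * (‖v (ζ - η)‖ * ‖m₂ w ζ‖) ≤
              ‖v (κ - ζ)‖ * (‖v (ζ - η)‖ * C₂) := by gcongr; exact hb₂ w ζ
          have e3 := mul_nonneg hC₂ (sq_nonneg (‖v (κ - ζ)‖ - ‖v (ζ - η)‖))
          simp only
          nlinarith
        refine e1.trans (le_of_eq ?_)
        rw [integral_const_mul, integral_add (hv.integrable_sq.comp_sub_left κ)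
          (hv.integrable_sq.comp_sub_right η), integral_sub_left_eq_self (fun ζ => ‖v ζ‖ ^ 2),
          integral_sub_right_eq_self (fun ζ => ‖v ζ‖ ^ 2)]
        ring
    · refine Integrable.mono' (((hΨi.comp_sub_left ξ).norm.const_mul (C₁ * C₃ * (C₂ * I))).comp_fst
        μ) ?_ (Filter.Eventually.of_forall fun p => ?_)
      · simp only [← h1]
        exact ((hkm.comp measurable_prodMk_left).mul
          (hlm.comp measurable_prodMk_left)).aestronglyMeasurable
      · have hw1 : weight ξ ^ 2 ≤ 1 := pow_le_one₀ (weight_pos _).le (weight_le_one _)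
        have hm1 : ‖m₁ p.2 ξ‖ ≤ C₁ := (hb₁ p.2 ξ).trans (mul_le_of_le_one_right hC₁ hw1)
        rw [norm_mul, norm_mul, norm_mul]
        calc ‖m₁ p.2 ξ‖ * ‖m₃ p.2 η‖ * (‖Ψ (ξ - p.1)‖ * ‖H (η, p)‖)
            ≤ C₁ * C₃ * (‖Ψ (ξ - p.1)‖ * (C₂ * I)) := by
              gcongr
              · exact hb₃ _ _
              · exact hHb η p.1 p.2
          _ = _ := by ring

/-- If the last symbol decays, the transposed kernel is one whose first symbol decays. -/
theorem isFactorable_sandwich_right (hv : IsPotentialTransform v) (h₁ : IsBddSymbol m₁)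
    (h₂ : IsBddSymbol m₂) (h₃ : IsDecayingSymbol m₃) :
    IsFactorable (sandwich v μ m₁ m₂ m₃) := by
  have := (hv.comp_neg.isFactorable_sandwich_left (μ := μ) h₃ h₂ h₁).swap
  refine (?_ : sandwich v μ m₁ m₂ m₃ = _) ▸ this
  funext ξ η
  exact sandwich_swap v μ m₁ m₂ m₃ ξ η

end IsPotentialTransform

end NuclearKernel

/-! ### The scalar wave equation -/

section ScalarWave

/-- `sin(t a) / a`, the solution of `y'' + a² y = 0`, `y(0) = 0`, `y'(0) = 1`. -/
def sinProp (a t : ℝ) : ℝ := t * Real.sinc (t * a)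

theorem sinProp_of_ne {a : ℝ} (ha : a ≠ 0) (t : ℝ) : sinProp a t = Real.sin (t * a) / a := by
  unfold sinProp
  by_cases ht : t = 0
  · simp [ht]
  · rw [Real.sinc_of_ne_zero (mul_ne_zero ht ha)]
    field_simp

theorem sinProp_zero_left (t : ℝ) : sinProp 0 t = t := by simp [sinProp]

theorem sinProp_zero (a : ℝ) : sinProp a 0 = 0 := by simp [sinProp]

theorem mul_sinProp (a t : ℝ) : a * sinProp a t = Real.sin (t * a) := by
  by_cases ha : a = 0
  · simp [ha]
  · rw [sinProp_of_ne ha]; field_simp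

theorem hasDerivAt_sinProp (a t : ℝ) : HasDerivAt (sinProp a) (Real.cos (t * a)) t := by
  by_cases ha : a = 0
  · subst ha
    rw [show sinProp 0 = id from funext sinProp_zero_left]
    simpa using hasDerivAt_id t
  · have h1 : HasDerivAt (fun t => Real.sin (t * a) / a) (Real.cos (t * a) * a / a) t := by
      have := ((Real.hasDerivAt_sin (t * a)).comp t ((hasDerivAt_id t).mul_const a)).div_const a
      simpa using this
    rw [mul_div_cancel_right₀ _ ha] at h1
    exact (funext (sinProp_of_ne ha) : sinProp a = _) ▸ h1

theorem hasDerivAt_cosProp (a t : ℝ) :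
    HasDerivAt (fun t => Real.cos (t * a)) (-(a ^ 2 * sinProp a t)) t := by
  have := (Real.hasDerivAt_cos (t * a)).comp t ((hasDerivAt_id t).mul_const a)
  refine this.congr_deriv ?_
  rw [sq, mul_assoc, mul_sinProp]
  simp [mul_comm]

theorem sinProp_sub (a t s : ℝ) :
    sinProp a (t - s) = sinProp a t * Real.cos (s * a) - Real.cos (t * a) * sinProp a s := by
  by_cases ha : a = 0
  · simp [ha, sinProp_zero_left]
  · simp only [sinProp_of_ne ha, sub_mul, Real.sin_sub]
    ring

theorem cos_sub_eq (a t s : ℝ) :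
    Real.cos ((t - s) * a) =
      Real.cos (t * a) * Real.cos (s * a) + a ^ 2 * sinProp a t * sinProp a s := by
  rw [sub_mul, Real.cos_sub, ← mul_sinProp, ← mul_sinProp]
  ring

theorem cos_sq_add (a t : ℝ) : Real.cos (t * a) ^ 2 + a ^ 2 * sinProp a t ^ 2 = 1 := by
  rw [← mul_pow, mul_sinProp, Real.cos_sq_add_sin_sq]

theorem sinProp_neg (a t : ℝ) : sinProp a (-t) = -sinProp a t := by
  simp [sinProp]

theorem continuous_sinProp : Continuous fun p : ℝ × ℝ => sinProp p.1 p.2 :=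
  continuous_snd.mul (Real.continuous_sinc.comp (continuous_snd.mul continuous_fst))

@[fun_prop]
theorem continuous_sinProp_right (a : ℝ) : Continuous (sinProp a) :=
  continuous_sinProp.comp (by fun_prop : Continuous fun t : ℝ => (a, t))

theorem abs_sinProp_le (a t : ℝ) : |sinProp a t| ≤ |t| := by
  rw [sinProp, abs_mul]
  exact mul_le_of_le_one_right (abs_nonneg _) (Real.abs_sinc_le_one _)

/-- The convolution `∫₀ᵗ p(t - s) f(s) ds`. -/
def volterra (p f : ℝ → ℝ) (t : ℝ) : ℝ := ∫ s in (0 : ℝ)..t, p (t - s) * f s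

theorem volterra_eq_unit (p f : ℝ → ℝ) (t : ℝ) :
    volterra p f t = ∫ σ in (0 : ℝ)..1, t * (p (t * (1 - σ)) * f (t * σ)) := by
  have := intervalIntegral.mul_integral_comp_mul_left (a := 0) (b := 1)
    (f := fun s => p (t - s) * f s) t
  rw [mul_zero, mul_one] at this
  rw [volterra, ← this, ← intervalIntegral.integral_const_mul]
  simp only [mul_sub, mul_one]

theorem volterra_zero (p f : ℝ → ℝ) : volterra p f 0 = 0 := by simp [volterra]

theorem volterra_neg {p f : ℝ → ℝ} {e₁ e₂ : ℝ} (hp : ∀ t, p (-t) = e₁ * p t)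
    (hf : ∀ t, f (-t) = e₂ * f t) (t : ℝ) :
    volterra p f (-t) = -(e₁ * e₂) * volterra p f t := by
  rw [volterra_eq_unit, volterra_eq_unit, ← intervalIntegral.integral_const_mul]
  congr 1; funext σ
  rw [neg_mul t (1 - σ), neg_mul t σ, hp, hf]
  ring

theorem continuous_volterra {p f : ℝ → ℝ} (hp : Continuous p) (hf : Continuous f) :
    Continuous (volterra p f) := by
  have h : volterra p f = fun t => ∫ σ in (0 : ℝ)..1, t * (p (t * (1 - σ)) * f (t * σ)) :=
    funext (volterra_eq_unit p f)
  rw [h]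
  exact intervalIntegral.continuous_parametric_intervalIntegral_of_continuous' (by fun_prop) _ _

variable {f : ℝ → ℝ} (a : ℝ)

theorem hasDerivAt_volterra_sin (hf : Continuous f) (t : ℝ) :
    HasDerivAt (volterra (sinProp a) f) (volterra (fun t => Real.cos (t * a)) f t) t := by
  have h1 : Continuous fun s => Real.cos (s * a) * f s := by fun_prop
  have h2 : Continuous fun s => sinProp a s * f s := by fun_prop
  have e1 : volterra (sinProp a) f = fun t =>
      sinProp a t * (∫ s in (0 : ℝ)..t, Real.cos (s * a) * f s)
      - Real.cos (t * a) * ∫ s in (0 : ℝ)..t, sinProp a s * f s := by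
    funext t
    rw [volterra, ← intervalIntegral.integral_const_mul, ← intervalIntegral.integral_const_mul,
      ← intervalIntegral.integral_sub ((h1.const_mul _).intervalIntegrable _ _)
      ((h2.const_mul _).intervalIntegrable _ _)]
    congr 1; funext s
    rw [sinProp_sub]; ring
  have e2 : volterra (fun t => Real.cos (t * a)) f t =
      Real.cos (t * a) * (∫ s in (0 : ℝ)..t, Real.cos (s * a) * f s)
      + a ^ 2 * sinProp a t * ∫ s in (0 : ℝ)..t, sinProp a s * f s := by
    rw [volterra, ← intervalIntegral.integral_const_mul, ← intervalIntegral.integral_const_mul,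
      ← intervalIntegral.integral_add ((h1.const_mul _).intervalIntegrable _ _)
      ((h2.const_mul _).intervalIntegrable _ _)]
    congr 1; funext s
    rw [cos_sub_eq]; ring
  rw [e1, e2]
  refine (((hasDerivAt_sinProp a t).mul (h1.integral_hasStrictDerivAt 0 t).hasDerivAt).sub
    ((hasDerivAt_cosProp a t).mul (h2.integral_hasStrictDerivAt 0 t).hasDerivAt)).congr_deriv ?_
  ring

theorem hasDerivAt_volterra_cos (hf : Continuous f) (t : ℝ) :
    HasDerivAt (volterra (fun t => Real.cos (t * a)) f)
      (f t - a ^ 2 * volterra (sinProp a) f t) t := by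
  have h1 : Continuous fun s => Real.cos (s * a) * f s := by fun_prop
  have h2 : Continuous fun s => sinProp a s * f s := by fun_prop
  have e1 : volterra (sinProp a) f t = sinProp a t * (∫ s in (0 : ℝ)..t, Real.cos (s * a) * f s)
      - Real.cos (t * a) * ∫ s in (0 : ℝ)..t, sinProp a s * f s := by
    rw [volterra, ← intervalIntegral.integral_const_mul, ← intervalIntegral.integral_const_mul,
      ← intervalIntegral.integral_sub ((h1.const_mul _).intervalIntegrable _ _)
      ((h2.const_mul _).intervalIntegrable _ _)]
    congr 1; funext s
    rw [sinProp_sub]; ring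
  have e2 : volterra (fun t => Real.cos (t * a)) f = fun t =>
      Real.cos (t * a) * (∫ s in (0 : ℝ)..t, Real.cos (s * a) * f s)
      + a ^ 2 * sinProp a t * ∫ s in (0 : ℝ)..t, sinProp a s * f s := by
    funext t
    rw [volterra, ← intervalIntegral.integral_const_mul, ← intervalIntegral.integral_const_mul,
      ← intervalIntegral.integral_add ((h1.const_mul _).intervalIntegrable _ _)
      ((h2.const_mul _).intervalIntegrable _ _)]
    congr 1; funext s
    rw [cos_sub_eq]; ring
  rw [e1, e2]
  refine (((hasDerivAt_cosProp a t).mul (h1.integral_hasStrictDerivAt 0 t).hasDerivAt).add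
    (((hasDerivAt_sinProp a t).const_mul (a ^ 2)).mul
      (h2.integral_hasStrictDerivAt 0 t).hasDerivAt)).congr_deriv ?_
  linear_combination f t * cos_sq_add a t

/-- Uniqueness for the scalar wave equation, by conservation of the energy `z'² + a² z²`. -/
theorem eq_zero_of_wave {a : ℝ} {z z' : ℝ → ℝ} (h : ∀ t, HasDerivAt z (z' t) t)
    (h' : ∀ t, HasDerivAt z' (-(a ^ 2 * z t)) t) (h0 : z 0 = 0) (h0' : z' 0 = 0) (t : ℝ) :
    z t = 0 ∧ z' t = 0 := by
  have hE : ∀ t, HasDerivAt (fun t => z' t ^ 2 + a ^ 2 * z t ^ 2) 0 t := fun t => by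
    refine (((h' t).pow 2).add (((h t).pow 2).const_mul (a ^ 2))).congr_deriv ?_
    simp; ring
  have hE' : ∀ t, z' t ^ 2 + a ^ 2 * z t ^ 2 = 0 := fun t => by
    have := is_const_of_deriv_eq_zero (fun t => (hE t).differentiableAt)
      (fun t => (hE t).deriv) t 0
    simpa [h0, h0'] using this
  have hz' : ∀ t, z' t = 0 := fun t => by
    have := hE' t
    have h1 : z' t ^ 2 = 0 := by nlinarith [sq_nonneg (z' t), sq_nonneg (a * z t)]
    exact pow_eq_zero_iff two_ne_zero |>.1 h1
  refine ⟨?_, hz' t⟩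
  have := is_const_of_deriv_eq_zero (fun t => (h t).differentiableAt)
    (fun t => by rw [(h t).deriv, hz']) t 0
  rw [this, h0]

/-- The solution of `z'' + a² z = f` with vanishing initial data, and its derivative, are given by
Duhamel's formula. -/
theorem eq_volterra_of_wave {a : ℝ} (hf : Continuous f) {z z' : ℝ → ℝ}
    (h : ∀ t, HasDerivAt z (z' t) t)
    (h' : ∀ t, HasDerivAt z' (f t - a ^ 2 * z t) t) (h0 : z 0 = 0) (h0' : z' 0 = 0) (t : ℝ) :
    z t = volterra (sinProp a) f t ∧ z' t = volterra (fun t => Real.cos (t * a)) f t := by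
  have := eq_zero_of_wave (a := a) (fun t => (h t).sub (hasDerivAt_volterra_sin a hf t))
    (fun t => ((h' t).sub (hasDerivAt_volterra_cos a hf t)).congr_deriv (by
      simp only [Pi.sub_apply]; ring))
    (by simp [h0, volterra_zero]) (by simp [h0', volterra_zero]) t
  exact ⟨sub_eq_zero.1 this.1, sub_eq_zero.1 this.2⟩

/-- A derivative may be moved from the propagator to the source. -/
theorem volterra_cos_eq (hf : Continuous f) {f' : ℝ → ℝ} (hf' : Continuous f')
    (h : ∀ t, HasDerivAt f (f' t) t) (h0 : f 0 = 0) (t : ℝ) :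
    volterra (fun t => Real.cos (t * a)) f t = volterra (sinProp a) f' t :=
  (eq_volterra_of_wave (a := a) hf' (hasDerivAt_volterra_cos a hf)
    (fun t => (((h t).sub ((hasDerivAt_volterra_sin a hf t).const_mul (a ^ 2)))))
    (volterra_zero _ _) (by simp [h0, volterra_zero]) t).1

/-- `∫ φ(t) y(t) dt`. -/
def smear (φ : ℝ → ℂ) (y : ℝ → ℝ) : ℂ := ∫ t, φ t * (y t : ℂ)

theorem smear_of_odd {φ : ℝ → ℂ} (hφ : EvenTest φ) {y : ℝ → ℝ} (hy : ∀ t, y (-t) = -y t) :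
    smear φ y = 0 := by
  have h : smear φ y = -smear φ y := by
    conv_lhs => rw [smear, ← integral_neg_eq_self]
    rw [smear, ← integral_neg]
    congr 1; funext t
    rw [hφ.even, hy]; push_cast; ring
  exact self_eq_neg.1 h

/-- The wave equation satisfied by `z`, integrated against a test function. -/
theorem smear_volterra_sin {φ : ℝ → ℂ} (hφ : EvenTest φ) (hf : Continuous f) :
    (1 + (a : ℂ) ^ 2) * smear φ (volterra (sinProp a) f) =
      smear (fun t => φ t - deriv (deriv φ) t) (volterra (sinProp a) f) + smear φ f := by
  set z := volterra (sinProp a) f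
  set z' := volterra (fun t => Real.cos (t * a)) f
  have hz : Continuous z := continuous_volterra (by fun_prop) hf
  have hz' : Continuous z' := continuous_volterra (by fun_prop) hf
  have hzc : Continuous fun t => (z t : ℂ) := by fun_prop
  have hfc : Continuous fun t => (f t : ℂ) := by fun_prop
  have d1 : ∀ t, HasDerivAt (fun t => (z t : ℂ)) (z' t : ℂ) t := fun t =>
    (hasDerivAt_volterra_sin a hf t).ofReal_comp
  have d2 : ∀ t, HasDerivAt (fun t => (z' t : ℂ)) ((f t : ℂ) - a ^ 2 * z t) t := fun t => by
    have := (hasDerivAt_volterra_cos a hf t).ofReal_comp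
    push_cast at this
    exact this
  have p1 := EvenTest.integral_deriv_mul hφ.smooth_deriv hφ.supp.deriv d1 (by fun_prop)
  have p2 := EvenTest.integral_deriv_mul hφ.smooth hφ.supp d2 (by fun_prop)
  have i1 := hφ.integrable_mul hzc
  have i2 := hφ.integrable_mul hfc
  have e1 : smear (fun t => φ t - deriv (deriv φ) t) z =
      smear φ z - ∫ t, deriv (deriv φ) t * (z t : ℂ) := by
    rw [smear, smear, ← integral_sub i1 (hφ.deriv_deriv.integrable_mul hzc)]
    congr 1; funext t; ring
  have e2 : ∫ t, φ t * ((f t : ℂ) - a ^ 2 * z t) = smear φ f - (a : ℂ) ^ 2 * smear φ z := by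
    rw [smear, smear, ← integral_const_mul, ← integral_sub i2 (i1.const_mul _)]
    congr 1; funext t; ring
  rw [e1, p1, p2, e2]
  ring

/-- The wave equation satisfied by the cosine, integrated against a test function. -/
theorem smear_cos {φ : ℝ → ℂ} (hφ : EvenTest φ) (c : ℝ) :
    (1 + (c : ℂ) ^ 2) * smear φ (fun t => Real.cos (t * c)) =
      smear (fun t => φ t - deriv (deriv φ) t) fun t => Real.cos (t * c) :=
  hφ.cosTransform_mul c

/-- The first Duhamel term is the divided difference of the propagators. -/
theorem volterra_sin_cos {a b : ℝ} (hab : a ^ 2 ≠ b ^ 2) (t : ℝ) :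
    volterra (sinProp b) (fun t => Real.cos (t * a)) t =
      (Real.cos (t * a) - Real.cos (t * b)) / (b ^ 2 - a ^ 2) := by
  have hne : b ^ 2 - a ^ 2 ≠ 0 := sub_ne_zero.2 hab.symm
  refine (eq_volterra_of_wave (a := b) (by fun_prop) (z := fun t =>
    (Real.cos (t * a) - Real.cos (t * b)) / (b ^ 2 - a ^ 2)) (z' := fun t =>
    (-(a ^ 2 * sinProp a t) - -(b ^ 2 * sinProp b t)) / (b ^ 2 - a ^ 2))
    (fun t => ((hasDerivAt_cosProp a t).sub (hasDerivAt_cosProp b t)).div_const _)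
    (fun t => (((((hasDerivAt_sinProp a t).const_mul (a ^ 2)).neg).sub
      (((hasDerivAt_sinProp b t).const_mul (b ^ 2)).neg)).div_const _).congr_deriv ?_) (by simp)
    (by simp [sinProp_zero]) t).1.symm
  field_simp
  ring

theorem hasDerivAt_mul_sinProp (a t : ℝ) :
    HasDerivAt (fun t => t * sinProp a t) (sinProp a t + t * Real.cos (t * a)) t :=
  ((hasDerivAt_id t).mul (hasDerivAt_sinProp a t)).congr_deriv (by simp)

/-- The second Duhamel term when the outgoing and the incoming frequency agree. -/
theorem volterra_sin_sin_cos {a b : ℝ} (hab : a ^ 2 ≠ b ^ 2) (t : ℝ) :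
    volterra (sinProp a) (volterra (sinProp b) fun t => Real.cos (t * a)) t =
      (t * sinProp a t / 2 - (Real.cos (t * a) - Real.cos (t * b)) / (b ^ 2 - a ^ 2))
        / (b ^ 2 - a ^ 2) := by
  have hne : b ^ 2 - a ^ 2 ≠ 0 := sub_ne_zero.2 hab.symm
  have hf : (volterra (sinProp b) fun t => Real.cos (t * a)) = fun t =>
      (Real.cos (t * a) - Real.cos (t * b)) / (b ^ 2 - a ^ 2) := funext (volterra_sin_cos hab)
  rw [hf]
  refine (eq_volterra_of_wave (a := a) (by fun_prop) (z := fun t =>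
    (t * sinProp a t / 2 - (Real.cos (t * a) - Real.cos (t * b)) / (b ^ 2 - a ^ 2))
        / (b ^ 2 - a ^ 2)) (z' := fun t =>
    ((sinProp a t + t * Real.cos (t * a)) / 2 -
      (-(a ^ 2 * sinProp a t) - -(b ^ 2 * sinProp b t)) / (b ^ 2 - a ^ 2)) / (b ^ 2 - a ^ 2))
    (fun t => (((hasDerivAt_mul_sinProp a t).div_const 2).sub
      (((hasDerivAt_cosProp a t).sub (hasDerivAt_cosProp b t)).div_const _)).div_const _)
    (fun t => ((((((hasDerivAt_sinProp a t).add ((hasDerivAt_id t).mul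
      (hasDerivAt_cosProp a t))).div_const 2).sub
      (((((hasDerivAt_sinProp a t).const_mul (a ^ 2)).neg).sub
      (((hasDerivAt_sinProp b t).const_mul (b ^ 2)).neg)).div_const _)).div_const _)).congr_deriv ?_)
    (by simp) (by simp [sinProp_zero]) t).1.symm
  simp only [id]
  field_simp
  ring

/-- The symmetrized second Duhamel term is a divided difference. -/
theorem volterra_symm {a b : ℝ} (hab : a ^ 2 ≠ b ^ 2) (t : ℝ) :
    volterra (sinProp a) (volterra (sinProp b) fun t => Real.cos (t * a)) t +
      volterra (sinProp b) (volterra (sinProp a) fun t => Real.cos (t * b)) t =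
    (t * sinProp a t - t * sinProp b t) / 2 / (b ^ 2 - a ^ 2) := by
  have hne : b ^ 2 - a ^ 2 ≠ 0 := sub_ne_zero.2 hab.symm
  have hne' : a ^ 2 - b ^ 2 ≠ 0 := sub_ne_zero.2 hab
  rw [volterra_sin_sin_cos hab, volterra_sin_sin_cos hab.symm]
  rw [← neg_sub (b ^ 2) (a ^ 2)]
  field_simp
  ring

end ScalarWave

/-! ### Trace class estimates for the smeared symbols -/

section WaveSymbol

/-- The symbol of the second Duhamel term between frequencies `a`, `b` and `c`. -/
def duhamelSymbol (φ : ℝ → ℂ) (a b c : ℝ) : ℂ :=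
  smear φ (volterra (sinProp a) (volterra (sinProp b) fun t => Real.cos (t * c)))

/-- The wave equation in the outgoing variable; the lower order term is the first Duhamel term. -/
theorem duhamelSymbol_wave {φ : ℝ → ℂ} (hφ : EvenTest φ) (a b c : ℝ) :
    (1 + (a : ℂ) ^ 2) * duhamelSymbol φ a b c =
      duhamelSymbol (fun t => φ t - deriv (deriv φ) t) a b c +
        smear φ (volterra (sinProp b) fun t => Real.cos (t * c)) :=
  smear_volterra_sin a hφ (continuous_volterra (by fun_prop) (by fun_prop))

/-- Projection onto `[-R, R]`. It makes the symbols bounded for all values of the parameters without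
changing them on the domain of integration. -/
def clip (R t : ℝ) : ℝ := max (-R) (min R t)

theorem continuous_clip (R : ℝ) : Continuous (clip R) := by unfold clip; fun_prop

theorem abs_clip_le {R : ℝ} (hR : 0 ≤ R) (t : ℝ) : |clip R t| ≤ R := by
  unfold clip
  exact abs_le.2 ⟨le_max_left _ _, max_le (by linarith) (min_le_left _ _)⟩

theorem clip_of_mem {R t : ℝ} (ht : t ∈ Icc (-R) R) : clip R t = t := by
  unfold clip
  rw [min_eq_right ht.2, max_eq_right ht.1]

theorem EvenTest.smear_eq {χ : ℝ → ℂ} {R : ℝ} (hR : ∀ t, R ≤ |t| → χ t = 0)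
    (y : ℝ → ℝ) : smear χ y = ∫ t in Icc (-R) R, χ t * (y t : ℂ) := by
  rw [smear, setIntegral_eq_integral_of_forall_compl_eq_zero]
  intro t ht
  rw [hR t ?_, zero_mul]
  by_contra hlt
  exact ht (abs_le.1 (not_le.1 hlt).le)

/-- Lebesgue measure on `[-R, R]`. -/
abbrev boxMeasure (R : ℝ) : Measure ℝ := volume.restrict (Icc (-R) R)

/-- Lebesgue measure on `[0, 1]`. -/
abbrev unitMeasure : Measure ℝ := volume.restrict (Icc (0 : ℝ) 1)

theorem volterra_eq_unitMeasure (p f : ℝ → ℝ) (t : ℝ) :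
    volterra p f t = ∫ σ, t * (p (t * (1 - σ)) * f (t * σ)) ∂unitMeasure := by
  rw [volterra_eq_unit, intervalIntegral.integral_of_le zero_le_one, integral_Icc_eq_integral_Ioc]

theorem integrable_box_prod {R : ℝ} {g : ℝ × ℝ → ℂ} (hg : Continuous g) :
    Integrable g ((boxMeasure R).prod unitMeasure) := by
  rw [Measure.prod_restrict]
  exact hg.continuousOn.integrableOn_compact (isCompact_Icc.prod isCompact_Icc)

theorem integrable_box_prod_prod {R : ℝ} {g : ℝ × ℝ × ℝ → ℂ} (hg : Continuous g) :
    Integrable g ((boxMeasure R).prod (unitMeasure.prod unitMeasure)) := by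
  rw [Measure.prod_restrict, Measure.prod_restrict]
  exact hg.continuousOn.integrableOn_compact
    (isCompact_Icc.prod (isCompact_Icc.prod isCompact_Icc))

theorem smear_volterra_eq {χ : ℝ → ℂ} (hχ : Continuous χ) {R : ℝ} (hR : ∀ t, R ≤ |t| → χ t = 0)
    {q r : ℝ → ℝ} (hq : Continuous q) (hr : Continuous r) :
    smear χ (volterra q r) = ∫ w : ℝ × ℝ, χ w.1 * ((w.1 * q (w.1 * (1 - w.2)) : ℝ) : ℂ) *
      (r (w.1 * w.2) : ℂ) ∂((boxMeasure R).prod unitMeasure) := by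
  rw [EvenTest.smear_eq hR, integral_prod _ (integrable_box_prod (by fun_prop))]
  congr 1; funext t
  rw [volterra_eq_unitMeasure, ← integral_complex_ofReal, ← integral_const_mul]
  congr 1; funext σ
  push_cast; ring

/-- The smeared iterated convolution as an integral of products over a box. -/
theorem smear_volterra_volterra_eq {χ : ℝ → ℂ} (hχ : Continuous χ) {R : ℝ}
    (hR : ∀ t, R ≤ |t| → χ t = 0) {p q r : ℝ → ℝ} (hp : Continuous p) (hq : Continuous q)
    (hr : Continuous r) :
    smear χ (volterra p (volterra q r)) = ∫ w : ℝ × ℝ × ℝ,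
      χ w.1 * ((w.1 * p (w.1 * (1 - w.2.1)) : ℝ) : ℂ) *
        (((w.1 * w.2.1) * q (w.1 * w.2.1 * (1 - w.2.2)) : ℝ) : ℂ) *
      (r (w.1 * w.2.1 * w.2.2) : ℂ) ∂((boxMeasure R).prod (unitMeasure.prod unitMeasure)) := by
  have hc : Continuous fun w : ℝ × ℝ × ℝ => χ w.1 * ((w.1 * p (w.1 * (1 - w.2.1)) : ℝ) : ℂ) *
        (((w.1 * w.2.1) * q (w.1 * w.2.1 * (1 - w.2.2)) : ℝ) : ℂ) *
      (r (w.1 * w.2.1 * w.2.2) : ℂ) := by fun_prop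
  rw [EvenTest.smear_eq hR, integral_prod _ (integrable_box_prod_prod hc)]
  congr 1; funext t
  have hc' : Continuous fun z : ℝ × ℝ => χ t * ((t * p (t * (1 - z.1)) : ℝ) : ℂ) *
        (((t * z.1) * q (t * z.1 * (1 - z.2)) : ℝ) : ℂ) * (r (t * z.1 * z.2) : ℂ) := by fun_prop
  have hi : Integrable (fun z : ℝ × ℝ => χ t * ((t * p (t * (1 - z.1)) : ℝ) : ℂ) *
        (((t * z.1) * q (t * z.1 * (1 - z.2)) : ℝ) : ℂ) * (r (t * z.1 * z.2) : ℂ))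
        (unitMeasure.prod unitMeasure) := by
    rw [Measure.prod_restrict]
    exact hc'.continuousOn.integrableOn_compact (isCompact_Icc.prod isCompact_Icc)
  rw [integral_prod _ hi, volterra_eq_unitMeasure, ← integral_complex_ofReal, ← integral_const_mul]
  congr 1; funext ρ
  rw [volterra_eq_unitMeasure]
  push_cast
  rw [← integral_complex_ofReal, ← integral_const_mul, ← integral_const_mul, ← integral_const_mul]
  congr 1; funext σ
  push_cast; ring

variable {d : ℕ}

/-- The kernel with symbol `M`, on the Fourier side. -/
def symKernel (v : Rd d → ℂ) (M : Rd d → Rd d → Rd d → ℂ) (ξ η : Rd d) : ℂ :=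
  ∫ ζ, v (ξ - ζ) * v (ζ - η) * M ξ ζ η

/-- The kernel with symbol `M` is nuclear. -/
def IsNuclearSymbol (v : Rd d → ℂ) (M : Rd d → Rd d → Rd d → ℂ) : Prop :=
  (∀ ξ η, Integrable fun ζ => v (ξ - ζ) * v (ζ - η) * M ξ ζ η) ∧ IsNuclearKernel (symKernel v M)

theorem IsNuclearSymbol.add {v : Rd d → ℂ} {M N : Rd d → Rd d → Rd d → ℂ}
    (hM : IsNuclearSymbol v M) (hN : IsNuclearSymbol v N) :
    IsNuclearSymbol v fun ξ ζ η => M ξ ζ η + N ξ ζ η := by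
  refine ⟨fun ξ η => ?_, ?_⟩
  · simp only [mul_add]
    exact (hM.1 ξ η).add (hN.1 ξ η)
  · have h : symKernel v (fun ξ ζ η => M ξ ζ η + N ξ ζ η) =
        fun ξ η => symKernel v M ξ η + symKernel v N ξ η := by
      funext ξ η
      simp only [symKernel, mul_add]
      exact integral_add (hM.1 ξ η) (hN.1 ξ η)
    rw [h]
    exact hM.2.add hN.2

theorem IsNuclearSymbol.congr {v : Rd d → ℂ} {M N : Rd d → Rd d → Rd d → ℂ}
    (hM : IsNuclearSymbol v M) (h : ∀ ξ ζ η, N ξ ζ η = M ξ ζ η) : IsNuclearSymbol v N := by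
  have : N = M := by funext ξ ζ η; exact h ξ ζ η
  rwa [this]

variable {Ω : Type} [MeasurableSpace Ω] {m m₁ m₂ m₃ : Ω → Rd d → ℂ}

/-- Integrals of products of bounded symbols are symbols of sandwiches. -/
theorem IsPotentialTransform.symKernel_eq {v : Rd d → ℂ} (hv : IsPotentialTransform v)
    {μ : Measure Ω} [IsFiniteMeasure μ] (h₁ : IsBddSymbol m₁) (h₂ : IsBddSymbol m₂)
    (h₃ : IsBddSymbol m₃) {M : Rd d → Rd d → Rd d → ℂ}
    (hM : ∀ ξ ζ η, M ξ ζ η = ∫ w, m₁ w ξ * m₂ w ζ * m₃ w η ∂μ) :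
    (∀ ξ η, Integrable fun ζ => v (ξ - ζ) * v (ζ - η) * M ξ ζ η) ∧
      symKernel v M = sandwich v μ m₁ m₂ m₃ := by
  obtain ⟨C₁, hC₁, hb₁⟩ := h₁.bound
  obtain ⟨C₂, hC₂, hb₂⟩ := h₂.bound
  obtain ⟨C₃, hC₃, hb₃⟩ := h₃.bound
  have hvm := hv.continuous.measurable
  have hint : ∀ ξ η, Integrable (Function.uncurry fun (ζ : Rd d) w =>
      v (ξ - ζ) * v (ζ - η) * (m₁ w ξ * m₂ w ζ * m₃ w η)) (volume.prod μ) := fun ξ η => by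
    refine Integrable.mono' (((hv.integrable_mul ξ η).norm.mul_const (C₁ * C₂ * C₃)).comp_fst μ)
      (Measurable.aestronglyMeasurable ?_) (Filter.Eventually.of_forall fun p => ?_)
    · exact (((hvm.comp (by fun_prop)).mul (hvm.comp (by fun_prop)))).mul
        ((((h₁.measurable.comp measurable_prodMk_right).comp measurable_snd).mul
          (h₂.measurable.comp measurable_swap)).mul
          ((h₃.measurable.comp measurable_prodMk_right).comp measurable_snd))
    · simp only [Function.uncurry]
      rw [norm_mul, norm_mul (m₁ _ _ * _), norm_mul (m₁ _ _)]
      gcongr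
      · exact hb₁ _ _
      · exact hb₂ _ _
      · exact hb₃ _ _
  refine ⟨fun ξ η => ?_, ?_⟩
  · have := (hint ξ η).integral_prod_left
    refine this.congr (Filter.Eventually.of_forall fun ζ => ?_)
    simp only [Function.uncurry, hM]
    rw [integral_const_mul]
  · funext ξ η
    simp only [symKernel, hM, sandwich, ← integral_const_mul]
    rw [integral_integral_swap (hint ξ η)]
    congr 1; funext w
    congr 1; funext ζ
    ring

/-- A bounded measurable function. -/
structure IsBddFun (w : Rd d → ℂ) : Prop where
  measurable : Measurable w
  bound : ∃ C : ℝ, 0 ≤ C ∧ ∀ ξ, ‖w ξ‖ ≤ C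

theorem IsBddFun.isBddSymbol {w : Rd d → ℂ} (h : IsBddFun w) :
    IsBddSymbol fun (_ : Ω) => w :=
  ⟨h.measurable.comp measurable_snd, let ⟨C, hC, hb⟩ := h.bound; ⟨C, hC, fun _ => hb⟩⟩

theorem IsBddFun.mul {w w' : Rd d → ℂ} (h : IsBddFun w) (h' : IsBddFun w') :
    IsBddFun fun ξ => w ξ * w' ξ := by
  obtain ⟨C, hC, hb⟩ := h.bound
  obtain ⟨C', hC', hb'⟩ := h'.bound
  refine ⟨h.measurable.mul h'.measurable, C * C', by positivity, fun ξ => ?_⟩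
  rw [norm_mul]
  exact mul_le_mul (hb ξ) (hb' ξ) (norm_nonneg _) hC

theorem IsBddSymbol.mul (h : IsBddSymbol m₁) (h' : IsBddSymbol m₂) :
    IsBddSymbol fun w ξ => m₁ w ξ * m₂ w ξ := by
  obtain ⟨C, hC, hb⟩ := h.bound
  obtain ⟨C', hC', hb'⟩ := h'.bound
  refine ⟨h.measurable.mul h'.measurable, C * C', by positivity, fun w ξ => ?_⟩
  rw [norm_mul]
  exact mul_le_mul (hb w ξ) (hb' w ξ) (norm_nonneg _) hC

/-- The symbol of the resolvent `(1 + |D|²)⁻¹`. -/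
def resolvent (ξ : Rd d) : ℂ := (1 + (freq ξ : ℂ) ^ 2)⁻¹

theorem one_add_freq_sq_ne_zero (ξ : Rd d) : (1 + (freq ξ : ℂ) ^ 2) ≠ 0 := by
  have : (0 : ℝ) < 1 + freq ξ ^ 2 := by positivity
  exact_mod_cast this.ne'

theorem resolvent_mul (ξ : Rd d) : resolvent ξ * (1 + (freq ξ : ℂ) ^ 2) = 1 :=
  inv_mul_cancel₀ (one_add_freq_sq_ne_zero ξ)

theorem norm_resolvent (ξ : Rd d) : ‖resolvent ξ‖ = (1 + freq ξ ^ 2)⁻¹ := by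
  have h : resolvent ξ = (((1 + freq ξ ^ 2)⁻¹ : ℝ) : ℂ) := by simp [resolvent]
  rw [h, Complex.norm_real, Real.norm_of_nonneg (by positivity)]

theorem measurable_resolvent : Measurable (resolvent : Rd d → ℂ) := by
  have := (continuous_freq (d := d)).measurable
  unfold resolvent
  fun_prop

theorem isBddFun_resolvent_pow (n : ℕ) : IsBddFun fun ξ : Rd d => resolvent ξ ^ n := by
  refine ⟨measurable_resolvent.pow_const n, 1, zero_le_one, fun ξ => ?_⟩
  rw [norm_pow, norm_resolvent]
  exact pow_le_one₀ (by positivity) (inv_le_one_of_one_le₀ (by nlinarith [sq_nonneg (freq ξ)]))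

theorem norm_resolvent_pow_le (ξ : Rd d) :
    ‖resolvent ξ ^ (d + 1)‖ ≤ 2 ^ (d + 1) * weight ξ ^ 2 := by
  have h0 : weight ξ ^ 2 = (((1 + ‖ξ‖) ^ 2)⁻¹) ^ (d + 1) := by
    rw [weight, ← inv_pow, ← inv_pow, ← pow_mul, ← pow_mul, mul_comm]
  rw [norm_pow, norm_resolvent, h0, ← mul_pow]
  refine pow_le_pow_left₀ (by positivity) ?_ _
  rw [← div_eq_mul_inv, inv_le_comm₀ (by positivity) (by positivity), inv_div,
    div_le_iff₀ (by norm_num)]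
  have h1 : ‖ξ‖ ≤ freq ξ := by
    unfold freq
    nlinarith [Real.pi_gt_three, norm_nonneg ξ]
  nlinarith [norm_nonneg ξ, sq_nonneg (‖ξ‖ - 1), pow_le_pow_left₀ (norm_nonneg ξ) h1 2]

theorem IsBddSymbol.mul_resolvent (h : IsBddSymbol m) :
    IsDecayingSymbol fun w ξ => resolvent ξ ^ (d + 1) * m w ξ := by
  obtain ⟨C, hC, hb⟩ := h.bound
  refine ⟨(measurable_resolvent.pow_const _).comp measurable_snd |>.mul h.measurable,
    2 ^ (d + 1) * C, by positivity, fun w ξ => ?_⟩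
  rw [norm_mul]
  calc _ ≤ 2 ^ (d + 1) * weight ξ ^ 2 * C :=
        mul_le_mul (norm_resolvent_pow_le ξ) (hb w ξ) (norm_nonneg _) (by positivity)
    _ = _ := by ring

theorem isBddSymbol_of_continuous {g : Ω → ℝ} (hg : Measurable g) {F : ℝ → ℝ → ℝ}
    (hF : Continuous (Function.uncurry F)) {C : ℝ} (hC : 0 ≤ C) (hb : ∀ w a, |F (g w) a| ≤ C) :
    IsBddSymbol fun (w : Ω) (ξ : Rd d) => (F (g w) (freq ξ) : ℂ) := by
  refine ⟨Complex.measurable_ofReal.comp (hF.measurable.comp ((hg.comp measurable_fst).prodMk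
    (continuous_freq.measurable.comp measurable_snd))), C, hC, fun w ξ => ?_⟩
  rw [Complex.norm_real]
  exact hb w _

theorem isBddSymbol_cos {g : Ω → ℝ} (hg : Measurable g) :
    IsBddSymbol fun (w : Ω) (ξ : Rd d) => (Real.cos (g w * freq ξ) : ℂ) :=
  isBddSymbol_of_continuous hg (F := fun t a => Real.cos (t * a)) (by fun_prop) zero_le_one
    fun w a => Real.abs_cos_le_one _

theorem isBddSymbol_sin {g : Ω → ℝ} (hg : Measurable g) {C : ℝ} (hC : 0 ≤ C)
    (hb : ∀ w, |g w| ≤ C) :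
    IsBddSymbol fun (w : Ω) (ξ : Rd d) => (sinProp (freq ξ) (g w) : ℂ) :=
  isBddSymbol_of_continuous hg (F := fun t a => sinProp a t)
    (continuous_sinProp.comp continuous_swap) hC
    fun w a => (abs_sinProp_le a _).trans (hb w)

theorem isBddSymbol_const {g : Ω → ℂ} (hg : Measurable g) {C : ℝ} (hC : 0 ≤ C)
    (hb : ∀ w, ‖g w‖ ≤ C) : IsBddSymbol fun (w : Ω) (_ : Rd d) => g w :=
  ⟨hg.comp measurable_fst, C, hC, fun w _ => hb w⟩

theorem EvenTest.exists_norm_le {χ : ℝ → ℂ} (h : EvenTest χ) : ∃ C : ℝ, 0 ≤ C ∧ ∀ t, ‖χ t‖ ≤ C := by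
  obtain ⟨C, hC⟩ := h.continuous.bounded_above_of_compact_support h.supp
  exact ⟨C, (norm_nonneg _).trans (hC 0), hC⟩

/-- `(1 - ∂²)ⁿ χ`. -/
def dualPow (n : ℕ) (χ : ℝ → ℂ) : ℝ → ℂ := (fun χ t => χ t - deriv (deriv χ) t)^[n] χ

theorem EvenTest.dualPow {χ : ℝ → ℂ} (h : EvenTest χ) (n : ℕ) : EvenTest (dualPow n χ) := by
  induction n with
  | zero => exact h
  | succ n ih =>
    rw [WaveTrace.dualPow, Function.iterate_succ_apply']
    exact ih.sub_deriv_deriv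

/-- Smearing in time gives decay of any order in the frequency of the free propagator. -/
theorem smear_cos_eq_resolvent {χ : ℝ → ℂ} (h : EvenTest χ) (n : ℕ) (η : Rd d) :
    smear χ (fun t => Real.cos (t * freq η)) =
      resolvent η ^ n * smear (dualPow n χ) fun t => Real.cos (t * freq η) := by
  induction n with
  | zero => simp [dualPow]
  | succ n ih =>
    have h1 : dualPow (n + 1) χ = fun t => dualPow n χ t - deriv (deriv (dualPow n χ)) t := by
      rw [dualPow, Function.iterate_succ_apply']; rfl
    rw [ih, h1, ← smear_cos (h.dualPow n), pow_succ, mul_assoc, ← mul_assoc (resolvent η),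
      resolvent_mul, one_mul]

variable {v w₁ w₂ w₃ : Rd d → ℂ} {χ : ℝ → ℂ}

/-- When no convolution is left, the smeared propagator decays in the last variable. -/
theorem isNuclearSymbol_cos (hv : IsPotentialTransform v) (h : EvenTest χ) (h₁ : IsBddFun w₁)
    (h₂ : IsBddFun w₂) (h₃ : IsBddFun w₃) :
    IsNuclearSymbol v fun ξ ζ η => w₁ ξ * w₂ ζ * w₃ η * smear χ fun t => Real.cos (t * freq η) := by
  obtain ⟨C, hC, hb⟩ := (h.dualPow (d + 1)).exists_norm_le
  obtain ⟨R, hR, hs⟩ := (h.dualPow (d + 1)).exists_bound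
  have b₃ : IsBddSymbol fun (t : ℝ) η => w₃ η * (dualPow (d + 1) χ t * Real.cos (t * freq η)) :=
    h₃.isBddSymbol.mul ((isBddSymbol_const (h.dualPow _).continuous.measurable hC hb).mul
      (isBddSymbol_cos measurable_id))
  have hM := hv.symKernel_eq (μ := boxMeasure R) h₁.isBddSymbol h₂.isBddSymbol
    b₃.mul_resolvent.isBddSymbol (M := fun ξ ζ η => w₁ ξ * w₂ ζ * w₃ η *
      smear χ fun t => Real.cos (t * freq η)) fun ξ ζ η => by
      rw [smear_cos_eq_resolvent h (d + 1), EvenTest.smear_eq hs, ← integral_const_mul,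
        ← integral_const_mul]
      congr 1; funext t; ring
  refine ⟨hM.1, ?_⟩
  rw [hM.2]
  exact (hv.isFactorable_sandwich_right h₁.isBddSymbol h₂.isBddSymbol
    b₃.mul_resolvent).isNuclearKernel

/-- The first Duhamel term in the variables `(ζ, η)`, multiplied by `n` resolvents in `ζ`. The wave
equation produces a further resolvent, up to a term without convolution; once `d + 1` of them are
present, the middle symbol decays. -/
theorem isNuclearSymbol_sin_cos_aux (hv : IsPotentialTransform v) (h₁ : IsBddFun w₁)
    (h₂ : IsBddFun w₂) (h₃ : IsBddFun w₃)
    (n k : ℕ) (hn : n + k = d + 1) : ∀ {χ : ℝ → ℂ}, EvenTest χ →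
    IsNuclearSymbol v fun ξ ζ η => w₁ ξ * (resolvent ζ ^ n * w₂ ζ) * w₃ η *
      smear χ (volterra (sinProp (freq ζ)) fun t => Real.cos (t * freq η)) := by
  induction k generalizing n with
  | zero =>
    intro χ h
    rw [add_zero] at hn
    subst hn
    obtain ⟨C, hC, hb⟩ := h.exists_norm_le
    obtain ⟨R, hR, hs⟩ := h.exists_bound
    have hcl : Measurable (clip R) := (continuous_clip R).measurable
    have hcl1 : Measurable (clip 1) := (continuous_clip 1).measurable
    have b₁ : IsBddSymbol fun (x : ℝ × ℝ) ξ => w₁ ξ * (χ x.1 * (clip R x.1 : ℂ)) :=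
      h₁.isBddSymbol.mul ((isBddSymbol_const (h.continuous.measurable.comp measurable_fst) hC
        fun x => hb _).mul (isBddSymbol_const (by fun_prop) hR.le fun x => by
          rw [Complex.norm_real]; exact abs_clip_le hR.le _))
    have b₂ : IsBddSymbol fun (x : ℝ × ℝ) ζ => w₂ ζ *
        (sinProp (freq ζ) (clip R x.1 * (1 - clip 1 x.2)) : ℂ) :=
      h₂.isBddSymbol.mul (isBddSymbol_sin (by fun_prop) (C := R * 2) (by positivity) fun x => by
        rw [abs_mul]
        refine mul_le_mul (abs_clip_le hR.le _) ?_ (abs_nonneg _) hR.le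
        have := abs_le.1 (abs_clip_le zero_le_one x.2)
        exact abs_le.2 ⟨by linarith, by linarith⟩)
    have b₃ : IsBddSymbol fun (x : ℝ × ℝ) η => w₃ η * (Real.cos (x.1 * x.2 * freq η) : ℂ) :=
      h₃.isBddSymbol.mul (isBddSymbol_cos (by fun_prop))
    have hM := hv.symKernel_eq (μ := (boxMeasure R).prod unitMeasure) b₁
      b₂.mul_resolvent.isBddSymbol b₃ (M := fun ξ ζ η => w₁ ξ * (resolvent ζ ^ (d + 1) * w₂ ζ) *
        w₃ η * smear χ (volterra (sinProp (freq ζ)) fun t => Real.cos (t * freq η)))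
      fun ξ ζ η => by
        rw [smear_volterra_eq h.continuous hs (by fun_prop) (by fun_prop), ← integral_const_mul]
        refine integral_congr_ae ?_
        have hmem : ∀ᵐ x ∂((boxMeasure R).prod unitMeasure), x ∈ Icc (-R) R ×ˢ Icc (0 : ℝ) 1 := by
          rw [Measure.prod_restrict]
          exact ae_restrict_mem (measurableSet_Icc.prod measurableSet_Icc)
        filter_upwards [hmem] with x hx
        rw [clip_of_mem hx.1, clip_of_mem ⟨by linarith [hx.2.1], hx.2.2⟩]
        push_cast; ring
    refine ⟨hM.1, ?_⟩
    rw [hM.2]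
    exact (hv.isFactorable_sandwich_middle b₁ b₂.mul_resolvent b₃).isNuclearKernel
  | succ k ih =>
    intro χ h
    have h1 := ih (n + 1) (by omega) h.sub_deriv_deriv
    have h2 := isNuclearSymbol_cos hv h h₁ ((isBddFun_resolvent_pow (n + 1)).mul h₂) h₃
    -- the wave equation, multiplied by one more resolvent in `ζ`
    refine (h1.add h2).congr fun ξ ζ η => ?_
    rw [← mul_add, ← smear_volterra_sin _ h (by fun_prop), pow_succ]
    linear_combination (-(w₁ ξ * resolvent ζ ^ n * w₂ ζ * w₃ η *
      smear χ (volterra (sinProp (freq ζ)) fun t => Real.cos (t * freq η)))) * resolvent_mul ζ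

theorem isNuclearSymbol_sin_cos (hv : IsPotentialTransform v) (h : EvenTest χ)
    (h₁ : IsBddFun w₁) (h₂ : IsBddFun w₂)
    (h₃ : IsBddFun w₃) :
    IsNuclearSymbol v fun ξ ζ η => w₁ ξ * w₂ ζ * w₃ η *
      smear χ (volterra (sinProp (freq ζ)) fun t => Real.cos (t * freq η)) := by
  simpa using isNuclearSymbol_sin_cos_aux hv h₁ h₂ h₃ 0 (d + 1) (by omega) h

/-- The second Duhamel term multiplied by `n` resolvents in `ξ`. The wave equation produces a
further resolvent, up to a first Duhamel term; once `d + 1` of them are present, the first symbol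
decays. -/
theorem isNuclearSymbol_duhamel_aux (hv : IsPotentialTransform v) (h₁ : IsBddFun w₁)
    (h₂ : IsBddFun w₂) (h₃ : IsBddFun w₃)
    (n k : ℕ) (hn : n + k = d + 1) : ∀ {χ : ℝ → ℂ}, EvenTest χ →
    IsNuclearSymbol v fun ξ ζ η => (resolvent ξ ^ n * w₁ ξ) * w₂ ζ * w₃ η *
      duhamelSymbol χ (freq ξ) (freq ζ) (freq η) := by
  induction k generalizing n with
  | zero =>
    intro χ h
    rw [add_zero] at hn
    subst hn
    obtain ⟨C, hC, hb⟩ := h.exists_norm_le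
    obtain ⟨R, hR, hs⟩ := h.exists_bound
    have hcl : Measurable (clip R) := (continuous_clip R).measurable
    have hcl1 : Measurable (clip 1) := (continuous_clip 1).measurable
    have hone : ∀ t, |1 - clip 1 t| ≤ 2 := fun t => by
      have := abs_le.1 (abs_clip_le zero_le_one t)
      exact abs_le.2 ⟨by linarith, by linarith⟩
    have b₁ : IsBddSymbol fun (x : ℝ × ℝ × ℝ) ξ => w₁ ξ *
        (sinProp (freq ξ) (clip R x.1 * (1 - clip 1 x.2.1)) : ℂ) :=
      h₁.isBddSymbol.mul (isBddSymbol_sin (by fun_prop) (C := R * 2) (by positivity) fun x => by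
        rw [abs_mul]
        exact mul_le_mul (abs_clip_le hR.le _) (hone _) (abs_nonneg _) hR.le)
    have b₂ : IsBddSymbol fun (x : ℝ × ℝ × ℝ) ζ => w₂ ζ *
        (sinProp (freq ζ) (clip R x.1 * clip 1 x.2.1 * (1 - clip 1 x.2.2)) : ℂ) :=
      h₂.isBddSymbol.mul (isBddSymbol_sin (by fun_prop) (C := R * 1 * 2) (by positivity)
        fun x => by
          rw [abs_mul, abs_mul]
          exact mul_le_mul (mul_le_mul (abs_clip_le hR.le _) (abs_clip_le zero_le_one _)
            (abs_nonneg _) hR.le) (hone _) (abs_nonneg _) (by positivity))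
    have b₃ : IsBddSymbol fun (x : ℝ × ℝ × ℝ) η =>
        w₃ η * (χ x.1 * (clip R x.1 : ℂ) * ((clip R x.1 * clip 1 x.2.1 : ℝ) : ℂ) *
          (Real.cos (x.1 * x.2.1 * x.2.2 * freq η) : ℂ)) :=
      h₃.isBddSymbol.mul ((((isBddSymbol_const (h.continuous.measurable.comp measurable_fst) hC
        fun x => hb _).mul (isBddSymbol_const (by fun_prop) hR.le fun x => by
          rw [Complex.norm_real]; exact abs_clip_le hR.le _)).mul
        (isBddSymbol_const (by fun_prop) (C := R * 1) (by positivity) fun x => by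
          rw [Complex.norm_real, Real.norm_eq_abs, abs_mul]
          exact mul_le_mul (abs_clip_le hR.le _) (abs_clip_le zero_le_one _) (abs_nonneg _)
            hR.le)).mul (isBddSymbol_cos (by fun_prop)))
    have hM := hv.symKernel_eq (μ := (boxMeasure R).prod (unitMeasure.prod unitMeasure))
      b₁.mul_resolvent.isBddSymbol b₂ b₃ (M := fun ξ ζ η => (resolvent ξ ^ (d + 1) * w₁ ξ) * w₂ ζ *
        w₃ η * duhamelSymbol χ (freq ξ) (freq ζ) (freq η)) fun ξ ζ η => by
        rw [duhamelSymbol, smear_volterra_volterra_eq h.continuous hs (by fun_prop) (by fun_prop)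
          (by fun_prop), ← integral_const_mul]
        refine integral_congr_ae ?_
        have hmem : ∀ᵐ x ∂((boxMeasure R).prod (unitMeasure.prod unitMeasure)),
            x ∈ Icc (-R) R ×ˢ (Icc (0 : ℝ) 1 ×ˢ Icc (0 : ℝ) 1) := by
          rw [Measure.prod_restrict, Measure.prod_restrict]
          exact ae_restrict_mem (measurableSet_Icc.prod (measurableSet_Icc.prod measurableSet_Icc))
        filter_upwards [hmem] with x hx
        rw [clip_of_mem hx.1, clip_of_mem ⟨by linarith [hx.2.1.1], hx.2.1.2⟩,
          clip_of_mem ⟨by linarith [hx.2.2.1], hx.2.2.2⟩]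
        push_cast; ring
    refine ⟨hM.1, ?_⟩
    rw [hM.2]
    exact (hv.isFactorable_sandwich_left b₁.mul_resolvent b₂ b₃).isNuclearKernel
  | succ k ih =>
    intro χ h
    have h1 := ih (n + 1) (by omega) h.sub_deriv_deriv
    have h2 := isNuclearSymbol_sin_cos hv h ((isBddFun_resolvent_pow (n + 1)).mul h₁) h₂ h₃
    -- the wave equation, multiplied by one more resolvent in `ξ`
    refine (h1.add h2).congr fun ξ ζ η => ?_
    rw [← mul_add, ← duhamelSymbol_wave h, pow_succ]
    linear_combination (-(resolvent ξ ^ n * w₁ ξ * w₂ ζ * w₃ η *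
      duhamelSymbol χ (freq ξ) (freq ζ) (freq η))) * resolvent_mul ξ

/-- The kernel of the second Duhamel term is nuclear. -/
theorem isNuclearSymbol_duhamel (hv : IsPotentialTransform v) (h : EvenTest χ)
    (h₁ : IsBddFun w₁) (h₂ : IsBddFun w₂)
    (h₃ : IsBddFun w₃) :
    IsNuclearSymbol v fun ξ ζ η => w₁ ξ * w₂ ζ * w₃ η *
      duhamelSymbol χ (freq ξ) (freq ζ) (freq η) := by
  simpa using isNuclearSymbol_duhamel_aux hv h₁ h₂ h₃ 0 (d + 1) (by omega) h

/-- The kernel remains nuclear when it is conjugated by `⟨D⟩`. -/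
theorem isNuclearSymbol_duhamel_bracket (hv : IsPotentialTransform v) (h : EvenTest χ) :
    IsNuclearSymbol v fun ξ ζ η => (bracket ξ : ℂ) * (bracket η : ℂ)⁻¹ *
      duhamelSymbol χ (freq ξ) (freq ζ) (freq η) := by
  have hbr : IsBddFun fun ξ : Rd d => (bracket ξ : ℂ)⁻¹ := by
    refine ⟨(Complex.measurable_ofReal.comp continuous_bracket.measurable).inv, 1, zero_le_one,
      fun ξ => ?_⟩
    rw [norm_inv, Complex.norm_real, Real.norm_of_nonneg (by linarith [one_le_bracket ξ])]
    exact inv_le_one_of_one_le₀ (one_le_bracket ξ)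
  have hone : IsBddFun fun _ : Rd d => (1 : ℂ) := ⟨measurable_const, 1, zero_le_one, by simp⟩
  -- `⟨ξ⟩ = ⟨ξ⟩⁻¹ (1 + |ξ|²)`, and the wave equation absorbs the unbounded factor
  refine ((isNuclearSymbol_duhamel hv h.sub_deriv_deriv hbr hone hbr).add
    (isNuclearSymbol_sin_cos hv h hbr hone hbr)).congr fun ξ ζ η => ?_
  have hb : (bracket ξ : ℂ) ^ 2 = 1 + (freq ξ : ℂ) ^ 2 := by
    have : bracket ξ ^ 2 = 1 + freq ξ ^ 2 := Real.sq_sqrt (by positivity)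
    exact_mod_cast this
  have hb0 : (bracket ξ : ℂ) ≠ 0 := by
    exact_mod_cast (lt_of_lt_of_le one_pos (one_le_bracket ξ)).ne'
  rw [← mul_add, ← duhamelSymbol_wave h, ← hb]
  field_simp

end WaveSymbol

/-! ### The Duhamel terms on the Fourier side -/

section Propagator

variable {d : ℕ}

/-- A continuous family of symbols with at most linear growth in time. -/
structure IsPropagator (p : ℝ → Rd d → ℝ) : Prop where
  continuous : Continuous (Function.uncurry p)
  bound : ∀ t ξ, |p t ξ| ≤ 1 + |t|

namespace IsPropagator

variable {p q : ℝ → Rd d → ℝ}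

theorem continuous_right (h : IsPropagator p) (t : ℝ) : Continuous (p t) :=
  h.continuous.comp (by fun_prop : Continuous fun ξ : Rd d => (t, ξ))

theorem memLp (h : IsPropagator p) (t : ℝ) (f : L2 d) :
    MemLp (fun ξ => (p t ξ : ℂ) * f ξ) 2 volume :=
  memLp_mul_of_bdd (h.continuous_right t) _ (h.bound t) f

/-- The operator of multiplication by `p(t, ·)`. -/
def op (h : IsPropagator p) (t : ℝ) : L2 d →L[ℂ] L2 d :=
  LinearMap.mkContinuous
    { toFun := fun f => (h.memLp t f).toLp _
      map_add' := fun f g => by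
        rw [← MemLp.toLp_add]
        refine (MemLp.toLp_eq_toLp_iff _ _).2 ?_
        filter_upwards [Lp.coeFn_add f g] with ξ hξ
        rw [hξ, Pi.add_apply, Pi.add_apply, mul_add]
      map_smul' := fun c f => by
        rw [RingHom.id_apply, ← MemLp.toLp_const_smul]
        refine (MemLp.toLp_eq_toLp_iff _ _).2 ?_
        filter_upwards [Lp.coeFn_smul c f] with ξ hξ
        rw [hξ, Pi.smul_apply, Pi.smul_apply, smul_eq_mul, smul_eq_mul, mul_left_comm] }
    (1 + |t|) fun f => by
      refine Lp.norm_le_mul_norm_of_ae_le_mul ?_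
      change ∀ᵐ ξ, ‖((h.memLp t f).toLp _ : L2 d) ξ‖ ≤ _
      filter_upwards [(h.memLp t f).coeFn_toLp] with ξ hξ
      rw [hξ, norm_mul, Complex.norm_real]
      exact mul_le_mul_of_nonneg_right (h.bound t ξ) (norm_nonneg _)

theorem coeFn_op (h : IsPropagator p) (t : ℝ) (f : L2 d) :
    (h.op t f : Rd d → ℂ) =ᵐ[volume] fun ξ => (p t ξ : ℂ) * f ξ :=
  (h.memLp t f).coeFn_toLp

theorem norm_op_le (h : IsPropagator p) (t : ℝ) (f : L2 d) : ‖h.op t f‖ ≤ (1 + |t|) * ‖f‖ :=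
  (h.op t).le_of_opNorm_le (LinearMap.mkContinuous_norm_le _ (by positivity) _) f

/-- Strong continuity, by dominated convergence on the Fourier side. -/
theorem continuous_op_apply (h : IsPropagator p) (f : L2 d) : Continuous fun t => h.op t f := by
  refine continuous_iff_continuousAt.2 fun t₀ => ?_
  have hn : ∀ t, ‖h.op t f - h.op t₀ f‖ ^ 2 = ∫ ξ, (p t ξ - p t₀ ξ) ^ 2 * ‖f ξ‖ ^ 2 := fun t => by
    rw [norm_sq_eq_integral]
    refine integral_congr_ae ?_
    filter_upwards [Lp.coeFn_sub (h.op t f) (h.op t₀ f), h.coeFn_op t f, h.coeFn_op t₀ f]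
      with ξ h1 h2 h3
    rw [h1, Pi.sub_apply, h2, h3, ← sub_mul, norm_mul, mul_pow, ← Complex.ofReal_sub,
      Complex.norm_real, Real.norm_eq_abs, sq_abs]
  have hf2 := (memLp_two_iff_integrable_sq_norm (Lp.memLp f).1).1 (Lp.memLp f)
  have hlim : Filter.Tendsto (fun t => ‖h.op t f - h.op t₀ f‖ ^ 2) (𝓝 t₀) (𝓝 0) := by
    simp only [hn]
    have h0 : (0 : ℝ) = ∫ ξ, (p t₀ ξ - p t₀ ξ) ^ 2 * ‖f ξ‖ ^ 2 := by simp
    rw [h0]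
    refine tendsto_integral_filter_of_dominated_convergence
      (fun ξ => (3 + 2 * |t₀|) ^ 2 * ‖f ξ‖ ^ 2) ?_ ?_ (hf2.const_mul _) ?_
    · refine Filter.Eventually.of_forall fun t => ?_
      exact (((h.continuous_right t).sub (h.continuous_right t₀)).pow 2).aestronglyMeasurable.mul
        hf2.1
    · filter_upwards [Metric.ball_mem_nhds t₀ one_pos] with t ht
      refine Filter.Eventually.of_forall fun ξ => ?_
      rw [Real.norm_of_nonneg (by positivity)]
      refine mul_le_mul_of_nonneg_right ?_ (by positivity)
      rw [← sq_abs]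
      refine pow_le_pow_left₀ (abs_nonneg _) ?_ 2
      have h1 : |t| ≤ |t₀| + 1 := by
        have := abs_sub_abs_le_abs_sub t t₀
        rw [Metric.mem_ball, Real.dist_eq] at ht
        linarith
      calc |p t ξ - p t₀ ξ| ≤ |p t ξ| + |p t₀ ξ| := abs_sub _ _
        _ ≤ (1 + |t|) + (1 + |t₀|) := add_le_add (h.bound _ _) (h.bound _ _)
        _ ≤ _ := by linarith
    · refine Filter.Eventually.of_forall fun ξ => ?_
      have : Continuous fun t => (p t ξ - p t₀ ξ) ^ 2 * ‖f ξ‖ ^ 2 := by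
        have := h.continuous.comp (by fun_prop : Continuous fun t : ℝ => (t, ξ))
        exact ((this.sub continuous_const).pow 2).mul continuous_const
      exact this.tendsto t₀
  rw [ContinuousAt, tendsto_iff_norm_sub_tendsto_zero]
  have := (Real.continuous_sqrt.tendsto 0).comp hlim
  simpa [Function.comp_def, Real.sqrt_sq] using this

theorem continuous_op (h : IsPropagator p) : Continuous fun x : ℝ × L2 d => h.op x.1 x.2 := by
  refine continuous_iff_continuousAt.2 fun x₀ => ?_
  have h1 : Filter.Tendsto (fun x : ℝ × L2 d => (1 + |x.1|) * ‖x.2 - x₀.2‖) (𝓝 x₀) (𝓝 0) := by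
    have : Continuous fun x : ℝ × L2 d => (1 + |x.1|) * ‖x.2 - x₀.2‖ := by fun_prop
    simpa using this.tendsto x₀
  have h2 : Filter.Tendsto (fun x : ℝ × L2 d => h.op x.1 (x.2 - x₀.2)) (𝓝 x₀) (𝓝 0) :=
    squeeze_zero_norm (fun x => h.norm_op_le _ _) h1
  have h3 := h2.add (((h.continuous_op_apply x₀.2).comp continuous_fst).tendsto x₀)
  rw [ContinuousAt]
  simpa [map_sub] using h3

@[fun_prop]
theorem continuous_op_comp {X : Type*} [TopologicalSpace X] (h : IsPropagator p) {g : X → ℝ}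
    {f : X → L2 d} (hg : Continuous g) (hf : Continuous f) :
    Continuous fun x => h.op (g x) (f x) :=
  h.continuous_op.comp (hg.prodMk hf)

end IsPropagator

theorem isPropagator_cos : IsPropagator fun t (ξ : Rd d) => Real.cos (t * freq ξ) where
  continuous := by have := continuous_freq (d := d); fun_prop
  bound t ξ := (Real.abs_cos_le_one _).trans (by linarith [abs_nonneg t])

theorem isPropagator_sin : IsPropagator fun t (ξ : Rd d) => sinProp (freq ξ) t where
  continuous :=
    continuous_sinProp.comp ((continuous_freq.comp continuous_snd).prodMk continuous_fst)
  bound t ξ := (abs_sinProp_le _ _).trans (by linarith)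

theorem bracket_pos (ξ : Rd d) : 0 < bracket ξ := lt_of_lt_of_le one_pos (one_le_bracket ξ)

theorem isPropagator_bracket_sin :
    IsPropagator fun t (ξ : Rd d) => bracket ξ * sinProp (freq ξ) t where
  continuous := (continuous_bracket.comp continuous_snd).mul isPropagator_sin.continuous
  bound t ξ := by
    have h1 : |freq ξ * sinProp (freq ξ) t| ≤ 1 := mul_abs_sinc_le t (freq ξ)
    have h2 := abs_sinProp_le (freq ξ) t
    have hb := bracket_le ξ
    rw [abs_mul, abs_of_nonneg (freq_nonneg ξ)] at h1
    rw [abs_mul, abs_of_nonneg (bracket_pos ξ).le]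
    nlinarith [abs_nonneg (sinProp (freq ξ) t)]

theorem abs_inv_bracket_le (ξ : Rd d) : |(bracket ξ)⁻¹| ≤ 1 := by
  rw [abs_of_nonneg (inv_nonneg.2 (bracket_pos ξ).le)]
  exact inv_le_one_of_one_le₀ (one_le_bracket ξ)

theorem continuous_inv_bracket : Continuous fun ξ : Rd d => (bracket ξ)⁻¹ :=
  continuous_bracket.inv₀ fun ξ => (bracket_pos ξ).ne'

theorem isPropagator_inv_bracket : IsPropagator fun _ (ξ : Rd d) => (bracket ξ)⁻¹ where
  continuous := continuous_inv_bracket.comp continuous_snd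
  bound t ξ := (abs_inv_bracket_le ξ).trans (by linarith [abs_nonneg t])

theorem isPropagator_cos_div :
    IsPropagator fun t (ξ : Rd d) => Real.cos (t * freq ξ) * (bracket ξ)⁻¹ where
  continuous := isPropagator_cos.continuous.mul isPropagator_inv_bracket.continuous
  bound t ξ := by
    rw [abs_mul]
    exact (mul_le_one₀ (Real.abs_cos_le_one _) (abs_nonneg _) (abs_inv_bracket_le ξ)).trans
      (by linarith [abs_nonneg t])

theorem isPropagator_lapSin :
    IsPropagator fun t (ξ : Rd d) => -(freq ξ * Real.sin (t * freq ξ)) * (bracket ξ)⁻¹ where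
  continuous := by
    have := continuous_freq (d := d)
    exact (by fun_prop : Continuous fun x : ℝ × Rd d => -(freq x.2 * Real.sin (x.1 * freq x.2))).mul
      isPropagator_inv_bracket.continuous
  bound t ξ := by
    have h : |-(freq ξ * Real.sin (t * freq ξ)) * (bracket ξ)⁻¹| ≤ 1 := by
      rw [abs_mul, abs_neg, abs_mul, abs_of_nonneg (freq_nonneg ξ),
        abs_of_nonneg (inv_nonneg.2 (bracket_pos ξ).le), ← div_eq_mul_inv,
        div_le_one (bracket_pos ξ)]
      exact (mul_le_of_le_one_right (freq_nonneg ξ) (Real.abs_sin_le_one _)).trans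
        (freq_le_bracket ξ)
    exact h.trans (by linarith [abs_nonneg t])

/-- The unitary map `f ↦ 𝓕 (⟨D⟩ f)` from `H¹` to `L²`. -/
def H1.equiv : H1 d ≃ₗᵢ[ℂ] L2 d :=
  { LinearEquiv.ofBijective H1.weighted ⟨H1.weighted_injective, H1.weighted_surjective⟩ with
    norm_map' := fun _ => rfl }

theorem H1.equiv_apply (f : H1 d) : H1.equiv f = H1.weighted f := rfl

/-- The Fourier transform of `⟨D⟩` applied to the position. -/
def posPart : Energy d →L[ℂ] L2 d :=
  (H1.equiv : H1 d ≃ₗᵢ[ℂ] L2 d).toContinuousLinearEquiv.toContinuousLinearMap ∘L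
    WithLp.fstL 2 ℂ (H1 d) (L2 d)

/-- The Fourier transform of the velocity. -/
def velPart : Energy d →L[ℂ] L2 d :=
  (Lp.fourierTransformₗᵢ (Rd d) ℂ).toContinuousLinearEquiv.toContinuousLinearMap ∘L
    WithLp.sndL 2 ℂ (H1 d) (L2 d)

theorem posPart_apply (u : Energy d) : posPart u = H1.weighted u.fst := rfl

theorem velPart_apply (u : Energy d) : velPart u = 𝓕 u.snd := rfl

/-- The inclusion of positions, the adjoint of `posPart`. -/
def posIncl : L2 d →ₗᵢ[ℂ] Energy d where
  toFun f := WithLp.toLp 2 (H1.equiv.symm f, 0)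
  map_add' f g := by
    rw [map_add, ← WithLp.toLp_add, Prod.mk_add_mk, add_zero]
  map_smul' c f := by
    rw [map_smul, RingHom.id_apply, ← WithLp.toLp_smul, Prod.smul_mk, smul_zero]
  norm_map' f := by
    change ‖WithLp.toLp 2 (H1.equiv.symm f, (0 : L2 d))‖ = ‖f‖
    rw [← sq_eq_sq₀ (norm_nonneg _) (norm_nonneg _), WithLp.prod_norm_sq_eq_of_L2]
    simp

/-- The inclusion of velocities, the adjoint of `velPart`. -/
def velIncl : L2 d →ₗᵢ[ℂ] Energy d where
  toFun f := WithLp.toLp 2 (0, (Lp.fourierTransformₗᵢ (Rd d) ℂ).symm f)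
  map_add' f g := by
    rw [map_add, ← WithLp.toLp_add, Prod.mk_add_mk, add_zero]
  map_smul' c f := by
    rw [map_smul, RingHom.id_apply, ← WithLp.toLp_smul, Prod.smul_mk, smul_zero]
  norm_map' f := by
    change ‖WithLp.toLp 2 ((0 : H1 d), (Lp.fourierTransformₗᵢ (Rd d) ℂ).symm f)‖ = ‖f‖
    rw [← sq_eq_sq₀ (norm_nonneg _) (norm_nonneg _), WithLp.prod_norm_sq_eq_of_L2]
    simp

theorem posIncl_apply (f : L2 d) : posIncl f = WithLp.toLp 2 (H1.equiv.symm f, 0) := rfl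

theorem velIncl_apply (f : L2 d) :
    velIncl f = WithLp.toLp 2 (0, (Lp.fourierTransformₗᵢ (Rd d) ℂ).symm f) := rfl

theorem posPart_posIncl (f : L2 d) : posPart (posIncl f) = f :=
  H1.equiv.apply_symm_apply f

theorem posPart_velIncl (f : L2 d) : posPart (velIncl f) = 0 := by
  rw [posPart_apply, velIncl_apply]
  exact map_zero _

theorem velPart_velIncl (f : L2 d) : velPart (velIncl f) = f :=
  (Lp.fourierTransformₗᵢ (Rd d) ℂ).apply_symm_apply f

theorem velPart_posIncl (f : L2 d) : velPart (posIncl f) = 0 := by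
  rw [velPart_apply, posIncl_apply]
  exact (Lp.fourierTransformₗᵢ (Rd d) ℂ).map_zero

theorem posIncl_add_velIncl (u : Energy d) : posIncl (posPart u) + velIncl (velPart u) = u := by
  rw [posIncl_apply, velIncl_apply, ← WithLp.toLp_add, Prod.mk_add_mk, add_zero, zero_add]
  have h1 : H1.equiv.symm (posPart u) = u.fst := H1.equiv.symm_apply_apply _
  have h2 : (Lp.fourierTransformₗᵢ (Rd d) ℂ).symm (velPart u) = u.snd :=
    (Lp.fourierTransformₗᵢ (Rd d) ℂ).symm_apply_apply _
  rw [h1, h2]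
  rfl

theorem energy_ext {u w : Energy d} (h1 : posPart u = posPart w) (h2 : velPart u = velPart w) :
    u = w := by
  rw [← posIncl_add_velIncl u, ← posIncl_add_velIncl w, h1, h2]

theorem inner_posIncl (f : L2 d) (u : Energy d) :
    inner ℂ (posIncl f) u = inner ℂ f (posPart u) := by
  rw [posIncl_apply, WithLp.prod_inner_apply]
  simp only [inner_zero_left, add_zero]
  have := (H1.equiv (d := d)).inner_map_map (H1.equiv.symm f) u.fst
  rw [LinearIsometryEquiv.apply_symm_apply] at this
  exact this.symm

theorem inner_velIncl (f : L2 d) (u : Energy d) :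
    inner ℂ (velIncl f) u = inner ℂ f (velPart u) := by
  rw [velIncl_apply, WithLp.prod_inner_apply]
  simp only [inner_zero_left, zero_add]
  have := (Lp.fourierTransformₗᵢ (Rd d) ℂ).inner_map_map
    ((Lp.fourierTransformₗᵢ (Rd d) ℂ).symm f) u.snd
  rw [LinearIsometryEquiv.apply_symm_apply] at this
  exact this.symm

theorem fourier_add (f g : L2 d) : (𝓕 (f + g) : L2 d) = 𝓕 f + 𝓕 g :=
  (Lp.fourierTransformₗᵢ (Rd d) ℂ).map_add f g

/-- The Fourier transform of the position, in terms of that of its weighted version. -/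
theorem fourier_toL2_eq (f : H1 d) :
    (𝓕 (H1.toL2 f) : L2 d) = isPropagator_inv_bracket.op 0 (H1.weighted f) := by
  refine Lp.ext ?_
  filter_upwards [isPropagator_inv_bracket.coeFn_op 0 (H1.weighted f), H1.coeFn_weighted f]
    with ξ h1 h2
  have hb : (bracket ξ : ℂ) ≠ 0 := by exact_mod_cast (bracket_pos ξ).ne'
  rw [h1, h2, Complex.ofReal_inv, inv_mul_cancel_left₀ hb]

theorem posPart_freeWave (t : ℝ) (u : Energy d) :
    posPart (freeWave t u) =
      isPropagator_cos.op t (posPart u) + isPropagator_bracket_sin.op t (velPart u) := by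
  have e1 : H1.weighted (cosH1 t u.fst) = isPropagator_cos.op t (posPart u) := by
    refine Lp.ext ?_
    filter_upwards [isPropagator_cos.coeFn_op t (posPart u), H1.coeFn_weighted (cosH1 t u.fst),
      H1.coeFn_weighted u.fst, fourier_multiplier _ _ (memLp_cos t (H1.toL2 u.fst))]
      with ξ h1 h2 h3 h4
    have h5 : H1.toL2 (cosH1 t u.fst) = multiplier (fun ξ => Real.cos (t * freq ξ))
      (H1.toL2 u.fst) (memLp_cos t _) := rfl
    rw [h1, posPart_apply, h2, h3, h5, h4]
    ring
  have e2 : H1.weighted (sinH1 t u.snd) = isPropagator_bracket_sin.op t (velPart u) := by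
    refine Lp.ext ?_
    filter_upwards [isPropagator_bracket_sin.coeFn_op t (velPart u),
      H1.coeFn_weighted (sinH1 t u.snd), fourier_multiplier _ _ (memLp_sin t u.snd)] with ξ h1 h2 h4
    have h5 : H1.toL2 (sinH1 t u.snd) = multiplier (fun ξ => t * Real.sinc (t * freq ξ))
      u.snd (memLp_sin t _) := rfl
    rw [h1, velPart_apply, h2, h5, h4, sinProp]
    push_cast; ring
  rw [← e1, ← e2, ← map_add]
  rfl

theorem velPart_freeWave (t : ℝ) (u : Energy d) :
    velPart (freeWave t u) =
      isPropagator_lapSin.op t (posPart u) + isPropagator_cos.op t (velPart u) := by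
  have e1 : (𝓕 (lapSin t u.fst) : L2 d) = isPropagator_lapSin.op t (posPart u) := by
    refine Lp.ext ?_
    filter_upwards [isPropagator_lapSin.coeFn_op t (posPart u), H1.coeFn_weighted u.fst,
      fourier_multiplier (fun ξ => -(freq ξ * Real.sin (t * freq ξ))) (H1.toL2 u.fst) _]
      with ξ h1 h3 h4
    have hb : (bracket ξ : ℂ) ≠ 0 := by exact_mod_cast (bracket_pos ξ).ne'
    rw [h1, posPart_apply, h3, lapSin, h4]
    push_cast
    field_simp
  have e2 : (𝓕 (cosL2 t u.snd) : L2 d) = isPropagator_cos.op t (velPart u) := by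
    refine Lp.ext ?_
    filter_upwards [isPropagator_cos.coeFn_op t (velPart u),
      fourier_multiplier _ _ (memLp_cos t u.snd)] with ξ h1 h4
    rw [h1, velPart_apply, cosL2, h4]
  rw [← e1, ← e2, ← fourier_add]
  rfl

theorem continuous_freeWave : Continuous fun x : ℝ × Energy d => freeWave x.1 x.2 := by
  have h : (fun x : ℝ × Energy d => freeWave x.1 x.2) = fun x =>
      posIncl (isPropagator_cos.op x.1 (posPart x.2) +
        isPropagator_bracket_sin.op x.1 (velPart x.2)) +
      velIncl (isPropagator_lapSin.op x.1 (posPart x.2) +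
        isPropagator_cos.op x.1 (velPart x.2)) := by
    funext x
    rw [← posPart_freeWave, ← velPart_freeWave, posIncl_add_velIncl]
  rw [h]
  have hp := (posPart (d := d)).continuous
  have hv := (velPart (d := d)).continuous
  have hi := (posIncl (d := d)).continuous
  have hj := (velIncl (d := d)).continuous
  fun_prop

/-- Multiplication by the potential on the Fourier side. -/
def potOp (V : LInfty d) : L2 d →L[ℂ] L2 d :=
  LinearMap.mkContinuous
    { toFun := fun f => 𝓕 (V • (Lp.fourierTransformₗᵢ (Rd d) ℂ).symm f)
      map_add' := fun f g => by rw [map_add, Lp.add_smul, fourier_add]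
      map_smul' := fun c f => by
        rw [map_smul, ← Lp.smul_comm]
        exact (Lp.fourierTransformₗᵢ (Rd d) ℂ).map_smul c _ } ‖V‖ fun f => by
    change ‖(𝓕 (V • (Lp.fourierTransformₗᵢ (Rd d) ℂ).symm f) : L2 d)‖ ≤ _
    rw [Lp.norm_fourier_eq]
    refine (Lp.norm_smul_le _ _).trans ?_
    rw [LinearIsometryEquiv.norm_map]

theorem coeFn_potOp {V : LInfty d} (hV : IsBddCompact (V : Rd d → ℂ)) (f : L2 d) :
    (potOp V f : Rd d → ℂ) =ᵐ[volume] fun ξ => ∫ ζ, 𝓕 (V : Rd d → ℂ) (ξ - ζ) * f ζ := by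
  set g : L2 d := (Lp.fourierTransformₗᵢ (Rd d) ℂ).symm f
  have h1 : (V • g : L2 d) = (hV.memLp_mul (Lp.memLp g)).toLp _ := by
    refine Lp.ext ?_
    filter_upwards [Lp.coeFn_lpSMul (r := 2) V g,
      (hV.memLp_mul (Lp.memLp g)).coeFn_toLp] with x h1 h2
    rw [h1, h2]; rfl
  have h2 : potOp V f = 𝓕 ((hV.memLp_mul (Lp.memLp g)).toLp _) := by
    rw [← h1]; rfl
  have h3 : (𝓕 g : L2 d) = f := (Lp.fourierTransformₗᵢ (Rd d) ℂ).apply_symm_apply f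
  rw [h2]
  refine (hV.coeFn_fourier_mul g).trans (Filter.Eventually.of_forall fun ξ => ?_)
  simp only [h3]

theorem potential_eq (V : LInfty d) (u : Energy d) :
    potential V u = velIncl (potOp V (isPropagator_inv_bracket.op 0 (posPart u))) := by
  rw [posPart_apply, ← fourier_toL2_eq, velIncl_apply, potential]
  congr 2
  have : potOp V (𝓕 (H1.toL2 u.fst)) =
      𝓕 (V • (Lp.fourierTransformₗᵢ (Rd d) ℂ).symm (𝓕 (H1.toL2 u.fst))) := rfl
  have h2 : (Lp.fourierTransformₗᵢ (Rd d) ℂ).symm (𝓕 (H1.toL2 u.fst)) = H1.toL2 u.fst :=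
    (Lp.fourierTransformₗᵢ (Rd d) ℂ).symm_apply_apply _
  rw [this, h2]
  exact ((Lp.fourierTransformₗᵢ (Rd d) ℂ).symm_apply_apply _).symm

theorem continuous_potential (V : LInfty d) : Continuous (potential V) := by
  have h : potential V = fun u =>
    velIncl (potOp V (isPropagator_inv_bracket.op 0 (posPart u))) := funext (potential_eq V)
  rw [h]
  have hp := (posPart (d := d)).continuous
  have hj := (velIncl (d := d)).continuous
  have ho := (potOp V).continuous
  fun_prop

theorem continuous_freeWave_comp {X : Type*} [TopologicalSpace X] {g : X → ℝ} {f : X → Energy d}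
    (hg : Continuous g) (hf : Continuous f) : Continuous fun x => freeWave (g x) (f x) :=
  Continuous.comp (g := fun x : ℝ × Energy d => freeWave x.1 x.2) (f := fun x => (g x, f x))
    continuous_freeWave (hg.prodMk hf)

theorem continuous_duhamel {X : Type*} [TopologicalSpace X] {F : X → ℝ → Energy d}
    (hF : Continuous (Function.uncurry F)) :
    Continuous fun x : X × ℝ => duhamel (F x.1) x.2 := by
  have h1 : Continuous fun y : (X × ℝ) × ℝ => F y.1.1 y.2 :=
    hF.comp (by fun_prop : Continuous fun y : (X × ℝ) × ℝ => (y.1.1, y.2))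
  have h0 : Continuous fun y : (X × ℝ) × ℝ => y.1.2 - y.2 := by fun_prop
  have h2 : Continuous fun y : (X × ℝ) × ℝ => freeWave (y.1.2 - y.2) (F y.1.1 y.2) :=
    continuous_freeWave_comp h0 h1
  exact intervalIntegral.continuous_parametric_intervalIntegral_of_continuous
    (f := fun (x : X × ℝ) (s : ℝ) => freeWave (x.2 - s) (F x.1 s)) h2 continuous_snd

theorem continuous_duhamelTerm (V : LInfty d) (k : ℕ) :
    Continuous fun x : Energy d × ℝ => duhamelTerm V x.1 k x.2 := by
  induction k with
  | zero => exact continuous_freeWave_comp continuous_snd continuous_fst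
  | succ k ih =>
    exact continuous_duhamel (F := fun u s => potential V (duhamelTerm V u k s))
      (Continuous.comp (g := potential V) (f := fun x : Energy d × ℝ => duhamelTerm V x.1 k x.2)
        (continuous_potential V) ih)

theorem continuous_duhamelTerm_right (V : LInfty d) (k : ℕ) (u : Energy d) :
    Continuous (duhamelTerm V u k) :=
  Continuous.comp (g := fun x : Energy d × ℝ => duhamelTerm V x.1 k x.2) (f := fun t : ℝ => (u, t))
    (continuous_duhamelTerm V k) (by fun_prop)

theorem continuous_smearedTerm (V : LInfty d) (k : ℕ) {φ : ℝ → ℂ} (hφ : Continuous φ)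
    (hs : HasCompactSupport φ) : Continuous (smearedTerm V k φ) := by
  obtain ⟨R, hR⟩ := hs.isCompact.isBounded.subset_closedBall (0 : ℝ)
  have h : smearedTerm V k φ = fun u => ∫ t in (-(max R 0))..(max R 0),
      φ t • duhamelTerm V u k t := by
    funext u
    rw [smearedTerm, intervalIntegral.integral_of_le (by linarith [le_max_right R 0]),
      ← integral_Icc_eq_integral_Ioc, setIntegral_eq_integral_of_forall_compl_eq_zero]
    intro t ht
    have : φ t = 0 := by
      by_contra hne
      have := hR (subset_tsupport φ hne)
      rw [Metric.mem_closedBall, dist_zero_right, Real.norm_eq_abs] at this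
      exact ht (abs_le.1 (this.trans (le_max_left _ _)))
    rw [this, zero_smul]
  rw [h]
  refine intervalIntegral.continuous_parametric_intervalIntegral_of_continuous' ?_ _ _
  exact (hφ.comp continuous_snd).smul (continuous_duhamelTerm V k)

end Propagator

/-! ### The integral kernel of the second Duhamel term -/

section DuhamelKernel

variable {d : ℕ}

theorem IsPropagator.op_op {p q r : ℝ → Rd d → ℝ} (hp : IsPropagator p) (hq : IsPropagator q)
    (hr : IsPropagator r) {s t : ℝ} (h : ∀ ξ, p s ξ * q t ξ = r t ξ) (f : L2 d) :
    hp.op s (hq.op t f) = hr.op t f := by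
  refine Lp.ext ?_
  filter_upwards [hp.coeFn_op s (hq.op t f), hq.coeFn_op t f, hr.coeFn_op t f] with ξ h1 h2 h3
  rw [h1, h2, h3, ← h]
  push_cast; ring

/-- The integrand of the second Duhamel term, with outgoing propagator `l` and incoming propagator
`c`. -/
def duhamelVec {l c : ℝ → Rd d → ℝ} (hl : IsPropagator l) (hc : IsPropagator c) (V : LInfty d)
    (f : L2 d) (x : ℝ × ℝ × ℝ) : L2 d :=
  hl.op (x.1 - x.2.1) (potOp V (isPropagator_sin.op (x.2.1 - x.2.2) (potOp V (hc.op x.2.2 f))))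

variable {l c : ℝ → Rd d → ℝ} (hl : IsPropagator l) (hc : IsPropagator c)

theorem continuous_duhamelVec (V : LInfty d) (f : L2 d) : Continuous (duhamelVec hl hc V f) := by
  have ho := (potOp V).continuous
  unfold duhamelVec
  fun_prop

theorem posPart_freeWave_velIncl (t : ℝ) (f : L2 d) :
    posPart (freeWave t (velIncl f)) = isPropagator_bracket_sin.op t f := by
  rw [posPart_freeWave, posPart_velIncl, velPart_velIncl, map_zero, zero_add]

theorem velPart_freeWave_velIncl (t : ℝ) (f : L2 d) :
    velPart (freeWave t (velIncl f)) = isPropagator_cos.op t f := by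
  rw [velPart_freeWave, posPart_velIncl, velPart_velIncl, map_zero, zero_add]

/-- The position of a free wave, to which the potential is applied. -/
theorem inv_bracket_posPart_freeWave (t : ℝ) (u : Energy d) :
    isPropagator_inv_bracket.op 0 (posPart (freeWave t u)) =
      isPropagator_cos_div.op t (posPart u) + isPropagator_sin.op t (velPart u) := by
  rw [posPart_freeWave, map_add,
    isPropagator_inv_bracket.op_op isPropagator_cos isPropagator_cos_div fun ξ => mul_comm _ _,
    isPropagator_inv_bracket.op_op isPropagator_bracket_sin isPropagator_sin fun ξ =>
      inv_mul_cancel_left₀ (bracket_pos ξ).ne' _]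

/-- A component of the second Duhamel term, in terms of propagators. -/
theorem component_smearedTerm (V : LInfty d) {φ : ℝ → ℂ} (hφ : Continuous φ)
    (hs : HasCompactSupport φ) (L : Energy d →L[ℂ] L2 d)
    (hL : ∀ t f, L (freeWave t (velIncl f)) = hl.op t f) (u : Energy d) :
    L (smearedTerm V 2 φ u) = ∫ t, φ t • ∫ r in (0 : ℝ)..t, ∫ s in (0 : ℝ)..r,
      (duhamelVec hl isPropagator_cos_div V (posPart u) (t, r, s) +
        duhamelVec hl isPropagator_sin V (velPart u) (t, r, s)) := by
  -- the source of a Duhamel term, as a function on the Fourier side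
  set q : ℕ → ℝ → L2 d := fun k s =>
    potOp V (isPropagator_inv_bracket.op 0 (posPart (duhamelTerm V u k s))) with hq
  have hqc : ∀ k, Continuous (q k) := fun k =>
    (potOp V).continuous.comp ((isPropagator_inv_bracket.op 0).continuous.comp
      ((posPart (d := d)).continuous.comp (continuous_duhamelTerm_right V k u)))
  have hsrc : ∀ k, Continuous fun s => velIncl (q k s) := fun k =>
    (velIncl (d := d)).continuous.comp (hqc k)
  have hstep : ∀ (k : ℕ) (M : Energy d →L[ℂ] L2 d) (t : ℝ),
      M (duhamelTerm V u (k + 1) t) =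
        ∫ r in (0 : ℝ)..t, M (freeWave (t - r) (velIncl (q k r))) := by
    intro k M t
    have h1 : duhamelTerm V u (k + 1) t =
        ∫ r in (0 : ℝ)..t, freeWave (t - r) (velIncl (q k r)) := by
      simp only [duhamelTerm, duhamel, potential_eq, hq]
    have h2 : Continuous fun r => freeWave (t - r) (velIncl (q k r)) :=
      continuous_freeWave_comp (by fun_prop) (hsrc k)
    rw [h1, ← M.intervalIntegral_comp_comm (h2.intervalIntegrable _ _)]
  have hq0 : ∀ s, q 0 s = potOp V (isPropagator_cos_div.op s (posPart u)) +
      potOp V (isPropagator_sin.op s (velPart u)) := fun s => by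
    simp only [hq, duhamelTerm, inv_bracket_posPart_freeWave, map_add]
  have hq1 : ∀ r, q 1 r = ∫ s in (0 : ℝ)..r, potOp V (isPropagator_sin.op (r - s) (q 0 s)) :=
    fun r => by
      have := hstep 0 (potOp V ∘L isPropagator_inv_bracket.op 0 ∘L posPart) r
      refine this.trans ?_
      congr 1; funext s
      simp only [ContinuousLinearMap.comp_apply, posPart_freeWave_velIncl]
      rw [isPropagator_inv_bracket.op_op isPropagator_bracket_sin isPropagator_sin fun ξ =>
        inv_mul_cancel_left₀ (bracket_pos ξ).ne' _]
  have hint : Integrable fun t => φ t • duhamelTerm V u 2 t :=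
    (hφ.smul (continuous_duhamelTerm_right V 2 u)).integrable_of_hasCompactSupport hs.smul_right
  rw [smearedTerm, ← L.integral_comp_comm hint]
  congr 1; funext t
  rw [map_smul, hstep 1 L t]
  congr 2; funext r
  rw [hL, hq1]
  have hc1 : Continuous fun s => potOp V (isPropagator_sin.op (r - s) (q 0 s)) := by
    have ho := (potOp V).continuous
    have := hqc 0
    fun_prop
  rw [← (hl.op (t - r)).intervalIntegral_comp_comm (hc1.intervalIntegrable _ _)]
  congr 1; funext s
  rw [hq0]
  simp only [map_add, duhamelVec]

/-- The iterated time integral of the Duhamel formula as an integral over a box. -/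
theorem integral_iterated_eq {φ : ℝ → ℂ} (hφ : Continuous φ) {R : ℝ}
    (hR : ∀ t, R ≤ |t| → φ t = 0) {G : ℝ × ℝ × ℝ → ℂ} (hG : Continuous G) :
    ∫ t, φ t * ∫ r in (0 : ℝ)..t, ∫ s in (0 : ℝ)..r, G (t, r, s) =
      ∫ w : ℝ × ℝ × ℝ, φ w.1 * ((w.1 * (w.1 * w.2.1) : ℝ) : ℂ) *
        G (w.1, w.1 * w.2.1, w.1 * w.2.1 * w.2.2)
        ∂((boxMeasure R).prod (unitMeasure.prod unitMeasure)) := by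
  have hunit : ∀ (F : ℝ → ℂ) (t : ℝ), ∫ r in (0 : ℝ)..t, F r =
      ∫ ρ, (t : ℂ) * F (t * ρ) ∂unitMeasure := fun F t => by
    have := intervalIntegral.smul_integral_comp_mul_left (a := 0) (b := 1) (f := F) t
    rw [mul_zero, mul_one] at this
    rw [← this, integral_const_mul, intervalIntegral.integral_of_le zero_le_one,
      ← integral_Icc_eq_integral_Ioc, Complex.real_smul]
  rw [integral_prod _ (integrable_box_prod_prod (by fun_prop)),
    ← setIntegral_eq_integral_of_forall_compl_eq_zero (s := Icc (-R) R)]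
  · congr 1; funext t
    have hi : Integrable (fun z : ℝ × ℝ => φ t * ((t * (t * z.1) : ℝ) : ℂ) *
        G (t, t * z.1, t * z.1 * z.2)) (unitMeasure.prod unitMeasure) := by
      rw [Measure.prod_restrict]
      exact (by fun_prop : Continuous fun z : ℝ × ℝ => φ t * ((t * (t * z.1) : ℝ) : ℂ) *
        G (t, t * z.1, t * z.1 * z.2)).continuousOn.integrableOn_compact
          (isCompact_Icc.prod isCompact_Icc)
    rw [integral_prod _ hi, hunit, ← integral_const_mul]
    congr 1; funext ρ
    rw [hunit, ← integral_const_mul, ← integral_const_mul]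
    congr 1; funext σ
    push_cast; ring
  · intro t ht
    rw [hR t ?_, zero_mul]
    by_contra hlt
    exact ht (abs_le.1 (not_le.1 hlt).le)

variable {v : Rd d → ℂ}

/-- The integrand of the sesquilinear form of two potentials, with the variables ordered as
`((ξ, η), ζ)`. -/
def formDensity (v γ f : Rd d → ℂ) (x : (Rd d × Rd d) × Rd d) : ℂ :=
  starRingEnd ℂ (γ x.1.1) * f x.1.2 * (v (x.1.1 - x.2) * v (x.2 - x.1.2))

theorem IsPotentialTransform.integral_norm_mul_le (hv : IsPotentialTransform v) (ξ η : Rd d) :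
    ∫ ζ, ‖v (ξ - ζ) * v (ζ - η)‖ ≤ ∫ ζ, ‖v ζ‖ ^ 2 := by
  have e1 : ∫ ζ, ‖v (ξ - ζ) * v (ζ - η)‖ ≤
      ∫ ζ, (1 / 2) * (‖v (ξ - ζ)‖ ^ 2 + ‖v (ζ - η)‖ ^ 2) := by
    refine integral_mono (hv.integrable_mul ξ η).norm
      (((hv.integrable_sq.comp_sub_left ξ).add (hv.integrable_sq.comp_sub_right η)).const_mul _)
      fun ζ => ?_
    simp only [norm_mul]
    nlinarith [sq_nonneg (‖v (ξ - ζ)‖ - ‖v (ζ - η)‖)]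
  refine e1.trans (le_of_eq ?_)
  rw [integral_const_mul, integral_add (hv.integrable_sq.comp_sub_left ξ)
    (hv.integrable_sq.comp_sub_right η), integral_sub_left_eq_self (fun ζ => ‖v ζ‖ ^ 2),
    integral_sub_right_eq_self (fun ζ => ‖v ζ‖ ^ 2)]
  ring

theorem integrable_formDensity (hv : IsPotentialTransform v) {γ f : Rd d → ℂ} (hγ : Continuous γ)
    (hf : Continuous f) (hγi : Integrable γ) (hfi : Integrable f) :
    Integrable (formDensity v γ f) ((volume.prod volume).prod volume) := by
  have hvc := hv.continuous
  have hc : Continuous (formDensity v γ f) := by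
    unfold formDensity
    have := Complex.continuous_conj
    fun_prop
  rw [integrable_prod_iff hc.aestronglyMeasurable]
  refine ⟨Filter.Eventually.of_forall fun p =>
    (hv.integrable_mul p.1 p.2).const_mul (starRingEnd ℂ (γ p.1) * f p.2), ?_⟩
  refine Integrable.mono' ((hγi.norm.mul_prod hfi.norm).mul_const (∫ ζ, ‖v ζ‖ ^ 2))
    hc.norm.stronglyMeasurable.integral_prod_right'.aestronglyMeasurable
    (Filter.Eventually.of_forall fun p => ?_)
  rw [Real.norm_of_nonneg (integral_nonneg fun ζ => norm_nonneg _)]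
  simp only [formDensity]
  simp only [norm_mul (starRingEnd ℂ (γ p.1) * f p.2)]
  rw [integral_const_mul, norm_mul, RCLike.norm_conj]
  exact mul_le_mul_of_nonneg_left (hv.integral_norm_mul_le p.1 p.2) (by positivity)

/-- The product of the symbols of the three propagators, with the variables ordered as
`(t, r, s)` and `((ξ, η), ζ)`. -/
def propDensity (l c : ℝ → Rd d → ℝ) (x : ℝ × ℝ × ℝ) (y : (Rd d × Rd d) × Rd d) : ℂ :=
  (l (x.1 - x.2.1) y.1.1 : ℂ) * (sinProp (freq y.2) (x.2.1 - x.2.2) : ℂ) * (c x.2.2 y.1.2 : ℂ)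

theorem continuous_propDensity (hl : IsPropagator l) (hc : IsPropagator c) :
    Continuous fun z : (ℝ × ℝ × ℝ) × (Rd d × Rd d) × Rd d => propDensity l c z.1 z.2 := by
  have hsc : Continuous fun x : ℝ × Rd d => sinProp (freq x.2) x.1 := isPropagator_sin.continuous
  have hlc : Continuous fun x : ℝ × Rd d => l x.1 x.2 := hl.continuous
  have hcc : Continuous fun x : ℝ × Rd d => c x.1 x.2 := hc.continuous
  have g1 : Continuous fun z : (ℝ × ℝ × ℝ) × (Rd d × Rd d) × Rd d =>
      l (z.1.1 - z.1.2.1) z.2.1.1 := hlc.comp (by fun_prop :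
        Continuous fun z : (ℝ × ℝ × ℝ) × (Rd d × Rd d) × Rd d => (z.1.1 - z.1.2.1, z.2.1.1))
  have g2 : Continuous fun z : (ℝ × ℝ × ℝ) × (Rd d × Rd d) × Rd d =>
      sinProp (freq z.2.2) (z.1.2.1 - z.1.2.2) := hsc.comp (by fun_prop :
        Continuous fun z : (ℝ × ℝ × ℝ) × (Rd d × Rd d) × Rd d => (z.1.2.1 - z.1.2.2, z.2.2))
  have g3 : Continuous fun z : (ℝ × ℝ × ℝ) × (Rd d × Rd d) × Rd d =>
      c z.1.2.2 z.2.1.2 := hcc.comp (by fun_prop :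
        Continuous fun z : (ℝ × ℝ × ℝ) × (Rd d × Rd d) × Rd d => (z.1.2.2, z.2.1.2))
  unfold propDensity
  fun_prop

theorem norm_propDensity_le (hl : IsPropagator l) (hc : IsPropagator c) (x : ℝ × ℝ × ℝ)
    (y : (Rd d × Rd d) × Rd d) :
    ‖propDensity l c x y‖ ≤ (1 + |x.1 - x.2.1|) * (1 + |x.2.1 - x.2.2|) * (1 + |x.2.2|) := by
  simp only [propDensity, norm_mul, Complex.norm_real, Real.norm_eq_abs]
  exact mul_le_mul (mul_le_mul (hl.bound _ _) (isPropagator_sin.bound (x.2.1 - x.2.2) y.2)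
    (abs_nonneg _) (by positivity)) (hc.bound _ _) (abs_nonneg _) (by positivity)

theorem integrable_duhamel_fiber (hc : IsPropagator c) (hv : IsPotentialTransform v)
    (f : 𝓢(Rd d, ℂ)) (ξ : Rd d) (β ρ : ℝ) : Integrable (Function.uncurry fun ζ η =>
      v (ξ - ζ) * v (ζ - η) * f η * ((sinProp (freq ζ) β : ℂ) * (c ρ η : ℂ)))
      (volume.prod volume) := by
  have hvc := hv.continuous
  have hsβ : Continuous fun ζ : Rd d => sinProp (freq ζ) β := isPropagator_sin.continuous_right β
  have hcρ : Continuous (c ρ) := hc.continuous_right ρ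
  have hfc := f.continuous
  have hcont : Continuous (Function.uncurry fun ζ η =>
      v (ξ - ζ) * v (ζ - η) * f η * ((sinProp (freq ζ) β : ℂ) * (c ρ η : ℂ))) := by
    have e1 : Continuous fun p : Rd d × Rd d => c ρ p.2 := hcρ.comp continuous_snd
    have e2 : Continuous fun p : Rd d × Rd d => sinProp (freq p.1) β := hsβ.comp continuous_fst
    have e3 : Continuous fun p : Rd d × Rd d => f p.2 := hfc.comp continuous_snd
    simp only [Function.uncurry_def]
    fun_prop
  rw [integrable_prod_iff' hcont.aestronglyMeasurable]
  have hb : ∀ η ζ : Rd d,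
      ‖v (ξ - ζ) * v (ζ - η) * f η * ((sinProp (freq ζ) β : ℂ) * (c ρ η : ℂ))‖ ≤
      ‖v (ξ - ζ) * v (ζ - η)‖ * (‖f η‖ * ((1 + |β|) * (1 + |ρ|))) := fun η ζ => by
    have h1 : ‖(sinProp (freq ζ) β : ℂ)‖ ≤ 1 + |β| := by
      rw [Complex.norm_real]; exact isPropagator_sin.bound β ζ
    have h2 : ‖(c ρ η : ℂ)‖ ≤ 1 + |ρ| := by
      rw [Complex.norm_real]; exact hc.bound _ _
    calc _ = ‖v (ξ - ζ) * v (ζ - η)‖ * (‖f η‖ *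
          (‖(sinProp (freq ζ) β : ℂ)‖ * ‖(c ρ η : ℂ)‖)) := by simp only [norm_mul]; ring
      _ ≤ _ := by gcongr
  have hi : ∀ η : Rd d, Integrable fun ζ : Rd d =>
      v (ξ - ζ) * v (ζ - η) * f η * ((sinProp (freq ζ) β : ℂ) * (c ρ η : ℂ)) := fun η =>
    ((hv.integrable_mul ξ η).norm.mul_const _).mono'
      (hcont.comp (by fun_prop : Continuous fun ζ : Rd d => (ζ, η))).aestronglyMeasurable
      (Filter.Eventually.of_forall fun ζ => hb η ζ)
  refine ⟨Filter.Eventually.of_forall hi, ?_⟩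
  refine Integrable.mono' ((f.integrable (μ := volume)).norm.mul_const
    ((1 + |β|) * (1 + |ρ|) * ∫ ζ, ‖v ζ‖ ^ 2))
    hcont.norm.stronglyMeasurable.integral_prod_left'.aestronglyMeasurable
    (Filter.Eventually.of_forall fun η => ?_)
  rw [Real.norm_of_nonneg (integral_nonneg fun ζ => norm_nonneg _)]
  calc _ ≤ ∫ ζ, ‖v (ξ - ζ) * v (ζ - η)‖ * (‖f η‖ * ((1 + |β|) * (1 + |ρ|))) :=
        integral_mono (hi η).norm ((hv.integrable_mul ξ η).norm.mul_const _) fun ζ => hb η ζ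
    _ ≤ (∫ ζ, ‖v ζ‖ ^ 2) * (‖f η‖ * ((1 + |β|) * (1 + |ρ|))) := by
        rw [integral_mul_const]
        exact mul_le_mul_of_nonneg_right (hv.integral_norm_mul_le ξ η) (by positivity)
    _ = _ := by ring

theorem coeFn_duhamelVec {V : LInfty d} (hV : IsBddCompact (V : Rd d → ℂ)) (f : L2 d)
    (x : ℝ × ℝ × ℝ) :
    (duhamelVec hl hc V f x : Rd d → ℂ) =ᵐ[volume] fun ξ => (l (x.1 - x.2.1) ξ : ℂ) *
      ∫ ζ, 𝓕 (V : Rd d → ℂ) (ξ - ζ) * ((sinProp (freq ζ) (x.2.1 - x.2.2) : ℂ) *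
        ∫ η, 𝓕 (V : Rd d → ℂ) (ζ - η) * ((c x.2.2 η : ℂ) * f η)) := by
  unfold duhamelVec
  have h1 := hc.coeFn_op x.2.2 f
  generalize hc.op x.2.2 f = f₁ at *
  have h2 := coeFn_potOp hV f₁
  generalize potOp V f₁ = f₂ at *
  have h3 := isPropagator_sin.coeFn_op (x.2.1 - x.2.2) f₂
  generalize isPropagator_sin.op (x.2.1 - x.2.2) f₂ = f₃ at *
  have h4 := coeFn_potOp hV f₃
  generalize potOp V f₃ = f₄ at *
  have h5 := hl.coeFn_op (x.1 - x.2.1) f₄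
  filter_upwards [h5, h4] with ξ h5 h4
  rw [h5, h4]
  congr 1
  refine integral_congr_ae ?_
  filter_upwards [h3, h2] with ζ h3 h2
  rw [h3, h2]
  congr 2
  refine integral_congr_ae ?_
  filter_upwards [h1] with η h1
  rw [h1]

/-- The sesquilinear form of the composition of two potentials and three propagators. -/
theorem inner_duhamelVec {V : LInfty d} (hV : IsBddCompact (V : Rd d → ℂ)) (γ f : 𝓢(Rd d, ℂ))
    (x : ℝ × ℝ × ℝ) :
    inner ℂ (γ.toLp 2) (duhamelVec hl hc V (f.toLp 2) x) =
      ∫ y, formDensity (𝓕 (V : Rd d → ℂ)) γ f y * propDensity l c x y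
        ∂((volume.prod volume).prod volume) := by
  set v := 𝓕 (V : Rd d → ℂ) with hvdef
  have hv : IsPotentialTransform v := hV.isPotentialTransform
  have hFi : Integrable (fun y : (Rd d × Rd d) × Rd d => formDensity v γ f y *
      propDensity l c x y) ((volume.prod volume).prod volume) :=
    (integrable_formDensity hv γ.continuous f.continuous γ.integrable f.integrable).mul_bdd
      (c := ((1 + |x.1 - x.2.1|) * (1 + |x.2.1 - x.2.2|) * (1 + |x.2.2|)))
      ((continuous_propDensity hl hc).comp (by fun_prop :
        Continuous fun y : (Rd d × Rd d) × Rd d => (x, y))).aestronglyMeasurable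
      (Filter.Eventually.of_forall fun y => norm_propDensity_le hl hc x y)
  rw [integral_prod _ hFi, integral_prod _ hFi.integral_prod_left, inner_eq_integral]
  refine integral_congr_ae ?_
  filter_upwards [SchwartzMap.coeFn_toLp γ 2 volume, coeFn_duhamelVec hl hc hV (f.toLp 2) x]
    with ξ h1 h2
  have h3 : ∀ ζ, ∫ η, v (ζ - η) * ((c x.2.2 η : ℂ) * (f.toLp 2 : L2 d) η) =
      ∫ η, v (ζ - η) * ((c x.2.2 η : ℂ) * f η) := fun ζ => by
    refine integral_congr_ae ?_
    filter_upwards [SchwartzMap.coeFn_toLp f 2 volume] with η h8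
    rw [h8]
  have h4 : ∫ ζ, v (ξ - ζ) * ((sinProp (freq ζ) (x.2.1 - x.2.2) : ℂ) *
      ∫ η, v (ζ - η) * ((c x.2.2 η : ℂ) * f η)) = ∫ ζ, ∫ η, v (ξ - ζ) * v (ζ - η) * f η *
        ((sinProp (freq ζ) (x.2.1 - x.2.2) : ℂ) * (c x.2.2 η : ℂ)) := by
    congr 1; funext ζ
    rw [← integral_const_mul, ← integral_const_mul]
    congr 1; funext η
    ring
  simp only [← hvdef, h3] at h2
  rw [h1, h2, h4, integral_integral_swap (integrable_duhamel_fiber hc hv f ξ _ _),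
    ← integral_const_mul, ← integral_const_mul]
  congr 1; funext η
  rw [← integral_const_mul, ← integral_const_mul]
  congr 1; funext ζ
  simp only [formDensity, propDensity]
  ring

/-- The symbol of the second Duhamel term with outgoing propagator `l` and incoming propagator
`c`. -/
def propSymbol (φ : ℝ → ℂ) (l c : ℝ → Rd d → ℝ) (ξ ζ η : Rd d) : ℂ :=
  smear φ (volterra (fun t => l t ξ) (volterra (sinProp (freq ζ)) fun t => c t η))

theorem inner_integral_iterated (g : L2 d) {φ : ℝ → ℂ} (hφ : Continuous φ)
    (hs : HasCompactSupport φ) {W : ℝ × ℝ × ℝ → L2 d} (hW : Continuous W) :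
    inner ℂ g (∫ t, φ t • ∫ r in (0 : ℝ)..t, ∫ s in (0 : ℝ)..r, W (t, r, s)) =
      ∫ t, φ t * ∫ r in (0 : ℝ)..t, ∫ s in (0 : ℝ)..r, inner ℂ g (W (t, r, s)) := by
  set L : L2 d →L[ℂ] ℂ := innerSL ℂ g with hL
  have hLa : ∀ x, inner ℂ g x = L x := fun x => rfl
  simp only [hLa]
  have c1 : Continuous fun x : ℝ × ℝ => ∫ s in (0 : ℝ)..x.2, W (x.1, x.2, s) :=
    intervalIntegral.continuous_parametric_intervalIntegral_of_continuous
      (f := fun (x : ℝ × ℝ) s => W (x.1, x.2, s))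
      (hW.comp (by fun_prop : Continuous fun y : (ℝ × ℝ) × ℝ => (y.1.1, y.1.2, y.2)))
      continuous_snd
  have c2 : Continuous fun t => ∫ r in (0 : ℝ)..t, ∫ s in (0 : ℝ)..r, W (t, r, s) :=
    intervalIntegral.continuous_parametric_intervalIntegral_of_continuous
      (f := fun t r => ∫ s in (0 : ℝ)..r, W (t, r, s)) c1 continuous_id
  have hint : Integrable fun t => φ t • ∫ r in (0 : ℝ)..t, ∫ s in (0 : ℝ)..r, W (t, r, s) :=
    (hφ.smul c2).integrable_of_hasCompactSupport hs.smul_right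
  rw [← L.integral_comp_comm hint]
  congr 1; funext t
  have c3 : Continuous fun r => ∫ s in (0 : ℝ)..r, W (t, r, s) :=
    c1.comp (by fun_prop : Continuous fun r : ℝ => (t, r))
  rw [map_smul, smul_eq_mul, ← L.intervalIntegral_comp_comm (c3.intervalIntegrable _ _)]
  congr 2; funext r
  have c4 : Continuous fun s => W (t, r, s) :=
    hW.comp (by fun_prop : Continuous fun s : ℝ => (t, r, s))
  rw [← L.intervalIntegral_comp_comm (c4.intervalIntegrable _ _)]

/-- The change of variables from the unit cube to the simplex of times. -/
def timeMap (w : ℝ × ℝ × ℝ) : ℝ × ℝ × ℝ := (w.1, w.1 * w.2.1, w.1 * w.2.1 * w.2.2)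

theorem continuous_timeMap : Continuous timeMap := by
  unfold timeMap; fun_prop

theorem integrable_timeMap_formDensity (hl : IsPropagator l) (hc : IsPropagator c)
    (hv : IsPotentialTransform v) (γ f : 𝓢(Rd d, ℂ))
    {φ : ℝ → ℂ} (hφ : Continuous φ) (R : ℝ) :
    Integrable (Function.uncurry fun (w : ℝ × ℝ × ℝ) (y : (Rd d × Rd d) × Rd d) =>
      φ w.1 * ((w.1 * (w.1 * w.2.1) : ℝ) : ℂ) *
        (formDensity v γ f y * propDensity l c (timeMap w) y))
      (((boxMeasure R).prod (unitMeasure.prod unitMeasure)).prod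
        ((volume.prod volume).prod volume)) := by
  have hvc := hv.continuous
  have hfd := integrable_formDensity hv γ.continuous f.continuous γ.integrable f.integrable
  set B : ℝ × ℝ × ℝ → ℝ := fun w => (1 + |(timeMap w).1 - (timeMap w).2.1|) *
    (1 + |(timeMap w).2.1 - (timeMap w).2.2|) * (1 + |(timeMap w).2.2|) with hB
  have hBi : Integrable (fun w : ℝ × ℝ × ℝ => φ w.1 * ((w.1 * (w.1 * w.2.1) : ℝ) : ℂ) * (B w : ℂ))
      ((boxMeasure R).prod (unitMeasure.prod unitMeasure)) := by
    refine integrable_box_prod_prod ?_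
    have := continuous_timeMap
    simp only [hB]
    fun_prop
  refine Integrable.mono' (hBi.norm.mul_prod hfd.norm) (Continuous.aestronglyMeasurable ?_)
    (Filter.Eventually.of_forall fun x => ?_)
  · have := Complex.continuous_conj
    have h1 := γ.continuous
    have h2 := f.continuous
    have h3 : Continuous fun x : (ℝ × ℝ × ℝ) × (Rd d × Rd d) × Rd d =>
        propDensity l c (timeMap x.1) x.2 := (continuous_propDensity hl hc).comp
          ((continuous_timeMap.comp continuous_fst).prodMk continuous_snd)
    simp only [Function.uncurry_def, formDensity]
    fun_prop
  · have h3 : ‖propDensity l c (timeMap x.1) x.2‖ ≤ ‖(B x.1 : ℂ)‖ := by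
      rw [Complex.norm_real]
      exact (norm_propDensity_le hl hc (timeMap x.1) x.2).trans (le_abs_self _)
    simp only [Function.uncurry]
    rw [norm_mul, norm_mul (formDensity _ _ _ _), norm_mul _ (B x.1 : ℂ)]
    calc _ ≤ ‖φ x.1.1 * ((x.1.1 * (x.1.1 * x.1.2.1) : ℝ) : ℂ)‖ *
          (‖formDensity v γ f x.2‖ * ‖(B x.1 : ℂ)‖) :=
            mul_le_mul_of_nonneg_left (mul_le_mul_of_nonneg_left h3 (norm_nonneg _))
              (norm_nonneg _)
      _ = _ := by ring

theorem integral_timeMap_formDensity (hl : IsPropagator l) (hc : IsPropagator c) {φ : ℝ → ℂ}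
    (hφ : Continuous φ) {R : ℝ} (hR : ∀ t, R ≤ |t| → φ t = 0) (γ f : Rd d → ℂ)
    (y : (Rd d × Rd d) × Rd d) :
    ∫ w, φ w.1 * ((w.1 * (w.1 * w.2.1) : ℝ) : ℂ) *
      (formDensity v γ f y * propDensity l c (timeMap w) y)
        ∂((boxMeasure R).prod (unitMeasure.prod unitMeasure)) =
      formDensity v γ f y * propSymbol φ l c y.1.1 y.2 y.1.2 := by
  have hlc : Continuous fun x : ℝ × Rd d => l x.1 x.2 := hl.continuous
  have hcc : Continuous fun x : ℝ × Rd d => c x.1 x.2 := hc.continuous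
  have k1 : Continuous fun t => l t y.1.1 := hlc.comp (by fun_prop :
    Continuous fun t : ℝ => (t, y.1.1))
  have k2 : Continuous fun t => c t y.1.2 := hcc.comp (by fun_prop :
    Continuous fun t : ℝ => (t, y.1.2))
  rw [propSymbol, smear_volterra_volterra_eq hφ hR k1 (by fun_prop) k2, ← integral_const_mul]
  congr 1; funext w
  simp only [propDensity, timeMap, mul_sub, mul_one]
  push_cast; ring

end DuhamelKernel

section DuhamelTrace

variable {d : ℕ} {v : Rd d → ℂ} {l c : ℝ → Rd d → ℝ} (hl : IsPropagator l) (hc : IsPropagator c)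

theorem continuous_inner_left (g : L2 d) {X : Type*} [TopologicalSpace X] {F : X → L2 d}
    (hF : Continuous F) : Continuous fun x => inner ℂ g (F x) :=
  continuous_const.inner hF

/-- The smeared second Duhamel term has the symbol `propSymbol`. -/
theorem inner_smeared_duhamelVec {V : LInfty d} (hV : IsBddCompact (V : Rd d → ℂ))
    (γ f : 𝓢(Rd d, ℂ)) {φ : ℝ → ℂ} (hφ : EvenTest φ) :
    Integrable (fun y => formDensity (𝓕 (V : Rd d → ℂ)) γ f y * propSymbol φ l c y.1.1 y.2 y.1.2)
        ((volume.prod volume).prod volume) ∧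
      inner ℂ (γ.toLp 2) (∫ t, φ t • ∫ r in (0 : ℝ)..t, ∫ s in (0 : ℝ)..r,
        duhamelVec hl hc V (f.toLp 2) (t, r, s)) =
      ∫ y, formDensity (𝓕 (V : Rd d → ℂ)) γ f y * propSymbol φ l c y.1.1 y.2 y.1.2
        ∂((volume.prod volume).prod volume) := by
  obtain ⟨R, -, hR⟩ := hφ.exists_bound
  have hv : IsPotentialTransform (𝓕 (V : Rd d → ℂ)) := hV.isPotentialTransform
  have hW := continuous_duhamelVec hl hc V (f.toLp 2)
  have hFi := integrable_timeMap_formDensity hl hc hv γ f hφ.continuous R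
  have hM := integral_timeMap_formDensity (v := 𝓕 (V : Rd d → ℂ)) hl hc hφ.continuous hR γ f
  have h1 := inner_integral_iterated (γ.toLp 2) hφ.continuous hφ.supp hW
  have h2 := integral_iterated_eq hφ.continuous hR (continuous_inner_left (γ.toLp 2) hW)
  refine ⟨hFi.integral_prod_right.congr (Filter.Eventually.of_forall hM), ?_⟩
  rw [h1, h2]
  have h3 := integral_integral_swap hFi
  simp only [hM] at h3
  rw [← h3]
  congr 1; funext w
  rw [inner_duhamelVec hl hc hV γ f, integral_const_mul]
  rfl

/-- The sesquilinear form of the operator with a given symbol. -/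
theorem inner_kernelOp_symKernel {M : Rd d → Rd d → Rd d → ℂ}
    (hK : MemLp (Function.uncurry (symKernel v M)) 2 ((volume : Measure (Rd d)).prod volume))
    (γ f : 𝓢(Rd d, ℂ))
    (hM : Integrable (fun y => formDensity v γ f y * M y.1.1 y.2 y.1.2)
      ((volume.prod volume).prod volume)) :
    inner ℂ (γ.toLp 2) (kernelOp hK (f.toLp 2)) =
      ∫ y, formDensity v γ f y * M y.1.1 y.2 y.1.2 ∂((volume.prod volume).prod volume) := by
  rw [integral_prod _ hM, integral_prod _ hM.integral_prod_left, inner_eq_integral]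
  refine integral_congr_ae ?_
  filter_upwards [SchwartzMap.coeFn_toLp γ 2 volume, coeFn_kernelOp hK (f.toLp 2)] with ξ h1 h2
  rw [h1, h2, ← integral_const_mul]
  refine integral_congr_ae ?_
  filter_upwards [SchwartzMap.coeFn_toLp f 2 volume] with η h3
  rw [h3, Function.uncurry_apply_pair, symKernel, mul_comm _ (f η), ← mul_assoc,
    ← integral_const_mul]
  congr 1; funext ζ
  simp only [formDensity]
  ring

theorem inner_iterated_add (g : L2 d) {φ : ℝ → ℂ} (hφ : EvenTest φ) {W₁ W₂ : ℝ × ℝ × ℝ → L2 d}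
    (h₁ : Continuous W₁) (h₂ : Continuous W₂) :
    inner ℂ g (∫ t, φ t • ∫ r in (0 : ℝ)..t, ∫ s in (0 : ℝ)..r, (W₁ (t, r, s) + W₂ (t, r, s))) =
      inner ℂ g (∫ t, φ t • ∫ r in (0 : ℝ)..t, ∫ s in (0 : ℝ)..r, W₁ (t, r, s)) +
      inner ℂ g (∫ t, φ t • ∫ r in (0 : ℝ)..t, ∫ s in (0 : ℝ)..r, W₂ (t, r, s)) := by
  obtain ⟨R, -, hR⟩ := hφ.exists_bound
  have hφc := hφ.continuous
  have k₁ := continuous_inner_left g h₁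
  have k₂ := continuous_inner_left g h₂
  rw [inner_integral_iterated g hφc hφ.supp h₁, inner_integral_iterated g hφc hφ.supp h₂,
    inner_integral_iterated g hφc hφ.supp (W := fun x => W₁ x + W₂ x) (h₁.add h₂),
    integral_iterated_eq hφc hR k₁, integral_iterated_eq hφc hR k₂,
    integral_iterated_eq hφc hR (G := fun x => inner ℂ g (W₁ x + W₂ x))
      (continuous_inner_left g (h₁.add h₂)), ← integral_add]
  · congr 1; funext w
    rw [inner_add_right, mul_add]
  · exact integrable_box_prod_prod (((hφc.comp continuous_fst).mul (by fun_prop)).mul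
      (k₁.comp continuous_timeMap))
  · exact integrable_box_prod_prod (((hφc.comp continuous_fst).mul (by fun_prop)).mul
      (k₂.comp continuous_timeMap))

theorem smear_mul_left (φ : ℝ → ℂ) (b : ℝ) (y : ℝ → ℝ) :
    smear φ (fun t => b * y t) = b * smear φ y := by
  rw [smear, smear, ← integral_const_mul]
  congr 1; funext t; push_cast; ring

theorem volterra_mul_left (b : ℝ) (p f : ℝ → ℝ) :
    volterra (fun t => b * p t) f = fun t => b * volterra p f t := by
  funext t
  simp only [volterra, mul_assoc, intervalIntegral.integral_const_mul]

theorem volterra_mul_right (b : ℝ) (p f : ℝ → ℝ) :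
    volterra p (fun t => f t * b) = fun t => b * volterra p f t := by
  funext t
  simp only [volterra, ← mul_assoc, intervalIntegral.integral_mul_const, mul_comm b]

/-- The diagonal symbol of the position component. -/
theorem propSymbol_pos_pos (φ : ℝ → ℂ) (ξ ζ η : Rd d) :
    propSymbol φ (fun t ξ => bracket ξ * sinProp (freq ξ) t)
      (fun t ξ => Real.cos (t * freq ξ) * (bracket ξ)⁻¹) ξ ζ η =
      (bracket ξ : ℂ) * (bracket η : ℂ)⁻¹ * duhamelSymbol φ (freq ξ) (freq ζ) (freq η) := by
  have h : ∀ (b : ℝ) (p f : ℝ → ℝ), volterra p (fun t => b * f t) = fun t => b * volterra p f t :=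
    fun b p f => by simp only [mul_comm b, volterra_mul_right b p f]
  rw [propSymbol, volterra_mul_right, volterra_mul_left, h, smear_mul_left, smear_mul_left,
    duhamelSymbol]
  push_cast; ring

/-- The symbol of the velocity component is the same: the time derivative is moved from the outgoing
to the incoming propagator. -/
theorem propSymbol_vel_vel (φ : ℝ → ℂ) (ξ ζ η : Rd d) :
    propSymbol φ (fun t ξ => Real.cos (t * freq ξ)) (fun t ξ => sinProp (freq ξ) t) ξ ζ η =
      duhamelSymbol φ (freq ξ) (freq ζ) (freq η) := by
  have h1 : volterra (fun t => Real.cos (t * freq ζ)) (sinProp (freq η)) =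
      volterra (sinProp (freq ζ)) fun t => Real.cos (t * freq η) :=
    funext fun t => volterra_cos_eq _ (by fun_prop) (by fun_prop)
      (hasDerivAt_sinProp (freq η)) (sinProp_zero _) t
  have h2 : volterra (fun t => Real.cos (t * freq ξ))
      (volterra (sinProp (freq ζ)) (sinProp (freq η))) = volterra (sinProp (freq ξ))
        (volterra (sinProp (freq ζ)) fun t => Real.cos (t * freq η)) := by
    rw [← h1]
    exact funext fun t => volterra_cos_eq _ (continuous_volterra (by fun_prop) (by fun_prop))
      (continuous_volterra (by fun_prop) (by fun_prop))
      (hasDerivAt_volterra_sin (freq ζ) (by fun_prop)) (volterra_zero _ _) t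
  rw [propSymbol, duhamelSymbol, ← h2]

/-- The off-diagonal symbols are odd functions of time integrated against an even one. -/
theorem propSymbol_pos_vel {φ : ℝ → ℂ} (hφ : EvenTest φ) (ξ ζ η : Rd d) :
    propSymbol φ (fun t ξ => bracket ξ * sinProp (freq ξ) t) (fun t ξ => sinProp (freq ξ) t)
      ξ ζ η = 0 := by
  have h1 := volterra_neg (p := sinProp (freq ζ)) (f := sinProp (freq η)) (e₁ := -1) (e₂ := -1)
    (fun t => by rw [sinProp_neg]; ring) (fun t => by rw [sinProp_neg]; ring)
  have h2 := volterra_neg (p := fun t => bracket ξ * sinProp (freq ξ) t)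
    (f := volterra (sinProp (freq ζ)) (sinProp (freq η))) (e₁ := -1) (e₂ := -1)
    (fun t => by rw [sinProp_neg]; ring) (fun t => by rw [h1]; ring)
  exact smear_of_odd hφ fun t => by rw [h2]; ring

theorem propSymbol_vel_pos {φ : ℝ → ℂ} (hφ : EvenTest φ) (ξ ζ η : Rd d) :
    propSymbol φ (fun t ξ => Real.cos (t * freq ξ))
      (fun t ξ => Real.cos (t * freq ξ) * (bracket ξ)⁻¹) ξ ζ η = 0 := by
  have h1 := volterra_neg (p := sinProp (freq ζ))
    (f := fun t => Real.cos (t * freq η) * (bracket η)⁻¹) (e₁ := -1) (e₂ := 1)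
    (fun t => by rw [sinProp_neg]; ring) (fun t => by rw [neg_mul, Real.cos_neg]; ring)
  have h2 := volterra_neg (p := fun t => Real.cos (t * freq ξ))
    (f := volterra (sinProp (freq ζ)) fun t => Real.cos (t * freq η) * (bracket η)⁻¹)
    (e₁ := 1) (e₂ := 1)
    (fun t => by rw [neg_mul, Real.cos_neg]; ring) (fun t => by rw [h1]; ring)
  exact smear_of_odd hφ fun t => by rw [h2]; ring

/-- Schwartz functions are dense in `L²`. -/
theorem eq_of_inner_schwartz {g h : L2 d}
    (H : ∀ γ : 𝓢(Rd d, ℂ), inner ℂ (γ.toLp 2 : L2 d) g = inner ℂ (γ.toLp 2 : L2 d) h) : g = h := by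
  have hd := SchwartzMap.denseRange_toLpCLM (E := Rd d) (F := ℂ) (p := 2) (μ := volume)
    ENNReal.ofNat_ne_top
  have : (fun x : L2 d => inner ℂ x g) = fun x => inner ℂ x h :=
    hd.equalizer (continuous_id.inner continuous_const) (continuous_id.inner continuous_const)
      (funext H)
  exact ext_inner_left ℂ (congrFun this)

theorem continuous_component (L : Energy d →L[ℂ] L2 d) (V : LInfty d) {φ : ℝ → ℂ}
    (hφ : EvenTest φ) : Continuous fun x : L2 d × L2 d =>
      L (smearedTerm V 2 φ (posIncl x.1 + velIncl x.2)) := by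
  have h1 : Continuous fun x : L2 d × L2 d => posIncl x.1 + velIncl x.2 :=
    ((posIncl (d := d)).continuous.comp continuous_fst).add
      ((velIncl (d := d)).continuous.comp continuous_snd)
  have h2 := continuous_smearedTerm V 2 hφ.continuous hφ.supp
  exact Continuous.comp (g := L) L.continuous (Continuous.comp (g := smearedTerm V 2 φ) h2 h1)

theorem inner_component_smearedTerm (V : LInfty d) {φ : ℝ → ℂ} (hφ : EvenTest φ)
    (L : Energy d →L[ℂ] L2 d) (hL : ∀ t f, L (freeWave t (velIncl f)) = hl.op t f)
    (g f₁ f₂ : L2 d) :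
    inner ℂ g (L (smearedTerm V 2 φ (posIncl f₁ + velIncl f₂))) =
      inner ℂ g (∫ t, φ t • ∫ r in (0 : ℝ)..t, ∫ s in (0 : ℝ)..r,
        duhamelVec hl isPropagator_cos_div V f₁ (t, r, s)) +
      inner ℂ g (∫ t, φ t • ∫ r in (0 : ℝ)..t, ∫ s in (0 : ℝ)..r,
        duhamelVec hl isPropagator_sin V f₂ (t, r, s)) := by
  have e1 : posPart (posIncl f₁ + velIncl f₂) = f₁ := by
    rw [map_add, posPart_posIncl, posPart_velIncl, add_zero]
  have e2 : velPart (posIncl f₁ + velIncl f₂) = f₂ := by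
    rw [map_add, velPart_posIncl, velPart_velIncl, zero_add]
  rw [component_smearedTerm hl V hφ.continuous hφ.supp L hL, e1, e2]
  exact inner_iterated_add g hφ (continuous_duhamelVec hl isPropagator_cos_div V f₁)
    (continuous_duhamelVec hl isPropagator_sin V f₂)

/-- Continuous maps on `L² × L²` are determined by their values on Schwartz functions. -/
theorem eq_of_eq_schwartz {X : Type*} [TopologicalSpace X] [T2Space X] {F G : L2 d × L2 d → X}
    (hF : Continuous F) (hG : Continuous G)
    (h : ∀ f₁ f₂ : 𝓢(Rd d, ℂ), F (f₁.toLp 2, f₂.toLp 2) = G (f₁.toLp 2, f₂.toLp 2)) : F = G := by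
  have hd := SchwartzMap.denseRange_toLpCLM (E := Rd d) (F := ℂ) (p := 2) (μ := volume)
    ENNReal.ofNat_ne_top
  exact (hd.prodMap hd).equalizer hF hG (funext fun p => h p.1 p.2)

/-- A component of the smeared second Duhamel term is a pair of integral operators, whose symbols
are given by `propSymbol`. -/
theorem component_eq {V : LInfty d} (hV : IsBddCompact (V : Rd d → ℂ)) {φ : ℝ → ℂ}
    (hφ : EvenTest φ) (L : Energy d →L[ℂ] L2 d)
    (hL : ∀ t f, L (freeWave t (velIncl f)) = hl.op t f) {T₁ T₂ : L2 d →L[ℂ] L2 d}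
    (h₁ : ∀ γ f : 𝓢(Rd d, ℂ), inner ℂ (γ.toLp 2 : L2 d) (T₁ (f.toLp 2)) =
      ∫ y, formDensity (𝓕 (V : Rd d → ℂ)) γ f y * propSymbol φ l
        (fun t ξ => Real.cos (t * freq ξ) * (bracket ξ)⁻¹) y.1.1 y.2 y.1.2
        ∂((volume.prod volume).prod volume))
    (h₂ : ∀ γ f : 𝓢(Rd d, ℂ), inner ℂ (γ.toLp 2 : L2 d) (T₂ (f.toLp 2)) =
      ∫ y, formDensity (𝓕 (V : Rd d → ℂ)) γ f y * propSymbol φ l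
        (fun t ξ => sinProp (freq ξ) t) y.1.1 y.2 y.1.2
        ∂((volume.prod volume).prod volume)) (u : Energy d) :
    L (smearedTerm V 2 φ u) = T₁ (posPart u) + T₂ (velPart u) := by
  have hT : Continuous fun x : L2 d × L2 d => T₁ x.1 + T₂ x.2 :=
    (T₁.continuous.comp continuous_fst).add (T₂.continuous.comp continuous_snd)
  have key := eq_of_eq_schwartz (continuous_component L V hφ) hT fun f₁ f₂ =>
    eq_of_inner_schwartz fun γ => by
      simp only
      rw [inner_add_right, h₁, h₂, inner_component_smearedTerm hl V hφ L hL,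
        (inner_smeared_duhamelVec hl isPropagator_cos_div hV γ f₁ hφ).2,
        (inner_smeared_duhamelVec hl isPropagator_sin hV γ f₂ hφ).2]
  have := congrFun key (posPart u, velPart u)
  simp only [posIncl_add_velIncl] at this
  exact this

/-- The smeared second Duhamel term is trace class: in the decomposition of the energy space into
its two components, with the Fourier transform applied, it is a diagonal matrix of integral
operators, since the off-diagonal symbols are odd functions of time. -/
theorem exists_hasTrace_smearedTerm {V : LInfty d} (hV : IsBddCompact (V : Rd d → ℂ)) {φ : ℝ → ℂ}
    (hφ : EvenTest φ) : ∃ A : Energy d →L[ℂ] Energy d, (∀ u, A u = smearedTerm V 2 φ u) ∧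
      HasTrace A (2 * ∫ ξ, ∫ ζ, 𝓕 (V : Rd d → ℂ) (ξ - ζ) * 𝓕 (V : Rd d → ℂ) (ζ - ξ) *
        duhamelSymbol φ (freq ξ) (freq ζ) (freq ξ)) := by
  have hv : IsPotentialTransform (𝓕 (V : Rd d → ℂ)) := hV.isPotentialTransform
  obtain ⟨-, -, hK₁, hN₁⟩ := isNuclearSymbol_duhamel_bracket hv hφ
  have hone : IsBddFun fun _ : Rd d => (1 : ℂ) := ⟨measurable_const, 1, zero_le_one, by simp⟩
  obtain ⟨-, -, hK₂, hN₂⟩ := (isNuclearSymbol_duhamel hv hφ hone hone hone).congr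
    (N := fun ξ ζ η => duhamelSymbol φ (freq ξ) (freq ζ) (freq η)) fun ξ ζ η => by ring
  have hpos : ∀ u, posPart (smearedTerm V 2 φ u) = kernelOp hK₁ (posPart u) := fun u => by
    have := component_eq isPropagator_bracket_sin hV hφ posPart posPart_freeWave_velIncl
      (T₁ := kernelOp hK₁) (T₂ := 0) (fun γ f => ?_) (fun γ f => ?_) u
    · simpa using this
    · have hi := (inner_smeared_duhamelVec isPropagator_bracket_sin isPropagator_cos_div hV γ f
        hφ).1
      simp only [propSymbol_pos_pos] at hi ⊢
      exact inner_kernelOp_symKernel hK₁ γ f hi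
    · simp [propSymbol_pos_vel hφ]
  have hvel : ∀ u, velPart (smearedTerm V 2 φ u) = kernelOp hK₂ (velPart u) := fun u => by
    have := component_eq isPropagator_cos hV hφ velPart velPart_freeWave_velIncl
      (T₁ := 0) (T₂ := kernelOp hK₂) (fun γ f => ?_) (fun γ f => ?_) u
    · simpa using this
    · simp [propSymbol_vel_pos hφ]
    · have hi := (inner_smeared_duhamelVec isPropagator_cos isPropagator_sin hV γ f hφ).1
      simp only [propSymbol_vel_vel] at hi ⊢
      exact inner_kernelOp_symKernel hK₂ γ f hi
  have htr : (2 * ∫ ξ, ∫ ζ, 𝓕 (V : Rd d → ℂ) (ξ - ζ) * 𝓕 (V : Rd d → ℂ) (ζ - ξ) *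
      duhamelSymbol φ (freq ξ) (freq ζ) (freq ξ)) =
      (∫ ξ, symKernel (𝓕 (V : Rd d → ℂ)) (fun ξ ζ η => (bracket ξ : ℂ) * (bracket η : ℂ)⁻¹ *
        duhamelSymbol φ (freq ξ) (freq ζ) (freq η)) ξ ξ) +
      ∫ ξ, symKernel (𝓕 (V : Rd d → ℂ)) (fun ξ ζ η =>
        duhamelSymbol φ (freq ξ) (freq ζ) (freq η)) ξ ξ := by
    rw [two_mul]
    congr 1
    congr 1; funext ξ
    simp only [symKernel]
    congr 1; funext ζ
    have hb : (bracket ξ : ℂ) ≠ 0 := by exact_mod_cast (bracket_pos ξ).ne'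
    rw [mul_inv_cancel₀ hb, one_mul]
  rw [htr]
  refine ⟨_, fun u => ?_, ((hN₁.map posIncl posPart inner_posIncl).add
    (hN₂.map velIncl velPart inner_velIncl)).hasTrace⟩
  refine energy_ext ?_ ?_
  · simp [hpos, posPart_posIncl, posPart_velIncl]
  · simp [hvel, velPart_posIncl, velPart_velIncl]

end DuhamelTrace

/-! ### Evaluation of the trace -/

section TraceEvaluation

/-- Each convolution with the propagator costs at most two powers of `t`. -/
theorem abs_volterra_sinProp_le {a t : ℝ} {f : ℝ → ℝ} {k : ℕ} (hf : ∀ s, |f s| ≤ |s| ^ k) :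
    |volterra (sinProp a) f t| ≤ |t| ^ (k + 2) := by
  rw [volterra_eq_unit]
  have h := intervalIntegral.norm_integral_le_of_norm_le_const (a := 0) (b := 1)
    (C := |t| ^ (k + 2)) (f := fun σ => t * (sinProp a (t * (1 - σ)) * f (t * σ))) fun σ hσ => by
      rw [uIoc_of_le zero_le_one] at hσ
      have h1 : |sinProp a (t * (1 - σ))| ≤ |t| := by
        refine (abs_sinProp_le _ _).trans ?_
        rw [abs_mul]
        exact mul_le_of_le_one_right (abs_nonneg _)
          (abs_le.2 ⟨by linarith [hσ.2], by linarith [hσ.1]⟩)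
      have h2 : |f (t * σ)| ≤ |t| ^ k := by
        refine (hf _).trans (pow_le_pow_left₀ (abs_nonneg _) ?_ k)
        rw [abs_mul]
        exact mul_le_of_le_one_right (abs_nonneg _) (abs_le.2 ⟨by linarith [hσ.1], hσ.2⟩)
      rw [Real.norm_eq_abs, abs_mul, abs_mul]
      calc |t| * (|sinProp a (t * (1 - σ))| * |f (t * σ)|) ≤ |t| * (|t| * |t| ^ k) := by gcongr
        _ = _ := by ring
  simpa using h

theorem norm_smear_le {χ : ℝ → ℂ} (hχ : EvenTest χ) {y : ℝ → ℝ} {k : ℕ}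
    (hy : ∀ t, |y t| ≤ |t| ^ k) :
    ‖smear χ y‖ ≤ ∫ t, ‖χ t * (t : ℂ) ^ k‖ := by
  refine norm_integral_le_of_norm_le (hχ.integrable_mul (by fun_prop)).norm
    (Filter.Eventually.of_forall fun t => ?_)
  rw [norm_mul, norm_mul, Complex.norm_real, norm_pow, Complex.norm_real]
  exact mul_le_mul_of_nonneg_left (hy t) (norm_nonneg _)

/-- Repeated use of the wave equation turns decay of the source into decay in the frequency of the
propagator. -/
theorem exists_norm_smear_volterra_le {ι : Type*} {a : ι → ℝ} {f : ι → ℝ → ℝ}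
    (hf : ∀ i, Continuous (f i)) {k : ℕ} (hk : ∀ i t, |f i t| ≤ |t| ^ k) {E : ι → ℝ}
    (hE : ∀ i, 0 ≤ E i)
    (h : ∀ χ, EvenTest χ → ∃ C : ℝ, 0 ≤ C ∧ ∀ i, ‖smear χ (f i)‖ ≤ C * E i) (n : ℕ) :
    ∀ χ, EvenTest χ → ∃ C : ℝ, 0 ≤ C ∧ ∀ i,
      ‖smear χ (volterra (sinProp (a i)) (f i))‖ ≤ C * (((1 + a i ^ 2) ^ n)⁻¹ + E i) := by
  induction n with
  | zero =>
    intro χ hχ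
    refine ⟨∫ t, ‖χ t * (t : ℂ) ^ (k + 2)‖, integral_nonneg fun t => norm_nonneg _, fun i => ?_⟩
    refine (norm_smear_le hχ fun t => abs_volterra_sinProp_le (hk i)).trans ?_
    rw [pow_zero, inv_one]
    exact le_mul_of_one_le_right (integral_nonneg fun t => norm_nonneg _) (by linarith [hE i])
  | succ n ih =>
    intro χ hχ
    obtain ⟨C, hC, h1⟩ := ih _ hχ.sub_deriv_deriv
    obtain ⟨C', hC', h2⟩ := h χ hχ
    refine ⟨C + C', by positivity, fun i => ?_⟩
    have h3 := smear_volterra_sin (a := a i) hχ (hf i)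
    have h4 : ‖(1 + (a i : ℂ) ^ 2)‖ = 1 + a i ^ 2 := by
      have : (1 + (a i : ℂ) ^ 2) = ((1 + a i ^ 2 : ℝ) : ℂ) := by push_cast; ring
      rw [this, Complex.norm_real, Real.norm_eq_abs, abs_of_pos (by positivity)]
    have h5 : (1 + a i ^ 2) * ‖smear χ (volterra (sinProp (a i)) (f i))‖ ≤
        C * (((1 + a i ^ 2) ^ n)⁻¹ + E i) + C' * E i := by
      have h8 := congrArg norm h3
      rw [norm_mul, h4] at h8
      rw [h8]
      exact (norm_add_le _ _).trans (add_le_add (h1 i) (h2 i))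
    have h6 : (1 + a i ^ 2)⁻¹ ≤ 1 := inv_le_one_of_one_le₀ (by nlinarith [sq_nonneg (a i)])
    have h7 : 0 < 1 + a i ^ 2 := by positivity
    have hEi := hE i
    calc ‖smear χ (volterra (sinProp (a i)) (f i))‖
        = (1 + a i ^ 2)⁻¹ * ((1 + a i ^ 2) * ‖smear χ (volterra (sinProp (a i)) (f i))‖) := by
          rw [inv_mul_cancel_left₀ h7.ne']
      _ ≤ (1 + a i ^ 2)⁻¹ * (C * (((1 + a i ^ 2) ^ n)⁻¹ + E i) + C' * E i) := by gcongr
      _ = C * ((1 + a i ^ 2) ^ (n + 1))⁻¹ + (1 + a i ^ 2)⁻¹ * ((C + C') * E i) := by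
          rw [pow_succ _ n, mul_inv]; ring
      _ ≤ (C + C') * ((1 + a i ^ 2) ^ (n + 1))⁻¹ + 1 * ((C + C') * E i) := by
          have : 0 ≤ ((1 + a i ^ 2) ^ (n + 1))⁻¹ := by positivity
          gcongr
          linarith
      _ = _ := by ring

/-- The symbol of the second Duhamel term decays rapidly on the diagonal. -/
theorem exists_norm_duhamelSymbol_le (n : ℕ) {χ : ℝ → ℂ} (hχ : EvenTest χ) :
    ∃ C : ℝ, 0 ≤ C ∧ ∀ a b : ℝ, ‖duhamelSymbol χ a b a‖ ≤
      C * (((1 + a ^ 2) ^ n)⁻¹ + (((1 + b ^ 2) ^ n)⁻¹ + ((1 + a ^ 2) ^ n)⁻¹)) := by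
  have hcos : ∀ (x : ℝ × ℝ) t, |Real.cos (t * x.1)| ≤ |t| ^ 0 := fun x t => by
    rw [pow_zero]; exact Real.abs_cos_le_one _
  have h1 := exists_norm_smear_volterra_le (ι := ℝ × ℝ) (a := fun x => x.2)
    (f := fun x t => Real.cos (t * x.1)) (E := fun x => ((1 + x.1 ^ 2) ^ n)⁻¹)
    (fun x => by fun_prop) hcos (fun x => by positivity)
    (fun χ hχ => let ⟨C, hC, h⟩ := EvenTest.norm_cosTransform_le n hχ; ⟨C, hC, fun x => h x.1⟩) n
  obtain ⟨C, hC, h2⟩ := exists_norm_smear_volterra_le (ι := ℝ × ℝ) (a := fun x => x.1)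
    (f := fun x => volterra (sinProp x.2) fun t => Real.cos (t * x.1))
    (E := fun x => ((1 + x.2 ^ 2) ^ n)⁻¹ + ((1 + x.1 ^ 2) ^ n)⁻¹)
    (fun x => continuous_volterra (by fun_prop) (by fun_prop))
    (fun x t => abs_volterra_sinProp_le (hcos x)) (fun x => by positivity) h1 n χ hχ
  exact ⟨C, hC, fun a b => h2 (a, b)⟩

theorem stronglyMeasurable_duhamelSymbol {χ : ℝ → ℂ} (hχ : EvenTest χ) :
    StronglyMeasurable fun p : ℝ × ℝ × ℝ => duhamelSymbol χ p.1 p.2.1 p.2.2 := by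
  obtain ⟨R, -, hR⟩ := hχ.exists_bound
  have hc := hχ.continuous
  have hs : ∀ (Y : Type) [TopologicalSpace Y] (g h : Y → ℝ), Continuous g → Continuous h →
      Continuous fun y => sinProp (g y) (h y) := fun Y _ g h hg hh =>
    continuous_sinProp.comp (hg.prodMk hh)
  have : StronglyMeasurable fun p : ℝ × ℝ × ℝ => ∫ w : ℝ × ℝ × ℝ,
      χ w.1 * ((w.1 * sinProp p.1 (w.1 * (1 - w.2.1)) : ℝ) : ℂ) *
        (((w.1 * w.2.1) * sinProp p.2.1 (w.1 * w.2.1 * (1 - w.2.2)) : ℝ) : ℂ) *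
      (Real.cos (w.1 * w.2.1 * w.2.2 * p.2.2) : ℂ)
        ∂((boxMeasure R).prod (unitMeasure.prod unitMeasure)) := by
    refine StronglyMeasurable.integral_prod_right' (f := fun x : (ℝ × ℝ × ℝ) × (ℝ × ℝ × ℝ) =>
      χ x.2.1 * ((x.2.1 * sinProp x.1.1 (x.2.1 * (1 - x.2.2.1)) : ℝ) : ℂ) *
        (((x.2.1 * x.2.2.1) * sinProp x.1.2.1 (x.2.1 * x.2.2.1 * (1 - x.2.2.2)) : ℝ) : ℂ) *
      (Real.cos (x.2.1 * x.2.2.1 * x.2.2.2 * x.1.2.2) : ℂ)) (Continuous.stronglyMeasurable ?_)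
    have g1 := hs ((ℝ × ℝ × ℝ) × (ℝ × ℝ × ℝ)) (fun x => x.1.1) (fun x => x.2.1 * (1 - x.2.2.1))
      (by fun_prop) (by fun_prop)
    have g2 := hs ((ℝ × ℝ × ℝ) × (ℝ × ℝ × ℝ)) (fun x => x.1.2.1)
      (fun x => x.2.1 * x.2.2.1 * (1 - x.2.2.2)) (by fun_prop) (by fun_prop)
    fun_prop
  refine (congrArg StronglyMeasurable (funext fun p => ?_)).mp this
  rw [duhamelSymbol, smear_volterra_volterra_eq hc hR (by fun_prop) (by fun_prop) (by fun_prop)]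

/-- Integration by parts, as `(tailMoment φ)' = t φ`. -/
theorem smear_mul_sinProp {φ : ℝ → ℂ} (hφ : EvenTest φ) (a : ℝ) :
    smear φ (fun t => t * sinProp a t) = -cosTransform (tailMoment φ) a := by
  have h := EvenTest.integral_deriv_mul hφ.tailMoment.smooth hφ.tailMoment.supp
    (g := fun t => (sinProp a t : ℂ)) (fun t => (hasDerivAt_sinProp a t).ofReal_comp)
    (by fun_prop)
  rw [smear, cosTransform, ← h]
  congr 1; funext t
  rw [hφ.deriv_tailMoment]
  push_cast; ring

/-- The symmetrized symbol, as an average over the segment between the squared frequencies. -/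
theorem duhamelSymbol_add_symm {φ : ℝ → ℂ} (hφ : EvenTest φ) {a b : ℝ} (ha : 0 < a) (hb : 0 < b)
    (hab : a ≠ b) : duhamelSymbol φ a b a + duhamelSymbol φ b a b =
      (1 / 4) * ∫ θ, cosTransform (tailMoment (tailMoment φ)) (√((1 - θ) * a ^ 2 + θ * b ^ 2))
        ∂unitMeasure := by
  have hab2 : a ^ 2 ≠ b ^ 2 := fun h => hab ((pow_left_inj₀ ha.le hb.le two_ne_zero).1 h)
  have hne : b ^ 2 - a ^ 2 ≠ 0 := sub_ne_zero.2 hab2.symm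
  have hne' : (b : ℂ) ^ 2 - (a : ℂ) ^ 2 ≠ 0 := by exact_mod_cast hne
  have hs : ∀ a : ℝ, Continuous fun t => sinProp a t := fun a => by fun_prop
  have hi : ∀ a : ℝ, Integrable fun t => φ t * ((t * sinProp a t : ℝ) : ℂ) := fun a =>
    hφ.integrable_mul (by have := hs a; fun_prop)
  have hvc : ∀ a b : ℝ, Integrable fun t => φ t *
      (volterra (sinProp a) (volterra (sinProp b) fun t => Real.cos (t * a)) t : ℂ) := fun a b =>
    hφ.integrable_mul (Complex.continuous_ofReal.comp
      (continuous_volterra (by fun_prop) (continuous_volterra (by fun_prop) (by fun_prop))))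
  have h1 : duhamelSymbol φ a b a + duhamelSymbol φ b a b =
      (cosTransform (tailMoment φ) b - cosTransform (tailMoment φ) a) / 2 / (b ^ 2 - a ^ 2) := by
    rw [duhamelSymbol, duhamelSymbol, smear, smear, ← integral_add (hvc a b) (hvc b a)]
    have : ∀ t, φ t * (volterra (sinProp a) (volterra (sinProp b) fun t => Real.cos (t * a)) t : ℂ) +
        φ t * (volterra (sinProp b) (volterra (sinProp a) fun t => Real.cos (t * b)) t : ℂ) =
        (2 * ((b : ℂ) ^ 2 - a ^ 2))⁻¹ *
          (φ t * ((t * sinProp a t : ℝ) : ℂ) - φ t * ((t * sinProp b t : ℝ) : ℂ)) := fun t => by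
      rw [← mul_add, ← Complex.ofReal_add, volterra_symm hab2]
      push_cast
      field_simp
    simp only [this]
    rw [integral_const_mul, integral_sub (hi a) (hi b)]
    have e := smear_mul_sinProp hφ
    unfold smear at e
    rw [e, e]
    field_simp
    ring
  have hc := hφ.tailMoment.tailMoment.continuous_cosTransform
  have hpos : ∀ θ ∈ uIcc (0 : ℝ) 1, 0 < (1 - θ) * a ^ 2 + θ * b ^ 2 := fun θ hθ => by
    rw [uIcc_of_le zero_le_one] at hθ
    rcases hθ.2.lt_or_eq with h | h
    · have : 0 < (1 - θ) * a ^ 2 := mul_pos (by linarith) (by positivity)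
      have := mul_nonneg hθ.1 (sq_nonneg b)
      linarith
    · rw [h]; simp; positivity
  have h2 := intervalIntegral.integral_eq_sub_of_hasDerivAt
    (f := fun θ : ℝ => cosTransform (tailMoment φ) (√((1 - θ) * a ^ 2 + θ * b ^ 2)))
    (f' := fun θ : ℝ => ((b ^ 2 - a ^ 2 : ℝ) : ℂ) * (cosTransform (tailMoment (tailMoment φ))
      (√((1 - θ) * a ^ 2 + θ * b ^ 2)) / 2)) (a := 0) (b := 1) (fun θ hθ => by
      have hd : HasDerivAt (fun θ : ℝ => (1 - θ) * a ^ 2 + θ * b ^ 2) (b ^ 2 - a ^ 2) θ := by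
        have := (((hasDerivAt_id θ).const_sub 1).mul_const (a ^ 2)).add
          ((hasDerivAt_id θ).mul_const (b ^ 2))
        exact this.congr_deriv (by ring)
      have := (hφ.tailMoment.hasDerivAt_cosTransform_sqrt (hpos θ hθ)).scomp θ hd
      exact this.congr_deriv (by rw [Complex.real_smul]))
    ((by fun_prop : Continuous fun θ : ℝ => ((b ^ 2 - a ^ 2 : ℝ) : ℂ) *
      (cosTransform (tailMoment (tailMoment φ))
      (√((1 - θ) * a ^ 2 + θ * b ^ 2)) / 2)).intervalIntegrable _ _)
  rw [intervalIntegral.integral_const_mul, intervalIntegral.integral_div,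
    intervalIntegral.integral_of_le zero_le_one, ← integral_Icc_eq_integral_Ioc] at h2
  simp only [sub_self, zero_mul, one_mul, zero_add, sub_zero, add_zero, Real.sqrt_sq ha.le,
    Real.sqrt_sq hb.le] at h2
  change ((b ^ 2 - a ^ 2 : ℝ) : ℂ) * ((∫ θ, cosTransform (tailMoment (tailMoment φ))
    (√((1 - θ) * a ^ 2 + θ * b ^ 2)) ∂unitMeasure) / 2) = _ at h2
  rw [h1, ← h2]
  generalize (∫ θ, cosTransform (tailMoment (tailMoment φ))
    (√((1 - θ) * a ^ 2 + θ * b ^ 2)) ∂unitMeasure) = I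
  push_cast
  field_simp
  norm_num

variable {d : ℕ}

/-- A rapidly decreasing function of the frequency. -/
def decay (ξ : Rd d) : ℝ := ((1 + freq ξ ^ 2) ^ (d + 1))⁻¹

theorem decay_nonneg (ξ : Rd d) : 0 ≤ decay ξ := by unfold decay; positivity

theorem integrable_decay : Integrable (decay : Rd d → ℝ) := by
  refine (integrable_weight_sq.const_mul (2 ^ (d + 1))).mono' (Continuous.aestronglyMeasurable ?_)
    (Filter.Eventually.of_forall fun ξ => ?_)
  · have := continuous_freq (d := d)
    unfold decay
    exact Continuous.inv₀ (by fun_prop) fun ξ => by positivity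
  · have := norm_resolvent_pow_le ξ
    rw [norm_pow, norm_resolvent, inv_pow] at this
    rwa [Real.norm_of_nonneg (decay_nonneg ξ)]

theorem stronglyMeasurable_freqSymbol {φ : ℝ → ℂ} (hφ : EvenTest φ) :
    StronglyMeasurable fun p : Rd d × Rd d => duhamelSymbol φ (freq p.1) (freq p.2) (freq p.1) := by
  have hf := (continuous_freq (d := d)).measurable
  exact (stronglyMeasurable_duhamelSymbol hφ).comp_measurable
    (g := fun p : Rd d × Rd d => (freq p.1, freq p.2, freq p.1)) (by fun_prop)

theorem integrable_freqSymbol {φ : ℝ → ℂ} (hφ : EvenTest φ) :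
    ∃ C : ℝ, 0 ≤ C ∧ ∀ η : Rd d,
      Integrable (fun ξ => duhamelSymbol φ (freq ξ) (freq (ξ - η)) (freq ξ)) ∧
      ∫ ξ, ‖duhamelSymbol φ (freq ξ) (freq (ξ - η)) (freq ξ)‖ ≤ C := by
  obtain ⟨C, hC, hb⟩ := exists_norm_duhamelSymbol_le (d + 1) hφ
  have hd := integrable_decay (d := d)
  have hint : ∀ η : Rd d, Integrable fun ξ => C * (decay ξ + (decay (ξ - η) + decay ξ)) := fun η =>
    (hd.add ((hd.comp_sub_right η).add hd)).const_mul C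
  have hi : ∀ η : Rd d, Integrable (fun ξ => duhamelSymbol φ (freq ξ) (freq (ξ - η)) (freq ξ)) :=
    fun η => (hint η).mono' ((stronglyMeasurable_freqSymbol hφ).comp_measurable
      (g := fun ξ => (ξ, ξ - η)) (by fun_prop)).aestronglyMeasurable
      (Filter.Eventually.of_forall fun ξ => hb _ _)
  refine ⟨C * (3 * ∫ ξ : Rd d, decay ξ),
    mul_nonneg hC (mul_nonneg zero_le_three (integral_nonneg decay_nonneg)), fun η => ⟨hi η, ?_⟩⟩
  refine (integral_mono (hi η).norm (hint η) fun ξ => hb _ _).trans (le_of_eq ?_)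
  have h1 : ∫ ξ : Rd d, (decay (ξ - η) + decay ξ) = (∫ ξ : Rd d, decay ξ) + ∫ ξ : Rd d, decay ξ := by
    rw [integral_add (hd.comp_sub_right η) hd, integral_sub_right_eq_self (decay (d := d))]
  have h2 : ∫ ξ : Rd d, (decay ξ + (decay (ξ - η) + decay ξ)) =
      (∫ ξ : Rd d, decay ξ) + ∫ ξ : Rd d, (decay (ξ - η) + decay ξ) :=
    integral_add hd ((hd.comp_sub_right η).add hd)
  rw [integral_const_mul, h2, h1]
  ring

/-- Fubini's theorem with `η = ξ - ζ`, the frequency of the potential. -/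
theorem integral_mul_freqSymbol {φ : ℝ → ℂ} (hφ : EvenTest φ) {v : Rd d → ℂ}
    (hv : IsPotentialTransform v) :
    ∫ ξ, ∫ ζ, v (ξ - ζ) * v (ζ - ξ) * duhamelSymbol φ (freq ξ) (freq ζ) (freq ξ) =
      ∫ η, v η * v (-η) * ∫ ξ, duhamelSymbol φ (freq ξ) (freq (ξ - η)) (freq ξ) := by
  obtain ⟨C, hC, hb⟩ := integrable_freqSymbol (d := d) hφ
  have hvc := hv.continuous
  have hF : Integrable fun η => v η * v (-η) := by
    have := hv.integrable_mul 0 0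
    simp only [zero_sub, sub_zero] at this
    exact this.congr (Filter.Eventually.of_forall fun η => mul_comm _ _)
  have h1 : ∀ ξ, ∫ ζ, v (ξ - ζ) * v (ζ - ξ) * duhamelSymbol φ (freq ξ) (freq ζ) (freq ξ) =
      ∫ η, v η * v (-η) * duhamelSymbol φ (freq ξ) (freq (ξ - η)) (freq ξ) := fun ξ => by
    rw [← integral_sub_left_eq_self _ volume ξ]
    congr 1; funext η
    rw [sub_sub_cancel, sub_sub_cancel_left]
  have hm : AEStronglyMeasurable (Function.uncurry fun η ξ : Rd d =>
      v η * v (-η) * duhamelSymbol φ (freq ξ) (freq (ξ - η)) (freq ξ)) (volume.prod volume) :=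
    ((by fun_prop : Continuous fun p : Rd d × Rd d => v p.1 * v (-p.1)).stronglyMeasurable.mul
      ((stronglyMeasurable_freqSymbol hφ).comp_measurable
        (g := fun p : Rd d × Rd d => (p.2, p.2 - p.1)) (by fun_prop))).aestronglyMeasurable
  have hi : Integrable (Function.uncurry fun η ξ : Rd d =>
      v η * v (-η) * duhamelSymbol φ (freq ξ) (freq (ξ - η)) (freq ξ)) (volume.prod volume) := by
    rw [integrable_prod_iff hm]
    refine ⟨Filter.Eventually.of_forall fun η =>
      (hb η).1.const_mul (v η * v (-η)), ?_⟩
    refine Integrable.mono' (hF.norm.mul_const C) hm.norm.integral_prod_right'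
      (Filter.Eventually.of_forall fun η => ?_)
    rw [Real.norm_of_nonneg (integral_nonneg fun ζ => norm_nonneg _)]
    simp only [Function.uncurry_apply_pair]
    simp only [norm_mul (v η * v (-η))]
    rw [integral_const_mul]
    exact mul_le_mul_of_nonneg_left (hb η).2 (norm_nonneg _)
  simp only [h1]
  rw [← integral_integral_swap hi]
  simp only [integral_const_mul]

theorem ae_freq_ne {η : Rd d} (hη : η ≠ 0) : ∀ᵐ ξ : Rd d, freq ξ ≠ freq (ξ - η) := by
  have h := Measure.addHaar_affineSubspace (volume : Measure (Rd d))
    (AffineSubspace.perpBisector 0 η) (by simpa using hη.symm)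
  refine (ae_iff.2 ?_)
  refine measure_mono_null (fun ξ hξ => ?_) h
  simp only [ne_eq, not_not, mem_ofPred_eq, freq] at hξ
  rw [SetLike.mem_coe, AffineSubspace.mem_perpBisector_iff_dist_eq, dist_zero_right,
    dist_eq_norm]
  exact mul_left_cancel₀ (by positivity) hξ

theorem freq_pos {ξ : Rd d} (h : ξ ≠ 0) : 0 < freq ξ := by
  have := norm_pos_iff.2 h
  unfold freq; positivity

theorem freq_neg (ξ : Rd d) : freq (-ξ) = freq ξ := by rw [freq, norm_neg, freq]

theorem freq_sub_comm (ξ η : Rd d) : freq (ξ - η) = freq (η - ξ) := by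
  rw [freq, norm_sub_rev, freq]

/-- Completion of the square. -/
theorem segment_freq (θ : ℝ) (ξ η : Rd d) : (1 - θ) * freq ξ ^ 2 + θ * freq (ξ - η) ^ 2 =
    freq (ξ - θ • η) ^ 2 + θ * (1 - θ) * freq η ^ 2 := by
  simp only [freq, mul_pow, norm_sub_sq_real, inner_smul_right, norm_smul, Real.norm_eq_abs, sq_abs]
  ring

/-- Rescaling from `freq ξ = 2π‖ξ‖` to `‖ξ‖`. -/
theorem integral_cosTransform_freq (χ : ℝ → ℂ) (M : ℝ) :
    ∫ ξ : Rd d, cosTransform χ (√(freq ξ ^ 2 + M)) =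
      (((2 * Real.pi) ^ d)⁻¹ : ℝ) * radialInt d χ M := by
  have h := Measure.integral_comp_smul (volume : Measure (Rd d))
    (fun ξ => cosTransform χ (√(‖ξ‖ ^ 2 + M))) (2 * Real.pi)
  rw [finrank_euclideanSpace_fin, abs_of_nonneg (by positivity), Complex.real_smul] at h
  rw [radialInt, ← h]
  congr 1; funext ξ
  rw [norm_smul, Real.norm_of_nonneg (by positivity), freq]

/-- The bound `|ξ - θ η|² ≤ (1 - θ)|ξ|² + θ|ξ - η|²` gives decay uniformly in `θ`. -/
theorem integrable_segment {χ : ℝ → ℂ} (h : EvenTest χ) (η : Rd d) :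
    Integrable (Function.uncurry fun (ξ : Rd d) (θ : ℝ) =>
      cosTransform χ (√((1 - θ) * freq ξ ^ 2 + θ * freq (ξ - η) ^ 2)))
      (volume.prod unitMeasure) := by
  obtain ⟨C, hC, hb⟩ := EvenTest.norm_cosTransform_le (d + 1) h
  have hf := continuous_freq (d := d)
  have hcc := h.continuous_cosTransform
  have hcont : Continuous (Function.uncurry fun (ξ : Rd d) (θ : ℝ) =>
      cosTransform χ (√((1 - θ) * freq ξ ^ 2 + θ * freq (ξ - η) ^ 2))) := by
    simp only [Function.uncurry_def]
    fun_prop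
  have hB : ∀ θ ∈ Icc (0 : ℝ) 1, ∀ ξ : Rd d,
      ‖cosTransform χ (√((1 - θ) * freq ξ ^ 2 + θ * freq (ξ - η) ^ 2))‖ ≤
        C * decay (ξ - θ • η) := fun θ hθ ξ => by
    refine (hb _).trans (mul_le_mul_of_nonneg_left ?_ hC)
    have h0 : 0 ≤ θ * (1 - θ) * freq η ^ 2 :=
      mul_nonneg (mul_nonneg hθ.1 (by linarith [hθ.2])) (sq_nonneg _)
    rw [segment_freq, Real.sq_sqrt (by positivity), decay]
    refine inv_anti₀ (by positivity) (pow_le_pow_left₀ (by positivity) (by linarith) _)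
  have hdθ : ∀ θ : ℝ, Integrable fun ξ : Rd d => C * decay (ξ - θ • η) := fun θ =>
    (integrable_decay.comp_sub_right (θ • η)).const_mul C
  have hi : ∀ θ ∈ Icc (0 : ℝ) 1, Integrable fun ξ : Rd d =>
      cosTransform χ (√((1 - θ) * freq ξ ^ 2 + θ * freq (ξ - η) ^ 2)) := fun θ hθ =>
    (hdθ θ).mono' (hcont.comp (by fun_prop :
      Continuous fun ξ : Rd d => (ξ, θ))).aestronglyMeasurable
      (Filter.Eventually.of_forall (hB θ hθ))
  rw [integrable_prod_iff' hcont.aestronglyMeasurable]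
  have hmem : ∀ᵐ θ ∂unitMeasure, θ ∈ Icc (0 : ℝ) 1 := ae_restrict_mem measurableSet_Icc
  refine ⟨hmem.mono hi, ?_⟩
  refine Integrable.of_bound hcont.norm.stronglyMeasurable.integral_prod_left'.aestronglyMeasurable
    (C * ∫ ξ : Rd d, decay ξ) (hmem.mono fun θ hθ => ?_)
  rw [Real.norm_of_nonneg (integral_nonneg fun ζ => norm_nonneg _)]
  refine (integral_mono (hi θ hθ).norm (hdθ θ) (hB θ hθ)).trans (le_of_eq ?_)
  rw [integral_const_mul, integral_sub_right_eq_self (decay (d := d))]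

/-- Symmetrization in the two frequencies reduces the integral of the symbol to radial integrals:
along the segment from `|ξ|²` to `|ξ - η|²` the square can be completed. -/
theorem integral_freqSymbol (hd : 1 ≤ d) {φ : ℝ → ℂ} (hφ : EvenTest φ) {η : Rd d} (hη : η ≠ 0) :
    ∫ ξ, duhamelSymbol φ (freq ξ) (freq (ξ - η)) (freq ξ) =
      (1 / 8) * (((2 * Real.pi) ^ d)⁻¹ : ℝ) * ∫ θ,
        radialInt d (tailMoment (tailMoment φ)) (θ * (1 - θ) * freq η ^ 2) ∂unitMeasure := by
  have : Nonempty (Fin d) := ⟨⟨0, hd⟩⟩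
  obtain ⟨C, hC, hb⟩ := integrable_freqSymbol (d := d) hφ
  -- the substitution `ξ ↦ η - ξ` exchanges the two frequencies
  have hswap : ∀ ξ, duhamelSymbol φ (freq (η - ξ)) (freq (η - ξ - η)) (freq (η - ξ)) =
      duhamelSymbol φ (freq (ξ - η)) (freq ξ) (freq (ξ - η)) := fun ξ => by
    rw [freq_sub_comm η ξ, sub_sub_cancel_left, freq_neg]
  have h1 : ∫ ξ, duhamelSymbol φ (freq ξ) (freq (ξ - η)) (freq ξ) =
      ∫ ξ, duhamelSymbol φ (freq (ξ - η)) (freq ξ) (freq (ξ - η)) := by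
    rw [← integral_sub_left_eq_self _ volume η]
    exact integral_congr_ae (Filter.Eventually.of_forall hswap)
  have hi' : Integrable fun ξ => duhamelSymbol φ (freq (ξ - η)) (freq ξ) (freq (ξ - η)) :=
    ((hb η).1.comp_sub_left η).congr (Filter.Eventually.of_forall hswap)
  have h2 : ∫ ξ, duhamelSymbol φ (freq ξ) (freq (ξ - η)) (freq ξ) =
      (1 / 2) * ∫ ξ, (duhamelSymbol φ (freq ξ) (freq (ξ - η)) (freq ξ) +
        duhamelSymbol φ (freq (ξ - η)) (freq ξ) (freq (ξ - η))) := by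
    rw [integral_add (hb η).1 hi', ← h1]; ring
  have h3 : ∫ ξ, (duhamelSymbol φ (freq ξ) (freq (ξ - η)) (freq ξ) +
        duhamelSymbol φ (freq (ξ - η)) (freq ξ) (freq (ξ - η))) =
      ∫ ξ : Rd d, (1 / 4) * ∫ θ, cosTransform (tailMoment (tailMoment φ))
        (√((1 - θ) * freq ξ ^ 2 + θ * freq (ξ - η) ^ 2)) ∂unitMeasure := by
    refine integral_congr_ae ?_
    have h0 : ∀ᵐ ξ : Rd d, ξ ≠ 0 := Measure.ae_ne _ _
    have h0' : ∀ᵐ ξ : Rd d, ξ ≠ η := Measure.ae_ne _ _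
    filter_upwards [ae_freq_ne hη, h0, h0'] with ξ hξ hξ0 hξη
    exact duhamelSymbol_add_symm hφ (freq_pos hξ0) (freq_pos (sub_ne_zero.2 hξη)) hξ
  rw [h2, h3, integral_const_mul, integral_integral_swap (integrable_segment
    hφ.tailMoment.tailMoment η)]
  have h4 : ∀ θ : ℝ, ∫ ξ : Rd d, cosTransform (tailMoment (tailMoment φ))
      (√((1 - θ) * freq ξ ^ 2 + θ * freq (ξ - η) ^ 2)) = (((2 * Real.pi) ^ d)⁻¹ : ℝ) *
        radialInt d (tailMoment (tailMoment φ)) (θ * (1 - θ) * freq η ^ 2) := fun θ => by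
    simp only [segment_freq]
    rw [integral_sub_right_eq_self (fun ξ : Rd d => cosTransform (tailMoment (tailMoment φ))
      (√(freq ξ ^ 2 + θ * (1 - θ) * freq η ^ 2))), integral_cosTransform_freq]
  simp only [h4]
  rw [integral_const_mul]
  ring

/-- `ν` and `K` represent the trace: the pairing of the trace with a test function is `K` times the
pairing of its weight with cosine transforms of `ν`. -/
structure IsTraceMeasure (d : ℕ) (ν : Measure ℝ) (K : ℝ) : Prop where
  finite : IsFiniteMeasure ν
  ne_zero : K ≠ 0
  le_one : ∀ᵐ u ∂ν, |u| ≤ 1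
  ae_ne : ∃ᵐ u ∂ν, u ≠ 0
  mass : |K| * ν.real univ ≤ ((2 * Real.pi) ^ (d / 2))⁻¹
  eq : ∀ φ : ℝ → ℂ, EvenTest φ → ∀ η : Rd d, η ≠ 0 →
    2 * ∫ ξ, duhamelSymbol φ (freq ξ) (freq (ξ - η)) (freq ξ) =
      K * ∫ t in Ioi (0 : ℝ), traceWeight d φ t * (cosMeasure ν (t * freq η) : ℂ)

/-- The image of `dθ dν(u)` on `[0, 1] × ℝ` under `(θ, u) ↦ √(θ (1 - θ)) u`. -/
def chordMeasure (ν : Measure ℝ) : Measure ℝ :=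
  (unitMeasure.prod ν).map fun p => √(p.1 * (1 - p.1)) * p.2

theorem measurable_chord : Measurable fun p : ℝ × ℝ => √(p.1 * (1 - p.1)) * p.2 :=
  (by fun_prop : Continuous fun p : ℝ × ℝ => √(p.1 * (1 - p.1)) * p.2).measurable

theorem unitMeasure_univ : unitMeasure univ = 1 := by simp [unitMeasure]

theorem cosMeasure_chordMeasure (ν : Measure ℝ) [IsFiniteMeasure ν] (x : ℝ) :
    cosMeasure (chordMeasure ν) x = ∫ θ, cosMeasure ν (x * √(θ * (1 - θ))) ∂unitMeasure := by
  have hc : Continuous fun u : ℝ => Real.cos (x * u) := by fun_prop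
  rw [cosMeasure, chordMeasure, integral_map measurable_chord.aemeasurable hc.aestronglyMeasurable,
    integral_prod (fun p : ℝ × ℝ => Real.cos (x * (√(p.1 * (1 - p.1)) * p.2)))
      (Integrable.of_bound (hc.measurable.comp measurable_chord).aestronglyMeasurable
        1 (Filter.Eventually.of_forall fun p => Real.abs_cos_le_one _))]
  simp only [cosMeasure, mul_assoc]

theorem chord_le_one {θ : ℝ} : √(θ * (1 - θ)) ≤ 1 := by
  rw [Real.sqrt_le_one]
  nlinarith [sq_nonneg (θ - 1 / 2)]

theorem ae_unitMeasure : ∀ᵐ θ ∂unitMeasure, 0 < √(θ * (1 - θ)) := by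
  have h1 : ∀ᵐ θ ∂unitMeasure, θ ∈ Icc (0 : ℝ) 1 := ae_restrict_mem measurableSet_Icc
  have h2 : ∀ᵐ θ ∂unitMeasure, θ ≠ 0 := ae_restrict_of_ae (Measure.ae_ne _ _)
  have h3 : ∀ᵐ θ ∂unitMeasure, θ ≠ 1 := ae_restrict_of_ae (Measure.ae_ne _ _)
  filter_upwards [h1, h2, h3] with θ h1 h2 h3
  exact Real.sqrt_pos.2 (mul_pos (lt_of_le_of_ne h1.1 h2.symm) (sub_pos.2 (lt_of_le_of_ne h1.2 h3)))

theorem integrableOn_traceWeight (d : ℕ) {φ : ℝ → ℂ} (hφ : EvenTest φ) :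
    IntegrableOn (traceWeight d φ) (Ioi 0) := by
  obtain ⟨w, hw, hs, h⟩ := exists_traceWeight_eq d hφ
  exact (hw.integrable_of_hasCompactSupport hs).integrableOn.congr_fun
    (fun t ht => (h t ht).symm) measurableSet_Ioi

/-- Superposition of the kernels at `|η| √(θ (1 - θ))` over the segment `0 ≤ θ ≤ 1`. -/
theorem IsTraceKernel.isTraceMeasure {ν : Measure ℝ} {κ : ℝ} (hd : 1 ≤ d)
    (h : IsTraceKernel d ν κ) :
    IsTraceMeasure d (chordMeasure ν) ((1 / 4) * ((2 * Real.pi) ^ d)⁻¹ * κ) := by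
  have hfin := h.finite
  have hm := measurable_chord
  have hfin' : IsFiniteMeasure (chordMeasure ν) := by unfold chordMeasure; infer_instance
  refine ⟨hfin', ?_, ?_, ?_, ?_, fun φ hφ η hη => ?_⟩
  · have := h.ne_zero
    positivity
  · have hms : MeasurableSet {u : ℝ | |u| ≤ 1} := measurableSet_le (by fun_prop) measurable_const
    rw [chordMeasure, ae_map_iff hm.aemeasurable hms]
    filter_upwards [Measure.quasiMeasurePreserving_snd.ae h.le_one] with p hp
    rw [abs_mul, abs_of_nonneg (Real.sqrt_nonneg _)]
    exact mul_le_one₀ chord_le_one (abs_nonneg _) hp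
  · intro hne
    simp only [ne_eq, not_not] at hne
    have hms : MeasurableSet {u : ℝ | u = 0} := measurableSet_singleton 0
    rw [chordMeasure, ae_map_iff hm.aemeasurable hms] at hne
    have h1 : ∀ᵐ θ ∂unitMeasure, ∀ᵐ u ∂ν, √(θ * (1 - θ)) * u = 0 := Measure.ae_ae_of_ae_prod hne
    have hne0 : (ae unitMeasure).NeBot := by
      rw [ae_neBot]
      intro h0
      have := unitMeasure_univ
      rw [h0] at this
      simp at this
    -- if `√(θ (1 - θ)) u` vanished almost everywhere, so would `u`, on some fibre `0 < θ < 1`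
    obtain ⟨θ, h2, h3⟩ := (h1.and ae_unitMeasure).exists
    exact h.ae_ne (h2.mono fun u hu => by simpa [h3.ne'] using hu)
  · have hmass : (chordMeasure ν).real univ = ν.real univ := by
      rw [Measure.real, Measure.real, chordMeasure, Measure.map_apply hm MeasurableSet.univ,
        preimage_univ, ← univ_prod_univ, Measure.prod_prod, unitMeasure_univ, one_mul]
    have h1 := h.mass
    -- of the `d` factors `(2π)⁻¹` of the Fourier transform, the mass of `κ ν` uses up `d - ⌊d/2⌋`
    have h2 : (2 * Real.pi) ^ d = (2 * Real.pi) ^ (d - d / 2) * (2 * Real.pi) ^ (d / 2) := by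
      rw [← pow_add]; congr 1; omega
    rw [hmass, abs_mul, abs_of_pos (by positivity : (0 : ℝ) < 1 / 4 * ((2 * Real.pi) ^ d)⁻¹)]
    calc _ = (1 / 4 * ((2 * Real.pi) ^ d)⁻¹) * (|κ| * ν.real univ) := by ring
      _ ≤ (1 / 4 * ((2 * Real.pi) ^ d)⁻¹) * (4 * (2 * Real.pi) ^ (d - d / 2)) := by gcongr
      _ = _ := by
        rw [h2]
        have : (2 * Real.pi) ^ (d - d / 2) ≠ 0 := by positivity
        field_simp
  · have hw := integrableOn_traceWeight d hφ
    have hcc := continuous_cosMeasure ν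
    have h1 : ∫ θ, radialInt d (tailMoment (tailMoment φ)) (θ * (1 - θ) * freq η ^ 2) ∂unitMeasure =
        ∫ θ, (κ * ∫ t in Ioi (0 : ℝ), traceWeight d φ t *
          (cosMeasure ν (t * freq η * √(θ * (1 - θ))) : ℂ)) ∂unitMeasure := by
      have hmem : ∀ᵐ θ ∂unitMeasure, θ ∈ Icc (0 : ℝ) 1 := ae_restrict_mem measurableSet_Icc
      refine integral_congr_ae (hmem.mono fun θ hθ => ?_)
      have h2 := h.eq φ hφ (freq η * √(θ * (1 - θ)))
      rw [mul_pow, Real.sq_sqrt (mul_nonneg hθ.1 (by linarith [hθ.2])), mul_comm (freq η ^ 2)] at h2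
      simp only [← mul_assoc] at h2
      exact h2
    have hi : Integrable (Function.uncurry fun (θ t : ℝ) => traceWeight d φ t *
        (cosMeasure ν (t * freq η * √(θ * (1 - θ))) : ℂ))
        (unitMeasure.prod (volume.restrict (Ioi 0))) := by
      refine ((integrable_const (1 : ℂ)).mul_prod hw).mul_bdd (c := ν.real univ)
        (g := fun p => (cosMeasure ν (p.2 * freq η * √(p.1 * (1 - p.1))) : ℂ))
        (Continuous.aestronglyMeasurable (by fun_prop))
        (Filter.Eventually.of_forall fun p => ?_) |>.congr
          (Filter.Eventually.of_forall fun p => by simp [Function.uncurry])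
      rw [Complex.norm_real]
      exact abs_cosMeasure_le _ _
    rw [integral_freqSymbol hd hφ hη, h1, integral_const_mul, integral_integral_swap hi]
    simp only [integral_const_mul, cosMeasure_chordMeasure, integral_complex_ofReal]
    push_cast
    ring

theorem exists_isTraceMeasure (hd : 1 ≤ d) : ∃ ν K, IsTraceMeasure d ν K := by
  obtain ⟨ν, κ, h⟩ := exists_isTraceKernel d hd
  exact ⟨_, _, h.isTraceMeasure hd⟩

/-- The density `a` of the trace formula, for a potential with Fourier transform `v`. -/
def traceDensity (ν : Measure ℝ) (K : ℝ) (v : Rd d → ℂ) (t : ℝ) : ℂ :=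
  K * ∫ η, v η * v (-η) * (cosMeasure ν (t * freq η) : ℂ)

theorem IsPotentialTransform.integrable_mul_neg {v : Rd d → ℂ} (hv : IsPotentialTransform v) :
    Integrable fun η => v η * v (-η) := by
  have := hv.integrable_mul 0 0
  simp only [zero_sub, sub_zero] at this
  exact this.congr (Filter.Eventually.of_forall fun η => mul_comm _ _)

/-- The trace of the smeared second Duhamel term, as a pairing with `traceDensity`. -/
theorem IsTraceMeasure.trace_eq {ν : Measure ℝ} {K : ℝ} (hd : 1 ≤ d) (h : IsTraceMeasure d ν K)
    {φ : ℝ → ℂ} (hφ : EvenTest φ) {v : Rd d → ℂ} (hv : IsPotentialTransform v) :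
    2 * ∫ ξ, ∫ ζ, v (ξ - ζ) * v (ζ - ξ) * duhamelSymbol φ (freq ξ) (freq ζ) (freq ξ) =
      ∫ t in Ioi (0 : ℝ), traceWeight d φ t * traceDensity ν K v t := by
  have : Nonempty (Fin d) := ⟨⟨0, hd⟩⟩
  have hfin := h.finite
  have hF := hv.integrable_mul_neg
  have hw := integrableOn_traceWeight d hφ
  have hcc := continuous_cosMeasure ν
  have hfr := continuous_freq (d := d)
  have h0 : ∀ᵐ η : Rd d, η ≠ 0 := Measure.ae_ne _ _
  have h1 : ∫ η, v η * v (-η) * ∫ ξ, duhamelSymbol φ (freq ξ) (freq (ξ - η)) (freq ξ) =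
      ∫ η, ∫ t in Ioi (0 : ℝ), K / 2 * (v η * v (-η) * (traceWeight d φ t *
        (cosMeasure ν (t * freq η) : ℂ))) := by
    refine integral_congr_ae (h0.mono fun η hη => ?_)
    simp only [integral_const_mul]
    linear_combination (v η * v (-η) / 2) * h.eq φ hφ η hη
  have hi : Integrable (Function.uncurry fun (η : Rd d) (t : ℝ) => K / 2 * (v η * v (-η) *
      (traceWeight d φ t * (cosMeasure ν (t * freq η) : ℂ))))
      (volume.prod (volume.restrict (Ioi 0))) := by
    refine (((hF.mul_prod hw).mul_bdd (c := ν.real univ)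
      (g := fun p : Rd d × ℝ => (cosMeasure ν (p.2 * freq p.1) : ℂ))
      (Continuous.aestronglyMeasurable (by fun_prop))
      (Filter.Eventually.of_forall fun p => ?_)).const_mul (K / 2 : ℂ)).congr
        (Filter.Eventually.of_forall fun p => by simp only [Function.uncurry]; ring)
    rw [Complex.norm_real]
    exact abs_cosMeasure_le _ _
  rw [integral_mul_freqSymbol hφ hv, h1, integral_integral_swap hi, ← integral_const_mul]
  congr 1; funext t
  rw [integral_const_mul, traceDensity]
  have : ∀ η, v η * v (-η) * (traceWeight d φ t * (cosMeasure ν (t * freq η) : ℂ)) =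
      traceWeight d φ t * (v η * v (-η) * (cosMeasure ν (t * freq η) : ℂ)) := fun η => by ring
  simp only [this]
  rw [integral_const_mul]
  ring

end TraceEvaluation

/-! ### Smoothness of the trace density -/

section CosineIntegral

variable {X : Type*} [MeasurableSpace X] {μ : Measure X} {h : X → ℂ} {ω₀ : X → ℝ}

/-- `∫ h(x) cos(t ω(x) + k π / 2) dμ(x)`; the shift of the phase records derivatives. -/
def cosIntegral (μ : Measure X) (h : X → ℂ) (ω₀ : X → ℝ) (k : ℕ) (t : ℝ) : ℂ :=
  ∫ x, h x * (Real.cos (t * ω₀ x + k * (Real.pi / 2)) : ℂ) ∂μ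

theorem integrable_cosIntegrand (hh : Integrable h μ) (hω : Measurable ω₀) (k : ℕ) (t : ℝ) :
    Integrable (fun x => h x * (Real.cos (t * ω₀ x + k * (Real.pi / 2)) : ℂ)) μ :=
  hh.mul_bdd (c := 1) (Measurable.aestronglyMeasurable (by fun_prop))
    (Filter.Eventually.of_forall fun x => by
      rw [Complex.norm_real]; exact Real.abs_cos_le_one _)

theorem continuous_cosIntegral (hh : Integrable h μ) (hω : Measurable ω₀) (k : ℕ) :
    Continuous (cosIntegral μ h ω₀ k) := by
  refine continuous_of_dominated (bound := fun x => ‖h x‖)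
    (fun t => (integrable_cosIntegrand hh hω k t).aestronglyMeasurable)
    (fun t => Filter.Eventually.of_forall fun x => ?_) hh.norm
    (Filter.Eventually.of_forall fun x => by fun_prop)
  rw [norm_mul, Complex.norm_real]
  exact mul_le_of_le_one_right (norm_nonneg _) (Real.abs_cos_le_one _)

/-- A derivative in `t` brings down the frequency and shifts the phase by `π / 2`. -/
theorem hasDerivAt_cosIntegral (hh : Integrable h μ) (hh' : Integrable (fun x => h x * ω₀ x) μ)
    (hω : Measurable ω₀) (k : ℕ) (t : ℝ) :
    HasDerivAt (cosIntegral μ h ω₀ k) (cosIntegral μ (fun x => h x * ω₀ x) ω₀ (k + 1) t) t := by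
  refine (hasDerivAt_integral_of_dominated_loc_of_deriv_le (bound := fun x => ‖h x * ω₀ x‖)
    (F' := fun t x => h x * ω₀ x * (Real.cos (t * ω₀ x + (k + 1 : ℕ) * (Real.pi / 2)) : ℂ))
    Filter.univ_mem
    (Filter.Eventually.of_forall fun t => (integrable_cosIntegrand hh hω k t).aestronglyMeasurable)
    (integrable_cosIntegrand hh hω k t)
    (integrable_cosIntegrand hh' hω (k + 1) t).aestronglyMeasurable
    (Filter.Eventually.of_forall fun x s _ => ?_) hh'.norm
    (Filter.Eventually.of_forall fun x s _ => ?_)).2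
  · rw [norm_mul, Complex.norm_real]
    exact mul_le_of_le_one_right (norm_nonneg _) (Real.abs_cos_le_one _)
  · have h1 : HasDerivAt (fun s : ℝ => s * ω₀ x + k * (Real.pi / 2)) (ω₀ x) s := by
      simpa using ((hasDerivAt_id s).mul_const (ω₀ x)).add_const (k * (Real.pi / 2))
    have h2 := (h1.cos.ofReal_comp).const_mul (h x)
    refine h2.congr_deriv ?_
    have h3 : Real.cos (s * ω₀ x + (k + 1 : ℕ) * (Real.pi / 2)) =
        -Real.sin (s * ω₀ x + k * (Real.pi / 2)) := by
      rw [← Real.cos_add_pi_div_two]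
      congr 1; push_cast; ring
    rw [h3]
    push_cast; ring

theorem contDiff_cosIntegral (hω : Measurable ω₀) (n : ℕ) : ∀ (k : ℕ) (h : X → ℂ),
    (∀ j ≤ n, Integrable (fun x => h x * (ω₀ x : ℂ) ^ j) μ) →
    ContDiff ℝ n (cosIntegral μ h ω₀ k) ∧ ∀ j ≤ n, iteratedDeriv j (cosIntegral μ h ω₀ k) =
      cosIntegral μ (fun x => h x * (ω₀ x : ℂ) ^ j) ω₀ (k + j) := by
  induction n with
  | zero =>
    intro k h hh
    have h0 : Integrable h μ := by simpa using hh 0 le_rfl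
    refine ⟨by simpa [contDiff_zero] using continuous_cosIntegral h0 hω k, fun j hj => ?_⟩
    obtain rfl : j = 0 := by omega
    simp
  | succ n ih =>
    intro k h hh
    have h0 : Integrable h μ := by simpa using hh 0 (by omega)
    have h1 : Integrable (fun x => h x * ω₀ x) μ := by simpa using hh 1 (by omega)
    have hd := hasDerivAt_cosIntegral h0 h1 hω k
    have hderiv : deriv (cosIntegral μ h ω₀ k) =
        cosIntegral μ (fun x => h x * ω₀ x) ω₀ (k + 1) := funext fun t => (hd t).deriv
    obtain ⟨i1, i2⟩ := ih (k + 1) (fun x => h x * ω₀ x) fun j hj => by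
      have := hh (j + 1) (by omega)
      refine this.congr (Filter.Eventually.of_forall fun x => ?_)
      simp only [pow_succ]; ring
    refine ⟨?_, fun j hj => ?_⟩
    · push_cast
      rw [contDiff_succ_iff_deriv]
      exact ⟨fun t => (hd t).differentiableAt, by simp, hderiv ▸ i1⟩
    · rcases j with _ | j
      · simp
      · rw [iteratedDeriv_succ', hderiv, i2 j (by omega)]
        congr 1
        · funext x; ring
        · omega

theorem norm_cosIntegral_le (hh : Integrable h μ) (k : ℕ) (t : ℝ) :
    ‖cosIntegral μ h ω₀ k t‖ ≤ ∫ x, ‖h x‖ ∂μ :=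
  norm_integral_le_of_norm_le hh.norm (Filter.Eventually.of_forall fun x => by
    rw [norm_mul, Complex.norm_real]
    exact mul_le_of_le_one_right (norm_nonneg _) (Real.abs_cos_le_one _))

end CosineIntegral

section TraceDensity

variable {d : ℕ} {ν : Measure ℝ} {K : ℝ} {v : Rd d → ℂ}

/-- The frequency of the oscillation in time attached to `(ξ, u)`. -/
def chordFreq (x : Rd d × ℝ) : ℝ := freq x.1 * x.2

theorem continuous_chordFreq : Continuous (chordFreq : Rd d × ℝ → ℝ) := by
  have := continuous_freq (d := d)
  unfold chordFreq
  fun_prop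

theorem traceDensity_eq_cosIntegral [IsFiniteMeasure ν] (hF : Integrable fun η => v η * v (-η)) :
    traceDensity ν K v = cosIntegral ((volume : Measure (Rd d)).prod ν)
      (fun x => K * (v x.1 * v (-x.1))) chordFreq 0 := by
  have hm := (continuous_chordFreq (d := d)).measurable
  funext t
  have h1 : Integrable (fun x : Rd d × ℝ => K * (v x.1 * v (-x.1)))
      ((volume : Measure (Rd d)).prod ν) := (hF.comp_fst ν).const_mul _
  rw [cosIntegral, integral_prod _ (integrable_cosIntegrand h1 hm 0 t), traceDensity,
    ← integral_const_mul]
  congr 1; funext η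
  simp only [chordFreq, Nat.cast_zero, zero_mul, add_zero]
  rw [integral_const_mul, integral_complex_ofReal, cosMeasure]
  simp only [mul_assoc]

theorem norm_mul_neg_le (v : Rd d → ℂ) (η : Rd d) :
    ‖v η * v (-η)‖ ≤ (1 / 2) * (‖v η‖ ^ 2 + ‖v (-η)‖ ^ 2) := by
  rw [norm_mul]
  nlinarith [sq_nonneg (‖v η‖ - ‖v (-η)‖)]

/-- The product `v(η) v(-η)` is controlled by the mean of `|v(η)|²` and `|v(-η)|²`. -/
theorem integral_weighted_mul_neg {m : ℕ} (hvc : Continuous v)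
    (hm : Integrable fun η => (1 + freq η ^ 2) ^ m * ‖v η‖ ^ 2) :
    Integrable (fun η => (1 + freq η ^ 2) ^ m * ‖v η * v (-η)‖) ∧
      ∫ η, (1 + freq η ^ 2) ^ m * ‖v η * v (-η)‖ ≤ ∫ η, (1 + freq η ^ 2) ^ m * ‖v η‖ ^ 2 := by
  have hfr := continuous_freq (d := d)
  have hm' : Integrable fun η => (1 + freq η ^ 2) ^ m * ‖v (-η)‖ ^ 2 := by
    refine hm.comp_neg.congr (Filter.Eventually.of_forall fun η => ?_)
    simp only [freq_neg]
  have hB : Integrable fun η => (1 / 2) * ((1 + freq η ^ 2) ^ m * ‖v η‖ ^ 2 +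
      (1 + freq η ^ 2) ^ m * ‖v (-η)‖ ^ 2) := (hm.add hm').const_mul _
  have hle : ∀ η, (1 + freq η ^ 2) ^ m * ‖v η * v (-η)‖ ≤ (1 / 2) *
      ((1 + freq η ^ 2) ^ m * ‖v η‖ ^ 2 + (1 + freq η ^ 2) ^ m * ‖v (-η)‖ ^ 2) := fun η => by
    have := mul_le_mul_of_nonneg_left (norm_mul_neg_le v η)
      (by positivity : 0 ≤ (1 + freq η ^ 2) ^ m)
    linarith
  have hi : Integrable (fun η => (1 + freq η ^ 2) ^ m * ‖v η * v (-η)‖) :=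
    hB.mono' (Continuous.aestronglyMeasurable (by fun_prop)) (Filter.Eventually.of_forall fun η => by
      rw [Real.norm_of_nonneg (by positivity)]
      exact hle η)
  refine ⟨hi, (integral_mono hi hB hle).trans (le_of_eq ?_)⟩
  have h1 : ∫ η, (1 + freq η ^ 2) ^ m * ‖v (-η)‖ ^ 2 = ∫ η, (1 + freq η ^ 2) ^ m * ‖v η‖ ^ 2 := by
    rw [← integral_neg_eq_self (fun η => (1 + freq η ^ 2) ^ m * ‖v η‖ ^ 2)]
    simp only [freq_neg]
  rw [integral_const_mul, integral_add hm hm', h1]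
  ring

theorem freq_pow_le (η : Rd d) {j m : ℕ} (hj : j ≤ 2 * m) :
    freq η ^ j ≤ (1 + freq η ^ 2) ^ m := by
  have h0 := freq_nonneg η
  have h1 : 1 ≤ √(1 + freq η ^ 2) := Real.one_le_sqrt.2 (by nlinarith [sq_nonneg (freq η)])
  have h2 : freq η ≤ √(1 + freq η ^ 2) := Real.le_sqrt_of_sq_le (by linarith)
  calc freq η ^ j ≤ √(1 + freq η ^ 2) ^ j := pow_le_pow_left₀ h0 h2 j
    _ ≤ √(1 + freq η ^ 2) ^ (2 * m) := pow_le_pow_right₀ h1 hj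
    _ = _ := by rw [pow_mul, Real.sq_sqrt (by positivity)]

/-- The moments of the trace density up to twice the order of regularity. -/
theorem IsTraceMeasure.integrable_moment (h : IsTraceMeasure d ν K) (hvc : Continuous v) {m : ℕ}
    (hm : Integrable fun η => (1 + freq η ^ 2) ^ m * ‖v η‖ ^ 2) {j : ℕ} (hj : j ≤ 2 * m) :
    Integrable (fun x : Rd d × ℝ => K * (v x.1 * v (-x.1)) * (chordFreq x : ℂ) ^ j)
        ((volume : Measure (Rd d)).prod ν) ∧
      ∫ x : Rd d × ℝ, ‖K * (v x.1 * v (-x.1)) * (chordFreq x : ℂ) ^ j‖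
        ∂((volume : Measure (Rd d)).prod ν) ≤
        |K| * ν.real univ * ∫ η, (1 + freq η ^ 2) ^ m * ‖v η‖ ^ 2 := by
  have hfin := h.finite
  obtain ⟨hi, hle⟩ := integral_weighted_mul_neg hvc hm
  have hcf := continuous_chordFreq (d := d)
  have hb : ∀ᵐ x ∂((volume : Measure (Rd d)).prod ν),
      ‖K * (v x.1 * v (-x.1)) * (chordFreq x : ℂ) ^ j‖ ≤
        |K| * ((1 + freq x.1 ^ 2) ^ m * ‖v x.1 * v (-x.1)‖) := by
    filter_upwards [Measure.quasiMeasurePreserving_snd.ae h.le_one] with x hx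
    have h1 : |chordFreq x| ≤ freq x.1 := by
      rw [chordFreq, abs_mul, abs_of_nonneg (freq_nonneg _)]
      exact mul_le_of_le_one_right (freq_nonneg _) hx
    have h2 : |chordFreq x| ^ j ≤ (1 + freq x.1 ^ 2) ^ m :=
      (pow_le_pow_left₀ (abs_nonneg _) h1 j).trans (freq_pow_le _ hj)
    rw [norm_mul, norm_mul (K : ℂ), norm_pow, Complex.norm_real, Complex.norm_real,
      Real.norm_eq_abs, Real.norm_eq_abs]
    calc _ ≤ |K| * ‖v x.1 * v (-x.1)‖ * (1 + freq x.1 ^ 2) ^ m := by gcongr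
      _ = _ := by ring
  have hB : Integrable (fun x : Rd d × ℝ => |K| * ((1 + freq x.1 ^ 2) ^ m * ‖v x.1 * v (-x.1)‖))
      ((volume : Measure (Rd d)).prod ν) := (hi.comp_fst ν).const_mul _
  have hI : Integrable (fun x : Rd d × ℝ => K * (v x.1 * v (-x.1)) * (chordFreq x : ℂ) ^ j)
        ((volume : Measure (Rd d)).prod ν) :=
    hB.mono' (Continuous.aestronglyMeasurable (by fun_prop)) hb
  refine ⟨hI, (integral_mono_ae hI.norm hB hb).trans ?_⟩
  rw [integral_const_mul, integral_fun_fst (fun η : Rd d => (1 + freq η ^ 2) ^ m * ‖v η * v (-η)‖),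
    smul_eq_mul, mul_assoc]
  gcongr

/-- If `V ∈ H^m`, the trace density extends to an even function of class `C^{2m}`. -/
theorem IsTraceMeasure.contDiff_traceDensity (h : IsTraceMeasure d ν K)
    (hv : IsPotentialTransform v) {m : ℕ}
    (hm : Integrable fun η => (1 + freq η ^ 2) ^ m * ‖v η‖ ^ 2) :
    ContDiff ℝ (2 * m : ℕ) (traceDensity ν K v) ∧ ∀ j ≤ 2 * m,
      iteratedDeriv j (traceDensity ν K v) = cosIntegral ((volume : Measure (Rd d)).prod ν)
        (fun x => K * (v x.1 * v (-x.1)) * (chordFreq x : ℂ) ^ j) chordFreq j := by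
  have hfin := h.finite
  rw [traceDensity_eq_cosIntegral hv.integrable_mul_neg]
  have := contDiff_cosIntegral (continuous_chordFreq (d := d)).measurable (2 * m) 0
    (fun x => K * (v x.1 * v (-x.1))) fun j hj => (h.integrable_moment hv.continuous hm hj).1
  simpa only [zero_add] using this

theorem continuous_traceDensity [IsFiniteMeasure ν] (hv : IsPotentialTransform v) :
    Continuous (traceDensity ν K v) := by
  rw [traceDensity_eq_cosIntegral hv.integrable_mul_neg]
  exact continuous_cosIntegral ((hv.integrable_mul_neg.comp_fst ν).const_mul _)
    continuous_chordFreq.measurable 0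

theorem IsTraceMeasure.norm_iteratedDeriv_le (h : IsTraceMeasure d ν K)
    (hv : IsPotentialTransform v) {m : ℕ}
    (hm : Integrable fun η => (1 + freq η ^ 2) ^ m * ‖v η‖ ^ 2) {j : ℕ} (hj : j ≤ 2 * m) (t : ℝ) :
    ‖iteratedDeriv j (traceDensity ν K v) t‖ ≤
      |K| * ν.real univ * ∫ η, (1 + freq η ^ 2) ^ m * ‖v η‖ ^ 2 := by
  obtain ⟨h1, h2⟩ := h.integrable_moment hv.continuous hm hj
  rw [(h.contDiff_traceDensity hv hm).2 j hj]
  exact (norm_cosIntegral_le h1 j t).trans h2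

theorem IsTraceMeasure.norm_traceDensity_le (h : IsTraceMeasure d ν K)
    (hv : IsPotentialTransform v) (t : ℝ) :
    ‖traceDensity ν K v t‖ ≤ ((2 * Real.pi) ^ (d / 2))⁻¹ * ∫ η, ‖v η‖ ^ 2 := by
  have := h.norm_iteratedDeriv_le hv (m := 0) (by simpa using hv.integrable_sq) le_rfl t
  simp only [pow_zero, one_mul] at this
  exact this.trans (mul_le_mul_of_nonneg_right h.mass (integral_nonneg fun η => by positivity))

/-- At `t = 0` and for odd `j` the phase is an odd multiple of `π / 2`. -/
theorem IsTraceMeasure.iteratedDeriv_odd (h : IsTraceMeasure d ν K)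
    (hv : IsPotentialTransform v) {m : ℕ}
    (hm : Integrable fun η => (1 + freq η ^ 2) ^ m * ‖v η‖ ^ 2) {j : ℕ} (hj : j ≤ 2 * m)
    (ho : Odd j) : iteratedDeriv j (traceDensity ν K v) 0 = 0 := by
  obtain ⟨k, rfl⟩ := ho
  have hc : Real.cos ((2 * k + 1 : ℕ) * (Real.pi / 2)) = 0 :=
    Real.cos_eq_zero_iff.2 ⟨k, by push_cast; ring⟩
  rw [(h.contDiff_traceDensity hv hm).2 _ hj, cosIntegral]
  simp only [zero_mul, zero_add, hc, Complex.ofReal_zero, mul_zero, integral_zero]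

/-- The factor relating the Taylor coefficients of the trace density to the homogeneous Sobolev
norms. -/
def taylorFactor (ν : Measure ℝ) (K : ℝ) (j : ℕ) : ℝ := (-1) ^ j * K * ∫ u, u ^ (2 * j) ∂ν

theorem IsTraceMeasure.integrable_pow (h : IsTraceMeasure d ν K) (j : ℕ) :
    Integrable (fun u : ℝ => u ^ j) ν := by
  have := h.finite
  refine Integrable.of_bound (by fun_prop : Continuous fun u : ℝ => u ^ j).aestronglyMeasurable 1
    (h.le_one.mono fun u hu => ?_)
  rw [norm_pow]
  exact pow_le_one₀ (norm_nonneg _) hu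

theorem IsTraceMeasure.taylorFactor_ne_zero (h : IsTraceMeasure d ν K) (j : ℕ) :
    taylorFactor ν K j ≠ 0 := by
  refine mul_ne_zero (mul_ne_zero (by simp) h.ne_zero) ?_
  have h0 : ∀ u : ℝ, 0 ≤ u ^ (2 * j) := fun u => by rw [pow_mul]; positivity
  intro hz
  rw [integral_eq_zero_iff_of_nonneg h0 (h.integrable_pow _)] at hz
  exact h.ae_ne (hz.mono fun u hu => by
    have hu' : u ^ (2 * j) = 0 := hu
    simpa using eq_zero_of_pow_eq_zero hu')

theorem IsTraceMeasure.iteratedDeriv_even (h : IsTraceMeasure d ν K)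
    (hv : IsPotentialTransform v) {m : ℕ}
    (hm : Integrable fun η => (1 + freq η ^ 2) ^ m * ‖v η‖ ^ 2) {j : ℕ} (hj : j ≤ m)
    (hreal : ∀ η, v η * v (-η) = ((‖v η‖ ^ 2 : ℝ) : ℂ)) :
    iteratedDeriv (2 * j) (traceDensity ν K v) 0 =
      ((taylorFactor ν K j * ∫ η, freq η ^ (2 * j) * ‖v η‖ ^ 2 : ℝ) : ℂ) := by
  have hfin := h.finite
  have hc : Real.cos ((2 * j : ℕ) * (Real.pi / 2)) = (-1) ^ j := by
    rw [← Real.cos_nat_mul_pi]; congr 1; push_cast; ring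
  rw [(h.contDiff_traceDensity hv hm).2 _ (by omega), cosIntegral]
  simp only [zero_mul, zero_add, hc, hreal, chordFreq]
  have h1 : ∀ x : Rd d × ℝ, (K : ℂ) * ((‖v x.1‖ ^ 2 : ℝ) : ℂ) *
      ((freq x.1 * x.2 : ℝ) : ℂ) ^ (2 * j) * (((-1) ^ j : ℝ) : ℂ) =
      (((-1) ^ j * K * ((freq x.1 ^ (2 * j) * ‖v x.1‖ ^ 2) * x.2 ^ (2 * j)) : ℝ) : ℂ) := fun x => by
    push_cast; ring
  simp only [h1]
  rw [integral_complex_ofReal, integral_const_mul, integral_prod_mul (fun η : Rd d =>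
    freq η ^ (2 * j) * ‖v η‖ ^ 2) (fun u : ℝ => u ^ (2 * j)), taylorFactor]
  congr 1
  ring

end TraceDensity

/-! ### Regularity of the potential from the expansion of the trace density -/

section Converse

open Filter Finset in
/-- Central differences of the cosine. -/
theorem sum_choose_mul_cos (m : ℕ) (x : ℝ) :
    ∑ k ∈ range (2 * m + 1), ((-1 : ℝ) ^ (2 * m - k) * (2 * m).choose k) *
      Real.cos ((k - m) * x) = (2 * Real.cos x - 2) ^ m := by
  have he : Complex.exp (x * Complex.I) * Complex.exp (-(x * Complex.I)) = 1 := by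
    rw [← Complex.exp_add, add_neg_cancel, Complex.exp_zero]
  have h1 : (((2 * Real.cos x - 2) ^ m : ℝ) : ℂ) =
      (Complex.exp (x * Complex.I) + (-1)) ^ (2 * m) * Complex.exp (-(x * Complex.I)) ^ m := by
    push_cast
    rw [pow_mul, ← mul_pow, Complex.cos]
    congr 1
    rw [neg_mul]
    linear_combination (Complex.exp (x * Complex.I) - 2) * (-he)
  have h2 : (((2 * Real.cos x - 2) ^ m : ℝ) : ℂ) = ∑ k ∈ range (2 * m + 1),
      (((-1 : ℝ) ^ (2 * m - k) * (2 * m).choose k : ℝ) : ℂ) *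
        Complex.exp ((((k - m) * x : ℝ) : ℂ) * Complex.I) := by
    rw [h1, add_pow, sum_mul]
    refine sum_congr rfl fun k _ => ?_
    have h3 : Complex.exp ((((k - m) * x : ℝ) : ℂ) * Complex.I) =
        Complex.exp (x * Complex.I) ^ k * Complex.exp (-(x * Complex.I)) ^ m := by
      rw [← Complex.exp_nat_mul, ← Complex.exp_nat_mul, ← Complex.exp_add]
      congr 1; push_cast; ring
    rw [h3]; push_cast; ring
  have h4 := congrArg Complex.re h2
  rw [Complex.ofReal_re, Complex.re_sum] at h4
  rw [h4]
  refine sum_congr rfl fun k _ => ?_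
  rw [Complex.re_ofReal_mul, Complex.exp_ofReal_mul_I_re]

open Finset in
/-- Central differences of order `2 m` annihilate the monomials of lower degree. -/
theorem sum_choose_mul_pow {j m : ℕ} (hj : j < m) :
    ∑ k ∈ range (2 * m + 1), ((-1 : ℂ) ^ (2 * m - k) * (2 * m).choose k) *
      ((k : ℂ) - m) ^ (2 * j) = 0 := by
  have h := congrFun (fwdDiff_iter_pow_eq_zero_of_lt (R := ℂ) (by omega : 2 * j < 2 * m)) (-(m : ℂ))
  rw [fwdDiff_iter_eq_sum_shift, Pi.zero_apply] at h
  rw [← h]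
  refine sum_congr rfl fun k _ => ?_
  rw [zsmul_eq_mul, nsmul_eq_mul, mul_one]
  push_cast
  rw [neg_add_eq_sub]

variable {X : Type*} [MeasurableSpace X] {μ : Measure X}

/-- Fatou's lemma, as a criterion of integrability. -/
theorem integrable_of_tendsto_of_integral_le {f : ℕ → X → ℝ} {g : X → ℝ} {C : ℝ}
    (hf : ∀ n, Integrable (f n) μ) (h0 : ∀ n x, 0 ≤ f n x) (hC : ∀ n, ∫ x, f n x ∂μ ≤ C)
    (hlim : ∀ x, Filter.Tendsto (fun n => f n x) Filter.atTop (𝓝 (g x))) : Integrable g μ := by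
  have hg0 : ∀ x, 0 ≤ g x := fun x => ge_of_tendsto' (hlim x) fun n => h0 n x
  refine ⟨aestronglyMeasurable_of_tendsto_ae _ (fun n => (hf n).aestronglyMeasurable)
    (Filter.Eventually.of_forall hlim), ?_⟩
  rw [hasFiniteIntegral_iff_ofReal (Filter.Eventually.of_forall hg0)]
  have h1 : ∀ x, ENNReal.ofReal (g x) =
      Filter.liminf (fun n => ENNReal.ofReal (f n x)) Filter.atTop := fun x =>
    ((ENNReal.continuous_ofReal.tendsto _).comp (hlim x)).liminf_eq.symm
  simp only [h1]
  refine (lintegral_liminf_le' fun n =>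
    (hf n).aestronglyMeasurable.aemeasurable.ennreal_ofReal).trans_lt ?_
  refine lt_of_le_of_lt
    (Filter.liminf_le_of_frequently_le' (Filter.Frequently.of_forall fun n => ?_))
    (ENNReal.ofReal_lt_top (r := C))
  rw [← ofReal_integral_eq_lintegral_ofReal (hf n) (Filter.Eventually.of_forall (h0 n))]
  exact ENNReal.ofReal_le_ofReal (hC n)

/-- The symbol of the second central difference, divided by `t²`, is continuous up to `t = 0`. -/
theorem sq_mul_sinc (t r : ℝ) :
    (t * (r * Real.sinc (t * r / 2))) ^ 2 = 2 - 2 * Real.cos (t * r) := by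
  have h1 : t * r / 2 * Real.sinc (t * r / 2) = Real.sin (t * r / 2) := by
    by_cases h : t * r / 2 = 0
    · simp [h]
    · rw [Real.sinc_of_ne_zero h, mul_div_cancel₀ _ h]
  have h2 : Real.cos (t * r) = 1 - 2 * Real.sin (t * r / 2) ^ 2 := by
    have := Real.cos_sq (t * r / 2)
    rw [mul_div_cancel₀ (t * r) two_ne_zero] at this
    have := Real.sin_sq_add_cos_sq (t * r / 2)
    linarith
  rw [h2, ← h1]; ring

variable {w : X → ℝ} {ω₀ : X → ℝ} {K : ℝ}

open Finset in
/-- Central differences of a cosine integral. -/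
theorem sum_choose_mul_cosIntegral (hw : Integrable w μ) (hω : Measurable ω₀) (m : ℕ) (t : ℝ) :
    ∑ k ∈ range (2 * m + 1), ((-1 : ℂ) ^ (2 * m - k) * (2 * m).choose k) *
      cosIntegral μ (fun x => (K : ℂ) * (w x : ℂ)) ω₀ 0 (((k : ℝ) - m) * t) =
      (((-1) ^ m * K * ∫ x, w x * (2 - 2 * Real.cos (t * ω₀ x)) ^ m ∂μ : ℝ) : ℂ) := by
  have hw' : Integrable (fun x => (K : ℂ) * (w x : ℂ)) μ := hw.ofReal.const_mul _
  simp only [cosIntegral]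
  simp_rw [← integral_const_mul]
  rw [← integral_finsetSum _ fun k _ => (integrable_cosIntegrand hw' hω 0 _).const_mul _,
    ← integral_complex_ofReal]
  congr 1; funext x
  have h := sum_choose_mul_cos m (t * ω₀ x)
  have h2 : (2 - 2 * Real.cos (t * ω₀ x)) ^ m = (-1) ^ m * (2 * Real.cos (t * ω₀ x) - 2) ^ m := by
    rw [← mul_pow]; congr 1; ring
  have h3 : ((-1 : ℝ) ^ m) * (-1) ^ m = 1 := by rw [← mul_pow]; simp
  have h4 : (-1) ^ m * K * (w x * (2 - 2 * Real.cos (t * ω₀ x)) ^ m) =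
      K * w x * ∑ k ∈ range (2 * m + 1), ((-1 : ℝ) ^ (2 * m - k) * (2 * m).choose k) *
      Real.cos ((k - m) * (t * ω₀ x)) := by
    rw [h, h2]; linear_combination (K * w x * (2 * Real.cos (t * ω₀ x) - 2) ^ m) * h3
  rw [h4, mul_sum]
  push_cast
  refine sum_congr rfl fun k _ => ?_
  rw [zero_mul, add_zero, mul_assoc ((k : ℂ) - m)]
  ring

open Finset in
/-- If a cosine integral of a nonnegative density has an even expansion of order `2 m` at the
origin, then its spectral moment of order `2 m` is finite: the central difference of order `2 m`
kills the expansion, and is the integral of a nonnegative function. -/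
theorem integrable_moment_of_expansion (hw : Integrable w μ) (hw0 : ∀ x, 0 ≤ w x)
    (hω : Measurable ω₀) (hK : K ≠ 0) (m : ℕ) (b : ℕ → ℂ) (M : ℝ)
    (hM : ∀ t ∈ Icc (0 : ℝ) 1, ‖cosIntegral μ (fun x => (K : ℂ) * (w x : ℂ)) ω₀ 0 t -
      ∑ j ∈ range m, b j * (t : ℂ) ^ (2 * j)‖ ≤ M * t ^ (2 * m)) :
    Integrable (fun x => w x * ω₀ x ^ (2 * m)) μ := by
  set a := cosIntegral μ (fun x => (K : ℂ) * (w x : ℂ)) ω₀ 0 with ha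
  set g : ℝ → ℂ := fun s => a s - ∑ j ∈ range m, b j * (s : ℂ) ^ (2 * j) with hg
  have heven : ∀ s, g (-s) = g s := fun s => by
    have h1 : a (-s) = a s := by
      simp only [ha, cosIntegral, Nat.cast_zero, zero_mul, add_zero, neg_mul, Real.cos_neg]
    simp only [hg, h1, Complex.ofReal_neg, Even.neg_pow (even_two_mul _)]
  have hgM : ∀ s, |s| ≤ 1 → ‖g s‖ ≤ M * |s| ^ (2 * m) := fun s hs => by
    have h1 : g s = g |s| := by
      rcases abs_choice s with h | h <;> rw [h]
      exact (heven s).symm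
    rw [h1]
    exact hM _ ⟨abs_nonneg s, hs⟩
  have hM0 : 0 ≤ M := by
    have := (norm_nonneg _).trans (hgM 1 (by simp))
    simpa using this
  -- the constant from the central difference, in which `|k - m| ≤ m`
  set D : ℝ := |K|⁻¹ * ∑ k ∈ range (2 * m + 1), ((2 * m).choose k : ℝ) * (M * (m : ℝ) ^ (2 * m))
    with hD
  have hbound : ∀ t : ℝ, 0 < t → (m : ℝ) * t ≤ 1 →
      ∫ x, w x * (2 - 2 * Real.cos (t * ω₀ x)) ^ m ∂μ ≤ D * t ^ (2 * m) := by
    intro t ht hmt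
    have h1 : ∑ k ∈ range (2 * m + 1), ((-1 : ℂ) ^ (2 * m - k) * (2 * m).choose k) *
        g (((k : ℝ) - m) * t) =
        (((-1) ^ m * K * ∫ x, w x * (2 - 2 * Real.cos (t * ω₀ x)) ^ m ∂μ : ℝ) : ℂ) := by
      rw [← sum_choose_mul_cosIntegral hw hω m t]
      simp only [hg, mul_sub, sum_sub_distrib, ← ha]
      rw [sub_eq_self]
      simp only [mul_sum]
      rw [sum_comm]
      refine sum_eq_zero fun j hj => ?_
      have := sum_choose_mul_pow (mem_range.1 hj)
      rw [← mul_zero (b j * (t : ℂ) ^ (2 * j)), ← this, mul_sum]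
      refine sum_congr rfl fun k _ => ?_
      push_cast
      rw [mul_pow]; ring
    have h2 := congrArg norm h1
    rw [Complex.norm_real, norm_mul, norm_mul, norm_pow, norm_neg, norm_one, one_pow, one_mul,
      Real.norm_eq_abs, Real.norm_eq_abs] at h2
    have h3 : |K| * ∫ x, w x * (2 - 2 * Real.cos (t * ω₀ x)) ^ m ∂μ ≤
        ∑ k ∈ range (2 * m + 1), ((2 * m).choose k : ℝ) * (M * (m : ℝ) ^ (2 * m)) * t ^ (2 * m) := by
      refine (mul_le_mul_of_nonneg_left (le_abs_self _) (abs_nonneg K)).trans ?_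
      rw [← h2]
      refine (norm_sum_le _ _).trans (sum_le_sum fun k hk => ?_)
      have hk' : |((k : ℝ) - m)| ≤ m := by
        have : (k : ℝ) ≤ 2 * m := by exact_mod_cast Nat.lt_succ_iff.1 (mem_range.1 hk)
        rw [abs_le]; constructor <;> linarith [(Nat.cast_nonneg k : (0 : ℝ) ≤ k)]
      have hs : |((k : ℝ) - m) * t| ≤ m * t := by
        rw [abs_mul, abs_of_pos ht]; gcongr
      rw [norm_mul, norm_mul, norm_pow, norm_neg, norm_one, one_pow, one_mul, Complex.norm_natCast,
        mul_assoc, mul_assoc M, ← mul_pow]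
      gcongr
      refine (hgM _ (hs.trans hmt)).trans ?_
      gcongr
    have hKp : 0 < |K| := abs_pos.2 hK
    rw [hD, mul_assoc, sum_mul, ← div_eq_inv_mul, le_div_iff₀ hKp, mul_comm]
    exact h3
  -- steps tending to `0`, for which all the points `(k - m) s` lie in `[-1, 1]`
  set s : ℕ → ℝ := fun n => (((m : ℝ) + 1) * ((n : ℝ) + 1))⁻¹ with hs
  have hs0 : ∀ n, 0 < s n := fun n => by simp only [hs]; positivity
  have hs1 : ∀ n, (m : ℝ) * s n ≤ 1 := fun n => by
    simp only [hs]
    rw [← div_eq_mul_inv, div_le_one (by positivity)]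
    nlinarith [(Nat.cast_nonneg n : (0 : ℝ) ≤ n), (Nat.cast_nonneg m : (0 : ℝ) ≤ m)]
  have hslim : Filter.Tendsto s Filter.atTop (𝓝 0) := by
    have h := (tendsto_one_div_add_atTop_nhds_zero_nat (𝕜 := ℝ)).const_mul ((m : ℝ) + 1)⁻¹
    rw [mul_zero] at h
    refine h.congr fun n => ?_
    simp only [hs, mul_inv, one_div]
  -- the difference quotients, written so that their limit as `s → 0` is visible
  have hdiv : ∀ n x, w x * (ω₀ x * Real.sinc (s n * ω₀ x / 2)) ^ (2 * m) =
      (s n ^ (2 * m))⁻¹ * (w x * (2 - 2 * Real.cos (s n * ω₀ x)) ^ m) := fun n x => by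
    have := pow_ne_zero (2 * m) (hs0 n).ne'
    rw [← sq_mul_sinc, ← pow_mul, mul_pow (s n)]
    field_simp
  have hi : ∀ n, Integrable (fun x => w x * (2 - 2 * Real.cos (s n * ω₀ x)) ^ m) μ := fun n => by
    refine hw.mul_bdd (c := 4 ^ m) (Measurable.aestronglyMeasurable (by fun_prop))
      (Filter.Eventually.of_forall fun x => ?_)
    rw [norm_pow]
    refine pow_le_pow_left₀ (norm_nonneg _) ?_ m
    rw [Real.norm_eq_abs, abs_le]
    constructor <;> linarith [Real.cos_le_one (s n * ω₀ x), Real.neg_one_le_cos (s n * ω₀ x)]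
  refine integrable_of_tendsto_of_integral_le (C := D)
    (f := fun n x => w x * (ω₀ x * Real.sinc (s n * ω₀ x / 2)) ^ (2 * m)) (fun n => ?_)
    (fun n x => ?_) (fun n => ?_) fun x => ?_
  · simp only [hdiv]
    exact (hi n).const_mul _
  · rw [pow_mul]; exact mul_nonneg (hw0 x) (by positivity)
  · simp only [hdiv]
    rw [integral_const_mul, inv_mul_le_iff₀ (pow_pos (hs0 n) _), mul_comm]
    exact hbound _ (hs0 n) (hs1 n)
  · have hc : Continuous fun r : ℝ => w x * (ω₀ x * Real.sinc (r * ω₀ x / 2)) ^ (2 * m) := by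
      have := Real.continuous_sinc
      fun_prop
    have := (hc.tendsto 0).comp hslim
    simp only [zero_mul, zero_div, Real.sinc_zero, mul_one] at this
    exact this

variable {d : ℕ} {ν : Measure ℝ} {v : Rd d → ℂ}

/-- The expansion bounds a moment of the product of `|v|² dη` with `ν`; a slice at some `u ≠ 0` is a
moment of `|v|²`. -/
theorem IsTraceMeasure.integrable_of_expansion (h : IsTraceMeasure d ν K)
    (hv : IsPotentialTransform v) (hreal : ∀ η, v η * v (-η) = ((‖v η‖ ^ 2 : ℝ) : ℂ))
    (m : ℕ) (b : ℕ → ℂ) (M : ℝ)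
    (hM : ∀ t ∈ Icc (0 : ℝ) 1, ‖traceDensity ν K v t -
      ∑ j ∈ Finset.range m, b j * (t : ℂ) ^ (2 * j)‖ ≤ M * t ^ (2 * m)) :
    Integrable fun η => (1 + freq η ^ 2) ^ m * ‖v η‖ ^ 2 := by
  have hfin := h.finite
  rw [traceDensity_eq_cosIntegral hv.integrable_mul_neg] at hM
  simp only [hreal] at hM
  have h1 := integrable_moment_of_expansion (hv.integrable_sq.comp_fst ν) (fun x => by positivity)
    continuous_chordFreq.measurable h.ne_zero m b M hM
  -- a slice `u ≠ 0` on which the moment is finite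
  obtain ⟨u, hu0, hu⟩ := (h.ae_ne.and_eventually h1.prod_left_ae).exists
  simp only [chordFreq] at hu
  have h2 : Integrable fun η : Rd d => ‖v η‖ ^ 2 * freq η ^ (2 * m) := by
    refine (hu.const_mul (u ^ (2 * m))⁻¹).congr (Filter.Eventually.of_forall fun η => ?_)
    have := pow_ne_zero (2 * m) hu0
    simp only [mul_pow]
    field_simp
  have hvc := hv.continuous
  have hfc := continuous_freq (d := d)
  refine ((hv.integrable_sq.add h2).const_mul (2 ^ m)).mono'
    (Continuous.aestronglyMeasurable (by fun_prop)) (Filter.Eventually.of_forall fun η => ?_)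
  rw [Real.norm_of_nonneg (by positivity), Pi.add_apply]
  have h3 : (1 + freq η ^ 2) ^ m ≤ 2 ^ m * (1 + freq η ^ (2 * m)) := by
    have := add_pow_le (zero_le_one' ℝ) (sq_nonneg (freq η)) m
    rw [one_pow, ← pow_mul] at this
    refine this.trans ?_
    have h0 := freq_nonneg η
    gcongr
    · norm_num
    · exact Nat.sub_le m 1
  calc _ ≤ 2 ^ m * (1 + freq η ^ (2 * m)) * ‖v η‖ ^ 2 := by gcongr
    _ = _ := by ring

end Converse

/-! ### Sobolev regularity of bounded potentials of compact support -/

section Sobolev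

variable {d : ℕ}

theorem hasTemperateGrowth_sobolevWeight (s : ℝ) :
    (fun x : Rd d => (((1 + ‖x‖ ^ 2) ^ s : ℝ) : ℂ)).HasTemperateGrowth := by
  fun_prop

/-- On `L¹ ∩ L²`, membership in `H^m` is integrability of `(1 + ‖ξ‖²)^m |𝓕 f(ξ)|²`. -/
theorem memSobolev_iff_integrable {f : Rd d → ℂ} (h1 : Integrable f) (h2 : MemLp f 2 volume)
    (m : ℕ) {T : 𝓢'(Rd d, ℂ)} (hT : T = (h2.toLp f : 𝓢'(Rd d, ℂ))) :
    TemperedDistribution.MemSobolev (m : ℝ) 2 T ↔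
      Integrable fun ξ => (1 + ‖ξ‖ ^ 2) ^ m * ‖𝓕 f ξ‖ ^ 2 := by
  have hcf : Continuous (𝓕 f) :=
    VectorFourier.fourierIntegral_continuous Real.continuous_fourierChar continuous_inner h1
  set W : Rd d → ℂ := fun x => (((1 + ‖x‖ ^ 2) ^ ((m : ℝ) / 2) : ℝ) : ℂ) with hW
  have hWt : W.HasTemperateGrowth := hasTemperateGrowth_sobolevWeight _
  have hWc : Continuous W := hWt.1.continuous
  have hnorm : ∀ ξ, ‖W ξ * 𝓕 f ξ‖ ^ 2 = (1 + ‖ξ‖ ^ 2) ^ m * ‖𝓕 f ξ‖ ^ 2 := fun ξ => by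
    have hp : (0 : ℝ) ≤ 1 + ‖ξ‖ ^ 2 := by positivity
    rw [norm_mul, mul_pow, hW, Complex.norm_real, Real.norm_of_nonneg (by positivity),
      ← Real.rpow_natCast, ← Real.rpow_mul hp, Nat.cast_ofNat, div_mul_cancel₀ _ two_ne_zero,
      Real.rpow_natCast]
  have hWf : Continuous fun ξ => W ξ * 𝓕 f ξ := hWc.mul hcf
  have hmem : MemLp (fun ξ => W ξ * 𝓕 f ξ) 2 volume ↔
      Integrable fun ξ => (1 + ‖ξ‖ ^ 2) ^ m * ‖𝓕 f ξ‖ ^ 2 := by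
    rw [memLp_two_iff_integrable_sq_norm hWf.aestronglyMeasurable]
    simp only [hnorm]
  -- the action on test functions of the Fourier transform multiplied by the weight
  have hact : ∀ g : 𝓢(Rd d, ℂ), TemperedDistribution.smulLeftCLM ℂ W (𝓕 T) g =
      ∫ ξ, g ξ * (W ξ * 𝓕 f ξ) := fun g => by
    rw [TemperedDistribution.smulLeftCLM_apply_apply, hT, Lp.fourier_toTemperedDistribution_eq,
      Lp.toTemperedDistribution_apply]
    refine integral_congr_ae ?_
    filter_upwards [coeFn_fourier_toLp h1 h2] with ξ hξ
    rw [hξ, SchwartzMap.smulLeftCLM_apply_apply hWt, smul_eq_mul, smul_eq_mul]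
    ring
  rw [TemperedDistribution.memSobolev_iff_exists_smulLeftCLM_fourier, ← hmem]
  constructor
  · rintro ⟨F, hF⟩
    have hae : (F : Rd d → ℂ) =ᵐ[volume] fun ξ => W ξ * 𝓕 f ξ := by
      refine ae_eq_of_integral_contDiff_smul_eq ((Lp.memLp F).locallyIntegrable (by norm_num))
        hWf.locallyIntegrable fun g hg hgs => ?_
      have hgs' : HasCompactSupport (Complex.ofRealCLM ∘ g) := hgs.comp_left rfl
      have hg' : ContDiff ℝ ∞ (Complex.ofRealCLM ∘ g) := by fun_prop
      have h := hact (hgs'.toSchwartzMap hg')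
      rw [hF, Lp.toTemperedDistribution_apply] at h
      simpa using h
    exact (memLp_congr_ae hae).1 (Lp.memLp F)
  · intro hL
    refine ⟨hL.toLp _, ?_⟩
    ext g
    rw [hact, Lp.toTemperedDistribution_apply]
    refine integral_congr_ae ?_
    filter_upwards [hL.coeFn_toLp] with ξ hξ
    rw [hξ, smul_eq_mul]

/-- The weights `1 + ‖ξ‖²` and `1 + (2π‖ξ‖)²` are comparable. -/
theorem inSobolev_iff {V : LInfty d} (hV : IsBddCompact (V : Rd d → ℂ)) (m : ℕ) :
    InSobolev m V ↔ Integrable fun ξ => (1 + freq ξ ^ 2) ^ m * ‖𝓕 (V : Rd d → ℂ) ξ‖ ^ 2 := by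
  -- `V` defines the same distribution as an element of `L^∞` and of `L²`
  have hT : (V : 𝓢'(Rd d, ℂ)) = ((hV.memLp_of 2).toLp V : 𝓢'(Rd d, ℂ)) := by
    ext g
    rw [Lp.toTemperedDistribution_apply, Lp.toTemperedDistribution_apply]
    refine integral_congr_ae ?_
    filter_upwards [(hV.memLp_of 2).coeFn_toLp] with ξ hξ
    rw [hξ]
  rw [InSobolev, memSobolev_iff_integrable hV.integrable (hV.memLp_of 2) m hT]
  have hc := hV.continuous_fourier
  have hf := continuous_freq (d := d)
  have hpi : (1 : ℝ) ≤ 2 * Real.pi := by linarith [Real.pi_gt_three]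
  have hle : ∀ ξ : Rd d, ‖ξ‖ ≤ freq ξ := fun ξ => by
    unfold freq; nlinarith [norm_nonneg ξ]
  have hge : ∀ ξ : Rd d, 1 + freq ξ ^ 2 ≤ (2 * Real.pi) ^ 2 * (1 + ‖ξ‖ ^ 2) := fun ξ => by
    unfold freq; nlinarith [sq_nonneg (2 * Real.pi)]
  constructor
  · intro h
    refine (h.const_mul (((2 * Real.pi) ^ 2) ^ m)).mono'
      (Continuous.aestronglyMeasurable (by fun_prop)) (Filter.Eventually.of_forall fun ξ => ?_)
    rw [Real.norm_of_nonneg (by positivity), ← mul_assoc, ← mul_pow]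
    gcongr
    exact hge ξ
  · intro h
    refine h.mono' (Continuous.aestronglyMeasurable (by fun_prop))
      (Filter.Eventually.of_forall fun ξ => ?_)
    rw [Real.norm_of_nonneg (by positivity)]
    gcongr
    exact hle ξ

end Sobolev

/-! ### The expansion of the second Duhamel term -/

section Conclusion

variable {d : ℕ}

theorem CompactlySupported.isBddCompact {V : LInfty d} (h : CompactlySupported V) :
    IsBddCompact (V : Rd d → ℂ) := by
  obtain ⟨S, hS, hV⟩ := h
  obtain ⟨R, hR0, hR⟩ := hS.isBounded.exists_pos_norm_le
  exact ⟨Lp.memLp V, R, hR0, hV.mono fun x hx hlt => hx fun hmem => (hR x hmem).not_gt hlt⟩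

/-- The Fourier transform of a real potential is Hermitian. -/
theorem IsReal.fourier_mul_neg {V : LInfty d} (h : IsReal V) (η : Rd d) :
    𝓕 (V : Rd d → ℂ) η * 𝓕 (V : Rd d → ℂ) (-η) = ((‖𝓕 (V : Rd d → ℂ) η‖ ^ 2 : ℝ) : ℂ) := by
  have h1 : 𝓕 (V : Rd d → ℂ) (-η) = starRingEnd ℂ (𝓕 (V : Rd d → ℂ) η) := by
    rw [Real.fourier_eq, Real.fourier_eq, ← integral_conj]
    refine integral_congr_ae ?_
    filter_upwards [h] with x hx
    rw [Circle.smul_def, Circle.smul_def, smul_eq_mul, smul_eq_mul, map_mul,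
      Complex.conj_eq_iff_im.2 hx,
      ← Circle.coe_inv_eq_conj, ← AddChar.map_neg_eq_inv, inner_neg_right]
  rw [h1, Complex.mul_conj, Complex.normSq_eq_norm_sq]

theorem traceWeight_of_le {φ : ℝ → ℂ} (hd : d ≤ 4) (t : ℝ) :
    traceWeight d φ t = (t : ℂ) ^ (4 - d) * φ t := by
  rw [traceWeight, if_pos hd]

theorem traceWeight_of_odd {φ : ℝ → ℂ} (hd : 5 ≤ d) (ho : Odd d) (t : ℝ) :
    traceWeight d φ t = deriv (invDeriv^[(d - 5) / 2] φ) t := by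
  rw [traceWeight, if_neg (by omega), if_pos ho]

theorem traceWeight_of_even {φ : ℝ → ℂ} (hd : 4 ≤ d) (he : Even d) (t : ℝ) :
    traceWeight d φ t = (invDeriv^[(d - 4) / 2] φ) t := by
  rcases hd.eq_or_lt with rfl | hlt
  · simp [traceWeight]
  · rw [traceWeight, if_neg (by omega), if_neg (Nat.not_odd_iff_even.2 he)]

end Conclusion

end WaveTrace

end

theorem mainTheorem4 (d : ℕ) (hd : 1 ≤ d) :
    ∃ (c : ℕ → ℝ) (B : ℕ → ℝ), (∀ j, c j ≠ 0) ∧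
      ∀ V : WaveTrace.LInfty d, WaveTrace.CompactlySupported V →
        ∃ a : ℝ → ℂ,
          ContinuousOn a (Ici 0) ∧
          (∀ φ : ℝ → ℂ, ContDiff ℝ ∞ φ → HasCompactSupport φ → (∀ t, φ (-t) = φ t) →
            ∃ (A : WaveTrace.Energy d →L[ℂ] WaveTrace.Energy d) (τ : ℂ),
              (∀ u, A u = WaveTrace.smearedTerm V 2 φ u) ∧
              WaveTrace.HasTrace A τ ∧
              (d ≤ 4 → τ = ∫ t in Ioi (0 : ℝ), (t : ℂ) ^ (4 - d) * a t * φ t) ∧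
              (5 ≤ d → Odd d →
                τ = ∫ t in Ioi (0 : ℝ), a t * deriv (WaveTrace.invDeriv^[(d - 5) / 2] φ) t) ∧
              (4 ≤ d → Even d →
                τ = ∫ t in Ioi (0 : ℝ), a t * (WaveTrace.invDeriv^[(d - 4) / 2] φ) t)) ∧
          (∀ t, 0 ≤ t → ‖a t‖ ≤ ((2 * Real.pi) ^ (d / 2))⁻¹ * WaveTrace.l2NormSq V) ∧
          (∀ m : ℕ, WaveTrace.InSobolev m V →
            ContDiffOn ℝ ((2 * m : ℕ) : ℕ∞) a (Ici 0) ∧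
            (∀ j ≤ 2 * m, ∀ t, 0 ≤ t →
              ‖iteratedDerivWithin j a (Ici 0) t‖ ≤ B m * WaveTrace.sobolevNormSq m V) ∧
            (∀ j ≤ 2 * m, Odd j → iteratedDerivWithin j a (Ici 0) 0 = 0) ∧
            (WaveTrace.IsReal V → ∀ j ≤ m,
              iteratedDerivWithin (2 * j) a (Ici 0) 0
                = ((c j * WaveTrace.homSobolevNormSq j V : ℝ) : ℂ))) ∧
          (WaveTrace.IsReal V → ∀ (m : ℕ) (b : ℕ → ℂ) (M : ℝ),
            (∀ t ∈ Icc (0 : ℝ) 1,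
              ‖a t - ∑ j ∈ Finset.range m, b j * (t : ℂ) ^ (2 * j)‖ ≤ M * t ^ (2 * m)) →
            WaveTrace.InSobolev m V) := by
  obtain ⟨ν, K, h⟩ := WaveTrace.exists_isTraceMeasure hd
  have hfin := h.finite
  refine ⟨WaveTrace.taylorFactor ν K, fun _ => |K| * ν.real univ, h.taylorFactor_ne_zero,
    fun V hV => ?_⟩
  have hb := hV.isBddCompact
  have hv := hb.isPotentialTransform
  refine ⟨WaveTrace.traceDensity ν K (𝓕 (V : WaveTrace.Rd d → ℂ)),
    (WaveTrace.continuous_traceDensity hv).continuousOn, fun φ h1 h2 h3 => ?_, fun t _ => ?_,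
    fun m hm => ?_, fun hr m b M hM => ?_⟩
  · have hφ : WaveTrace.EvenTest φ := ⟨h1, h2, h3⟩
    obtain ⟨A, hA, hτ⟩ := WaveTrace.exists_hasTrace_smearedTerm hb hφ
    rw [h.trace_eq hd hφ hv] at hτ
    refine ⟨A, _, hA, hτ, fun hd4 => ?_, fun hd5 ho => ?_, fun hd4 he => ?_⟩ <;>
      refine integral_congr_ae (Filter.Eventually.of_forall fun t => ?_) <;> dsimp only
    · rw [WaveTrace.traceWeight_of_le hd4, mul_right_comm]
    · rw [WaveTrace.traceWeight_of_odd hd5 ho, mul_comm]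
    · rw [WaveTrace.traceWeight_of_even hd4 he, mul_comm]
  · rw [WaveTrace.l2NormSq, ← hb.integral_norm_fourier_sq]
    exact h.norm_traceDensity_le hv t
  · have hi := (WaveTrace.inSobolev_iff hb m).1 hm
    have hc := (h.contDiff_traceDensity hv hi).1
    have heq : ∀ j ≤ 2 * m, ∀ t, 0 ≤ t →
        iteratedDerivWithin j (WaveTrace.traceDensity ν K (𝓕 (V : WaveTrace.Rd d → ℂ))) (Ici 0) t =
        iteratedDeriv j (WaveTrace.traceDensity ν K (𝓕 (V : WaveTrace.Rd d → ℂ))) t :=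
      fun j hj t ht => iteratedDerivWithin_eq_iteratedDeriv (uniqueDiffOn_Ici 0)
        (hc.contDiffAt.of_le (by exact_mod_cast hj)) ht
    refine ⟨hc.contDiffOn, fun j hj t ht => ?_, fun j hj ho => ?_, fun hr j hj => ?_⟩
    · rw [heq j hj t ht]
      exact h.norm_iteratedDeriv_le hv hi hj t
    · rw [heq j hj 0 le_rfl]
      exact h.iteratedDeriv_odd hv hi hj ho
    · rw [heq (2 * j) (by omega) 0 le_rfl]
      exact h.iteratedDeriv_even hv hi hj hr.fourier_mul_neg
  · exact (WaveTrace.inSobolev_iff hb m).2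
      (h.integrable_of_expansion hv hr.fourier_mul_neg m b M hM)
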